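/- **Setting.** Let $\mathcal S$ be a finite triangulation of an oriented surface, possibly with boundary: a finite two-dimensional simplicial complex in which every edge lies in at most two triangles and links of vertices are connected. Every triangle $T$ carries its affine structure, and triangles are glued affinely along common edges. Call an edge *interior* if it lies in two triangles, and a *boundary edge* otherwise. Write $H^k(T)$ for the Sobolev spaces. Let - $V$ be the space of $v\in\prod_T H^2(T)$ that are single-valued on interior edges and vanish on $\partial\mathcal S$; - $W$ be the space of one-forms $\alpha\in\prod_T H^1\Lambda^1(T)$ whose pullbacks to interior edges are single-valued and whose pullbacks to boundary edges vanish; - $\Sigma$ be the space of symmetric $(0,2)$-tensor fields $\sigma\in\prod_T H^1S^0_2(T)$ whose pullbacks to interior edges are single-valued; - $\mathcal M$ be the set of Regge metrics: families $g=(g_T)_T$ of Riemannian metrics on the closed triangles, smooth up to the boundary, whose pullbacks to interior edges are single-valued. $V'$ and $W'$ are the topological duals for the broken $H^2$ and $H^1$ norms. Fix an integer $r\ge 0$. Let $V_h^{r+1}\subset V$, $\Sigma_h^r\subset\Sigma$, $\mathcal M_h^r\subset\mathcal M$ consist of the elements whose coefficients on every $T$ are polynomials of degree at most $r+1$, $r$,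 $r$ respectively, and let $W_h^{r+1}=\{\alpha\in W : \alpha|_T\in\mathcal P^-_{r+1}\Lambda^1(T)\ \forall T\}$, where $\mathcal P^-_{r+1}\Lambda^1(T)$ is the space of one-forms $\alpha$ with coefficients in $\mathcal P_{r+1}(T)$ and $x^i\alpha_i\in\mathcal P_{r+1}(T)$. Spaces of polynomials of negative degree are zero. For $g\in\mathcal M$, denote by $\langle\cdot,\cdot\rangle_{g,D}$ the $L^2$ inner product with respect to $g$ on $D=\mathcal S$, $T$, or an edge $e$ (with arc length). Let $\tau$ and $n$ be the $g$-unit tangent and the outward $g$-unit normal on the edges of a triangle, let $S\sigma=\sigma-g\operatorname{Tr}_g\sigma$, let $\nabla$ be the Levi-Civita connection of $g_T$ on $T$, and let $[\![\alpha(n)]\!]$ be the sum of the values of $\alpha(n)$ from the triangles that contain $e$. Put $$c_h(g;\sigma,\alpha)=\sum_T\langle S\sigma,\nabla\alpha\rangle_{g,T}+\sum_e\langle\sigma(\tau,\tau),[\![\alpha(n)]\!]\rangle_{g,e}\qquad(\sigma\in\Sigma,\ \alpha\in W).$$ **Operators.** Let $g\in\mathcal M$, $g_h\in\mathcal M_h^r$,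 $\bar g_h\in\mathcal M_h^0$. Define - $\operatorname{div}_{\rm dist}:W'\to V'$, $\langle\operatorname{div}_{\rm dist}\alpha,v\rangle=-\langle\alpha,dv\rangle$ for all $v\in V$; - $(\operatorname{div}S)_{\rm dist}:\Sigma\to W'$, $\langle(\operatorname{div}S)_{\rm dist}\sigma,\alpha\rangle=-c_h(g;\sigma,\alpha)$ for all $\alpha\in W$; and $(\operatorname{div}\operatorname{div}S)_{\rm dist}=\operatorname{div}_{\rm dist}(\operatorname{div}S)_{\rm dist}$; - $\operatorname{div}_h:W_h^{r+1}\to V_h^{r+1}$, $\langle\operatorname{div}_h\alpha,v\rangle_{g_h,\mathcal S}=-\langle\alpha,dv\rangle_{g_h,\mathcal S}$ for all $v\in V_h^{r+1}$; - $(\operatorname{div}S)_h:\Sigma_h^r\to W_h^{r+1}$, $\langle(\operatorname{div}S)_h\sigma,\alpha\rangle_{g_h,\mathcal S}=-c_h(g_h;\sigma,\alpha)$ for all $\alpha\in W_h^{r+1}$; and $(\operatorname{div}\operatorname{div}S)_h=\operatorname{div}_h(\operatorname{div}S)_h$; - $\pi_h^V:V'\to V_h^{r+1}$, $\langle\pi_h^Vu,v\rangle_{g_h,\mathcal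 S}=\langle u,v\rangle_{V',V}$ for all $v\in V_h^{r+1}$; and $\pi_h^W:W'\to W_h^{r+1}$, $\langle\pi_h^W\alpha,\beta\rangle_{g_h,\mathcal S}=\langle\alpha,\beta\rangle_{W',W}$ for all $\beta\in W_h^{r+1}$; - $\pi_h^\Sigma:\Sigma\to\Sigma_h^r$ (the Regge interpolant), $\langle\pi_h^\Sigma\sigma-\sigma,\rho\rangle_{\bar g_h,T}=0$ for all $T$ and all symmetric $(0,2)$-tensor fields $\rho$ on $T$ with coefficients in $\mathcal P_{r-1}(T)$, and $\langle(\pi_h^\Sigma\sigma-\sigma)(\bar\tau_h,\bar\tau_h),q\rangle_{\bar g_h,e}=0$ for all edges $e$ and all $q\in\mathcal P_r(e)$, where $\bar\tau_h$ is the $\bar g_h$-unit tangent. If $\mathcal S$ is planar, i.e. triangulates a domain $\Omega\subset\mathbb R^2$ (with its standard orientation), let $U=\{u\in H^1(\Omega)\otimes\mathbb R^2: u|_T\in H^2(T)\otimes\mathbb R^2\ \forall T\}$, let $U_h^{r+1}\subset U$ be the subspace of piecewise polynomials of degree at most $r+1$, let $\operatorname{def}u=\tfrac12\mathcal L_ug$,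 and let $\pi_h^U:U\to U_h^{r+1}$ be the Lagrange interpolant: $\langle\pi_h^Uu-u,v\rangle_{\bar g_h,T}=0$ for $v\in\mathcal P_{r-2}(T)\otimes\mathbb R^2$, $\langle\pi_h^Uu-u,v\rangle_{\bar g_h,e}=0$ for $v\in\mathcal P_{r-1}(e)\otimes\mathbb R^2$, and $\pi_h^Uu(z)=u(z)$, for all triangles $T$, edges $e$ and vertices $z$. **Theorem.** One has $dV\subset W$, each of the operators above that do not involve $U$ is well defined (exactly one value satisfies its defining relation), and the following hold. 1. $\operatorname{div}_h\pi_h^W=\pi_h^V\operatorname{div}_{\rm dist}$ on $W'$. 2. If $g=g_h=\bar g_h$, then $(\operatorname{div}\operatorname{div}S)_h\pi_h^\Sigma=\pi_h^V(\operatorname{div}\operatorname{div}S)_{\rm dist}$ on $\Sigma$. 3. If $\mathcal S$ is planar and $g=g_h=\bar g_h=\delta$ is the Euclidean metric, then $\operatorname{def}:U\to\Sigma$, $\operatorname{def}:U_h^{r+1}\to\Sigma_h^r$ and $\pi_h^U$ are well defined, and $\pi_h^\Sigma\operatorname{def}=\operatorname{def}\pi_h^U$ on $U$. Moreover, in this case,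 $(\operatorname{div}\operatorname{div}S)_{\rm dist}\operatorname{def}=0$ on $U$, $(\operatorname{div}\operatorname{div}S)_h\operatorname{def}=0$ on $U_h^{r+1}$, and with $RM=\ker(\operatorname{def})\subset U$ one has $\pi_h^Uu=u$ for all $u\in RM$ (so that $RM\subset U_h^{r+1}$). Hence the rows of the commuting diagram $$\begin{array}{ccccccccc}RM&\xrightarrow{\ \subset\ }&U&\xrightarrow{\operatorname{def}}&\Sigma&\xrightarrow{(\operatorname{div}\operatorname{div}S)_{\rm dist}}&V'&\to&0\\ \|&&\downarrow{\scriptstyle\pi_h^U}&&\downarrow{\scriptstyle\pi_h^\Sigma}&&\downarrow{\scriptstyle\pi_h^V}&&\\ RM&\xrightarrow{\ \subset\ }&U_h^{r+1}&\xrightarrow{\operatorname{def}}&\Sigma_h^r&\xrightarrow{(\operatorname{div}\operatorname{div}S)_h}&V_h^{r+1}&\to&0\end{array}$$ are complexes. -/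

import Mathlib

open MeasureTheory Set
open scoped ContDiff

namespace ReggeFEM

noncomputable section

/-! ### Sobolev spaces on subsets of the plane -/

abbrev Plane := EuclideanSpace ℝ (Fin 2)

/-- The partial derivative `∂ₖ φ`. -/
def pd (k : Fin 2) (φ : Plane → ℝ) (x : Plane) : ℝ :=
  fderiv ℝ φ x (EuclideanSpace.single k 1)

/-- Real `L²(Ω)`. -/
abbrev L2 (Ω : Set Plane) := Lp ℝ 2 (volume.restrict Ω)

/-- Test functions: `φ ∈ C_c^∞(Ω)`. -/
structure IsTest (Ω : Set Plane) (φ : Plane → ℝ) : Prop where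
  smooth : ContDiff ℝ ∞ φ
  compact : HasCompactSupport φ
  supp : tsupport φ ⊆ Ω

/-- `h` is the weak partial derivative `∂ₖ f` on `Ω`. -/
def IsWeakDeriv (Ω : Set Plane) (k : Fin 2) (f h : Plane → ℝ) : Prop :=
  ∀ φ : Plane → ℝ, IsTest Ω φ →
    ∫ x in Ω, f x * pd k φ x = -∫ x in Ω, h x * φ x

theorem pd_continuous {φ : Plane → ℝ} (h : ContDiff ℝ ∞ φ) (k : Fin 2) :
    Continuous (pd k φ) :=
  (h.continuous_fderiv (by simp)).clm_apply continuous_const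

theorem IsTest.pd_compact {Ω : Set Plane} {φ : Plane → ℝ} (h : IsTest Ω φ) (k : Fin 2) :
    HasCompactSupport (pd k φ) :=
  HasCompactSupport.comp_left (f := fderiv ℝ φ)
    (g := fun L : Plane →L[ℝ] ℝ => L (EuclideanSpace.single k 1)) (h.compact.fderiv ℝ) rfl

theorem integrable_mul_cc {Ω : Set Plane} {ψ : Plane → ℝ} (f : L2 Ω)
    (hc : Continuous ψ) (hs : HasCompactSupport ψ) :
    Integrable (fun x => f x * ψ x) (volume.restrict Ω) :=
  (Lp.memLp f).integrable_mul (q := 2) ((hc.memLp_of_hasCompactSupport hs).restrict Ω)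

theorem isWeakDeriv_zero (Ω : Set Plane) (k : Fin 2) :
    IsWeakDeriv Ω k (0 : L2 Ω) (0 : L2 Ω) := by
  intro φ _
  have h0 := Lp.coeFn_zero ℝ 2 (volume.restrict Ω)
  have h1 : ∀ ψ : Plane → ℝ, ∫ x in Ω, (0 : L2 Ω) x * ψ x = 0 := fun ψ => by
    rw [← integral_zero Plane ℝ (μ := volume.restrict Ω)]
    refine integral_congr_ae ?_
    filter_upwards [h0] with x hx
    rw [hx]; simp
  rw [h1, h1]; simp

theorem isWeakDeriv_add {Ω : Set Plane} {k : Fin 2} {f f' h h' : L2 Ω}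
    (H : IsWeakDeriv Ω k f h) (H' : IsWeakDeriv Ω k f' h') :
    IsWeakDeriv Ω k (f + f' : L2 Ω) (h + h' : L2 Ω) := by
  intro φ hφ
  have key : ∀ (a b : L2 Ω) (ψ : Plane → ℝ), Continuous ψ → HasCompactSupport ψ →
      ∫ x in Ω, (a + b : L2 Ω) x * ψ x = (∫ x in Ω, a x * ψ x) + ∫ x in Ω, b x * ψ x := by
    intro a b ψ hc hs
    rw [← integral_add (integrable_mul_cc a hc hs) (integrable_mul_cc b hc hs)]
    refine integral_congr_ae ?_
    filter_upwards [Lp.coeFn_add a b] with x hx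
    rw [hx]; simp [add_mul]
  rw [key _ _ _ (pd_continuous hφ.smooth k) (hφ.pd_compact k),
    key _ _ _ hφ.smooth.continuous hφ.compact, H φ hφ, H' φ hφ]
  ring

theorem isWeakDeriv_smul {Ω : Set Plane} {k : Fin 2} {f h : L2 Ω} (c : ℝ)
    (H : IsWeakDeriv Ω k f h) : IsWeakDeriv Ω k (c • f : L2 Ω) (c • h : L2 Ω) := by
  intro φ hφ
  have key : ∀ (a : L2 Ω) (ψ : Plane → ℝ),
      ∫ x in Ω, (c • a : L2 Ω) x * ψ x = c * ∫ x in Ω, a x * ψ x := by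
    intro a ψ
    rw [← integral_const_mul]
    refine integral_congr_ae ?_
    filter_upwards [Lp.coeFn_smul c a] with x hx
    rw [hx]; simp [mul_assoc]
  rw [key, key, H φ hφ]
  ring

/-- The submodule underlying `H¹(Ω)`: an element is the tuple `(f, (∂ₖ f)ₖ)` of an `L²` function and its weak derivatives
(which are determined by `f`), so that the norm is equivalent to the usual Sobolev norm. -/
def H1Submodule (Ω : Set Plane) : Submodule ℝ (L2 Ω × (Fin 2 → L2 Ω)) where
  carrier := {p | ∀ k, IsWeakDeriv Ω k p.1 (p.2 k)}
  zero_mem' := fun k => isWeakDeriv_zero Ω k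
  add_mem' := fun ha hb k => isWeakDeriv_add (ha k) (hb k)
  smul_mem' := fun c _ ha k => isWeakDeriv_smul c (ha k)

/-- The submodule underlying `H²(Ω)`: tuples `(f, (∂ₖ f)ₖ, (∂ₗ ∂ₖ f)ₖₗ)` of an `L²` function and its weak derivatives. -/
def H2Submodule (Ω : Set Plane) :
    Submodule ℝ (L2 Ω × (Fin 2 → L2 Ω) × (Fin 2 → Fin 2 → L2 Ω)) where
  carrier := {p | (∀ k, IsWeakDeriv Ω k p.1 (p.2.1 k)) ∧
    ∀ k l, IsWeakDeriv Ω l (p.2.1 k) (p.2.2 k l)}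
  zero_mem' := ⟨fun k => isWeakDeriv_zero Ω k, fun _ l => isWeakDeriv_zero Ω l⟩
  add_mem' := fun ha hb => ⟨fun k => isWeakDeriv_add (ha.1 k) (hb.1 k),
    fun k l => isWeakDeriv_add (ha.2 k l) (hb.2 k l)⟩
  smul_mem' := fun c _ ha => ⟨fun k => isWeakDeriv_smul c (ha.1 k),
    fun k l => isWeakDeriv_smul c (ha.2 k l)⟩

/-- The Sobolev space `H¹(Ω)`. -/
def H1 (Ω : Set Plane) : Type := H1Submodule Ω

/-- The Sobolev space `H²(Ω)`. -/
def H2 (Ω : Set Plane) : Type := H2Submodule Ω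

instance (Ω : Set Plane) : NormedAddCommGroup (H1 Ω) :=
  inferInstanceAs (NormedAddCommGroup (H1Submodule Ω))

instance (Ω : Set Plane) : NormedSpace ℝ (H1 Ω) :=
  inferInstanceAs (NormedSpace ℝ (H1Submodule Ω))

instance (Ω : Set Plane) : NormedAddCommGroup (H2 Ω) :=
  inferInstanceAs (NormedAddCommGroup (H2Submodule Ω))

instance (Ω : Set Plane) : NormedSpace ℝ (H2 Ω) :=
  inferInstanceAs (NormedSpace ℝ (H2Submodule Ω))

/-- The function underlying an element of `H¹(Ω)`. -/
def fn {Ω : Set Plane} (f : H1 Ω) : L2 Ω := f.1.1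

/-- The weak derivative `∂ₖ f` of `f ∈ H¹(Ω)`. -/
def wd {Ω : Set Plane} (f : H1 Ω) (k : Fin 2) : L2 Ω := f.1.2 k

/-- The inclusion `H²(Ω) ⊆ H¹(Ω)`. -/
def toH1 {Ω : Set Plane} (f : H2 Ω) : H1 Ω := ⟨(f.1.1, f.1.2.1), f.2.1⟩

theorem toH1_add {Ω : Set Plane} (f f' : H2 Ω) : toH1 (f + f') = toH1 f + toH1 f' := rfl

theorem toH1_smul {Ω : Set Plane} (c : ℝ) (f : H2 Ω) : toH1 (c • f) = c • toH1 f := rfl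

/-- The weak derivative `∂ₖ f ∈ H¹(Ω)` of `f ∈ H²(Ω)`. -/
def wdH1 {Ω : Set Plane} (f : H2 Ω) (k : Fin 2) : H1 Ω :=
  ⟨(f.1.2.1 k, f.1.2.2 k), fun l => f.2.2 k l⟩

/-! ### Polynomials -/

/-- The value of the polynomial `p` at a point of the plane. -/
def pval (p : MvPolynomial (Fin 2) ℝ) (x : Plane) : ℝ := MvPolynomial.eval (fun i => x i) p

/-- The polynomials of total degree at most `n` in two variables. -/
abbrev Poly (n : ℕ) : Submodule ℝ (MvPolynomial (Fin 2) ℝ) :=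
  MvPolynomial.restrictTotalDegree (Fin 2) ℝ n

/-- The elements of `L²(Ω)` that are given by polynomials of degree at most `n`. -/
def PolyL2 (n : ℕ) (Ω : Set Plane) : Submodule ℝ (L2 Ω) where
  carrier := {f | ∃ p ∈ Poly n, f =ᵐ[volume.restrict Ω] pval p}
  zero_mem' := ⟨0, zero_mem _, by
    filter_upwards [Lp.coeFn_zero ℝ 2 (volume.restrict Ω)] with x hx
    rw [hx]; simp [pval]⟩
  add_mem' := by
    rintro a b ⟨p, hp, hpa⟩ ⟨q, hq, hqb⟩
    refine ⟨p + q, add_mem hp hq, ?_⟩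
    filter_upwards [hpa, hqb, Lp.coeFn_add a b] with x h1 h2 h3
    rw [h3]; simp [pval, h1, h2]
  smul_mem' := by
    rintro c a ⟨p, hp, hpa⟩
    refine ⟨c • p, Submodule.smul_mem _ c hp, ?_⟩
    filter_upwards [hpa, Lp.coeFn_smul c a] with x h1 h3
    rw [h3]; simp [pval, h1, MvPolynomial.smul_eval]

/-- The Koszul differential of the polynomial one-form `p₀ dx⁰ + p₁ dx¹`. -/
def kos (p : Fin 2 → MvPolynomial (Fin 2) ℝ) : MvPolynomial (Fin 2) ℝ :=
  ∑ k, MvPolynomial.X k * p k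

/-- The pairs of `L²(Ω)` functions that are the coefficients of a one-form in
`𝒫ₙ⁻Λ¹ = {α ∈ 𝒫ₙΛ¹ | kos α ∈ 𝒫ₙΛ⁰}`. -/
def PolyMinus (n : ℕ) (Ω : Set Plane) : Submodule ℝ (Fin 2 → L2 Ω) where
  carrier := {f | ∃ p : Fin 2 → MvPolynomial (Fin 2) ℝ, (∀ k, p k ∈ Poly n) ∧ kos p ∈ Poly n ∧
    ∀ k, f k =ᵐ[volume.restrict Ω] pval (p k)}
  zero_mem' := ⟨0, fun _ => zero_mem _, by simp [kos], fun _ => by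
    filter_upwards [Lp.coeFn_zero ℝ 2 (volume.restrict Ω)] with x hx
    simp only [Pi.zero_apply] at hx ⊢
    rw [hx]; simp [pval]⟩
  add_mem' := by
    rintro a b ⟨p, hp, hp', hpa⟩ ⟨q, hq, hq', hqb⟩
    refine ⟨p + q, fun k => add_mem (hp k) (hq k), ?_, fun k => ?_⟩
    · have : kos (p + q) = kos p + kos q := by simp [kos, mul_add, Finset.sum_add_distrib]
      rw [this]; exact add_mem hp' hq'
    · filter_upwards [hpa k, hqb k, Lp.coeFn_add (a k) (b k)] with x h1 h2 h3
      rw [Pi.add_apply, h3]; simp [pval, h1, h2]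
  smul_mem' := by
    rintro c a ⟨p, hp, hp', hpa⟩
    refine ⟨c • p, fun k => Submodule.smul_mem _ c (hp k), ?_, fun k => ?_⟩
    · have : kos (c • p) = c • kos p := by simp [kos]
      rw [this]; exact Submodule.smul_mem _ c hp'
    · filter_upwards [hpa k, Lp.coeFn_smul c (a k)] with x h1 h3
      rw [Pi.smul_apply, h3]; simp [pval, h1, MvPolynomial.smul_eval]

/-! ### Triangulated oriented surfaces -/

/-- A finite triangulation of an oriented surface (possibly with boundary).

It is a finite pure two-dimensional simplicial complex. The vertices of a triangle `T` are listed
in the order given by the orientation as `vert T 0`, `vert T 1`, `vert T 2`. Every triangle comes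
with an affine coordinate system, in which its vertices have coordinates `pos T 0`, `pos T 1`,
`pos T 2`; two triangles are glued along a common edge by the affine map that matches the
vertices. -/
structure TriangulatedSurface where
  /-- the vertices -/
  Vtx : Type
  /-- the triangles -/
  Tri : Type
  fintypeTri : Fintype Tri
  /-- the vertices of a triangle -/
  vert : Tri → Fin 3 → Vtx
  vert_injective : ∀ T, Function.Injective (vert T)
  vert_surjective : ∀ z, ∃ T i, vert T i = z
  /-- a triangle is determined by its set of vertices -/
  simplicial : ∀ T T', range (vert T) = range (vert T') → T = T'
  /-- an oriented edge belongs to at most one triangle: every edge lies in at most two triangles,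
  and these induce opposite orientations on it -/
  oriented : ∀ T T' i j, vert T i = vert T' j → vert T (i + 1) = vert T' (j + 1) → T = T'
  /-- the link of every vertex is connected: two triangles with a common vertex `z` are joined by
  a chain of triangles in which neighbours share an edge that contains `z` -/
  link_connected : ∀ z T T', z ∈ range (vert T) → z ∈ range (vert T') →
    Relation.ReflTransGen (fun A B => ∃ i j, vert A (i + 1) = vert B (j + 2) ∧
      vert A (i + 2) = vert B (j + 1) ∧ (z = vert A (i + 1) ∨ z = vert A (i + 2))) T T'
  /-- the coordinates of the vertices of a triangle -/
  pos : Tri → Fin 3 → Plane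
  /-- triangles are nondegenerate, and their coordinates are positively oriented -/
  pos_oriented : ∀ T, 0 < (pos T 1 0 - pos T 0 0) * (pos T 2 1 - pos T 0 1) -
    (pos T 1 1 - pos T 0 1) * (pos T 2 0 - pos T 0 0)

attribute [instance] TriangulatedSurface.fintypeTri

namespace TriangulatedSurface

variable (K : TriangulatedSurface)

/-- The closed triangle `T` in its coordinate plane. -/
def tri (T : K.Tri) : Set Plane := convexHull ℝ (range (K.pos T))

/-- The open triangle. -/
def cell (T : K.Tri) : Set Plane := interior (K.tri T)

/-- The side `i` of `T` is the one opposite to the vertex `i`; it runs from vertex `i + 1` to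
vertex `i + 2`, and this is its (not normalized) tangent vector. -/
def edgeVec (T : K.Tri) (i : Fin 3) : Plane := K.pos T (i + 2) - K.pos T (i + 1)

/-- The affine parametrization of the side `i` of `T` by `[0, 1]`. -/
def edgePt (T : K.Tri) (i : Fin 3) (s : ℝ) : Plane := K.pos T (i + 1) + s • K.edgeVec T i

/-- The outward conormal of the side `i` of `T`: the covector that annihilates the tangent
vector `e` of the side and is `(e₁, -e₀)`, with the Euclidean length of the side as its length. -/
def edgeConormal (T : K.Tri) (i : Fin 3) : Fin 2 → ℝ := ![K.edgeVec T i 1, -K.edgeVec T i 0]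

/-- The side `i` of `T` and the side `j` of `T'` are the same edge, run through in opposite
directions: the point with parameter `s` on the first is the point with parameter `1 - s` on the
second. -/
def Glued (T : K.Tri) (i : Fin 3) (T' : K.Tri) (j : Fin 3) : Prop :=
  K.vert T (i + 1) = K.vert T' (j + 2) ∧ K.vert T (i + 2) = K.vert T' (j + 1)

/-- The side `i` of `T` lies on the boundary of the surface. -/
def IsBoundarySide (T : K.Tri) (i : Fin 3) : Prop := ∀ T' j, ¬K.Glued T i T' j

/-! ### Traces -/

/-- `t 0`, `t 1`, `t 2`, viewed as functions on the three sides, are the trace of `f ∈ H¹(T)` on the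
boundary of `T`: the square-integrable functions for which Green's formula
`∫_T f ∂ₖψ + ∫_T (∂ₖ f) ψ = ∫_{∂T} t ψ nₖ` holds for all smooth `ψ`. -/
structure IsTrace (T : K.Tri) (f : H1 (K.cell T)) (t : Fin 3 → ℝ → ℝ) : Prop where
  memLp : ∀ i, MemLp (t i) 2 (volume.restrict (Icc (0 : ℝ) 1))
  green : ∀ (ψ : Plane → ℝ) (k : Fin 2), ContDiff ℝ ∞ ψ →
    (∫ x in K.cell T, (fn f) x * pd k ψ x) + ∫ x in K.cell T, (wd f k) x * ψ x =
      ∑ i, (∫ s in Icc (0 : ℝ) 1, t i s * ψ (K.edgePt T i s)) * K.edgeConormal T i k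

/-- The trace of `f ∈ H¹(T)` on the sides of `T`. -/
def trace (T : K.Tri) (f : H1 (K.cell T)) : Fin 3 → ℝ → ℝ :=
  Classical.epsilon fun t => K.IsTrace T f t

theorem tri_compact (T : K.Tri) : IsCompact (K.tri T) :=
  (finite_range _).isCompact_convexHull ℝ

theorem integrable_mul_cont (T : K.Tri) (f : L2 (K.cell T)) {ψ : Plane → ℝ}
    (hψ : Continuous ψ) :
    Integrable (fun x => f x * ψ x) (volume.restrict (K.cell T)) := by
  have hfin : IsFiniteMeasure (volume.restrict (K.cell T)) :=
    ⟨by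
      rw [Measure.restrict_apply_univ]
      exact (measure_mono interior_subset).trans_lt (K.tri_compact T).measure_lt_top⟩
  obtain ⟨C, hC⟩ := (K.tri_compact T).exists_bound_of_continuousOn hψ.continuousOn
  have hm : MemLp ψ 2 (volume.restrict (K.cell T)) := by
    refine MemLp.of_bound hψ.aestronglyMeasurable C ?_
    exact (ae_restrict_iff' isOpen_interior.measurableSet).2
      (Filter.Eventually.of_forall fun x hx => hC x (interior_subset hx))
  exact (Lp.memLp f).integrable_mul hm

theorem edgePt_continuous (T : K.Tri) (i : Fin 3) : Continuous (K.edgePt T i) := by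
  unfold edgePt; fun_prop

theorem integrable_mul_edge (T : K.Tri) (i : Fin 3) {t : ℝ → ℝ}
    (ht : MemLp t 2 (volume.restrict (Icc (0 : ℝ) 1))) {ψ : Plane → ℝ} (hψ : Continuous ψ) :
    Integrable (fun s => t s * ψ (K.edgePt T i s)) (volume.restrict (Icc (0 : ℝ) 1)) := by
  have hc : Continuous fun s => ψ (K.edgePt T i s) := hψ.comp (K.edgePt_continuous T i)
  obtain ⟨C, hC⟩ := (isCompact_Icc (a := (0 : ℝ)) (b := 1)).exists_bound_of_continuousOn
    hc.continuousOn
  have hm : MemLp (fun s => ψ (K.edgePt T i s)) 2 (volume.restrict (Icc (0 : ℝ) 1)) := by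
    refine MemLp.of_bound hc.aestronglyMeasurable C ?_
    exact (ae_restrict_iff' measurableSet_Icc).2
      (Filter.Eventually.of_forall fun x hx => hC x hx)
  exact ht.integrable_mul hm

theorem isTrace_zero (T : K.Tri) : K.IsTrace T 0 0 where
  memLp _ := MemLp.zero
  green ψ k _ := by
    have h0 := Lp.coeFn_zero ℝ 2 (volume.restrict (K.cell T))
    have h1 : ∀ φ : Plane → ℝ, ∫ x in K.cell T, (0 : L2 (K.cell T)) x * φ x = 0 := fun φ => by
      rw [← integral_zero Plane ℝ (μ := volume.restrict (K.cell T))]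
      refine integral_congr_ae ?_
      filter_upwards [h0] with x hx
      rw [hx]; simp
    have h2 : (fn (0 : H1 (K.cell T))) = 0 := rfl
    have h3 : wd (0 : H1 (K.cell T)) k = 0 := rfl
    rw [h2, h3, h1, h1]; simp

theorem IsTrace.add {T : K.Tri} {f f' : H1 (K.cell T)} {t t' : Fin 3 → ℝ → ℝ}
    (h : K.IsTrace T f t) (h' : K.IsTrace T f' t') : K.IsTrace T (f + f') (t + t') where
  memLp i := (h.memLp i).add (h'.memLp i)
  green ψ k hψ := by
    have key : ∀ (a b : L2 (K.cell T)) (φ : Plane → ℝ), Continuous φ →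
        ∫ x in K.cell T, (a + b : L2 (K.cell T)) x * φ x =
          (∫ x in K.cell T, a x * φ x) + ∫ x in K.cell T, b x * φ x := by
      intro a b φ hc
      rw [← integral_add (K.integrable_mul_cont T a hc) (K.integrable_mul_cont T b hc)]
      refine integral_congr_ae ?_
      filter_upwards [Lp.coeFn_add a b] with x hx
      rw [hx]; simp [add_mul]
    have h2 : (fn (f + f')) = (fn f) + (fn f') := rfl
    have h3 : wd (f + f') k = wd f k + wd f' k := rfl
    have h4 : ∀ i, ∫ s in Icc (0 : ℝ) 1, (t + t') i s * ψ (K.edgePt T i s) =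
        (∫ s in Icc (0 : ℝ) 1, t i s * ψ (K.edgePt T i s)) +
          ∫ s in Icc (0 : ℝ) 1, t' i s * ψ (K.edgePt T i s) := fun i => by
      rw [← integral_add (K.integrable_mul_edge T i (h.memLp i) hψ.continuous)
        (K.integrable_mul_edge T i (h'.memLp i) hψ.continuous)]
      simp [add_mul]
    simp only [h4, add_mul, Finset.sum_add_distrib]
    rw [h2, h3, key _ _ _ (pd_continuous hψ k), key _ _ _ hψ.continuous,
      ← h.green ψ k hψ, ← h'.green ψ k hψ]
    ring

theorem isTrace_toH1_add {T : K.Tri} {f f' : H2 (K.cell T)} {t t' : Fin 3 → ℝ → ℝ}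
    (h : K.IsTrace T (toH1 f) t) (h' : K.IsTrace T (toH1 f') t') :
    K.IsTrace T (toH1 (f + f')) (t + t') := by
  rw [toH1_add]; exact h.add K h'

theorem IsTrace.smul {T : K.Tri} {f : H1 (K.cell T)} {t : Fin 3 → ℝ → ℝ} (c : ℝ)
    (h : K.IsTrace T f t) : K.IsTrace T (c • f) (c • t) where
  memLp i := (h.memLp i).const_smul c
  green ψ k hψ := by
    have key : ∀ (a : L2 (K.cell T)) (φ : Plane → ℝ),
        ∫ x in K.cell T, (c • a : L2 (K.cell T)) x * φ x = c * ∫ x in K.cell T, a x * φ x := by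
      intro a φ
      rw [← integral_const_mul]
      refine integral_congr_ae ?_
      filter_upwards [Lp.coeFn_smul c a] with x hx
      rw [hx]; simp [mul_assoc]
    have h2 : (fn (c • f)) = c • (fn f) := rfl
    have h3 : wd (c • f) k = c • wd f k := rfl
    have h4 : ∀ i, ∫ s in Icc (0 : ℝ) 1, (c • t) i s * ψ (K.edgePt T i s) =
        c * ∫ s in Icc (0 : ℝ) 1, t i s * ψ (K.edgePt T i s) := fun i => by
      rw [← integral_const_mul]
      simp [mul_assoc]
    simp only [h4, mul_assoc, ← Finset.mul_sum]
    rw [h2, h3, key, key, ← h.green ψ k hψ]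
    ring

theorem isTrace_toH1_smul {T : K.Tri} {f : H2 (K.cell T)} {t : Fin 3 → ℝ → ℝ} (c : ℝ)
    (h : K.IsTrace T (toH1 f) t) : K.IsTrace T (toH1 (c • f)) (c • t) := by
  rw [toH1_smul]; exact h.smul K c

/-! ### The spaces `V`, `W`, `Σ` -/

/-- `V`: piecewise `H²` functions that are single-valued on interior edges and vanish on the
boundary. -/
def V : Submodule ℝ (∀ T : K.Tri, H2 (K.cell T)) where
  carrier := {v |
    (∀ T i T' j, K.Glued T i T' j → ∃ t t',
      K.IsTrace T (toH1 (v T)) t ∧ K.IsTrace T' (toH1 (v T')) t' ∧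
      ∀ᵐ s ∂volume.restrict (Icc (0 : ℝ) 1), t i s = t' j (1 - s)) ∧
    (∀ T i, K.IsBoundarySide T i → ∃ t, K.IsTrace T (toH1 (v T)) t ∧
      ∀ᵐ s ∂volume.restrict (Icc (0 : ℝ) 1), t i s = 0)}
  zero_mem' := ⟨fun T _ T' _ _ => ⟨0, 0, K.isTrace_zero T, K.isTrace_zero T', by simp⟩,
    fun T _ _ => ⟨0, K.isTrace_zero T, by simp⟩⟩
  add_mem' := by
    rintro a b ⟨ha, ha'⟩ ⟨hb, hb'⟩
    simp only [mem_ofPred_eq, Pi.add_apply]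
    refine ⟨fun T i T' j h => ?_, fun T i h => ?_⟩
    · obtain ⟨t, t', h1, h2, h3⟩ := ha T i T' j h
      obtain ⟨u, u', k1, k2, k3⟩ := hb T i T' j h
      refine ⟨t + u, t' + u', K.isTrace_toH1_add h1 k1, K.isTrace_toH1_add h2 k2, ?_⟩
      filter_upwards [h3, k3] with s e1 e2
      simp [e1, e2]
    · obtain ⟨t, h1, h3⟩ := ha' T i h
      obtain ⟨u, k1, k3⟩ := hb' T i h
      refine ⟨t + u, K.isTrace_toH1_add h1 k1, ?_⟩
      filter_upwards [h3, k3] with s e1 e2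
      simp [e1, e2]
  smul_mem' := by
    rintro c a ⟨ha, ha'⟩
    simp only [mem_ofPred_eq, Pi.smul_apply]
    refine ⟨fun T i T' j h => ?_, fun T i h => ?_⟩
    · obtain ⟨t, t', h1, h2, h3⟩ := ha T i T' j h
      refine ⟨c • t, c • t', K.isTrace_toH1_smul c h1, K.isTrace_toH1_smul c h2, ?_⟩
      filter_upwards [h3] with s e1
      simp [e1]
    · obtain ⟨t, h1, h3⟩ := ha' T i h
      refine ⟨c • t, K.isTrace_toH1_smul c h1, ?_⟩
      filter_upwards [h3] with s e1
      simp [e1]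

/-- The value of a one-form with components `a k` along the side `i` of `T` on the tangent
vector of that side. -/
def tangential (T : K.Tri) (i : Fin 3) (a : Fin 2 → Fin 3 → ℝ → ℝ) (s : ℝ) : ℝ :=
  ∑ k, a k i s * K.edgeVec T i k

/-- `W`: one-forms with piecewise `H¹` coefficients whose pullback to interior edges is
single-valued and whose pullback to boundary edges vanishes. The minus sign comes from the opposite
directions of the two parametrizations of the edge. -/
def W : Submodule ℝ (∀ T : K.Tri, Fin 2 → H1 (K.cell T)) where
  carrier := {α |
    (∀ T i T' j, K.Glued T i T' j → ∃ a a',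
      (∀ k, K.IsTrace T (α T k) (a k)) ∧ (∀ k, K.IsTrace T' (α T' k) (a' k)) ∧
      ∀ᵐ s ∂volume.restrict (Icc (0 : ℝ) 1),
        K.tangential T i a s = -K.tangential T' j a' (1 - s)) ∧
    (∀ T i, K.IsBoundarySide T i → ∃ a, (∀ k, K.IsTrace T (α T k) (a k)) ∧
      ∀ᵐ s ∂volume.restrict (Icc (0 : ℝ) 1), K.tangential T i a s = 0)}
  zero_mem' := ⟨fun T _ T' _ _ => ⟨0, 0, fun _ => K.isTrace_zero T, fun _ => K.isTrace_zero T',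
      by simp [tangential]⟩,
    fun T _ _ => ⟨0, fun _ => K.isTrace_zero T, by simp [tangential]⟩⟩
  add_mem' := by
    rintro a b ⟨ha, ha'⟩ ⟨hb, hb'⟩
    simp only [mem_ofPred_eq, Pi.add_apply]
    have key : ∀ T i t u s, K.tangential T i (t + u) s =
        K.tangential T i t s + K.tangential T i u s := fun T i t u s => by
      simp [tangential, add_mul, Finset.sum_add_distrib, -Fin.sum_univ_two]
    refine ⟨fun T i T' j h => ?_, fun T i h => ?_⟩
    · obtain ⟨t, t', h1, h2, h3⟩ := ha T i T' j h
      obtain ⟨u, u', k1, k2, k3⟩ := hb T i T' j h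
      refine ⟨t + u, t' + u', fun k => (h1 k).add K (k1 k), fun k => (h2 k).add K (k2 k), ?_⟩
      filter_upwards [h3, k3] with s e1 e2
      rw [key, key, e1, e2]; ring
    · obtain ⟨t, h1, h3⟩ := ha' T i h
      obtain ⟨u, k1, k3⟩ := hb' T i h
      refine ⟨t + u, fun k => (h1 k).add K (k1 k), ?_⟩
      filter_upwards [h3, k3] with s e1 e2
      rw [key, e1, e2]; ring
  smul_mem' := by
    rintro c a ⟨ha, ha'⟩
    simp only [mem_ofPred_eq, Pi.smul_apply]
    have key : ∀ T i t s, K.tangential T i (c • t) s = c * K.tangential T i t s :=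
      fun T i t s => by simp [tangential, mul_assoc, Finset.mul_sum, -Fin.sum_univ_two]
    refine ⟨fun T i T' j h => ?_, fun T i h => ?_⟩
    · obtain ⟨t, t', h1, h2, h3⟩ := ha T i T' j h
      refine ⟨c • t, c • t', fun k => (h1 k).smul K c, fun k => (h2 k).smul K c, ?_⟩
      filter_upwards [h3] with s e1
      rw [key, key, e1]; ring
    · obtain ⟨t, h1, h3⟩ := ha' T i h
      refine ⟨c • t, fun k => (h1 k).smul K c, ?_⟩
      filter_upwards [h3] with s e1
      rw [key, e1]; ring

/-- The value `σ(e, e)` of a `(0,2)`-tensor with components `a k l` along the side `i` of `T` on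
the tangent vector `e` of that side. -/
def tangential₂ (T : K.Tri) (i : Fin 3) (a : Fin 2 → Fin 2 → Fin 3 → ℝ → ℝ) (s : ℝ) : ℝ :=
  ∑ k, ∑ l, a k l i s * K.edgeVec T i k * K.edgeVec T i l

/-- `Σ`: symmetric `(0,2)`-tensor fields with piecewise `H¹` coefficients whose pullback to
interior edges is single-valued. -/
def Sigma : Submodule ℝ (∀ T : K.Tri, Fin 2 → Fin 2 → H1 (K.cell T)) where
  carrier := {σ |
    (∀ T k l, σ T k l = σ T l k) ∧
    (∀ T i T' j, K.Glued T i T' j → ∃ a a',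
      (∀ k l, K.IsTrace T (σ T k l) (a k l)) ∧ (∀ k l, K.IsTrace T' (σ T' k l) (a' k l)) ∧
      ∀ᵐ s ∂volume.restrict (Icc (0 : ℝ) 1),
        K.tangential₂ T i a s = K.tangential₂ T' j a' (1 - s))}
  zero_mem' := ⟨fun _ _ _ => rfl, fun T _ T' _ _ => ⟨0, 0, fun _ _ => K.isTrace_zero T,
    fun _ _ => K.isTrace_zero T', by simp [tangential₂]⟩⟩
  add_mem' := by
    rintro a b ⟨ha, ha'⟩ ⟨hb, hb'⟩
    simp only [mem_ofPred_eq, Pi.add_apply]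
    have key : ∀ T i t u s, K.tangential₂ T i (t + u) s =
        K.tangential₂ T i t s + K.tangential₂ T i u s := fun T i t u s => by
      simp [tangential₂, add_mul, Finset.sum_add_distrib, -Fin.sum_univ_two]
    refine ⟨fun T k l => ?_, fun T i T' j h => ?_⟩
    · rw [ha T k l, hb T k l]
    · obtain ⟨t, t', h1, h2, h3⟩ := ha' T i T' j h
      obtain ⟨u, u', k1, k2, k3⟩ := hb' T i T' j h
      refine ⟨t + u, t' + u', fun k l => (h1 k l).add K (k1 k l),
        fun k l => (h2 k l).add K (k2 k l), ?_⟩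
      filter_upwards [h3, k3] with s e1 e2
      rw [key, key, e1, e2]
  smul_mem' := by
    rintro c a ⟨ha, ha'⟩
    simp only [mem_ofPred_eq, Pi.smul_apply]
    have key : ∀ T i t s, K.tangential₂ T i (c • t) s = c * K.tangential₂ T i t s :=
      fun T i t s => by simp [tangential₂, mul_assoc, Finset.mul_sum, -Fin.sum_univ_two]
    refine ⟨fun T k l => ?_, fun T i T' j h => ?_⟩
    · rw [ha T k l]
    · obtain ⟨t, t', h1, h2, h3⟩ := ha' T i T' j h
      refine ⟨c • t, c • t', fun k l => (h1 k l).smul K c, fun k l => (h2 k l).smul K c, ?_⟩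
      filter_upwards [h3] with s e1
      rw [key, key, e1]

/-- The topological dual `V'`. -/
abbrev V' := K.V →L[ℝ] ℝ

/-- The topological dual `W'`. -/
abbrev W' := K.W →L[ℝ] ℝ

/-- `Vₕⁿ`: the elements of `V` that are piecewise polynomial of degree at most `n`. -/
def Vh (n : ℕ) : Submodule ℝ K.V where
  carrier := {v | ∀ T, (fn (toH1 (v.1 T))) ∈ PolyL2 n (K.cell T)}
  zero_mem' := fun T => zero_mem (PolyL2 n (K.cell T))
  add_mem' := fun ha hb T => add_mem (ha T) (hb T)
  smul_mem' := fun c _ ha T => Submodule.smul_mem _ c (ha T)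

/-- `Wₕⁿ`: the elements of `W` that belong to `𝒫ₙ⁻Λ¹` on every triangle. -/
def Wh (n : ℕ) : Submodule ℝ K.W where
  carrier := {α | ∀ T, (fun k => (fn (α.1 T k))) ∈ PolyMinus n (K.cell T)}
  zero_mem' := fun T => zero_mem (PolyMinus n (K.cell T))
  add_mem' := fun ha hb T => add_mem (ha T) (hb T)
  smul_mem' := fun c _ ha T => Submodule.smul_mem _ c (ha T)

/-- `Σₕⁿ`: the Regge finite elements of degree `n`. -/
def Sigmah (n : ℕ) : Submodule ℝ K.Sigma where
  carrier := {σ | ∀ T k l, (fn (σ.1 T k l)) ∈ PolyL2 n (K.cell T)}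
  zero_mem' := fun T _ _ => zero_mem (PolyL2 n (K.cell T))
  add_mem' := fun ha hb T k l => add_mem (ha T k l) (hb T k l)
  smul_mem' := fun c _ ha T k l => Submodule.smul_mem _ c (ha T k l)

/-! ### Regge metrics -/

/-- A Regge metric: on every closed triangle a Riemannian metric with coefficients smooth up to the
boundary, such that the tangential-tangential components on interior edges agree. The values of
`g T` outside of the triangle `T` are irrelevant. -/
structure ReggeMetric where
  /-- the matrix of coefficients of the metric in the coordinates of a triangle -/
  coeff : K.Tri → Plane → Matrix (Fin 2) (Fin 2) ℝ
  smooth : ∀ T a b, ContDiffOn ℝ ∞ (fun x => coeff T x a b) (K.tri T)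
  posDef : ∀ T, ∀ x ∈ K.tri T, (coeff T x).PosDef
  tangential_eq : ∀ T i T' j, K.Glued T i T' j → ∀ s ∈ Icc (0 : ℝ) 1,
    ∑ a, ∑ b, coeff T (K.edgePt T i s) a b * K.edgeVec T i a * K.edgeVec T i b =
      ∑ a, ∑ b, coeff T' (K.edgePt T' j (1 - s)) a b * K.edgeVec T' j a * K.edgeVec T' j b

namespace ReggeMetric

variable {K} (g : K.ReggeMetric)

/-- `g ∈ ℳₕⁿ`: the coefficients are polynomials of degree at most `n` on every triangle. -/
def IsPoly (n : ℕ) : Prop :=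
  ∀ T a b, ∃ p ∈ Poly n, ∀ x ∈ K.tri T, g.coeff T x a b = pval p x

/-- Two Regge metrics are equal as metrics on the surface. -/
def Agree (g' : K.ReggeMetric) : Prop := ∀ T, EqOn (g.coeff T) (g'.coeff T) (K.tri T)

/-- `g` is the Euclidean metric `δ` in the coordinates of every triangle. -/
def IsEuclidean : Prop := ∀ T, ∀ x ∈ K.tri T, g.coeff T x = 1

/-- The contravariant components `g^{ab}`. -/
def inv (T : K.Tri) (x : Plane) : Matrix (Fin 2) (Fin 2) ℝ := (g.coeff T x)⁻¹

/-- The density `√(det g)` of the volume form. -/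
def vol (T : K.Tri) (x : Plane) : ℝ := Real.sqrt (g.coeff T x).det

/-- The partial derivative `∂_c g_{ab}`. -/
def dcoeff (T : K.Tri) (x : Plane) (c a b : Fin 2) : ℝ :=
  fderivWithin ℝ (fun y => g.coeff T y a b) (K.tri T) x (EuclideanSpace.single c 1)

/-- The Christoffel symbol `Γ^c_{ab}`. -/
def christoffel (T : K.Tri) (x : Plane) (c a b : Fin 2) : ℝ :=
  (1 / 2) * ∑ d, g.inv T x c d * (g.dcoeff T x a b d + g.dcoeff T x b a d - g.dcoeff T x d a b)

/-- The pointwise inner product of two `(0,2)`-tensors. -/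
def inner₂ (T : K.Tri) (x : Plane) (A B : Fin 2 → Fin 2 → ℝ) : ℝ :=
  ∑ a, ∑ b, ∑ c, ∑ d, g.inv T x a c * g.inv T x b d * A a b * B c d

/-- `Sσ = σ - g Tr σ`. -/
def S (T : K.Tri) (x : Plane) (A : Fin 2 → Fin 2 → ℝ) (a b : Fin 2) : ℝ :=
  A a b - g.coeff T x a b * ∑ c, ∑ d, g.inv T x c d * A c d

/-- The covariant derivative `(∇α)_{ab} = ∂_a α_b - Γ^c_{ab} α_c` of a one-form with `H¹`
coefficients. -/
def covDeriv (T : K.Tri) (α : Fin 2 → H1 (K.cell T)) (x : Plane) (a b : Fin 2) : ℝ :=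
  wd (α b) a x - ∑ c, g.christoffel T x c a b * (fn (α c)) x

/-- The squared length `g(e, e)` of the tangent vector `e` of the side `i` of `T`, at the point with
parameter `s`. -/
def edgeSq (T : K.Tri) (i : Fin 3) (s : ℝ) : ℝ :=
  ∑ a, ∑ b, g.coeff T (K.edgePt T i s) a b * K.edgeVec T i a * K.edgeVec T i b

/-- The length element of the side `i` of `T`: the arc length is `ds = edgeLen ds'`, where `s'` is
the parameter in `[0, 1]`. -/
def edgeLen (T : K.Tri) (i : Fin 3) (s : ℝ) : ℝ := Real.sqrt (g.edgeSq T i s)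

/-- The unit tangent vector `τ` of the side `i` of `T`. -/
def tau (T : K.Tri) (i : Fin 3) (s : ℝ) (a : Fin 2) : ℝ := K.edgeVec T i a / g.edgeLen T i s

/-- The outward unit normal vector `n` of the side `i` of `T`: the outward conormal with its index
raised, normalized. -/
def normal (T : K.Tri) (i : Fin 3) (s : ℝ) (a : Fin 2) : ℝ :=
  (∑ b, g.inv T (K.edgePt T i s) a b * K.edgeConormal T i b) /
    Real.sqrt (∑ b, ∑ c, g.inv T (K.edgePt T i s) b c *
      K.edgeConormal T i b * K.edgeConormal T i c)

/-- `σ(τ, τ)` along the side `i` of `T`. -/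
def tautau (T : K.Tri) (i : Fin 3) (σ : Fin 2 → Fin 2 → H1 (K.cell T)) (s : ℝ) : ℝ :=
  ∑ a, ∑ b, K.trace T (σ a b) i s * g.tau T i s a * g.tau T i s b

/-- `α(n)` along the side `i` of `T`. -/
def normalComp (T : K.Tri) (i : Fin 3) (α : Fin 2 → H1 (K.cell T)) (s : ℝ) : ℝ :=
  ∑ a, K.trace T (α a) i s * g.normal T i s a

/-- The form `cₕ(g; σ, α) = ∑_T ⟨Sσ, ∇α⟩_{g,T} + ∑_e ⟨σ(τ,τ), ⟦α(n)⟧⟩_{g,e}`. The jump `⟦α(n)⟧` is the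
sum of the values of `α(n)` from the triangles that contain `e`, and `σ(τ,τ)` and the arc length are
single-valued on `e`, so that the sum over edges is a sum over the sides of all triangles. -/
def ch (σ : K.Sigma) (α : K.W) : ℝ :=
  (∑ T, ∫ x in K.cell T,
    g.inner₂ T x (g.S T x fun a b => (fn (σ.1 T a b)) x) (g.covDeriv T (α.1 T) x) * g.vol T x) +
  ∑ T, ∑ i, ∫ s in Icc (0 : ℝ) 1,
    g.tautau T i (σ.1 T) s * g.normalComp T i (α.1 T) s * g.edgeLen T i s

/-- The `L²` inner product of functions with respect to `g`. -/
def innerV (u v : K.V) : ℝ :=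
  ∑ T, ∫ x in K.cell T, (fn (toH1 (u.1 T))) x * (fn (toH1 (v.1 T))) x * g.vol T x

/-- The `L²` inner product of one-forms with respect to `g`. -/
def innerW (α β : K.W) : ℝ :=
  ∑ T, ∫ x in K.cell T,
    (∑ a, ∑ b, g.inv T x a b * (fn (α.1 T a)) x * (fn (β.1 T b)) x) * g.vol T x

end ReggeMetric

/-! ### Differential operators and projections

Every operator is given by a relation that characterizes its values; the operator picks the
element that satisfies the relation. -/

/-- `w = dv`. -/
def IsD (v : K.V) (w : K.W) : Prop := ∀ T k, w.1 T k = wdH1 (v.1 T) k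

/-- The exterior derivative `d : V → W`. -/
def d (v : K.V) : K.W := Classical.epsilon fun w => K.IsD v w

/-- `u = div_dist α`. -/
def IsDivDist (α : K.W') (u : K.V') : Prop := ∀ v, u v = -α (K.d v)

/-- `div_dist : W' → V'`. -/
def divDist (α : K.W') : K.V' := Classical.epsilon fun u => K.IsDivDist α u

namespace ReggeMetric

variable {K} (g : K.ReggeMetric)

/-- `α = (div S)_dist σ`. -/
def IsDivSDist (σ : K.Sigma) (α : K.W') : Prop := ∀ β, α β = -g.ch σ β

/-- `(div S)_dist : Σ → W'`. -/
def divSDist (σ : K.Sigma) : K.W' := Classical.epsilon fun α => g.IsDivSDist σ α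

/-- `(div div S)_dist : Σ → V'`. -/
def divDivSDist (σ : K.Sigma) : K.V' := K.divDist (g.divSDist σ)

/-- `u = divₕ α`. -/
def IsDivh (r : ℕ) (α : K.Wh (r + 1)) (u : K.Vh (r + 1)) : Prop :=
  ∀ v : K.Vh (r + 1), g.innerV u v = -g.innerW α (K.d v)

/-- `divₕ : Wₕ^{r+1} → Vₕ^{r+1}`. -/
def divh (r : ℕ) (α : K.Wh (r + 1)) : K.Vh (r + 1) := Classical.epsilon fun u => g.IsDivh r α u

/-- `α = (div S)ₕ σ`. -/
def IsDivSh (r : ℕ) (σ : K.Sigmah r) (α : K.Wh (r + 1)) : Prop :=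
  ∀ β : K.Wh (r + 1), g.innerW α β = -g.ch σ β

/-- `(div S)ₕ : Σₕ^r → Wₕ^{r+1}`. -/
def divSh (r : ℕ) (σ : K.Sigmah r) : K.Wh (r + 1) := Classical.epsilon fun α => g.IsDivSh r σ α

/-- `(div div S)ₕ : Σₕ^r → Vₕ^{r+1}`. -/
def divDivSh (r : ℕ) (σ : K.Sigmah r) : K.Vh (r + 1) := g.divh r (g.divSh r σ)

/-- `w = πₕ^V u`. -/
def IsPiV (r : ℕ) (u : K.V') (w : K.Vh (r + 1)) : Prop :=
  ∀ v : K.Vh (r + 1), g.innerV w v = u v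

/-- `πₕ^V : V' → Vₕ^{r+1}`. -/
def piV (r : ℕ) (u : K.V') : K.Vh (r + 1) := Classical.epsilon fun w => g.IsPiV r u w

/-- `γ = πₕ^W α`. -/
def IsPiW (r : ℕ) (α : K.W') (γ : K.Wh (r + 1)) : Prop :=
  ∀ β : K.Wh (r + 1), g.innerW γ β = α β

/-- `πₕ^W : W' → Wₕ^{r+1}`. -/
def piW (r : ℕ) (α : K.W') : K.Wh (r + 1) := Classical.epsilon fun γ => g.IsPiW r α γ

/-- `ρ = πₕ^Σ σ`, where the interpolant is taken with respect to the metric `g`. The degree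
conditions `< r` and `≤ r` describe `𝒫_{r-1}S₂⁰(T)` (which is zero if `r = 0`) and `𝒫_r(e)`. -/
structure IsPiSigma (r : ℕ) (σ : K.Sigma) (ρ : K.Sigmah r) : Prop where
  interior : ∀ T, ∀ p : Fin 2 → Fin 2 → MvPolynomial (Fin 2) ℝ,
    (∀ a b, p a b = p b a) → (∀ a b, (p a b).totalDegree < r) →
    ∫ x in K.cell T, g.inner₂ T x (fun a b => (fn (ρ.1.1 T a b)) x - (fn (σ.1 T a b)) x)
      (fun a b => pval (p a b) x) * g.vol T x = 0
  edge : ∀ T i, ∀ q : Polynomial ℝ, q.natDegree ≤ r →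
    ∫ s in Icc (0 : ℝ) 1, (g.tautau T i (ρ.1.1 T) s - g.tautau T i (σ.1 T) s) * q.eval s *
      g.edgeLen T i s = 0

/-- The Regge interpolant `πₕ^Σ : Σ → Σₕ^r` with respect to the metric `g`. -/
def piSigma (r : ℕ) (σ : K.Sigma) : K.Sigmah r := Classical.epsilon fun ρ => g.IsPiSigma r σ ρ

end ReggeMetric

/-! ### Planar triangulations -/

/-- The surface is a triangulated planar domain: the coordinates of all triangles are the Cartesian
coordinates, and any two triangles intersect in the convex hull of their common vertices. -/
def IsPlanar : Prop :=
  ∃ p : K.Vtx → Plane, (∀ T i, K.pos T i = p (K.vert T i)) ∧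
    ∀ T T', K.tri T ∩ K.tri T' = convexHull ℝ (p '' (range (K.vert T) ∩ range (K.vert T')))

/-- The planar domain `Ω` that is triangulated by a planar triangulation. -/
def domain : Set Plane := interior (⋃ T, K.tri T)

/-- `U = {u ∈ H¹(Ω) ⊗ ℝ² | u|_T ∈ H²(T) ⊗ ℝ²}`, for a planar triangulation. -/
def U : Submodule ℝ (∀ T : K.Tri, Fin 2 → H2 (K.cell T)) where
  carrier := {u | ∃ f : Fin 2 → H1 K.domain,
    ∀ T k, (fn (f k)) =ᵐ[volume.restrict (K.cell T)] (fn (toH1 (u T k)))}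
  zero_mem' := ⟨0, fun T k => by
    have hsub : K.cell T ⊆ K.domain := interior_mono (subset_iUnion _ T)
    have h1 := ae_restrict_of_ae_restrict_of_subset hsub
      (Lp.coeFn_zero ℝ 2 (volume.restrict K.domain))
    filter_upwards [h1, Lp.coeFn_zero ℝ 2 (volume.restrict (K.cell T))] with x e1 e2
    exact e1.trans e2.symm⟩
  add_mem' := by
    rintro a b ⟨f, hf⟩ ⟨f', hf'⟩
    refine ⟨f + f', fun T k => ?_⟩
    have hsub : K.cell T ⊆ K.domain := interior_mono (subset_iUnion _ T)
    have h1 := ae_restrict_of_ae_restrict_of_subset hsub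
      (Lp.coeFn_add (fn (f k)) (fn (f' k)))
    filter_upwards [h1, Lp.coeFn_add (fn (toH1 (a T k))) (fn (toH1 (b T k))), hf T k, hf' T k]
      with x e1 e2 e3 e4
    refine e1.trans (Eq.trans ?_ e2.symm)
    simp [e3, e4]
  smul_mem' := by
    rintro c a ⟨f, hf⟩
    refine ⟨c • f, fun T k => ?_⟩
    have hsub : K.cell T ⊆ K.domain := interior_mono (subset_iUnion _ T)
    have h1 := ae_restrict_of_ae_restrict_of_subset hsub (Lp.coeFn_smul c (fn (f k)))
    filter_upwards [h1, Lp.coeFn_smul c (fn (toH1 (a T k))), hf T k] with x e1 e2 e3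
    refine e1.trans (Eq.trans ?_ e2.symm)
    simp [e3]

/-- `Uₕⁿ`: the elements of `U` that are piecewise polynomial of degree at most `n`. -/
def Uh (n : ℕ) : Submodule ℝ K.U where
  carrier := {u | ∀ T k, (fn (toH1 (u.1 T k))) ∈ PolyL2 n (K.cell T)}
  zero_mem' := fun T _ => zero_mem (PolyL2 n (K.cell T))
  add_mem' := fun ha hb T k => add_mem (ha T k) (hb T k)
  smul_mem' := fun c _ ha T k => Submodule.smul_mem _ c (ha T k)

namespace ReggeMetric

variable {K} (g : K.ReggeMetric)

/-- `σ = def u = ½ L_u g`, with the Lie derivative in coordinates,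
`(L_u g)_{ab} = u^c ∂_c g_{ab} + g_{cb} ∂_a u^c + g_{ac} ∂_b u^c`. -/
def IsDef (u : K.U) (σ : K.Sigma) : Prop :=
  ∀ T a b, (fn (σ.1 T a b)) =ᵐ[volume.restrict (K.cell T)] fun x =>
    (1 / 2) * ∑ c, ((fn (toH1 (u.1 T c))) x * g.dcoeff T x c a b +
      g.coeff T x c b * (fn (wdH1 (u.1 T c) a)) x + g.coeff T x a c * (fn (wdH1 (u.1 T c) b)) x)

/-- `def : U → Σ`. -/
def defU (u : K.U) : K.Sigma := Classical.epsilon fun σ => g.IsDef u σ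

/-- `def : Uₕ^{r+1} → Σₕ^r`. -/
def defUh (r : ℕ) (u : K.Uh (r + 1)) : K.Sigmah r :=
  Classical.epsilon fun σ : K.Sigmah r => g.IsDef u σ

/-- `w = πₕ^U u`, with the inner products taken with respect to the metric `g`. The degree
conditions describe `𝒫_{r-2}(T)` and `𝒫_{r-1}(e)` (with `𝒫_m = 0` for negative `m`). Point values at
vertices are those of the continuous representative. -/
structure IsPiU (r : ℕ) (u : K.U) (w : K.Uh (r + 1)) : Prop where
  interior : ∀ T, ∀ p : Fin 2 → MvPolynomial (Fin 2) ℝ, (∀ b, (p b).totalDegree + 1 < r) →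
    ∫ x in K.cell T, (∑ a, ∑ b, g.coeff T x a b *
      ((fn (toH1 (w.1.1 T a))) x - (fn (toH1 (u.1 T a))) x) * pval (p b) x) * g.vol T x = 0
  edge : ∀ T i, ∀ q : Fin 2 → Polynomial ℝ, (∀ b, (q b).natDegree < r) →
    ∫ s in Icc (0 : ℝ) 1, (∑ a, ∑ b, g.coeff T (K.edgePt T i s) a b *
      (K.trace T (toH1 (w.1.1 T a)) i s - K.trace T (toH1 (u.1 T a)) i s) * (q b).eval s) *
      g.edgeLen T i s = 0
  vertex : ∀ T i a, ∃ c : Plane → ℝ, ContinuousOn c (K.tri T) ∧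
    (∀ᵐ x ∂volume.restrict (K.cell T), c x = (fn (toH1 (w.1.1 T a))) x - (fn (toH1 (u.1 T a))) x) ∧
    c (K.pos T i) = 0

/-- The Lagrange interpolant `πₕ^U : U → Uₕ^{r+1}`. -/
def piU (r : ℕ) (u : K.U) : K.Uh (r + 1) := Classical.epsilon fun w => g.IsPiU r u w

end ReggeMetric

end TriangulatedSurface

end

end ReggeFEM

namespace ReggeFEM

noncomputable section

/-! ### Geometry of a triangle -/

/-! Both div-div operators are the form `c_h` tested with gradients: `⟨(div div S)_dist σ, v⟩ =
c_h(σ, dv)` for `v` in `V`, and the same for the discrete operator and `v` in `V_h^{r+1}`. The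
discrete case needs `dv` to lie in `W_h^{r+1}`; it does (`dL_mem_Wh`), since its coefficients have
degree `r` and contraction with `x` raises the degree by one only. Item 1 is this inclusion together
with the definitions of the projections (`divh_piW`).

Item 2 is a count of degrees. For a piecewise constant metric, `S` is symmetric for the pointwise
inner product, so the cell terms of `c_h(σ, dv)` pair `σ` with `S` of the Hessian of `v`, a
symmetric polynomial tensor of degree at most `r - 1`; the side terms pair `σ(τ,τ)` with `dv(n)`, of
degree at most `r`. These are moments that the Regge interpolant preserves, so `c_h(π_h^Σ σ, dv) =
c_h(σ, dv)` (`ch_piSigma`).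

For the commutation in item 3, let `d = π_h^U u - u`, whose Lagrange moments and vertex values
vanish. Green's formula gives zero moments of its first derivatives against `𝒫_{r-1}(T)`, and
integration by parts along a side gives zero moments of its tangential derivative against `𝒫_r(e)`
(`LagZero.integral_wd`, `LagZero.integral_tan`). As `(def u)(e, e)` contains only tangential
derivatives along `e`, the tensor `def π_h^U u` satisfies the conditions that characterize `π_h^Σ
def u`.

The rows are complexes because, in the flat case, `⟨S def u, ∇dv⟩` is a combination of Jacobian
determinants of components of `dv` and `u`, and integrates to the boundary (`integral_jacobian`).
There the normal derivatives of `v` are cancelled by the side terms of `c_h`. What is left on a side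
is the tangential derivative of `v` times the conormal component of the tangential derivative of
`u`; it takes opposite values on glued sides and vanishes on boundary sides (`ch_symGradU`). A field
with `def u = 0` has vanishing second derivatives, so it is affine on each triangle and reproduced
by the interpolation.

Well-posedness takes most of the length. Traces on sides and point values of `H²` functions are
built by extension from smooth functions, which are dense because mollification combined with a
contraction into the convex triangle needs no boundary layer; the extension rests on an elementary
trace inequality and an elementary Sobolev inequality. They make `c_h` continuous in its last
argument. The Regge problem is split, by tensors dual to the three values `σ(e_i, e_i)`, into scalar
problems with moments on one side and in the triangle: a polynomial without side moments is `λ_i q`,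
and testing with `q` gives `q = 0`. The Lagrange problem is treated alike with `λ_0 λ_1 λ_2 q`.
Interpolants are single-valued because the moment problem on a side has only one solution. In the
planar case, membership in `U` is equivalent to matching of traces (`traceL_glued_of_mem_U`,
`mem_U_of_traceL`). -/

theorem fin3_two_one (i : Fin 3) : i + 2 + 1 = i := by revert i; decide

theorem fin3_two_two (i : Fin 3) : i + 2 + 2 = i + 1 := by revert i; decide

theorem fin3_one_one (i : Fin 3) : i + 1 + 1 = i + 2 := by revert i; decide

theorem fin3_one_two (i : Fin 3) : i + 1 + 2 = i := by revert i; decide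

theorem fin3_cases (i j : Fin 3) : j = i ∨ j = i + 1 ∨ j = i + 2 := by revert i j; decide

/-- The cross product in the plane. -/
def cross (a b : Plane) : ℝ := a 0 * b 1 - a 1 * b 0

/-- Twice the signed area of a triangle. -/
def tdet (P : Fin 3 → Plane) : ℝ := cross (P 1 - P 0) (P 2 - P 0)

/-- The barycentric coordinates of a triangle. -/
def lam (P : Fin 3 → Plane) (i : Fin 3) (x : Plane) : ℝ :=
  cross (P (i + 2) - P (i + 1)) (x - P (i + 1)) / tdet P

/-- The open triangle, in barycentric coordinates. -/
def ocell (P : Fin 3 → Plane) : Set Plane := {x | ∀ i, 0 < lam P i x}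

/-- The affine coordinates of a triangle with origin at the vertex `i`. -/
def chart (P : Fin 3 → Plane) (i : Fin 3) (u : Plane) : Plane :=
  P i + u 0 • (P (i + 1) - P i) + u 1 • (P (i + 2) - P i)

/-- The side `i` of a triangle, parametrized by `[0, 1]`. -/
def sidePt (P : Fin 3 → Plane) (i : Fin 3) (s : ℝ) : Plane :=
  P (i + 1) + s • (P (i + 2) - P (i + 1))

theorem tdet_cyclic (P : Fin 3 → Plane) (i : Fin 3) :
    cross (P (i + 1) - P i) (P (i + 2) - P i) = tdet P := by
  fin_cases i <;> simp [tdet, cross] <;> ring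

theorem lam_chart {P : Fin 3 → Plane} (hD : 0 < tdet P) (i : Fin 3) (u : Plane) :
    lam P i (chart P i u) = 1 - u 0 - u 1 ∧ lam P (i + 1) (chart P i u) = u 0 ∧
      lam P (i + 2) (chart P i u) = u 1 := by
  have h := hD.ne'
  simp only [lam]
  rw [div_eq_iff h, div_eq_iff h, div_eq_iff h]
  fin_cases i <;> simp [tdet, cross, chart] <;> refine ⟨?_, ?_, ?_⟩ <;> ring

theorem chart_lam {P : Fin 3 → Plane} (hD : 0 < tdet P) (i : Fin 3) (x : Plane) :
    chart P i !₂[lam P (i + 1) x, lam P (i + 2) x] = x := by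
  have h := hD.ne'
  ext k
  simp only [chart, lam, PiLp.add_apply, PiLp.smul_apply, PiLp.sub_apply, smul_eq_mul]
  simp only [div_mul_eq_mul_div, Matrix.cons_val_zero, Matrix.cons_val_one]
  rw [add_assoc, ← add_div, ← eq_sub_iff_add_eq', div_eq_iff h]
  fin_cases i <;> fin_cases k <;> simp [tdet, cross] <;> ring

theorem lam_sum {P : Fin 3 → Plane} (hD : 0 < tdet P) (x : Plane) : ∑ i, lam P i x = 1 := by
  have h := lam_chart hD 0 !₂[lam P 1 x, lam P 2 x]
  have h' := chart_lam hD 0 x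
  simp only [zero_add] at h h'
  rw [h'] at h
  rw [Fin.sum_univ_three, h.1]
  simp only [Matrix.cons_val_zero, Matrix.cons_val_one]
  ring

theorem lam_sum' {P : Fin 3 → Plane} (hD : 0 < tdet P) (i : Fin 3) (x : Plane) :
    lam P i x + lam P (i + 1) x + lam P (i + 2) x = 1 := by
  rw [← lam_sum hD x, Fin.sum_univ_three]
  fin_cases i <;> simp <;> ring

theorem lam_recon {P : Fin 3 → Plane} (hD : 0 < tdet P) (x : Plane) :
    ∑ i, lam P i x • P i = x := by
  have h := chart_lam hD 0 x
  have h2 := lam_sum hD x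
  rw [Fin.sum_univ_three] at h2 ⊢
  conv_rhs => rw [← h]
  have h3 : lam P 0 x = 1 - lam P 1 x - lam P 2 x := by linarith
  rw [h3]
  simp only [chart, zero_add, Matrix.cons_val_zero, Matrix.cons_val_one]
  module

theorem lam_combo (P : Fin 3 → Plane) (i : Fin 3) (x y : Plane) {a b : ℝ} (h : a + b = 1) :
    lam P i (a • x + b • y) = a * lam P i x + b * lam P i y := by
  have hb : b = 1 - a := by linarith
  subst hb
  simp [lam, cross]
  ring

theorem lam_vertex {P : Fin 3 → Plane} (hD : 0 < tdet P) (i j : Fin 3) :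
    lam P i (P j) = if i = j then 1 else 0 := by
  have h := hD.ne'
  rw [lam, div_eq_iff h]
  fin_cases i <;> fin_cases j <;> simp [tdet, cross] <;> ring

theorem lam_sidePt {P : Fin 3 → Plane} (hD : 0 < tdet P) (i : Fin 3) (s : ℝ) :
    lam P i (sidePt P i s) = 0 ∧ lam P (i + 1) (sidePt P i s) = 1 - s ∧
      lam P (i + 2) (sidePt P i s) = s := by
  have e : sidePt P i s = (1 - s) • P (i + 1) + s • P (i + 2) := by
    simp only [sidePt]; module
  rw [e]
  simp only [lam_combo P _ _ _ (show (1 - s) + s = 1 by ring), lam_vertex hD]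
  fin_cases i <;> simp

theorem lam_continuous (P : Fin 3 → Plane) (i : Fin 3) : Continuous (lam P i) := by
  unfold lam cross
  simp only [PiLp.sub_apply]
  fun_prop

theorem lam_contDiff (P : Fin 3 → Plane) (i : Fin 3) : ContDiff ℝ ∞ (lam P i) := by
  unfold lam cross
  simp only [PiLp.sub_apply]
  fun_prop

theorem isOpen_ocell (P : Fin 3 → Plane) : IsOpen (ocell P) := by
  simp only [ocell, ofPred_forall]
  exact isOpen_iInter_of_finite fun i => isOpen_lt continuous_const (lam_continuous P i)

/-- The half-planes are convex and contain the vertices; conversely, `x` is the combination of the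
vertices with its barycentric coordinates as weights. -/
theorem mem_convexHull_iff {P : Fin 3 → Plane} (hD : 0 < tdet P) (x : Plane) :
    x ∈ convexHull ℝ (range P) ↔ ∀ i, 0 ≤ lam P i x := by
  constructor
  · intro hx i
    have hc : Convex ℝ {y | 0 ≤ lam P i y} := by
      intro y hy z hz a b ha hb hab
      simp only [mem_ofPred_eq] at *
      rw [lam_combo P i y z hab]
      positivity
    have hs : range P ⊆ {y | 0 ≤ lam P i y} := by
      rintro _ ⟨j, rfl⟩
      simp only [mem_ofPred_eq, lam_vertex hD]
      split_ifs <;> norm_num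
    exact convexHull_min hs hc hx
  · intro h
    rw [← lam_recon hD x]
    exact (convex_convexHull ℝ _).sum_mem (fun i _ => h i) (lam_sum hD x)
      fun i _ => subset_convexHull ℝ _ (mem_range_self i)

/-- If the coordinate `i` vanishes at `x`, moving `x` straight away from `P i` makes it negative at
once, so `x` is not an interior point. -/
theorem interior_convexHull_eq {P : Fin 3 → Plane} (hD : 0 < tdet P) :
    interior (convexHull ℝ (range P)) = ocell P := by
  apply Subset.antisymm
  · intro x hx i
    have hx0 := (mem_convexHull_iff hD x).1 (interior_subset hx) i
    by_contra hneg
    have h0 : lam P i x = 0 := le_antisymm (not_lt.1 hneg) hx0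
    have hcont : Continuous fun t : ℝ => (1 + t) • x + (-t) • P i := by fun_prop
    have hmem : (fun t : ℝ => (1 + t) • x + (-t) • P i) 0 ∈ interior (convexHull ℝ (range P)) := by
      simpa using hx
    have hev := hcont.continuousAt.eventually (isOpen_interior.mem_nhds hmem)
    obtain ⟨ε, hε, hball⟩ := Metric.eventually_nhds_iff.1 hev
    have h1 := hball (y := ε / 2) (by rw [Real.dist_eq, sub_zero, abs_of_pos (by linarith)]; linarith)
    have h2 := (mem_convexHull_iff hD _).1 (interior_subset h1) i
    rw [lam_combo P i _ _ (by ring), h0, lam_vertex hD] at h2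
    simp at h2
    linarith
  · refine interior_maximal (fun x hx => ?_) (isOpen_ocell P)
    exact (mem_convexHull_iff hD x).2 fun i => (hx i).le

/-- The open reference triangle. -/
def refTri : Set Plane := {u | 0 < u 0 ∧ 0 < u 1 ∧ u 0 + u 1 < 1}

theorem measurableSet_refTri : MeasurableSet refTri := by
  have h0 : Measurable fun u : Plane => u 0 := (by fun_prop : Continuous fun u : Plane => u 0).measurable
  have h1 : Measurable fun u : Plane => u 1 := (by fun_prop : Continuous fun u : Plane => u 1).measurable
  exact (measurableSet_lt measurable_const h0).inter
    ((measurableSet_lt measurable_const h1).inter (measurableSet_lt (h0.add h1) measurable_const))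

theorem chart_image {P : Fin 3 → Plane} (hD : 0 < tdet P) (i : Fin 3) :
    chart P i '' refTri = ocell P := by
  ext x
  constructor
  · rintro ⟨u, ⟨h0, h1, h2⟩, rfl⟩
    obtain ⟨e0, e1, e2⟩ := lam_chart hD i u
    intro j
    rcases fin3_cases i j with rfl | rfl | rfl
    · rw [e0]; linarith
    · rw [e1]; exact h0
    · rw [e2]; exact h1
  · intro hx
    refine ⟨_, ⟨?_, ?_, ?_⟩, chart_lam hD i x⟩
    · exact hx _
    · exact hx _
    · have := lam_sum' hD i x
      have := hx i
      simp
      linarith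

theorem chart_injective {P : Fin 3 → Plane} (hD : 0 < tdet P) (i : Fin 3) :
    Function.Injective (chart P i) := by
  intro u v h
  have hu := lam_chart hD i u
  have hv := lam_chart hD i v
  rw [h] at hu
  ext k
  fin_cases k
  · exact hu.2.1.symm.trans hv.2.1
  · exact hu.2.2.symm.trans hv.2.2

/-- The linear part of `chart`. -/
def chartLin (P : Fin 3 → Plane) (i : Fin 3) : Plane →L[ℝ] Plane :=
  (EuclideanSpace.proj (𝕜 := ℝ) 0).smulRight (P (i + 1) - P i) +
    (EuclideanSpace.proj (𝕜 := ℝ) 1).smulRight (P (i + 2) - P i)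

theorem chart_hasFDerivAt (P : Fin 3 → Plane) (i : Fin 3) (u : Plane) :
    HasFDerivAt (chart P i) (chartLin P i) u := by
  have h : chart P i = fun u => P i + chartLin P i u := by
    funext u; simp [chart, chartLin, add_assoc]
  rw [h]
  exact (chartLin P i).hasFDerivAt.const_add _

theorem chartLin_det (P : Fin 3 → Plane) (i : Fin 3) : (chartLin P i).det = tdet P := by
  rw [← tdet_cyclic P i]
  change LinearMap.det (chartLin P i : Plane →ₗ[ℝ] Plane) = _
  rw [← LinearMap.det_toMatrix (EuclideanSpace.basisFun (Fin 2) ℝ).toBasis, Matrix.det_fin_two]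
  simp [LinearMap.toMatrix_apply, chartLin, cross]
  ring

theorem integral_ocell {P : Fin 3 → Plane} (hD : 0 < tdet P) (i : Fin 3) (h : Plane → ℝ) :
    ∫ x in ocell P, h x = tdet P * ∫ u in refTri, h (chart P i u) := by
  rw [← chart_image hD i, integral_image_eq_integral_abs_det_fderiv_smul volume
    measurableSet_refTri (fun x _ => (chart_hasFDerivAt P i x).hasFDerivWithinAt)
    (chart_injective hD i).injOn, ← integral_const_mul]
  simp only [chartLin_det, abs_of_pos hD, smul_eq_mul]

theorem integral_refTri {h : Plane → ℝ} (hc : Continuous h) :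
    ∫ u in refTri, h u = ∫ s in Ioo (0 : ℝ) 1, ∫ t in Ioo (0 : ℝ) (1 - s), h !₂[s, t] := by
  let e : ℝ × ℝ ≃ᵐ Plane := (MeasurableEquiv.finTwoArrow (α := ℝ)).symm.trans
    (MeasurableEquiv.toLp 2 (Fin 2 → ℝ))
  have he : MeasurePreserving e := by
    exact (PiLp.volume_preserving_toLp (Fin 2)).comp (volume_preserving_finTwoArrow ℝ).symm
  have hev : ∀ p : ℝ × ℝ, e p = !₂[p.1, p.2] := fun p => rfl
  rw [← he.setIntegral_preimage_emb e.measurableEmbedding]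
  have hm : MeasurableSet (e ⁻¹' refTri) := e.measurable measurableSet_refTri
  have hcont : Continuous fun p : ℝ × ℝ => h (e p) := by
    refine hc.comp ?_
    refine (PiLp.continuous_toLp 2 _).comp (continuous_pi fun k => ?_)
    fin_cases k
    · exact continuous_fst
    · exact continuous_snd
  have hsub : e ⁻¹' refTri ⊆ Icc (0 : ℝ) 1 ×ˢ Icc (0 : ℝ) 1 := by
    rintro ⟨s, t⟩ ⟨h0, h1, h2⟩
    simp [hev] at h0 h1 h2
    exact ⟨⟨h0.le, by simp; linarith⟩, ⟨h1.le, by simp; linarith⟩⟩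
  have hint : IntegrableOn (fun p => h (e p)) (e ⁻¹' refTri) volume :=
    (hcont.continuousOn.integrableOn_compact (isCompact_Icc.prod isCompact_Icc)).mono_set hsub
  rw [← integral_indicator hm, Measure.volume_eq_prod,
    integral_prod _ ((integrable_indicator_iff hm).2 (by rwa [← Measure.volume_eq_prod])),
    ← integral_indicator measurableSet_Ioo]
  congr 1
  funext s
  by_cases hs : s ∈ Ioo (0 : ℝ) 1
  · rw [indicator_of_mem hs, ← integral_indicator measurableSet_Ioo]
    congr 1
    funext t
    simp only [indicator, mem_preimage, hev, refTri, mem_ofPred_eq, mem_Ioo]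
    have : (0 < s ∧ 0 < t ∧ s + t < 1) ↔ (0 < t ∧ t < 1 - s) := by
      constructor
      · rintro ⟨_, h1, h2⟩; exact ⟨h1, by linarith⟩
      · rintro ⟨h1, h2⟩; exact ⟨hs.1, h1, by linarith⟩
    simp [this]
  · rw [indicator_of_notMem hs, ← integral_zero ℝ ℝ (μ := volume)]
    congr 1
    funext t
    rw [indicator_of_notMem]
    rintro ⟨h0, h1, h2⟩
    simp [hev] at h0 h1 h2
    exact hs ⟨h0, by linarith⟩

theorem continuous_plane_mk {f g : ℝ → ℝ} (hf : Continuous f) (hg : Continuous g) :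
    Continuous fun s => (!₂[f s, g s] : Plane) := by
  refine (PiLp.continuous_toLp 2 _).comp ?_
  refine continuous_pi fun k => ?_
  fin_cases k <;> simpa

theorem chart_continuous (P : Fin 3 → Plane) (i : Fin 3) : Continuous (chart P i) := by
  unfold chart; fun_prop

theorem sidePt_continuous (P : Fin 3 → Plane) (i : Fin 3) : Continuous (sidePt P i) := by
  unfold sidePt; fun_prop

/-- The divergence theorem for a vector field with constant direction parallel to one of the sides. -/
theorem integral_fderiv_ocell {P : Fin 3 → Plane} (hD : 0 < tdet P) (i : Fin 3) {ψ : Plane → ℝ}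
    (hψ : ContDiff ℝ ∞ ψ) :
    ∫ x in ocell P, fderiv ℝ ψ x (P (i + 2) - P i) =
      tdet P * ((∫ s in Icc (0 : ℝ) 1, ψ (sidePt P i s)) -
        ∫ s in Icc (0 : ℝ) 1, ψ (sidePt P (i + 2) s)) := by
  have hfc : Continuous fun x => fderiv ℝ ψ x (P (i + 2) - P i) :=
    (hψ.continuous_fderiv (by simp)).clm_apply continuous_const
  rw [integral_ocell hD i,
    integral_refTri (h := fun u => fderiv ℝ ψ (chart P i u) (P (i + 2) - P i))
      (hfc.comp (chart_continuous P i))]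
  congr 1
  have e1 : ∀ s, sidePt P i s = chart P i !₂[1 - s, s] := fun s => by
    simp only [sidePt, chart, Matrix.cons_val_zero, Matrix.cons_val_one]
    module
  have e2 : ∀ s, sidePt P (i + 2) s = chart P i !₂[s, 0] := fun s => by
    simp [sidePt, chart, fin3_two_one, fin3_two_two]
  -- Fundamental theorem of calculus on the segments parallel to `P (i + 2) - P i`: they start on
  -- the side `i + 2` and end on the side `i`.
  have hin : ∀ s ∈ Ioo (0 : ℝ) 1, ∫ t in Ioo (0 : ℝ) (1 - s),
      fderiv ℝ ψ (chart P i !₂[s, t]) (P (i + 2) - P i) =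
        ψ (chart P i !₂[s, 1 - s]) - ψ (chart P i !₂[s, 0]) := by
    intro s hs
    rw [← integral_Ioc_eq_integral_Ioo, ← intervalIntegral.integral_of_le (by linarith [hs.2])]
    refine intervalIntegral.integral_eq_sub_of_hasDerivAt
      (f := fun t => ψ (chart P i !₂[s, t])) (fun t _ => ?_) ?_
    · have hl : HasDerivAt (fun t : ℝ => chart P i !₂[s, t]) (P (i + 2) - P i) t := by
        have : (fun t : ℝ => chart P i !₂[s, t]) =
            fun t => P i + s • (P (i + 1) - P i) + t • (P (i + 2) - P i) := by
          funext t; simp [chart]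
        rw [this]
        simpa using ((hasDerivAt_id t).smul_const (P (i + 2) - P i)).const_add
          (P i + s • (P (i + 1) - P i))
      exact ((hψ.differentiable (by simp)).differentiableAt.hasFDerivAt).comp_hasDerivAt t hl
    · exact ((hfc.comp (chart_continuous P i)).comp
        (continuous_plane_mk continuous_const continuous_id)).intervalIntegrable _ _
  have c1 : Continuous fun s : ℝ => ψ (chart P i !₂[s, 1 - s]) :=
    (hψ.continuous.comp (chart_continuous P i)).comp
      (continuous_plane_mk continuous_id (by fun_prop))
  have c2 : Continuous fun s : ℝ => ψ (chart P i !₂[s, 0]) :=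
    (hψ.continuous.comp (chart_continuous P i)).comp
      (continuous_plane_mk continuous_id (by fun_prop))
  rw [setIntegral_congr_fun measurableSet_Ioo hin]
  simp only [e1, e2]
  simp only [integral_Icc_eq_integral_Ioc, ← integral_Ioc_eq_integral_Ioo,
    ← intervalIntegral.integral_of_le (zero_le_one' ℝ)]
  rw [intervalIntegral.integral_sub (c1.intervalIntegrable _ _) (c2.intervalIntegrable _ _)]
  congr 1
  -- The slices meet the side `i` in the direction opposite to its parametrization, hence the
  -- substitution `s ↦ 1 - s`.
  simpa using (intervalIntegral.integral_comp_sub_left (a := 0) (b := 1)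
    (fun s => ψ (chart P i !₂[s, 1 - s])) 1).symm

theorem fderiv_apply_eq (ψ : Plane → ℝ) (x v : Plane) :
    fderiv ℝ ψ x v = v 0 * pd 0 ψ x + v 1 * pd 1 ψ x := by
  have : v = v 0 • EuclideanSpace.single 0 (1 : ℝ) + v 1 • EuclideanSpace.single 1 (1 : ℝ) := by
    ext k; fin_cases k <;> simp
  conv_lhs => rw [this]
  simp [pd]

/-- The closed triangle. -/
def ctri (P : Fin 3 → Plane) : Set Plane := convexHull ℝ (range P)

theorem isCompact_ctri (P : Fin 3 → Plane) : IsCompact (ctri P) :=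
  (finite_range _).isCompact_convexHull ℝ

theorem ocell_subset_ctri {P : Fin 3 → Plane} (hD : 0 < tdet P) : ocell P ⊆ ctri P :=
  fun x hx => (mem_convexHull_iff hD x).2 fun i => (hx i).le

theorem integrableOn_ocell {P : Fin 3 → Plane} (hD : 0 < tdet P) {h : Plane → ℝ}
    (hc : Continuous h) : IntegrableOn h (ocell P) :=
  (hc.continuousOn.integrableOn_compact (isCompact_ctri P)).mono_set (ocell_subset_ctri hD)

/-- The divergence theorem on a triangle. -/
theorem integral_pd_ocell {P : Fin 3 → Plane} (hD : 0 < tdet P) {ψ : Plane → ℝ}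
    (hψ : ContDiff ℝ ∞ ψ) (k : Fin 2) :
    ∫ x in ocell P, pd k ψ x = ∑ i, (∫ s in Icc (0 : ℝ) 1, ψ (sidePt P i s)) *
      (![(P (i + 2) - P (i + 1)) 1, -(P (i + 2) - P (i + 1)) 0] : Fin 2 → ℝ) k := by
  -- The directions `P 2 - P 0` and `P 0 - P 1` span the plane; the partial derivatives are
  -- recovered from them by Cramer's rule, with determinant `tdet P`.
  have h0 := integral_fderiv_ocell hD 0 hψ
  have h1 := integral_fderiv_ocell hD 1 hψ
  have i0 := integrableOn_ocell hD (pd_continuous hψ 0)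
  have i1 := integrableOn_ocell hD (pd_continuous hψ 1)
  simp only [fderiv_apply_eq] at h0 h1
  rw [integral_add (i0.const_mul _) (i1.const_mul _), integral_const_mul, integral_const_mul]
    at h0 h1
  rw [Fin.sum_univ_three]
  simp only [show (1 : Fin 3) + 2 = 0 from rfl, show (1 : Fin 3) + 1 = 2 from rfl,
    show (0 : Fin 3) + 2 = 2 from rfl, show (0 : Fin 3) + 1 = 1 from rfl,
    show (2 : Fin 3) + 2 = 1 from rfl, show (2 : Fin 3) + 1 = 0 from rfl] at *
  generalize (∫ s in Icc (0 : ℝ) 1, ψ (sidePt P 0 s)) = I0 at *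
  generalize (∫ s in Icc (0 : ℝ) 1, ψ (sidePt P 1 s)) = I1 at *
  generalize (∫ s in Icc (0 : ℝ) 1, ψ (sidePt P 2 s)) = I2 at *
  have hd : tdet P = (P 1 0 - P 0 0) * (P 2 1 - P 0 1) - (P 1 1 - P 0 1) * (P 2 0 - P 0 0) := by
    simp [tdet, cross]
  simp only [PiLp.sub_apply] at *
  refine mul_left_cancel₀ hD.ne' ?_
  fin_cases k
  · simp only [Fin.zero_eta, Matrix.cons_val_zero]
    linear_combination (P 0 1 - P 2 1) * h1 - (P 1 1 - P 0 1) * h0 +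
      (∫ x in ocell P, pd 0 ψ x) * hd
  · simp only [Fin.mk_one, Matrix.cons_val_one, Matrix.cons_val_zero]
    linear_combination (P 1 0 - P 0 0) * h0 + (P 2 0 - P 0 0) * h1 +
      (∫ x in ocell P, pd 1 ψ x) * hd

end

end ReggeFEM

namespace ReggeFEM

noncomputable section

/-! ### Density of smooth functions in Sobolev spaces on bounded convex domains -/

/-- `Ω` is a nonempty bounded convex domain. -/
structure IsConvexDomain (Ω : Set Plane) : Prop where
  isOpen : IsOpen Ω
  convex : Convex ℝ Ω
  bounded : Bornology.IsBounded Ω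
  nonempty : Ω.Nonempty

/-- `φ` is a smooth probability density with compact support in `Ω`. -/
structure IsMollifier (Ω : Set Plane) (φ : Plane → ℝ) : Prop extends IsTest Ω φ where
  nonneg : ∀ x, 0 ≤ φ x
  integral_eq_one : ∫ x, φ x = 1

theorem IsConvexDomain.exists_isMollifier {Ω : Set Plane} (hΩ : IsConvexDomain Ω) :
    ∃ φ, IsMollifier Ω φ := by
  obtain ⟨c, hc⟩ := hΩ.nonempty
  obtain ⟨ε, hε, hb⟩ := Metric.isOpen_iff.1 hΩ.isOpen c hc
  let f : ContDiffBump c := ⟨ε / 4, ε / 2, by linarith, by linarith⟩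
  refine ⟨f.normed volume, ⟨f.contDiff_normed, f.hasCompactSupport_normed, ?_⟩,
    f.nonneg_normed, f.integral_normed⟩
  rw [f.tsupport_normed_eq]
  exact (Metric.closedBall_subset_ball (by simp only [f]; linarith)).trans hb

/-- The average of `f` over a copy of size `ε` of the domain of a mollifier. -/
def moll (φ : Plane → ℝ) (ε : ℝ) (f : Plane → ℝ) (x : Plane) : ℝ :=
  ∫ y, φ y * f ((1 - ε) • x + ε • y)

/-- The measure with density `φ`. -/
def mollMeasure (φ : Plane → ℝ) : Measure Plane :=
  volume.withDensity fun y => ENNReal.ofReal (φ y)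

section

variable {Ω : Set Plane} {φ : Plane → ℝ} (hφ : IsMollifier Ω φ)
include hφ

theorem integral_mollMeasure (F : Plane → ℝ) : ∫ y, F y ∂mollMeasure φ = ∫ y, φ y * F y := by
  rw [mollMeasure, integral_withDensity_eq_integral_toReal_smul
    hφ.smooth.continuous.measurable.ennreal_ofReal (by simp)]
  simp [ENNReal.toReal_ofReal (hφ.nonneg _)]

theorem isProbabilityMeasure_mollMeasure : IsProbabilityMeasure (mollMeasure φ) := by
  constructor
  rw [mollMeasure, withDensity_apply _ MeasurableSet.univ, Measure.restrict_univ,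
    ← ofReal_integral_eq_lintegral_ofReal
      (hφ.smooth.continuous.integrable_of_hasCompactSupport hφ.compact)
      (Filter.Eventually.of_forall hφ.nonneg), hφ.integral_eq_one, ENNReal.ofReal_one]

theorem ae_mollMeasure_mem : ∀ᵐ y ∂mollMeasure φ, y ∈ Ω := by
  rw [mollMeasure, ae_withDensity_iff hφ.smooth.continuous.measurable.ennreal_ofReal]
  refine Filter.Eventually.of_forall fun y hy => hφ.supp (subset_tsupport φ ?_)
  intro h0
  exact hy (by simp [h0])

omit hφ in
theorem lintegral_comp_affine {F : Plane → ENNReal} (hF : Measurable F) {c : ℝ} (hc : 0 < c)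
    (b : Plane) : ∫⁻ x, F (c • x + b) = ENNReal.ofReal ((c ^ 2)⁻¹) * ∫⁻ x, F x := by
  have h1 : ∫⁻ x, F (c • x + b) = ∫⁻ x, F (x + b) ∂(Measure.map (c • ·) volume) := by
    rw [lintegral_map (by fun_prop) (by fun_prop)]
  rw [h1, Measure.map_addHaar_smul _ hc.ne', lintegral_smul_measure, lintegral_add_right_eq_self]
  simp [abs_of_pos (pow_pos hc 2)]

omit hφ in
theorem eLpNorm_two_sq (f : Plane → ℝ) (μ : Measure Plane) :
    eLpNorm f 2 μ ^ 2 = ∫⁻ x, ‖f x‖ₑ ^ 2 ∂μ := by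
  have := eLpNorm_nnreal_pow_eq_lintegral (f := f) (μ := μ) (p := 2) two_ne_zero
  simpa using this

theorem memLp_comp_affine {f : Plane → ℝ} (hf : Measurable f) (hf2 : MemLp f 2 volume)
    {c : ℝ} (hc : 0 < c) (b : Plane) : MemLp (fun y => f (c • y + b)) 2 (mollMeasure φ) := by
  have hm : Measurable fun y => f (c • y + b) := hf.comp (by fun_prop)
  obtain ⟨M, hM⟩ := hφ.smooth.continuous.bounded_above_of_compact_support hφ.compact
  have hv : MemLp (fun y => f (c • y + b)) 2 volume := by
    refine ⟨hm.aestronglyMeasurable, ?_⟩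
    have h2 : eLpNorm (fun y => f (c • y + b)) 2 volume ^ 2 < ⊤ := by
      rw [eLpNorm_two_sq, lintegral_comp_affine (F := fun x => ‖f x‖ₑ ^ 2)
        (hf.enorm.pow_const 2) hc b, ← eLpNorm_two_sq]
      exact ENNReal.mul_lt_top ENNReal.ofReal_lt_top (ENNReal.pow_lt_top hf2.2)
    exact (ENNReal.pow_lt_top_iff.1 h2).resolve_right two_ne_zero
  -- The density is bounded, so square integrability for Lebesgue measure passes to the probability
  -- measure.
  have hle : mollMeasure φ ≤ ENNReal.ofReal M • volume := by
    rw [← withDensity_const]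
    exact withDensity_mono (Filter.Eventually.of_forall fun y =>
      ENNReal.ofReal_le_ofReal ((le_abs_self _).trans (hM y)))
  exact (hv.smul_measure ENNReal.ofReal_ne_top).mono_measure hle

theorem integrable_moll {f : Plane → ℝ} (hf : Measurable f) (hf2 : MemLp f 2 volume)
    {ε : ℝ} (hε : 0 < ε) (x : Plane) :
    Integrable (fun y => f ((1 - ε) • x + ε • y)) (mollMeasure φ) := by
  have := isProbabilityMeasure_mollMeasure hφ
  have h := (memLp_comp_affine hφ hf hf2 hε ((1 - ε) • x)).integrable one_le_two
  simpa only [add_comm] using h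

theorem moll_sub {f g : Plane → ℝ} (hf : Measurable f) (hf2 : MemLp f 2 volume)
    (hg : Measurable g) (hg2 : MemLp g 2 volume) {ε : ℝ} (hε : 0 < ε) :
    moll φ ε (f - g) = moll φ ε f - moll φ ε g := by
  funext x
  simp only [moll, Pi.sub_apply]
  rw [← integral_mollMeasure hφ, ← integral_mollMeasure hφ, ← integral_mollMeasure hφ,
    ← integral_sub (integrable_moll hφ hf hf2 hε x) (integrable_moll hφ hg hg2 hε x)]

/-- Jensen's inequality for the probability measure with density `φ`, then Tonelli: for fixed `y`
the integrand is `f` after a dilation by `1 - ε ≥ 1/2`, which costs a factor of at most 4 in the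
squared norm. The bound is uniform in `ε`, as the density argument requires. -/
theorem eLpNorm_moll_le {f : Plane → ℝ} (hf : Measurable f) {ε : ℝ}
    (hε2 : ε ≤ 1 / 2) : eLpNorm (moll φ ε f) 2 volume ≤ 2 * eLpNorm f 2 volume := by
  have := isProbabilityMeasure_mollMeasure hφ
  have hpt : ∀ x, ‖moll φ ε f x‖ₑ ^ 2 ≤
      ∫⁻ y, ‖f ((1 - ε) • x + ε • y)‖ₑ ^ 2 ∂mollMeasure φ := by
    intro x
    rw [moll, ← integral_mollMeasure hφ, ← eLpNorm_two_sq]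
    gcongr
    calc _ ≤ ∫⁻ y, ‖f ((1 - ε) • x + ε • y)‖ₑ ∂mollMeasure φ := enorm_integral_le_lintegral_enorm _
      _ = eLpNorm (fun y => f ((1 - ε) • x + ε • y)) 1 (mollMeasure φ) :=
        eLpNorm_one_eq_lintegral_enorm.symm
      _ ≤ _ := eLpNorm_le_eLpNorm_of_exponent_le one_le_two
        (hf.comp (by fun_prop)).aestronglyMeasurable
  have hsq : eLpNorm (moll φ ε f) 2 volume ^ 2 ≤ (2 * eLpNorm f 2 volume) ^ 2 := by
    rw [eLpNorm_two_sq, mul_pow, eLpNorm_two_sq]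
    calc _ ≤ ∫⁻ x, ∫⁻ y, ‖f ((1 - ε) • x + ε • y)‖ₑ ^ 2 ∂mollMeasure φ := lintegral_mono hpt
      _ = ∫⁻ y, ∫⁻ x, ‖f ((1 - ε) • x + ε • y)‖ₑ ^ 2 ∂volume ∂mollMeasure φ := by
        refine lintegral_lintegral_swap (Measurable.aemeasurable ?_)
        exact ((hf.comp (by fun_prop)).enorm.pow_const 2)
      _ = ∫⁻ _, (ENNReal.ofReal (((1 - ε) ^ 2)⁻¹) * ∫⁻ x, ‖f x‖ₑ ^ 2) ∂mollMeasure φ := by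
        refine lintegral_congr fun y => ?_
        exact lintegral_comp_affine (F := fun x => ‖f x‖ₑ ^ 2) (hf.enorm.pow_const 2)
          (by linarith) _
      _ = ENNReal.ofReal (((1 - ε) ^ 2)⁻¹) * ∫⁻ x, ‖f x‖ₑ ^ 2 := by simp
      _ ≤ 2 ^ 2 * ∫⁻ x, ‖f x‖ₑ ^ 2 := by
        gcongr
        rw [show (2 : ENNReal) ^ 2 = ENNReal.ofReal 4 by norm_num]
        refine ENNReal.ofReal_le_ofReal ?_
        rw [inv_le_comm₀ (by nlinarith) (by norm_num)]
        nlinarith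
  exact (ENNReal.pow_le_pow_left_iff two_ne_zero).1 hsq

omit hφ in
/-- The kernel of `moll`, as a convolution kernel. -/
theorem moll_eq_convolution {ε : ℝ} (hε : 0 < ε) (f : Plane → ℝ) (x : Plane) :
    moll φ ε f x = (ε ^ 2)⁻¹ *
      (convolution f (fun w => φ (-(ε⁻¹ • w))) (ContinuousLinearMap.mul ℝ ℝ) volume)
        ((1 - ε) • x) := by
  have h := Measure.integral_comp_smul (μ := (volume : Measure Plane))
    (fun w => φ (ε⁻¹ • w) * f ((1 - ε) • x + w)) ε
  simp only [smul_smul, inv_mul_cancel₀ hε.ne', one_smul, finrank_euclideanSpace, Fintype.card_fin,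
    smul_eq_mul, abs_inv, abs_of_pos (pow_pos hε 2)] at h
  rw [moll, h, convolution]
  congr 1
  rw [← integral_sub_right_eq_self (fun w => φ (ε⁻¹ • w) * f ((1 - ε) • x + w)) ((1 - ε) • x)]
  refine integral_congr_ae (Filter.Eventually.of_forall fun w => ?_)
  simp [mul_comm, smul_sub]

omit hφ in
theorem moll_of_ae_eq_zero {ε : ℝ} (hε : 0 < ε) {f : Plane → ℝ} (hf : f =ᵐ[volume] 0) :
    moll φ ε f = 0 := by
  funext x
  rw [moll_eq_convolution hε, convolution, integral_eq_zero_of_ae]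
  · simp
  · filter_upwards [hf] with z hz
    simp [hz]

theorem contDiff_kernel (ε : ℝ) : ContDiff ℝ ∞ fun w => φ (-(ε⁻¹ • w)) :=
  hφ.smooth.comp (by fun_prop)

theorem hasCompactSupport_kernel {ε : ℝ} (hε : 0 < ε) :
    HasCompactSupport fun w => φ (-(ε⁻¹ • w)) := by
  have := hφ.compact.comp_homeomorph
    ((Homeomorph.smulOfNeZero ε⁻¹ (inv_ne_zero hε.ne')).trans (Homeomorph.neg Plane))
  exact this

theorem moll_contDiff {ε : ℝ} (hε : 0 < ε) {f : Plane → ℝ} (hf : MemLp f 2 volume) :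
    ContDiff ℝ ∞ (moll φ ε f) := by
  have e : moll φ ε f = fun x => (ε ^ 2)⁻¹ *
      (convolution f (fun w => φ (-(ε⁻¹ • w))) (ContinuousLinearMap.mul ℝ ℝ) volume)
        ((1 - ε) • x) := funext (moll_eq_convolution hε f)
  rw [e]
  exact contDiff_const.mul (((hasCompactSupport_kernel hφ hε).contDiff_convolution_right _
    (hf.locallyIntegrable one_le_two) (contDiff_kernel hφ ε)).comp (by fun_prop))

/-- For `x` in `Ω` and `y` in the support of `φ`, the point `(1 - ε) x + ε y` is in `Ω` by
convexity. So the kernel is an admissible test function for every `x` in `Ω`, and no neighbourhood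
of the boundary has to be excluded. -/
theorem isTest_kernel (hΩ : IsConvexDomain Ω) {ε : ℝ} (hε : 0 < ε) (hε1 : ε < 1)
    {x : Plane} (hx : x ∈ Ω) : IsTest Ω fun z => φ (-(ε⁻¹ • ((1 - ε) • x - z))) := by
  let e : Plane ≃ₜ Plane := (Homeomorph.subLeft ((1 - ε) • x)).trans
    ((Homeomorph.smulOfNeZero ε⁻¹ (inv_ne_zero hε.ne')).trans (Homeomorph.neg Plane))
  refine ⟨hφ.smooth.comp (by fun_prop), hφ.compact.comp_homeomorph e, ?_⟩
  have : tsupport (φ ∘ e) ⊆ Ω := by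
    rw [tsupport_comp_eq_preimage]
    intro z hz
    have hy := hφ.supp hz
    have := hΩ.convex hx hy (a := 1 - ε) (b := ε) (by linarith) hε.le (by ring)
    convert this using 1
    simp [e, smul_smul, hε.ne']
  exact this

omit hφ in
theorem setIntegral_of_support {Ω : Set Plane} {F : Plane → ℝ} (h : ∀ x, x ∉ Ω → F x = 0) :
    ∫ x in Ω, F x = ∫ x, F x :=
  setIntegral_eq_integral_of_forall_compl_eq_zero h

/-- The derivative falls on the kernel, a function of `(1 - ε) x - z`, where `∂_x = -(1 - ε) ∂_z`;
the definition of the weak derivative then moves `∂_z` to `f`. The factor `1 - ε` is the price of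
the contraction. -/
theorem pd_moll (hΩ : IsConvexDomain Ω) {ε : ℝ} (hε : 0 < ε) (hε1 : ε < 1) {k : Fin 2}
    {f h : Plane → ℝ} (hf : MemLp f 2 volume) (hf0 : ∀ x, x ∉ Ω → f x = 0)
    (hh0 : ∀ x, x ∉ Ω → h x = 0) (hw : IsWeakDeriv Ω k f h) {x : Plane} (hx : x ∈ Ω) :
    pd k (moll φ ε f) x = (1 - ε) * moll φ ε h x := by
  set κ : Plane → ℝ := fun w => φ (-(ε⁻¹ • w)) with hκ
  have hκs := contDiff_kernel hφ ε
  have hκc := hasCompactSupport_kernel hφ hε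
  have hd := hκc.hasFDerivAt_convolution_right (ContinuousLinearMap.mul ℝ ℝ)
    (hf.locallyIntegrable one_le_two) (hκs.of_le (by simp)) ((1 - ε) • x)
  have hs : HasFDerivAt (fun x : Plane => (1 - ε) • x) ((1 - ε) • ContinuousLinearMap.id ℝ Plane) x :=
    (hasFDerivAt_id x).const_smul (1 - ε)
  have hd2 := ((HasFDerivAt.comp (f := fun x : Plane => (1 - ε) • x) x hd hs).const_mul
    (ε ^ 2)⁻¹).congr_of_eventuallyEq
      (Filter.Eventually.of_forall (moll_eq_convolution hε f))
  have ht := isTest_kernel hφ hΩ hε hε1 hx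
  have key := hw _ ht
  rw [setIntegral_of_support (fun z hz => by rw [hf0 z hz, zero_mul]),
    setIntegral_of_support (fun z hz => by rw [hh0 z hz, zero_mul])] at key
  have hpd : ∀ z, pd k (fun z => φ (-(ε⁻¹ • ((1 - ε) • x - z)))) z =
      -(fderiv ℝ κ ((1 - ε) • x - z) (EuclideanSpace.single k 1)) := by
    intro z
    have hs' : HasFDerivAt (fun z : Plane => (1 - ε) • x - z) (-ContinuousLinearMap.id ℝ Plane) z :=
      (hasFDerivAt_id z).const_sub ((1 - ε) • x)
    have h1 := HasFDerivAt.comp (f := fun z : Plane => (1 - ε) • x - z) z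
      (hκs.differentiable (by simp) ((1 - ε) • x - z)).hasFDerivAt hs'
    change fderiv ℝ (κ ∘ fun z => (1 - ε) • x - z) z _ = _
    rw [h1.fderiv]
    simp [hκ]
  rw [pd, hd2.fderiv, moll_eq_convolution hε h]
  simp only [smul_apply, ContinuousLinearMap.comp_apply, smul_eq_mul,
    ContinuousLinearMap.id_apply, map_smul]
  have hconv : (convolution f (fderiv ℝ κ) ((ContinuousLinearMap.mul ℝ ℝ).precompR Plane) volume
      ((1 - ε) • x)) (EuclideanSpace.single k 1) =
      ∫ z, f z * fderiv ℝ κ ((1 - ε) • x - z) (EuclideanSpace.single k 1) := by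
    rw [convolution, ContinuousLinearMap.integral_apply]
    · simp
    · exact ((hκc.fderiv ℝ).convolutionExists_right _ (hf.locallyIntegrable one_le_two)
        (hκs.continuous_fderiv (by simp))) _
  rw [hconv]
  simp only [hpd, mul_neg, integral_neg, neg_inj] at key
  rw [key, convolution]
  simp only [ContinuousLinearMap.mul_apply']
  ring

/-- Approximate `f` within `δ` by a continuous `g` with compact support. Uniform continuity makes
the averages of `g` uniformly close to `g` on the bounded set `Ω`, and `eLpNorm_moll_le` controls
the averages of `f - g`. The three errors are `2δ`, `δ` and `δ`, whence the condition `4 * δ ≤ η`.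
-/
theorem tendsto_moll (hΩ : IsConvexDomain Ω) {f : Plane → ℝ} (hf : Measurable f)
    (hf2 : MemLp f 2 volume) {ε : ℕ → ℝ} (hε0 : ∀ n, 0 < ε n) (hε2 : ∀ n, ε n ≤ 1 / 2)
    (hε : Filter.Tendsto ε Filter.atTop (nhds 0)) :
    Filter.Tendsto (fun n => eLpNorm (moll φ (ε n) f - f) 2 (volume.restrict Ω)) Filter.atTop
      (nhds 0) := by
  have := isProbabilityMeasure_mollMeasure hφ
  rw [ENNReal.tendsto_atTop_zero]
  intro η hη
  obtain ⟨δ, hδ, hδη⟩ : ∃ δ : ENNReal, δ ≠ 0 ∧ 4 * δ ≤ η := by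
    rcases eq_or_ne η ⊤ with rfl | hη'
    · exact ⟨1, one_ne_zero, le_top⟩
    · refine ⟨η / 4, ?_, ?_⟩
      · simp [ENNReal.div_eq_zero_iff, hη.ne']
      · rw [ENNReal.mul_div_cancel (by norm_num) (by norm_num)]
  obtain ⟨g, hgc, hgf, hg, hg2⟩ := hf2.exists_hasCompactSupport_eLpNorm_sub_le
    (ENNReal.ofNat_ne_top) hδ
  have hfin : volume Ω < ⊤ := hΩ.bounded.measure_lt_top
  obtain ⟨c, hc0, hcδ⟩ : ∃ c : ℝ, 0 < c ∧
      volume Ω ^ ((2 : ENNReal).toReal⁻¹) * ENNReal.ofReal c ≤ δ := by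
    set V := volume Ω ^ ((2 : ENNReal).toReal⁻¹) with hV
    have hVt : V ≠ ⊤ := ENNReal.rpow_ne_top_of_nonneg (by positivity) hfin.ne
    have : Filter.Tendsto (fun c : ℝ => V * ENNReal.ofReal c) (nhdsWithin 0 (Ioi 0)) (nhds (V * 0)) := by
      refine ENNReal.Tendsto.const_mul ?_ (Or.inr hVt)
      have h0 := (ENNReal.continuous_ofReal.tendsto 0)
      rw [ENNReal.ofReal_zero] at h0
      exact h0.mono_left nhdsWithin_le_nhds
    rw [mul_zero] at this
    obtain ⟨c, hc⟩ := ((this.eventually (Iio_mem_nhds (pos_iff_ne_zero.2 hδ))).and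
      self_mem_nhdsWithin).exists
    exact ⟨c, hc.2, hc.1.le⟩
  obtain ⟨ρ, hρ, hunif⟩ := Metric.uniformContinuous_iff.1
    (hgc.uniformContinuous_of_continuous hg) c hc0
  obtain ⟨R, hR⟩ := hΩ.bounded.subset_closedBall 0
  have hev : ∀ᶠ n in Filter.atTop, ε n * (2 * |R| + 1) < ρ := by
    have : Filter.Tendsto (fun n => ε n * (2 * |R| + 1)) Filter.atTop (nhds (0 * (2 * |R| + 1))) :=
      hε.mul_const _
    rw [zero_mul] at this
    exact this.eventually (Iio_mem_nhds hρ)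
  obtain ⟨N, hN⟩ := Filter.eventually_atTop.1 hev
  refine ⟨N, fun n hn => le_trans ?_ hδη⟩
  have hpt : ∀ x ∈ Ω, ‖(moll φ (ε n) g - g) x‖ ≤ c := by
    intro x hx
    have e1 : (moll φ (ε n) g - g) x =
        ∫ y, (g ((1 - ε n) • x + ε n • y) - g x) ∂mollMeasure φ := by
      rw [integral_sub (integrable_moll hφ hg.measurable hg2 (hε0 n) x) (integrable_const _),
        integral_mollMeasure hφ]
      simp [moll]
    rw [e1]
    refine (norm_integral_le_of_norm_le_const (C := c) ?_).trans (by simp)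
    filter_upwards [ae_mollMeasure_mem hφ] with y hy
    rw [← dist_eq_norm]
    refine (hunif ?_).le
    rw [dist_eq_norm, show (1 - ε n) • x + ε n • y - x = ε n • (y - x) by module, norm_smul,
      Real.norm_eq_abs, abs_of_pos (hε0 n)]
    refine lt_of_le_of_lt ?_ (hN n hn)
    have hx' := hR hx
    have hy' := hR hy
    rw [mem_closedBall_zero_iff] at hx' hy'
    have := norm_sub_le y x
    have := le_abs_self R
    exact mul_le_mul_of_nonneg_left (by linarith) (hε0 n).le
  have hsplit : moll φ (ε n) f - f = (moll φ (ε n) (f - g) + (moll φ (ε n) g - g)) + (g - f) := by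
    rw [moll_sub hφ hf hf2 hg.measurable hg2 (hε0 n)]
    ring
  have hm1 : AEStronglyMeasurable (moll φ (ε n) (f - g)) (volume.restrict Ω) :=
    (moll_contDiff hφ (hε0 n) (hf2.sub hg2)).continuous.aestronglyMeasurable
  have hm2 : AEStronglyMeasurable (moll φ (ε n) g - g) (volume.restrict Ω) :=
    ((moll_contDiff hφ (hε0 n) hg2).continuous.sub hg).aestronglyMeasurable
  have hm3 : AEStronglyMeasurable (g - f) (volume.restrict Ω) :=
    (hg.measurable.sub hf).aestronglyMeasurable
  rw [hsplit]
  calc _ ≤ _ := eLpNorm_add_le (hm1.add hm2) hm3 one_le_two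
    _ ≤ _ := add_le_add_left (eLpNorm_add_le hm1 hm2 one_le_two) _
    _ ≤ (2 * δ + δ) + δ := by
      gcongr
      · calc _ ≤ eLpNorm (moll φ (ε n) (f - g)) 2 volume :=
            eLpNorm_mono_measure _ Measure.restrict_le_self
          _ ≤ _ := eLpNorm_moll_le hφ (hf.sub hg.measurable) (hε2 n)
          _ ≤ _ := by gcongr
      · refine (eLpNorm_le_of_ae_bound (C := c) ?_).trans ?_
        · exact (ae_restrict_iff' hΩ.isOpen.measurableSet).2 (Filter.Eventually.of_forall hpt)
        · simpa using hcδ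
      · rw [eLpNorm_sub_comm]
        exact (eLpNorm_mono_measure _ Measure.restrict_le_self).trans hgf
    _ = 4 * δ := by ring

end

end

end ReggeFEM

/-! ### Smooth functions as dense subspaces of the Sobolev spaces -/

namespace ReggeFEM

noncomputable section

/-- The smooth functions on the plane. -/
def SmoothFn : Submodule ℝ (Plane → ℝ) where
  carrier := {ψ | ContDiff ℝ ∞ ψ}
  zero_mem' := (contDiff_const : ContDiff ℝ ∞ fun _ : Plane => (0 : ℝ))
  add_mem' {a b} (ha : ContDiff ℝ ∞ a) (hb : ContDiff ℝ ∞ b) := (ha.add hb : ContDiff ℝ ∞ (a + b))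
  smul_mem' c a (ha : ContDiff ℝ ∞ a) := (contDiff_const.smul ha : ContDiff ℝ ∞ (c • a))

theorem smoothFn_contDiff (ψ : SmoothFn) : ContDiff ℝ ∞ ψ.1 := ψ.2

theorem pd_contDiff {ψ : Plane → ℝ} (h : ContDiff ℝ ∞ ψ) (k : Fin 2) : ContDiff ℝ ∞ (pd k ψ) :=
  (h.fderiv_right (m := ∞) (by simp)).clm_apply contDiff_const

theorem pd_add {ψ χ : Plane → ℝ} (h : ContDiff ℝ ∞ ψ) (h' : ContDiff ℝ ∞ χ) (k : Fin 2) :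
    pd k (ψ + χ) = pd k ψ + pd k χ := by
  funext x
  simp [pd, fderiv_add (h.differentiable (by simp) x) (h'.differentiable (by simp) x)]

theorem pd_smul {ψ : Plane → ℝ} (h : ContDiff ℝ ∞ ψ) (c : ℝ) (k : Fin 2) :
    pd k (c • ψ) = c • pd k ψ := by
  funext x
  simp [pd, fderiv_const_smul (h.differentiable (by simp) x)]

theorem pd_mul {ψ χ : Plane → ℝ} (h : ContDiff ℝ ∞ ψ) (h' : ContDiff ℝ ∞ χ) (k : Fin 2)
    (x : Plane) : pd k (fun y => ψ y * χ y) x = ψ x * pd k χ x + pd k ψ x * χ x := by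
  simp only [pd]
  rw [fderiv_fun_mul (h.differentiable (by simp) x) (h'.differentiable (by simp) x)]
  simp
  ring

theorem pd_comm {ψ : Plane → ℝ} (h : ContDiff ℝ ∞ ψ) (k l : Fin 2) :
    pd k (pd l ψ) = pd l (pd k ψ) := by
  have key : ∀ k l x, pd k (pd l ψ) x =
      fderiv ℝ (fderiv ℝ ψ) x (EuclideanSpace.single k 1) (EuclideanSpace.single l 1) := by
    intro k l x
    have hd : DifferentiableAt ℝ (fderiv ℝ ψ) x :=
      (h.fderiv_right (m := ∞) (by simp)).differentiable (by simp) x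
    change fderiv ℝ (fun y => fderiv ℝ ψ y (EuclideanSpace.single l 1)) x _ = _
    rw [fderiv_clm_apply hd (differentiableAt_const _)]
    simp
  funext x
  rw [key, key]
  exact ((h.of_le (m := 2) (by norm_cast)).contDiffAt.isSymmSndFDerivAt (by simp)).eq _ _

theorem integral_mul_pd {Ω : Set Plane} {ψ φ : Plane → ℝ} (hψ : ContDiff ℝ ∞ ψ)
    (hφ : IsTest Ω φ) (k : Fin 2) :
    ∫ x in Ω, ψ x * pd k φ x = -∫ x in Ω, pd k ψ x * φ x := by
  have hz : ∀ x, x ∉ Ω → φ x = 0 := fun x hx =>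
    image_eq_zero_of_notMem_tsupport fun h => hx (hφ.supp h)
  have hz' : ∀ x, x ∉ Ω → pd k φ x = 0 := by
    intro x hx
    have : fderiv ℝ φ x = 0 :=
      image_eq_zero_of_notMem_tsupport fun h => hx (hφ.supp (tsupport_fderiv_subset ℝ h))
    simp [pd, this]
  rw [setIntegral_of_support fun x hx => by rw [hz' x hx, mul_zero],
    setIntegral_of_support fun x hx => by rw [hz x hx, mul_zero]]
  have c1 := hψ.continuous
  have c2 := hφ.smooth.continuous
  refine integral_mul_fderiv_eq_neg_fderiv_mul_of_integrable ?_ ?_ ?_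
    (fun x _ => hψ.differentiable (by simp) x) (fun x _ => hφ.smooth.differentiable (by simp) x)
  · exact ((pd_continuous hψ k).mul c2).integrable_of_hasCompactSupport hφ.compact.mul_left
  · exact (c1.mul (pd_continuous hφ.smooth k)).integrable_of_hasCompactSupport
      (hφ.pd_compact k).mul_left
  · exact (c1.mul c2).integrable_of_hasCompactSupport hφ.compact.mul_left

theorem isWeakDeriv_congr {Ω : Set Plane} {k : Fin 2} {f f' h h' : Plane → ℝ}
    (hf : f =ᵐ[volume.restrict Ω] f') (hh : h =ᵐ[volume.restrict Ω] h')
    (H : IsWeakDeriv Ω k f h) : IsWeakDeriv Ω k f' h' := by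
  intro φ hφ
  have e1 : ∫ x in Ω, f' x * pd k φ x = ∫ x in Ω, f x * pd k φ x :=
    integral_congr_ae (hf.mono fun x hx => by simp only [hx])
  have e2 : ∫ x in Ω, h' x * φ x = ∫ x in Ω, h x * φ x :=
    integral_congr_ae (hh.mono fun x hx => by simp only [hx])
  rw [e1, e2, H φ hφ]

/-- Weak derivatives are unique. -/
theorem isWeakDeriv_unique {Ω : Set Plane} (hΩ : IsOpen Ω) {k : Fin 2} {f : Plane → ℝ}
    {h h' : L2 Ω} (H : IsWeakDeriv Ω k f h) (H' : IsWeakDeriv Ω k f h') : h = h' := by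
  have key : ∀ᵐ x, x ∈ Ω → h x - h' x = 0 := by
    refine hΩ.ae_eq_zero_of_integral_contDiff_smul_eq_zero ?_ fun φ h1 h2 h3 => ?_
    · have : LocallyIntegrable (fun x => h x - h' x) (volume.restrict Ω) :=
        ((Lp.memLp h).sub (Lp.memLp h')).locallyIntegrable one_le_two
      exact locallyIntegrableOn_of_locallyIntegrable_restrict this
    · have e := (H φ ⟨h1, h2, h3⟩).symm.trans (H' φ ⟨h1, h2, h3⟩)
      rw [neg_inj] at e
      have hz : ∀ x, x ∉ Ω → φ x = 0 := fun x hx =>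
        image_eq_zero_of_notMem_tsupport fun h => hx (h3 h)
      rw [← setIntegral_of_support (Ω := Ω) fun x hx => by simp [hz x hx]]
      simp only [smul_eq_mul, mul_comm (φ _), sub_mul]
      rw [integral_sub (integrable_mul_cc h h1.continuous h2) (integrable_mul_cc h' h1.continuous h2),
        e, sub_self]
  refine Lp.ext ?_
  filter_upwards [(ae_restrict_iff' hΩ.measurableSet).2 key] with x hx
  linarith

/-- The weak derivatives stored in an element are determined by its function, so identities in `H¹`
can be checked almost everywhere on the function alone. -/
theorem H1.ext_fn {Ω : Set Plane} (hΩ : IsOpen Ω) {f g : H1 Ω} (h : fn f = fn g) : f = g := by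
  refine Subtype.ext (Prod.ext h (funext fun k => ?_))
  refine isWeakDeriv_unique hΩ (f.2 k) ?_
  have : f.1.1 = g.1.1 := h
  rw [this]
  exact g.2 k

theorem H2.ext_fn {Ω : Set Plane} (hΩ : IsOpen Ω) {f g : H2 Ω}
    (h : fn (toH1 f) = fn (toH1 g)) : f = g := by
  have h1 : toH1 f = toH1 g := H1.ext_fn hΩ h
  have h2 : f.1.2.1 = g.1.2.1 := congrArg (fun a : H1 Ω => a.1.2) h1
  refine Subtype.ext (Prod.ext h (Prod.ext h2 (funext fun k => ?_)))
  have h3 : wdH1 f k = wdH1 g k := H1.ext_fn hΩ (congrFun h2 k)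
  exact congrArg (fun a : H1 Ω => a.1.2) h3

section

variable {Ω : Set Plane} (hΩ : IsConvexDomain Ω)
include hΩ

theorem IsConvexDomain.isFiniteMeasure : IsFiniteMeasure (volume.restrict Ω) :=
  ⟨by rw [Measure.restrict_apply_univ]; exact hΩ.bounded.measure_lt_top⟩

theorem IsConvexDomain.memLp {ψ : Plane → ℝ} (hψ : Continuous ψ) :
    MemLp ψ 2 (volume.restrict Ω) := by
  have := hΩ.isFiniteMeasure
  obtain ⟨C, hC⟩ := hΩ.bounded.isCompact_closure.exists_bound_of_continuousOn hψ.continuousOn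
  exact MemLp.of_bound hψ.aestronglyMeasurable C
    ((ae_restrict_iff' hΩ.isOpen.measurableSet).2
      (Filter.Eventually.of_forall fun x hx => hC x (subset_closure hx)))

/-- The element of `L²(Ω)` given by a continuous function on the plane. -/
def contL2 (ψ : Plane → ℝ) (hψ : Continuous ψ) : L2 Ω := (hΩ.memLp hψ).toLp ψ

theorem coeFn_contL2 {ψ : Plane → ℝ} (hψ : Continuous ψ) :
    contL2 hΩ ψ hψ =ᵐ[volume.restrict Ω] ψ := (hΩ.memLp hψ).coeFn_toLp

theorem isWeakDeriv_smooth {ψ : Plane → ℝ} (hψ : ContDiff ℝ ∞ ψ) (k : Fin 2) :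
    IsWeakDeriv Ω k (contL2 hΩ ψ hψ.continuous) (contL2 hΩ (pd k ψ) (pd_continuous hψ k)) := by
  refine isWeakDeriv_congr (coeFn_contL2 hΩ _).symm (coeFn_contL2 hΩ _).symm ?_
  exact fun φ hφ => integral_mul_pd hψ hφ k

/-- The inclusion of the smooth functions into `H¹(Ω)`. -/
def smoothH1 : SmoothFn →ₗ[ℝ] H1 Ω where
  toFun ψ := ⟨(contL2 hΩ ψ.1 (smoothFn_contDiff ψ).continuous, fun k => contL2 hΩ (pd k ψ.1) (pd_continuous (smoothFn_contDiff ψ) k)),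
    fun k => isWeakDeriv_smooth hΩ (smoothFn_contDiff ψ) k⟩
  map_add' ψ χ := by
    refine H1.ext_fn hΩ.isOpen ?_
    exact MemLp.toLp_add (hΩ.memLp (smoothFn_contDiff ψ).continuous) (hΩ.memLp (smoothFn_contDiff χ).continuous)
  map_smul' c ψ := by
    refine H1.ext_fn hΩ.isOpen ?_
    exact MemLp.toLp_const_smul c (hΩ.memLp (smoothFn_contDiff ψ).continuous)

/-- The inclusion of the smooth functions into `H²(Ω)`. -/
def smoothH2 : SmoothFn →ₗ[ℝ] H2 Ω where
  toFun ψ := ⟨(contL2 hΩ ψ.1 (smoothFn_contDiff ψ).continuous, fun k => contL2 hΩ (pd k ψ.1) (pd_continuous (smoothFn_contDiff ψ) k),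
    fun k l => contL2 hΩ (pd l (pd k ψ.1)) (pd_continuous (pd_contDiff (smoothFn_contDiff ψ) k) l)),
    fun k => isWeakDeriv_smooth hΩ (smoothFn_contDiff ψ) k, fun k l => isWeakDeriv_smooth hΩ (pd_contDiff (smoothFn_contDiff ψ) k) l⟩
  map_add' ψ χ := by
    refine H2.ext_fn hΩ.isOpen ?_
    exact MemLp.toLp_add (hΩ.memLp (smoothFn_contDiff ψ).continuous) (hΩ.memLp (smoothFn_contDiff χ).continuous)
  map_smul' c ψ := by
    refine H2.ext_fn hΩ.isOpen ?_
    exact MemLp.toLp_const_smul c (hΩ.memLp (smoothFn_contDiff ψ).continuous)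

theorem fn_smoothH1 (ψ : SmoothFn) : fn (smoothH1 hΩ ψ) = contL2 hΩ ψ.1 (smoothFn_contDiff ψ).continuous := rfl

theorem wd_smoothH1 (ψ : SmoothFn) (k : Fin 2) :
    wd (smoothH1 hΩ ψ) k = contL2 hΩ (pd k ψ.1) (pd_continuous (smoothFn_contDiff ψ) k) := rfl

theorem toH1_smoothH2 (ψ : SmoothFn) : toH1 (smoothH2 hΩ ψ) = smoothH1 hΩ ψ := rfl

theorem wdH1_smoothH2 (ψ : SmoothFn) (k : Fin 2) :
    wdH1 (smoothH2 hΩ ψ) k = smoothH1 hΩ ⟨pd k ψ.1, pd_contDiff (smoothFn_contDiff ψ) k⟩ := rfl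

omit hΩ in
/-- The extension of an element of `L²(Ω)` by zero. -/
def zeroExt (f : L2 Ω) : Plane → ℝ := Ω.indicator f

theorem zeroExt_measurable (f : L2 Ω) : Measurable (zeroExt f) :=
  (Lp.stronglyMeasurable f).measurable.indicator hΩ.isOpen.measurableSet

theorem zeroExt_memLp (f : L2 Ω) : MemLp (zeroExt f) 2 volume :=
  (memLp_indicator_iff_restrict hΩ.isOpen.measurableSet).2 (Lp.memLp f)

theorem zeroExt_ae (f : L2 Ω) : zeroExt f =ᵐ[volume.restrict Ω] f := by
  filter_upwards [ae_restrict_mem hΩ.isOpen.measurableSet] with x hx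
  exact indicator_of_mem hx _

omit hΩ in
theorem zeroExt_eq_zero (f : L2 Ω) (x : Plane) (hx : x ∉ Ω) : zeroExt f x = 0 :=
  indicator_of_notMem hx _

theorem tendsto_contL2 {f : L2 Ω} {F : ℕ → Plane → ℝ} (hF : ∀ n, Continuous (F n)) {c : ℕ → ℝ}
    (hc : Filter.Tendsto c Filter.atTop (nhds 1)) {G : ℕ → Plane → ℝ}
    (hG : ∀ n, Continuous (G n)) (hFG : ∀ n, ∀ x ∈ Ω, F n x = c n * G n x)
    (h : Filter.Tendsto (fun n => eLpNorm (G n - zeroExt f) 2 (volume.restrict Ω)) Filter.atTop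
      (nhds 0)) :
    Filter.Tendsto (fun n => contL2 hΩ (F n) (hF n)) Filter.atTop (nhds f) := by
  have e : ∀ n, contL2 hΩ (F n) (hF n) = c n • contL2 hΩ (G n) (hG n) := by
    intro n
    refine Lp.ext ?_
    filter_upwards [coeFn_contL2 hΩ (hF n), coeFn_contL2 hΩ (hG n), Lp.coeFn_smul (c n)
      (contL2 hΩ (G n) (hG n)), ae_restrict_mem hΩ.isOpen.measurableSet] with x h1 h2 h3 h4
    rw [h1, h3, Pi.smul_apply, h2, hFG n x h4, smul_eq_mul]
  have h1 : Filter.Tendsto (fun n => contL2 hΩ (G n) (hG n)) Filter.atTop (nhds f) := by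
    have ef : f = ((Lp.memLp f).ae_eq (zeroExt_ae hΩ f).symm).toLp (zeroExt f) := by
      refine Lp.ext ?_
      exact (zeroExt_ae hΩ f).symm.trans (MemLp.coeFn_toLp _).symm
    rw [ef]
    exact (Lp.tendsto_Lp_iff_tendsto_eLpNorm'' _ _ _ _).2 h
  simp only [e]
  simpa using hc.smul h1

/-- Approximation by smooth functions. -/
theorem exists_smooth_approx : ∃ A : ℕ → L2 Ω → SmoothFn, ∃ c : ℕ → ℝ,
    Filter.Tendsto c Filter.atTop (nhds 1) ∧
    (∀ n (f : L2 Ω) k (h : L2 Ω), IsWeakDeriv Ω k f h → ∀ x ∈ Ω,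
      pd k (A n f).1 x = c n * (A n h).1 x) ∧ (∀ n, (A n 0).1 = 0) ∧
    ∀ f : L2 Ω, Filter.Tendsto (fun n => eLpNorm ((A n f).1 - zeroExt f) 2 (volume.restrict Ω))
      Filter.atTop (nhds 0) := by
  obtain ⟨φ, hφ⟩ := hΩ.exists_isMollifier
  -- The shift by 2 keeps `ε n ≤ 1 / 2`, as the uniform bound on the averages demands.
  let ε : ℕ → ℝ := fun n => 1 / ((n : ℝ) + 2)
  have h0 : ∀ n, 0 < ε n := fun n => by positivity
  have h2 : ∀ n, ε n ≤ 1 / 2 := fun n =>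
    one_div_le_one_div_of_le (by norm_num) (by linarith [n.cast_nonneg (α := ℝ)])
  have ht : Filter.Tendsto ε Filter.atTop (nhds 0) := by
    have := (tendsto_one_div_add_atTop_nhds_zero_nat (𝕜 := ℝ)).comp (Filter.tendsto_add_atTop_nat 1)
    refine this.congr fun n => ?_
    simp only [Function.comp, ε]
    push_cast
    ring
  refine ⟨fun n f => ⟨moll φ (ε n) (zeroExt f), moll_contDiff hφ (h0 n) (zeroExt_memLp hΩ f)⟩,
    fun n => 1 - ε n, by simpa using ht.const_sub 1, ?_, ?_, ?_⟩
  · intro n f k h hw x hx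
    exact pd_moll hφ hΩ (h0 n) (by linarith [h2 n]) (zeroExt_memLp hΩ f) (zeroExt_eq_zero f)
      (zeroExt_eq_zero h) (isWeakDeriv_congr (zeroExt_ae hΩ f).symm (zeroExt_ae hΩ h).symm hw) hx
  · intro n
    refine moll_of_ae_eq_zero (h0 n) ?_
    have h1 := (ae_restrict_iff' hΩ.isOpen.measurableSet).1 (Lp.coeFn_zero ℝ 2 (volume.restrict Ω))
    filter_upwards [h1] with x hx
    by_cases hxΩ : x ∈ Ω
    · rw [zeroExt, indicator_of_mem hxΩ, hx hxΩ]
    · exact zeroExt_eq_zero _ x hxΩ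
  · intro f
    exact tendsto_moll hφ hΩ (zeroExt_measurable hΩ f) (zeroExt_memLp hΩ f) h0 h2 ht

theorem denseRange_smoothH1 : DenseRange (smoothH1 hΩ) := by
  obtain ⟨A, c, hc, hA, -, hT⟩ := exists_smooth_approx hΩ
  intro f
  refine mem_closure_of_tendsto (b := Filter.atTop) (f := fun n => smoothH1 hΩ (A n (fn f))) ?_
    (Filter.Eventually.of_forall fun n => mem_range_self _)
  refine tendsto_subtype_rng.2 ?_
  refine Filter.Tendsto.prodMk_nhds ?_ (tendsto_pi_nhds.2 fun k => ?_)
  · exact tendsto_contL2 hΩ _ tendsto_const_nhds (fun n => (smoothFn_contDiff (A n (fn f))).continuous)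
      (fun n x _ => (one_mul _).symm) (hT _)
  · exact tendsto_contL2 hΩ _ hc (fun n => (smoothFn_contDiff (A n (wd f k))).continuous)
      (fun n x hx => hA n _ k _ (f.2 k) x hx) (hT _)

theorem denseRange_smoothH2 : DenseRange (smoothH2 hΩ) := by
  obtain ⟨A, c, hc, hA, -, hT⟩ := exists_smooth_approx hΩ
  intro f
  refine mem_closure_of_tendsto (b := Filter.atTop) (f := fun n => smoothH2 hΩ (A n (fn (toH1 f)))) ?_
    (Filter.Eventually.of_forall fun n => mem_range_self _)
  refine tendsto_subtype_rng.2 ?_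
  refine Filter.Tendsto.prodMk_nhds ?_ (Filter.Tendsto.prodMk_nhds (tendsto_pi_nhds.2 fun k => ?_)
    (tendsto_pi_nhds.2 fun k => tendsto_pi_nhds.2 fun l => ?_))
  · exact tendsto_contL2 hΩ _ tendsto_const_nhds (fun n => (smoothFn_contDiff (A n (fn (toH1 f)))).continuous)
      (fun n x _ => (one_mul _).symm) (hT _)
  · exact tendsto_contL2 hΩ _ hc (fun n => (smoothFn_contDiff (A n (fn (wdH1 f k)))).continuous)
      (fun n x hx => hA n _ k _ (f.2.1 k) x hx) (hT _)
  -- Each of the two differentiations contributes one factor `c n`.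
  · refine tendsto_contL2 hΩ _ (c := fun n => c n * c n) (by simpa using hc.mul hc)
      (fun n => (smoothFn_contDiff (A n (wd (wdH1 f k) l))).continuous) (fun n x hx => ?_) (hT _)
    have e : pd k (A n (fn (toH1 f))).1 =ᶠ[nhds x] c n • (A n (fn (wdH1 f k))).1 := by
      filter_upwards [hΩ.isOpen.mem_nhds hx] with y hy
      exact hA n _ k _ (f.2.1 k) y hy
    have e2 := hA n _ l _ (f.2.2 k l) x hx
    have e3 : pd l (pd k (A n (fn (toH1 f))).1) x = pd l (c n • (A n (fn (wdH1 f k))).1) x := by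
      simp only [pd] at e ⊢
      rw [e.fderiv_eq]
    rw [e3, pd_smul (smoothFn_contDiff (A n (fn (wdH1 f k)))), mul_assoc, Pi.smul_apply, smul_eq_mul]
    exact congrArg _ e2

/-- A function whose weak derivatives vanish is constant. -/
theorem exists_const_of_wd_eq_zero {f : H1 Ω} (hf : ∀ k, wd f k = 0) :
    ∃ c : ℝ, fn f =ᵐ[volume.restrict Ω] fun _ => c := by
  obtain ⟨A, c, -, hA, hA0, hT⟩ := exists_smooth_approx hΩ
  -- The constants form a finite-dimensional, hence closed, subspace of `L²`. The smooth
  -- approximations have zero gradient on the convex set `Ω`, so they lie in it, and so does their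
  -- limit.
  let L : ℝ →ₗ[ℝ] L2 Ω :=
    { toFun := fun a => contL2 hΩ (fun _ => a) continuous_const
      map_add' := fun a b => MemLp.toLp_add (hΩ.memLp continuous_const) (hΩ.memLp continuous_const)
      map_smul' := fun a b => MemLp.toLp_const_smul a (hΩ.memLp continuous_const) }
  have hcl : IsClosed (LinearMap.range L : Set (L2 Ω)) :=
    Submodule.closed_of_finiteDimensional _
  obtain ⟨x₀, hx₀⟩ := hΩ.nonempty
  have hmem : ∀ n, contL2 hΩ (A n (fn f)).1 (smoothFn_contDiff (A n (fn f))).continuous ∈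
      LinearMap.range L := by
    intro n
    refine ⟨(A n (fn f)).1 x₀, Lp.ext ?_⟩
    filter_upwards [coeFn_contL2 hΩ (continuous_const : Continuous fun _ => (A n (fn f)).1 x₀),
      coeFn_contL2 hΩ (smoothFn_contDiff (A n (fn f))).continuous,
      ae_restrict_mem hΩ.isOpen.measurableSet] with x h1 h2 hx
    refine h1.trans (Eq.trans ?_ h2.symm)
    have hz : ∀ y ∈ Ω, fderiv ℝ (A n (fn f)).1 y = 0 := by
      intro y hy
      ext v
      have : ∀ k, pd k (A n (fn f)).1 y = 0 := fun k => by
        rw [hA n (fn f) k (wd f k) (f.2 k) y hy, hf k, hA0 n]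
        simp
      rw [fderiv_apply_eq, this, this]
      simp
    exact (hΩ.convex.is_const_of_fderivWithin_eq_zero (𝕜 := ℝ)
      ((smoothFn_contDiff (A n (fn f))).differentiable (by simp)).differentiableOn
      (fun y hy => by rw [fderivWithin_of_isOpen hΩ.isOpen hy, hz y hy]) hx₀ hx)
  obtain ⟨a, ha⟩ := hcl.mem_of_tendsto (tendsto_contL2 hΩ
    (fun n => (smoothFn_contDiff (A n (fn f))).continuous) tendsto_const_nhds
    (fun n => (smoothFn_contDiff (A n (fn f))).continuous) (fun n x _ => (one_mul _).symm) (hT (fn f)))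
    (Filter.Eventually.of_forall hmem)
  refine ⟨a, ?_⟩
  rw [← ha]
  exact coeFn_contL2 hΩ continuous_const

end

end

end ReggeFEM

namespace ReggeFEM

noncomputable section

/-! ### Trace inequality and Sobolev inequality for smooth functions -/

/-- The unit interval measure that parametrizes the sides of triangles. -/
abbrev I01 : Measure ℝ := volume.restrict (Icc (0 : ℝ) 1)

theorem memLp_I01 {f : ℝ → ℝ} (hf : Continuous f) : MemLp f 2 I01 := by
  obtain ⟨C, hC⟩ := (isCompact_Icc (a := (0 : ℝ)) (b := 1)).exists_bound_of_continuousOn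
    hf.continuousOn
  refine MemLp.of_bound hf.aestronglyMeasurable C ?_
  exact (ae_restrict_iff' measurableSet_Icc).2 (Filter.Eventually.of_forall hC)

theorem integrable_I01 {f : ℝ → ℝ} (hf : Continuous f) : Integrable f I01 :=
  hf.continuousOn.integrableOn_compact isCompact_Icc

theorem integral_I01_deriv {f f' : ℝ → ℝ} (hf : ∀ s, HasDerivAt f (f' s) s) (hf' : Continuous f') :
    ∫ s in Icc (0 : ℝ) 1, f' s = f 1 - f 0 := by
  rw [integral_Icc_eq_integral_Ioc, ← intervalIntegral.integral_of_le zero_le_one]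
  exact intervalIntegral.integral_eq_sub_of_hasDerivAt (fun s _ => hf s)
    (hf'.intervalIntegrable _ _)

theorem hasDerivAt_sidePt (P : Fin 3 → Plane) (i : Fin 3) {ψ : Plane → ℝ} (hψ : ContDiff ℝ ∞ ψ)
    (s : ℝ) : HasDerivAt (fun s => ψ (sidePt P i s))
      (fderiv ℝ ψ (sidePt P i s) (P (i + 2) - P (i + 1))) s := by
  have hl : HasDerivAt (sidePt P i) (P (i + 2) - P (i + 1)) s := by
    have := ((hasDerivAt_id s).smul_const (P (i + 2) - P (i + 1))).const_add (P (i + 1))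
    rw [one_smul] at this
    exact this
  exact (hψ.differentiable (by simp) _).hasFDerivAt.comp_hasDerivAt s hl

theorem coord_contDiff (k : Fin 2) : ContDiff ℝ ∞ fun x : Plane => x k :=
  (EuclideanSpace.proj (𝕜 := ℝ) k).contDiff

theorem pd_coord (k l : Fin 2) (x : Plane) :
    pd k (fun x : Plane => x l) x = if k = l then 1 else 0 := by
  have : fderiv ℝ (fun x : Plane => x l) x = EuclideanSpace.proj (𝕜 := ℝ) l :=
    (EuclideanSpace.proj (𝕜 := ℝ) l).fderiv
  rw [pd, this]
  simp [eq_comm]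

/-- The sum of the squares of the derivatives of order at most one. -/
def jetSq (ψ : Plane → ℝ) (x : Plane) : ℝ := ψ x ^ 2 + pd 0 ψ x ^ 2 + pd 1 ψ x ^ 2

theorem jetSq_continuous {ψ : Plane → ℝ} (hψ : ContDiff ℝ ∞ ψ) : Continuous (jetSq ψ) := by
  have := hψ.continuous
  have := pd_continuous hψ 0
  have := pd_continuous hψ 1
  unfold jetSq
  fun_prop

theorem jetSq_nonneg (ψ : Plane → ℝ) (x : Plane) : 0 ≤ jetSq ψ x := by unfold jetSq; positivity

/-- Trace inequality. -/
theorem integral_side_sq_le {P : Fin 3 → Plane} (hD : 0 < tdet P) (i : Fin 3) {M : ℝ}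
    (hM : ∀ x ∈ ocell P, ∀ k, (x k - P i k) ^ 2 ≤ M) {ψ : Plane → ℝ} (hψ : ContDiff ℝ ∞ ψ) :
    tdet P * ∫ s in Icc (0 : ℝ) 1, ψ (sidePt P i s) ^ 2 ≤
      (4 + M) * ∫ x in ocell P, jetSq ψ x := by
  have hk : ∀ k, ContDiff ℝ ∞ fun x : Plane => x k - P i k := fun k =>
    (coord_contDiff k).sub contDiff_const
  have hsq : ContDiff ℝ ∞ fun x => ψ x * ψ x := hψ.mul hψ
  have hF : ∀ k, ContDiff ℝ ∞ fun x => (ψ x * ψ x) * (x k - P i k) := fun k => hsq.mul (hk k)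
  have hpd : ∀ k x, pd k (fun x => (ψ x * ψ x) * (x k - P i k)) x =
      ψ x ^ 2 + 2 * ψ x * pd k ψ x * (x k - P i k) := by
    intro k x
    rw [pd_mul hsq (hk k), pd_mul hψ hψ]
    have : pd k (fun x : Plane => x k - P i k) x = 1 := by
      have e : pd k (fun x : Plane => x k - P i k) x = pd k (fun x : Plane => x k) x := by
        simp only [pd]; rw [fderiv_sub_const]
      rw [e, pd_coord]; simp
    rw [this]; ring
  -- Divergence theorem for the field `ψ² (x - P i)`: it is tangential on the two sides through `P
  -- i`, and on the side `i` its product with the conormal is `tdet P * ψ²`.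
  have key : tdet P * ∫ s in Icc (0 : ℝ) 1, ψ (sidePt P i s) ^ 2 =
      ∑ k, ∫ x in ocell P, pd k (fun x => (ψ x * ψ x) * (x k - P i k)) x := by
    simp only [integral_pd_ocell hD (hF _)]
    rw [Finset.sum_comm]
    have hside : ∀ j, ∑ k, (∫ s in Icc (0 : ℝ) 1, ψ (sidePt P j s) * ψ (sidePt P j s) *
        ((sidePt P j s) k - P i k)) *
          (![(P (j + 2) - P (j + 1)) 1, -(P (j + 2) - P (j + 1)) 0] : Fin 2 → ℝ) k =
        if j = i then tdet P * ∫ s in Icc (0 : ℝ) 1, ψ (sidePt P i s) ^ 2 else 0 := by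
      intro j
      have hc : ∀ k, Integrable (fun s => ψ (sidePt P j s) * ψ (sidePt P j s) *
        ((sidePt P j s) k - P i k) * (![(P (j + 2) - P (j + 1)) 1,
          -(P (j + 2) - P (j + 1)) 0] : Fin 2 → ℝ) k) I01 := fun k =>
        integrable_I01 (((hF k).continuous.comp (sidePt_continuous P j)).mul continuous_const)
      simp only [← integral_mul_const]
      rw [← integral_finsetSum _ fun k _ => hc k]
      have hpt : ∀ s, ∑ k, ψ (sidePt P j s) * ψ (sidePt P j s) * ((sidePt P j s) k - P i k) *
          (![(P (j + 2) - P (j + 1)) 1, -(P (j + 2) - P (j + 1)) 0] : Fin 2 → ℝ) k =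
          if j = i then tdet P * ψ (sidePt P i s) ^ 2 else 0 := by
        intro s
        rw [Fin.sum_univ_two]
        have hcr : ((sidePt P j s) 0 - P i 0) * (P (j + 2) - P (j + 1)) 1 -
            ((sidePt P j s) 1 - P i 1) * (P (j + 2) - P (j + 1)) 0 =
            if j = i then tdet P else 0 := by
          fin_cases j <;> fin_cases i <;> simp [sidePt, tdet, cross] <;> ring
        simp only [Matrix.cons_val_zero, Matrix.cons_val_one]
        split_ifs with h
        · rw [if_pos h] at hcr; subst h; linear_combination ψ (sidePt P j s) ^ 2 * hcr
        · rw [if_neg h] at hcr; linear_combination ψ (sidePt P j s) ^ 2 * hcr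
      simp only [hpt]
      split_ifs
      · rw [integral_const_mul]
      · simp
    rw [Finset.sum_congr rfl fun j _ => hside j]
    simp
  rw [key, ← integral_finsetSum _ fun k _ => integrableOn_ocell hD (pd_continuous (hF k) k),
    ← integral_const_mul]
  refine setIntegral_mono_on
    (integrable_finsetSum _ fun k _ => integrableOn_ocell hD (pd_continuous (hF k) k))
    (integrableOn_ocell hD (continuous_const.mul (jetSq_continuous hψ)))
    (isOpen_ocell P).measurableSet fun x hx => ?_
  simp only [hpd, Fin.sum_univ_two, jetSq]
  have h0 := hM x hx 0
  have h1 := hM x hx 1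
  -- The divergence is `2ψ² + ∑ 2ψ ∂ₖψ (xₖ - Pₖ)`; each cross term is at most `ψ² + M (∂ₖψ)²`, which
  -- leads to the constant `4 + M`.
  nlinarith [sq_nonneg (ψ x - pd 0 ψ x * (x 0 - P i 0)), sq_nonneg (ψ x - pd 1 ψ x * (x 1 - P i 1)),
    mul_le_mul_of_nonneg_left h0 (sq_nonneg (pd 0 ψ x)),
    mul_le_mul_of_nonneg_left h1 (sq_nonneg (pd 1 ψ x)), sq_nonneg (pd 0 ψ x), sq_nonneg (pd 1 ψ x),
    mul_nonneg (le_trans (sq_nonneg _) h0) (sq_nonneg (ψ x))]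

theorem exists_coord_bound (P : Fin 3 → Plane) :
    ∃ M : ℝ, 0 ≤ M ∧ ∀ x ∈ ctri P, ∀ y ∈ ctri P, ∀ k, (x k - y k) ^ 2 ≤ M := by
  obtain ⟨R, hR⟩ := (isCompact_ctri P).isBounded.subset_closedBall 0
  refine ⟨(2 * R) ^ 2, by positivity, fun x hx y hy k => ?_⟩
  have hx' := hR hx
  have hy' := hR hy
  rw [mem_closedBall_zero_iff] at hx' hy'
  have h1 := PiLp.norm_apply_le x k
  have h2 := PiLp.norm_apply_le y k
  rw [Real.norm_eq_abs] at h1 h2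
  refine sq_le_sq' ?_ ?_ <;> linarith [abs_le.1 (h1.trans hx'), abs_le.1 (h2.trans hy'),
    (abs_le.1 (h1.trans hx')).1, (abs_le.1 (h2.trans hy')).2, (abs_le.1 (h1.trans hx')).2,
    (abs_le.1 (h2.trans hy')).1]

/-- The copy of a triangle with ratio `1/3` whose vertex `i` is moved to `x`. -/
def subTri (P : Fin 3 → Plane) (i : Fin 3) (x : Plane) (j : Fin 3) : Plane :=
  x + (1 / 3 : ℝ) • (P j - P i)

theorem tdet_subTri (P : Fin 3 → Plane) (i : Fin 3) (x : Plane) :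
    tdet (subTri P i x) = tdet P / 9 := by
  simp [tdet, cross, subTri]
  ring

theorem lam_subTri {P : Fin 3 → Plane} (hD : 0 < tdet P) (i j : Fin 3) (x y : Plane) :
    lam P j y = lam P j x + (lam (subTri P i x) j y - if j = i then 1 else 0) / 3 := by
  rw [← lam_vertex hD j i]
  simp only [lam, tdet_subTri]
  have := hD.ne'
  field_simp
  simp [cross, subTri]
  ring

/-- From `x` into the small copy only the coordinate `i` can decrease, and by less than `1/3`; the
others increase. -/
theorem ocell_subTri {P : Fin 3 → Plane} (hD : 0 < tdet P) {i : Fin 3} {x : Plane}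
    (hx : x ∈ ctri P) (hi : 1 / 3 ≤ lam P i x) : ocell (subTri P i x) ⊆ ocell P := by
  intro y hy j
  have h1 := (mem_convexHull_iff hD x).1 hx j
  have h2 := hy j
  rw [lam_subTri hD i j x y]
  split_ifs with h
  · subst h; linarith
  · linarith

/-- Integrate the derivative of `s h(s)²`, which has no contribution from `s = 0`, and use `2 s h h'
≤ h² + h'²` on the unit interval. -/
theorem sq_le_integral {h h' : ℝ → ℝ} (hh : ∀ s, HasDerivAt h (h' s) s) (hc' : Continuous h') :
    h 1 ^ 2 ≤ 2 * (∫ s in Icc (0 : ℝ) 1, h s ^ 2) + ∫ s in Icc (0 : ℝ) 1, h' s ^ 2 := by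
  have hc : Continuous h := continuous_iff_continuousAt.2 fun s => (hh s).continuousAt
  have hd : ∀ s, HasDerivAt (fun s => s * h s ^ 2) (h s ^ 2 + s * (2 * h s * h' s)) s := by
    intro s
    exact ((hasDerivAt_id s).mul ((hh s).pow 2)).congr_deriv (by simp)
  have key := integral_I01_deriv hd (by fun_prop)
  simp only [one_mul, zero_mul, sub_zero] at key
  rw [← key, ← integral_const_mul, ← integral_add (integrable_I01 (by fun_prop))
    (integrable_I01 (by fun_prop))]
  refine setIntegral_mono_on (integrable_I01 (by fun_prop)) (integrable_I01 (by fun_prop))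
    measurableSet_Icc fun s hs => ?_
  have h1 : s ^ 2 ≤ 1 := by nlinarith [hs.1, hs.2]
  nlinarith [sq_nonneg (s * h s - h' s), mul_le_mul_of_nonneg_right h1 (sq_nonneg (h s))]

/-- Sobolev inequality. -/
theorem exists_sobolev {P : Fin 3 → Plane} (hD : 0 < tdet P) : ∃ C : ℝ, 0 ≤ C ∧
    ∀ ψ : Plane → ℝ, ContDiff ℝ ∞ ψ → ∀ x ∈ ctri P, ψ x ^ 2 ≤
      C * ((∫ y in ocell P, jetSq ψ y) + ∑ k, ∫ y in ocell P, jetSq (pd k ψ) y) := by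
  obtain ⟨M, hM0, hM⟩ := exists_coord_bound P
  refine ⟨(2 + 2 * M) * ((4 + M) / (tdet P / 9)), by positivity, fun ψ hψ x hx => ?_⟩
  -- The point `x` is made a vertex of a copy of the triangle, of one third of its size, that stays
  -- inside; the size does not depend on `x`, so neither do the constants. The value at `x` is
  -- bounded by `ψ` and its derivative along a side of the copy that ends at `x`, and the trace
  -- inequality bounds these by integrals over the triangle, at the expense of second derivatives.
  obtain ⟨i, hi⟩ : ∃ i, 1 / 3 ≤ lam P i x := by
    by_contra hcon
    push Not at hcon
    have := lam_sum hD x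
    rw [Fin.sum_univ_three] at this
    linarith [hcon 0, hcon 1, hcon 2]
  set Q := subTri P i x with hQ
  have hDQ : 0 < tdet Q := by rw [hQ, tdet_subTri]; positivity
  have hsub : ocell Q ⊆ ocell P := ocell_subTri hD hx hi
  have hsubc : ctri Q ⊆ ctri P := by
    refine convexHull_min ?_ (convex_convexHull ℝ _)
    rintro _ ⟨j, rfl⟩
    refine (mem_convexHull_iff hD _).2 fun l => ?_
    rw [lam_subTri hD i l x]
    change 0 ≤ lam P l x + (lam Q l (Q j) - _) / 3
    rw [lam_vertex hDQ]
    have h1 := (mem_convexHull_iff hD x).1 hx l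
    split_ifs with h2 h3 h3 <;> first | (subst h3; linarith) | linarith
  have tr : ∀ χ : Plane → ℝ, ContDiff ℝ ∞ χ → ∫ s in Icc (0 : ℝ) 1, χ (sidePt Q (i + 1) s) ^ 2 ≤
      (4 + M) / (tdet P / 9) * ∫ y in ocell P, jetSq χ y := by
    intro χ hχ
    have h1 := integral_side_sq_le hDQ (i + 1) (M := M) (fun y hy k => hM _
      (hsubc (ocell_subset_ctri hDQ hy)) _ (hsubc (subset_convexHull ℝ _ (mem_range_self _))) k) hχ
    have h2 : ∫ y in ocell Q, jetSq χ y ≤ ∫ y in ocell P, jetSq χ y :=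
      setIntegral_mono_set (integrableOn_ocell hD (jetSq_continuous hχ))
        (Filter.Eventually.of_forall (jetSq_nonneg χ)) hsub.eventuallyLE
    rw [hQ, tdet_subTri, ← hQ] at h1
    rw [div_mul_eq_mul_div, le_div_iff₀ (by positivity), mul_comm]
    exact h1.trans (mul_le_mul_of_nonneg_left h2 (by positivity))
  have hfc : Continuous fun y => fderiv ℝ ψ y (Q (i + 1 + 2) - Q (i + 1 + 1)) :=
    (hψ.continuous_fderiv (by simp)).clm_apply continuous_const
  have h1 := sq_le_integral (fun s => hasDerivAt_sidePt Q (i + 1) hψ s)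
    (hfc.comp (sidePt_continuous Q (i + 1)))
  have e1 : sidePt Q (i + 1) 1 = x := by
    simp [sidePt, fin3_one_two, hQ, subTri]
  rw [e1] at h1
  have hc0 := ((pd_continuous hψ 0).comp (sidePt_continuous Q (i + 1)))
  have hc1 := ((pd_continuous hψ 1).comp (sidePt_continuous Q (i + 1)))
  simp only [Function.comp_def] at hc0 hc1
  have h2 : ∫ s in Icc (0 : ℝ) 1,
      fderiv ℝ ψ (sidePt Q (i + 1) s) (Q (i + 1 + 2) - Q (i + 1 + 1)) ^ 2 ≤
      2 * M * ((∫ s in Icc (0 : ℝ) 1, pd 0 ψ (sidePt Q (i + 1) s) ^ 2) +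
        ∫ s in Icc (0 : ℝ) 1, pd 1 ψ (sidePt Q (i + 1) s) ^ 2) := by
    rw [← integral_add (integrable_I01 (by fun_prop)) (integrable_I01 (by fun_prop)),
      ← integral_const_mul]
    refine setIntegral_mono_on (integrable_I01 ((hfc.comp (sidePt_continuous Q (i + 1))).pow 2))
      (integrable_I01 (by fun_prop)) measurableSet_Icc fun s _ => ?_
    rw [fderiv_apply_eq]
    have m0 := hM _ (hsubc (subset_convexHull ℝ _ (mem_range_self (i + 1 + 2)))) _
      (hsubc (subset_convexHull ℝ _ (mem_range_self (i + 1 + 1)))) 0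
    have m1 := hM _ (hsubc (subset_convexHull ℝ _ (mem_range_self (i + 1 + 2)))) _
      (hsubc (subset_convexHull ℝ _ (mem_range_self (i + 1 + 1)))) 1
    simp only [PiLp.sub_apply]
    generalize Q (i + 1 + 2) 0 - Q (i + 1 + 1) 0 = a at *
    generalize Q (i + 1 + 2) 1 - Q (i + 1 + 1) 1 = b at *
    generalize pd 0 ψ (sidePt Q (i + 1) s) = p at *
    generalize pd 1 ψ (sidePt Q (i + 1) s) = q at *
    nlinarith [sq_nonneg (a * p - b * q), mul_le_mul_of_nonneg_right m0 (sq_nonneg p),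
      mul_le_mul_of_nonneg_right m1 (sq_nonneg q)]
  have t0 := tr ψ hψ
  have t1 := tr _ (pd_contDiff hψ 0)
  have t2 := tr _ (pd_contDiff hψ 1)
  rw [Fin.sum_univ_two]
  have n0 : 0 ≤ ∫ y in ocell P, jetSq ψ y := integral_nonneg (jetSq_nonneg ψ)
  have n1 : 0 ≤ ∫ y in ocell P, jetSq (pd 0 ψ) y := integral_nonneg (jetSq_nonneg _)
  have n2 : 0 ≤ ∫ y in ocell P, jetSq (pd 1 ψ) y := integral_nonneg (jetSq_nonneg _)
  have hCC : 0 ≤ (4 + M) / (tdet P / 9) := by positivity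
  generalize (4 + M) / (tdet P / 9) = c at *
  have hcM : 0 ≤ c * M := by positivity
  have := mul_le_mul_of_nonneg_left (add_le_add t1 t2) (by positivity : 0 ≤ 2 * M)
  nlinarith [mul_nonneg hCC n0, mul_nonneg hCC n1, mul_nonneg hCC n2, mul_nonneg hcM n0]

end

end ReggeFEM

namespace ReggeFEM

noncomputable section

/-! ### Integrals as functionals on `L²` -/

section

variable {X : Type*} [MeasurableSpace X] {μ : Measure X}

theorem inner_L2 (f g : Lp ℝ 2 μ) : inner ℝ f g = ∫ x, f x * g x ∂μ := by
  rw [L2.inner_def]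
  refine integral_congr_ae (Filter.Eventually.of_forall fun x => ?_)
  simp [mul_comm]

theorem norm_sq_L2 (f : Lp ℝ 2 μ) : ‖f‖ ^ 2 = ∫ x, f x ^ 2 ∂μ := by
  rw [← real_inner_self_eq_norm_sq, inner_L2]
  simp only [sq]

/-- The functional `f ↦ ∫ F f` on `L²`. -/
def pairL {F : X → ℝ} (hF : MemLp F 2 μ) : Lp ℝ 2 μ →L[ℝ] ℝ := innerSL ℝ (hF.toLp F)

theorem pairL_apply {F : X → ℝ} (hF : MemLp F 2 μ) (f : Lp ℝ 2 μ) :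
    pairL hF f = ∫ x, F x * f x ∂μ := by
  rw [pairL, innerSL_apply_apply, inner_L2]
  exact integral_congr_ae (hF.coeFn_toLp.mono fun x hx => by simp only [hx])

theorem integrable_mul_L2 {F : X → ℝ} (hF : MemLp F 2 μ) (f : Lp ℝ 2 μ) :
    Integrable (fun x => F x * f x) μ := hF.integrable_mul (Lp.memLp f)

end

/-! ### Operators between Sobolev spaces -/

section

variable {Ω : Set Plane}

theorem norm_fn_le (f : H1 Ω) : ‖fn f‖ ≤ ‖f‖ := norm_fst_le f.1

theorem norm_wd_le (f : H1 Ω) (k : Fin 2) : ‖wd f k‖ ≤ ‖f‖ :=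
  (norm_le_pi_norm f.1.2 k).trans (norm_snd_le f.1)

theorem norm_H1_le {f : H1 Ω} {C : ℝ} (hC : 0 ≤ C) (h0 : ‖fn f‖ ≤ C) (h1 : ∀ k, ‖wd f k‖ ≤ C) :
    ‖f‖ ≤ C :=
  max_le h0 ((pi_norm_le_iff_of_nonneg hC).2 h1)

/-- The inclusion `H¹(Ω) → L²(Ω)`. -/
def fnL : H1 Ω →L[ℝ] L2 Ω :=
  LinearMap.mkContinuous { toFun := fn, map_add' := fun _ _ => rfl, map_smul' := fun _ _ => rfl } 1
    fun f => by rw [one_mul]; exact norm_fn_le f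

/-- The weak derivative `H¹(Ω) → L²(Ω)`. -/
def wdL (k : Fin 2) : H1 Ω →L[ℝ] L2 Ω :=
  LinearMap.mkContinuous
    { toFun := fun f => wd f k, map_add' := fun _ _ => rfl, map_smul' := fun _ _ => rfl } 1
    fun f => by rw [one_mul]; exact norm_wd_le f k

theorem norm_toH1_le (f : H2 Ω) : ‖toH1 f‖ ≤ ‖f‖ := by
  refine norm_H1_le (norm_nonneg _) (norm_fst_le f.1) fun k => ?_
  exact (norm_le_pi_norm f.1.2.1 k).trans ((norm_fst_le f.1.2).trans (norm_snd_le f.1))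

theorem norm_wdH1_le (f : H2 Ω) (k : Fin 2) : ‖wdH1 f k‖ ≤ ‖f‖ := by
  refine norm_H1_le (norm_nonneg _) ?_ fun l => ?_
  · exact (norm_le_pi_norm f.1.2.1 k).trans ((norm_fst_le f.1.2).trans (norm_snd_le f.1))
  · exact (norm_le_pi_norm (f.1.2.2 k) l).trans ((norm_le_pi_norm f.1.2.2 k).trans
      ((norm_snd_le f.1.2).trans (norm_snd_le f.1)))

/-- The inclusion `H²(Ω) → H¹(Ω)`. -/
def toH1L : H2 Ω →L[ℝ] H1 Ω :=
  LinearMap.mkContinuous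
    { toFun := toH1, map_add' := fun _ _ => rfl, map_smul' := fun _ _ => rfl } 1
    fun f => by rw [one_mul]; exact norm_toH1_le f

/-- The weak derivative `H²(Ω) → H¹(Ω)`. -/
def wdH1L (k : Fin 2) : H2 Ω →L[ℝ] H1 Ω :=
  LinearMap.mkContinuous
    { toFun := fun f => wdH1 f k, map_add' := fun _ _ => rfl, map_smul' := fun _ _ => rfl } 1
    fun f => by rw [one_mul]; exact norm_wdH1_le f k

@[simp] theorem fnL_apply (f : H1 Ω) : fnL f = fn f := rfl

@[simp] theorem wdL_apply (k : Fin 2) (f : H1 Ω) : wdL k f = wd f k := rfl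

@[simp] theorem toH1L_apply (f : H2 Ω) : toH1L f = toH1 f := rfl

@[simp] theorem wdH1L_apply (k : Fin 2) (f : H2 Ω) : wdH1L k f = wdH1 f k := rfl

theorem integral_sq_contL2 (hΩ : IsConvexDomain Ω) {ψ : Plane → ℝ} (hψ : Continuous ψ) :
    ∫ x in Ω, ψ x ^ 2 = ‖contL2 hΩ ψ hψ‖ ^ 2 := by
  rw [norm_sq_L2]
  exact integral_congr_ae ((coeFn_contL2 hΩ hψ).symm.mono fun x hx => by simp only [hx])

theorem integral_jetSq_le (hΩ : IsConvexDomain Ω) (ψ : SmoothFn) :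
    ∫ x in Ω, jetSq ψ.1 x ≤ 3 * ‖smoothH1 hΩ ψ‖ ^ 2 := by
  have hi : ∀ {χ : Plane → ℝ}, Continuous χ → Integrable (fun x => χ x ^ 2) (volume.restrict Ω) :=
    fun hχ => (hΩ.memLp hχ).integrable_sq
  have c0 := pd_continuous (smoothFn_contDiff ψ) 0
  have c1 := pd_continuous (smoothFn_contDiff ψ) 1
  simp only [jetSq]
  have hψ := hi (smoothFn_contDiff ψ).continuous
  rw [integral_add (f := fun x => ψ.1 x ^ 2 + pd 0 ψ.1 x ^ 2) (hψ.add (hi c0)) (hi c1),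
    integral_add hψ (hi c0),
    integral_sq_contL2 hΩ (smoothFn_contDiff ψ).continuous, integral_sq_contL2 hΩ c0,
    integral_sq_contL2 hΩ c1]
  have h0 := pow_le_pow_left₀ (norm_nonneg _) (norm_fn_le (smoothH1 hΩ ψ)) 2
  have h1 := pow_le_pow_left₀ (norm_nonneg _) (norm_wd_le (smoothH1 hΩ ψ) 0) 2
  have h2 := pow_le_pow_left₀ (norm_nonneg _) (norm_wd_le (smoothH1 hΩ ψ) 1) 2
  rw [fn_smoothH1] at h0
  rw [wd_smoothH1] at h1 h2
  linarith

end

/-! ### The unit interval -/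

theorem measurePreserving_reflect : MeasurePreserving (fun s : ℝ => 1 - s) I01 I01 := by
  have h := (Measure.measurePreserving_sub_left (volume : Measure ℝ) 1).restrict_preimage
    (measurableSet_Icc (a := (0 : ℝ)) (b := 1))
  have e : (fun s : ℝ => 1 - s) ⁻¹' Icc 0 1 = Icc 0 1 := by
    ext s; simp only [mem_preimage, mem_Icc]; constructor <;> rintro ⟨h1, h2⟩ <;> constructor <;> linarith
  rwa [e] at h

theorem integral_reflect (f : ℝ → ℝ) : ∫ s, f (1 - s) ∂I01 = ∫ s, f s ∂I01 :=
  measurePreserving_reflect.integral_comp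
    (MeasurableEquiv.subLeft (1 : ℝ)).measurableEmbedding f

theorem ae_reflect {p : ℝ → Prop} (h : ∀ᵐ s ∂I01, p s) : ∀ᵐ s ∂I01, p (1 - s) :=
  measurePreserving_reflect.quasiMeasurePreserving.ae h

theorem ae_zero_of_integral_test {h : ℝ → ℝ} (hi : Integrable h I01)
    (H : ∀ η : ℝ → ℝ, ContDiff ℝ ∞ η → tsupport η ⊆ Ioo 0 1 → ∫ s, h s * η s ∂I01 = 0) :
    ∀ᵐ s ∂I01, h s = 0 := by
  have key : ∀ᵐ s, s ∈ Ioo (0 : ℝ) 1 → h s = 0 := by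
    refine isOpen_Ioo.ae_eq_zero_of_integral_contDiff_smul_eq_zero ?_ fun η h1 _ h3 => ?_
    · exact (IntegrableOn.mono_set hi Ioo_subset_Icc_self).locallyIntegrableOn
    · have hz : ∀ s, s ∉ Icc (0 : ℝ) 1 → η s • h s = 0 := fun s hs => by
        have : η s = 0 := image_eq_zero_of_notMem_tsupport fun hm => hs (Ioo_subset_Icc_self (h3 hm))
        simp [this]
      rw [← setIntegral_eq_integral_of_forall_compl_eq_zero hz]
      simpa [mul_comm] using H η h1 h3
  have h2 := (ae_restrict_iff' measurableSet_Ioo).2 key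
  rwa [restrict_Ioo_eq_restrict_Icc] at h2

namespace TriangulatedSurface

variable (K : TriangulatedSurface)

/-! ### Triangles of a surface -/

theorem tdet_pos (T : K.Tri) : 0 < tdet (K.pos T) := by
  have := K.pos_oriented T
  simpa [tdet, cross] using this

theorem cell_eq (T : K.Tri) : K.cell T = ocell (K.pos T) := interior_convexHull_eq (K.tdet_pos T)

theorem convexDomain (T : K.Tri) : IsConvexDomain (K.cell T) where
  isOpen := isOpen_interior
  convex := (convex_convexHull ℝ _).interior
  bounded := (K.tri_compact T).isBounded.subset interior_subset
  nonempty := by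
    rw [cell_eq]
    refine ⟨chart (K.pos T) 0 !₂[1 / 3, 1 / 3], ?_⟩
    rw [← chart_image (K.tdet_pos T) 0]
    refine mem_image_of_mem _ ⟨?_, ?_, ?_⟩ <;> norm_num

theorem edgeVec_ne_zero (T : K.Tri) (i : Fin 3) : ∃ k, K.edgeConormal T i k ≠ 0 := by
  by_contra hcon
  push Not at hcon
  have h0 := hcon 0
  have h1 := hcon 1
  have := K.tdet_pos T
  rw [← tdet_cyclic _ (i + 1)] at this
  simp [edgeConormal, edgeVec] at h0 h1
  simp only [cross, PiLp.sub_apply, fin3_one_one] at this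
  rw [h0, show K.pos T (i + 2) 0 - K.pos T (i + 1) 0 = 0 by linarith] at this
  simp at this

/-! ### The trace operator -/

/-- The restriction of smooth functions to a side of a triangle. -/
def sideRestrict (T : K.Tri) (i : Fin 3) : SmoothFn →ₗ[ℝ] Lp ℝ 2 I01 where
  toFun ψ := (memLp_I01 ((smoothFn_contDiff ψ).continuous.comp (K.edgePt_continuous T i))).toLp
    (fun s => ψ.1 (K.edgePt T i s))
  map_add' _ _ := rfl
  map_smul' _ _ := rfl

theorem coeFn_sideRestrict (T : K.Tri) (i : Fin 3) (ψ : SmoothFn) :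
    K.sideRestrict T i ψ =ᵐ[I01] fun s => ψ.1 (K.edgePt T i s) :=
  (memLp_I01 ((smoothFn_contDiff ψ).continuous.comp (K.edgePt_continuous T i))).coeFn_toLp

/-- This is the estimate by which restriction to a side extends continuously from smooth functions
to `H¹(T)`. The factor 3 comes from `integral_jetSq_le`, the rest from the trace inequality. -/
theorem sideRestrict_bound (T : K.Tri) (i : Fin 3) :
    ∃ C : ℝ, ∀ ψ, ‖K.sideRestrict T i ψ‖ ≤ C * ‖smoothH1 (K.convexDomain T) ψ‖ := by
  obtain ⟨M, hM0, hM⟩ := exists_coord_bound (K.pos T)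
  have hD := K.tdet_pos T
  refine ⟨√((4 + M) * 3 / tdet (K.pos T)), fun ψ => ?_⟩
  refine le_of_sq_le_sq ?_ (by positivity)
  rw [mul_pow, Real.sq_sqrt (by positivity), norm_sq_L2, div_mul_eq_mul_div, le_div_iff₀ hD,
    mul_comm]
  have h1 := integral_side_sq_le hD i (M := M) (fun y hy k => hM _ (ocell_subset_ctri hD hy) _
    (subset_convexHull ℝ _ (mem_range_self _)) k) (smoothFn_contDiff ψ)
  have h2 := integral_jetSq_le (K.convexDomain T) ψ
  rw [← K.cell_eq] at h1
  have h3 : ∫ s, (K.sideRestrict T i ψ) s ^ 2 ∂I01 =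
      ∫ s in Icc (0 : ℝ) 1, ψ.1 (sidePt (K.pos T) i s) ^ 2 :=
    integral_congr_ae ((K.coeFn_sideRestrict T i ψ).mono fun s hs => by
      simp only [hs]; rfl)
  rw [h3]
  refine h1.trans ?_
  rw [mul_assoc]
  exact mul_le_mul_of_nonneg_left h2 (by positivity)

/-- The trace operator. -/
def traceL (T : K.Tri) (i : Fin 3) : H1 (K.cell T) →L[ℝ] Lp ℝ 2 I01 :=
  (K.sideRestrict T i).extendOfNorm (smoothH1 (K.convexDomain T))

theorem traceL_smooth (T : K.Tri) (i : Fin 3) (ψ : SmoothFn) :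
    K.traceL T i (smoothH1 (K.convexDomain T) ψ) = K.sideRestrict T i ψ :=
  LinearMap.extendOfNorm_eq (denseRange_smoothH1 _) (K.sideRestrict_bound T i) ψ

/-- Green's formula. -/
theorem green (T : K.Tri) (f h : H1 (K.cell T)) (k : Fin 2) :
    (∫ x in K.cell T, fn f x * wd h k x) + ∫ x in K.cell T, wd f k x * fn h x =
      ∑ i, (∫ s, K.traceL T i f s * K.traceL T i h s ∂I01) * K.edgeConormal T i k := by
  simp only [← inner_L2]
  simp only [← fnL_apply, ← wdL_apply]
  have hd := denseRange_smoothH1 (K.convexDomain T)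
  -- Both sides are continuous in `f` and `h` for the `H¹` norm, so smooth functions suffice; for
  -- them the formula is the divergence theorem applied to the product.
  refine hd.induction_on₂ (p := fun f h => inner ℝ (fnL f) (wdL k h) + inner ℝ (wdL k f) (fnL h) =
    ∑ i, inner ℝ (K.traceL T i f) (K.traceL T i h) * K.edgeConormal T i k) ?_ (fun ψ χ => ?_) f h
  · exact isClosed_eq (by fun_prop) (by fun_prop)
  · simp only [inner_L2, fnL_apply, wdL_apply, traceL_smooth, fn_smoothH1, wd_smoothH1]
    have hψ := smoothFn_contDiff ψ
    have hχ := smoothFn_contDiff χ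
    have e1 : ∀ {a b : Plane → ℝ} (ha : Continuous a) (hb : Continuous b),
        ∫ x in K.cell T, contL2 (K.convexDomain T) a ha x * contL2 (K.convexDomain T) b hb x =
          ∫ x in K.cell T, a x * b x := fun ha hb =>
      integral_congr_ae (by
        filter_upwards [coeFn_contL2 (K.convexDomain T) ha, coeFn_contL2 (K.convexDomain T) hb]
          with x h1 h2
        rw [h1, h2])
    have e2 : ∀ i, ∫ s, K.sideRestrict T i ψ s * K.sideRestrict T i χ s ∂I01 =
        ∫ s in Icc (0 : ℝ) 1, (fun x => ψ.1 x * χ.1 x) (sidePt (K.pos T) i s) := fun i =>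
      integral_congr_ae (by
        filter_upwards [K.coeFn_sideRestrict T i ψ, K.coeFn_sideRestrict T i χ] with x h1 h2
        rw [h1, h2]; rfl)
    simp only [e1, e2]
    have h3 := integral_pd_ocell (K.tdet_pos T) (hψ.mul hχ) k
    rw [← K.cell_eq] at h3
    refine Eq.trans ?_ h3
    simp only [pd_mul hψ hχ]
    have hi : ∀ {a : Plane → ℝ}, Continuous a → Integrable a (volume.restrict (K.cell T)) :=
      fun ha => by rw [K.cell_eq]; exact integrableOn_ocell (K.tdet_pos T) ha
    exact (integral_add (hi (hψ.continuous.mul (pd_continuous hχ k)))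
      (hi ((pd_continuous hψ k).mul hχ.continuous))).symm

theorem isTrace_traceL (T : K.Tri) (f : H1 (K.cell T)) :
    K.IsTrace T f fun i => K.traceL T i f where
  memLp i := Lp.memLp _
  green ψ k hψ := by
    have h := K.green T f (smoothH1 (K.convexDomain T) ⟨ψ, hψ⟩) k
    simp only [traceL_smooth, fn_smoothH1, wd_smoothH1] at h
    have e1 : ∀ (g : L2 (K.cell T)) {a : Plane → ℝ} (ha : Continuous a),
        ∫ x in K.cell T, g x * contL2 (K.convexDomain T) a ha x = ∫ x in K.cell T, g x * a x :=
      fun g a ha => integral_congr_ae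
        ((coeFn_contL2 (K.convexDomain T) ha).mono fun x hx => by simp only [hx])
    have e2 : ∀ i, ∫ s, K.traceL T i f s * K.sideRestrict T i ⟨ψ, hψ⟩ s ∂I01 =
        ∫ s, K.traceL T i f s * ψ (K.edgePt T i s) ∂I01 := fun i =>
      integral_congr_ae ((K.coeFn_sideRestrict T i ⟨ψ, hψ⟩).mono fun x hx => by simp only [hx])
    simp only [e1, e2] at h
    exact h

theorem lam_edgePt (T : K.Tri) (i : Fin 3) (s : ℝ) :
    lam (K.pos T) i (K.edgePt T i s) = 0 ∧ lam (K.pos T) (i + 1) (K.edgePt T i s) = 1 - s ∧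
      lam (K.pos T) (i + 2) (K.edgePt T i s) = s := lam_sidePt (K.tdet_pos T) i s

/-- Traces are unique. -/
theorem IsTrace.ae_eq {T : K.Tri} {f : H1 (K.cell T)} {t t' : Fin 3 → ℝ → ℝ}
    (h : K.IsTrace T f t) (h' : K.IsTrace T f t') (i : Fin 3) : t i =ᵐ[I01] t' i := by
  have hd : MemLp (fun s => t i s - t' i s) 2 I01 := (h.memLp i).sub (h'.memLp i)
  -- Green's formula sees all three sides at once. The factor `λ_{i+1} λ_{i+2}` in the test function
  -- removes the two other sides and restricts to `(1 - s) s` on the side `i`; being nonzero in the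
  -- open interval, it is divided out at the end.
  have key : ∀ᵐ s ∂I01, (t i s - t' i s) * ((1 - s) * s) = 0 := by
    refine ae_zero_of_integral_test ?_ fun η hη _ => ?_
    · exact hd.integrable_mul (memLp_I01 (f := fun s => (1 - s) * s) (by fun_prop))
    · set ψ : Plane → ℝ := fun x => lam (K.pos T) (i + 1) x * lam (K.pos T) (i + 2) x *
        η (lam (K.pos T) (i + 2) x) with hψd
      have hψ : ContDiff ℝ ∞ ψ := ((lam_contDiff _ _).mul (lam_contDiff _ _)).mul
        (hη.comp (lam_contDiff _ _))
      obtain ⟨k, hk⟩ := K.edgeVec_ne_zero T i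
      have e := (h.green ψ k hψ).symm.trans (h'.green ψ k hψ)
      have hz : ∀ (u : Fin 3 → ℝ → ℝ) j, j ≠ i →
          ∫ s in Icc (0 : ℝ) 1, u j s * ψ (K.edgePt T j s) = 0 := by
        intro u j hj
        have : ∀ s, ψ (K.edgePt T j s) = 0 := by
          intro s
          rcases fin3_cases i j with rfl | rfl | rfl
          · exact absurd rfl hj
          · simp [hψd, (K.lam_edgePt T (i + 1) s).1]
          · simp [hψd, (K.lam_edgePt T (i + 2) s).1]
        simp [this]
      have hs : ∀ u : Fin 3 → ℝ → ℝ, ∑ j, (∫ s in Icc (0 : ℝ) 1, u j s * ψ (K.edgePt T j s)) *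
          K.edgeConormal T j k =
          (∫ s in Icc (0 : ℝ) 1, u i s * ψ (K.edgePt T i s)) * K.edgeConormal T i k := fun u =>
        Finset.sum_eq_single i (fun j _ hj => by rw [hz u j hj, zero_mul]) (by simp)
      rw [hs, hs] at e
      have e' := mul_right_cancel₀ hk e
      have i1 := K.integrable_mul_edge T i (h.memLp i) hψ.continuous
      have i2 := K.integrable_mul_edge T i (h'.memLp i) hψ.continuous
      have e'' := sub_eq_zero.2 e'
      rw [← integral_sub i1 i2] at e''
      rw [← e'']
      refine integral_congr_ae (Filter.Eventually.of_forall fun s => ?_)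
      obtain ⟨-, l1, l2⟩ := K.lam_edgePt T i s
      simp only [hψd, l1, l2]
      ring
  have h2 : ∀ᵐ s ∂I01, s ∈ Ioo (0 : ℝ) 1 := by
    have := ae_restrict_mem (μ := (volume : Measure ℝ)) (measurableSet_Ioo (a := (0 : ℝ)) (b := 1))
    rwa [restrict_Ioo_eq_restrict_Icc] at this
  filter_upwards [key, h2] with s hs hs2
  have : (1 - s) * s ≠ 0 := mul_ne_zero (by linarith [hs2.2]) hs2.1.ne'
  have := (mul_eq_zero.1 hs).resolve_right this
  linarith

theorem IsTrace.ae_eq_traceL {T : K.Tri} {f : H1 (K.cell T)} {t : Fin 3 → ℝ → ℝ}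
    (h : K.IsTrace T f t) (i : Fin 3) : t i =ᵐ[I01] K.traceL T i f :=
  h.ae_eq K (K.isTrace_traceL T f) i

theorem isTrace_trace (T : K.Tri) (f : H1 (K.cell T)) : K.IsTrace T f (K.trace T f) :=
  Classical.epsilon_spec ⟨_, K.isTrace_traceL T f⟩

theorem trace_ae (T : K.Tri) (f : H1 (K.cell T)) (i : Fin 3) :
    K.trace T f i =ᵐ[I01] K.traceL T i f := (K.isTrace_trace T f).ae_eq_traceL K i

/-! ### Point values of functions in `H²` -/

instance (T : K.Tri) : CompactSpace (K.tri T) := isCompact_iff_compactSpace.1 (K.tri_compact T)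

/-- The restriction of smooth functions to the closed triangle. -/
def triRestrict (T : K.Tri) : SmoothFn →ₗ[ℝ] C(K.tri T, ℝ) where
  toFun ψ := ⟨fun x => ψ.1 x, (smoothFn_contDiff ψ).continuous.comp continuous_subtype_val⟩
  map_add' _ _ := rfl
  map_smul' _ _ := rfl

theorem triRestrict_bound (T : K.Tri) :
    ∃ C : ℝ, ∀ ψ, ‖K.triRestrict T ψ‖ ≤ C * ‖smoothH2 (K.convexDomain T) ψ‖ := by
  obtain ⟨C, hC0, hC⟩ := exists_sobolev (K.tdet_pos T)
  -- The 9 collects a factor 3 from `integral_jetSq_le` for each of `ψ`, `∂₀ψ`, `∂₁ψ`.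
  refine ⟨√(C * 9), fun ψ => (ContinuousMap.norm_le _ (by positivity)).2 fun x => ?_⟩
  refine le_of_sq_le_sq ?_ (by positivity)
  rw [mul_pow, Real.sq_sqrt (by positivity), Real.norm_eq_abs, sq_abs]
  have h := hC ψ.1 (smoothFn_contDiff ψ) x.1 x.2
  rw [← K.cell_eq] at h
  refine h.trans ?_
  rw [mul_assoc]
  refine mul_le_mul_of_nonneg_left ?_ hC0
  have h0 := integral_jetSq_le (K.convexDomain T) ψ
  have h1 := fun k => integral_jetSq_le (K.convexDomain T)
    ⟨pd k ψ.1, pd_contDiff (smoothFn_contDiff ψ) k⟩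
  have n0 := pow_le_pow_left₀ (norm_nonneg _) (norm_toH1_le (smoothH2 (K.convexDomain T) ψ)) 2
  have n1 := fun k =>
    pow_le_pow_left₀ (norm_nonneg _) (norm_wdH1_le (smoothH2 (K.convexDomain T) ψ) k) 2
  rw [toH1_smoothH2] at n0
  simp only [wdH1_smoothH2] at n1
  rw [Fin.sum_univ_two]
  linarith [h1 0, h1 1, n1 0, n1 1]

/-- The continuous representative of a function in `H²`. -/
def repL (T : K.Tri) : H2 (K.cell T) →L[ℝ] C(K.tri T, ℝ) :=
  (K.triRestrict T).extendOfNorm (smoothH2 (K.convexDomain T))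

theorem repL_smooth (T : K.Tri) (ψ : SmoothFn) :
    K.repL T (smoothH2 (K.convexDomain T) ψ) = K.triRestrict T ψ :=
  LinearMap.extendOfNorm_eq (denseRange_smoothH2 _) (K.triRestrict_bound T) ψ

open Classical in
/-- The continuous representative of a function in `H²`, as a function on the plane. -/
def rep (T : K.Tri) (f : H2 (K.cell T)) (x : Plane) : ℝ :=
  if h : x ∈ K.tri T then K.repL T f ⟨x, h⟩ else 0

theorem rep_of_mem {T : K.Tri} (f : H2 (K.cell T)) {x : Plane} (h : x ∈ K.tri T) :
    K.rep T f x = K.repL T f ⟨x, h⟩ := dif_pos h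

theorem continuousOn_rep (T : K.Tri) (f : H2 (K.cell T)) : ContinuousOn (K.rep T f) (K.tri T) := by
  rw [continuousOn_iff_continuous_domRestrict]
  refine (K.repL T f).continuous.congr fun x => ?_
  exact (K.rep_of_mem f x.2).symm

theorem exists_smooth_seq (T : K.Tri) (f : H2 (K.cell T)) : ∃ ψ : ℕ → SmoothFn,
    Filter.Tendsto (fun n => smoothH2 (K.convexDomain T) (ψ n)) Filter.atTop (nhds f) := by
  obtain ⟨u, hu, hlim⟩ := mem_closure_iff_seq_limit.1 (denseRange_smoothH2 (K.convexDomain T) f)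
  choose ψ hψ using hu
  exact ⟨ψ, by simpa only [hψ] using hlim⟩

theorem tendsto_rep {T : K.Tri} {f : H2 (K.cell T)} {ψ : ℕ → SmoothFn}
    (h : Filter.Tendsto (fun n => smoothH2 (K.convexDomain T) (ψ n)) Filter.atTop (nhds f))
    {x : Plane} (hx : x ∈ K.tri T) :
    Filter.Tendsto (fun n => (ψ n).1 x) Filter.atTop (nhds (K.rep T f x)) := by
  have h1 := ((K.repL T).continuous.tendsto f).comp h
  have h2 := ((ContinuousEvalConst.continuous_eval_const (⟨x, hx⟩ : K.tri T)).tendsto _).comp h1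
  rw [← K.rep_of_mem f hx] at h2
  refine h2.congr fun n => ?_
  simp only [Function.comp, repL_smooth]
  rfl

/-- Smooth functions that converge in `H²` converge pointwise to the continuous representative, and
a subsequence converges almost everywhere to the `L²` function; the limits coincide. -/
theorem rep_ae (T : K.Tri) (f : H2 (K.cell T)) :
    K.rep T f =ᵐ[volume.restrict (K.cell T)] fn (toH1 f) := by
  obtain ⟨ψ, hψ⟩ := K.exists_smooth_seq T f
  have h1 := ((fnL.comp toH1L).continuous.tendsto f).comp hψ
  obtain ⟨ns, hns', hns⟩ := (tendstoInMeasure_of_tendsto_Lp h1).exists_seq_tendsto_ae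
  have h2 := ae_all_iff.2 fun n => coeFn_contL2 (K.convexDomain T)
    (smoothFn_contDiff (ψ n)).continuous
  filter_upwards [hns, h2, ae_restrict_mem isOpen_interior.measurableSet] with x hx h2x hxm
  refine tendsto_nhds_unique ((K.tendsto_rep hψ (interior_subset hxm)).comp hns'.tendsto_atTop)
    (hx.congr fun n => ?_)
  exact h2x (ns n)

theorem edgePt_mem (T : K.Tri) (i : Fin 3) {s : ℝ} (hs : s ∈ Icc (0 : ℝ) 1) :
    K.edgePt T i s ∈ K.tri T := by
  refine (mem_convexHull_iff (K.tdet_pos T) _).2 fun j => ?_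
  obtain ⟨h0, h1, h2⟩ := K.lam_edgePt T i s
  rcases fin3_cases i j with rfl | rfl | rfl
  · rw [h0]
  · rw [h1]; linarith [hs.2]
  · rw [h2]; exact hs.1

/-- The same subsequence argument on a side. It ties the `L²` trace to point values, so that
matching traces will force matching values at vertices. -/
theorem rep_trace_ae (T : K.Tri) (f : H2 (K.cell T)) (i : Fin 3) :
    (fun s => K.rep T f (K.edgePt T i s)) =ᵐ[I01] K.traceL T i (toH1 f) := by
  obtain ⟨ψ, hψ⟩ := K.exists_smooth_seq T f
  have h1 := (((K.traceL T i).comp toH1L).continuous.tendsto f).comp hψ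
  obtain ⟨ns, hns', hns⟩ := (tendstoInMeasure_of_tendsto_Lp h1).exists_seq_tendsto_ae
  have h2 := ae_all_iff.2 fun n => K.coeFn_sideRestrict T i (ψ n)
  filter_upwards [hns, h2, ae_restrict_mem measurableSet_Icc] with x hx h2x hxm
  refine tendsto_nhds_unique ((K.tendsto_rep hψ (K.edgePt_mem T i hxm)).comp hns'.tendsto_atTop)
    (hx.congr fun n => ?_)
  refine Eq.trans ?_ (h2x (ns n))
  rw [← traceL_smooth]
  rfl

/-- The trace of the tangential derivative is the derivative of the trace. -/
theorem integral_trace_wdH1 (T : K.Tri) (f : H2 (K.cell T)) (i : Fin 3) {q : ℝ → ℝ}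
    (hq : ContDiff ℝ ∞ q) :
    ∑ k, K.edgeVec T i k * ∫ s, q s * K.traceL T i (wdH1 f k) s ∂I01 =
      q 1 * K.rep T f (K.pos T (i + 2)) - q 0 * K.rep T f (K.pos T (i + 1)) -
        ∫ s, deriv q s * K.traceL T i (toH1 f) s ∂I01 := by
  have hq' : Continuous (deriv q) := hq.continuous_deriv (by simp)
  have hm1 := memLp_I01 hq.continuous
  have hm2 := memLp_I01 hq'
  have hv : ∀ j, K.pos T j ∈ K.tri T := fun j => subset_convexHull ℝ _ (mem_range_self j)
  simp only [K.rep_of_mem f (hv _), ← pairL_apply hm1, ← pairL_apply hm2]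
  -- All terms are continuous in the `H²` norm, the vertex values through `repL`. For smooth
  -- functions the identity is the product rule along the side, integrated.
  refine (denseRange_smoothH2 (K.convexDomain T)).induction_on (p := fun f =>
    ∑ k, K.edgeVec T i k * pairL hm1 (K.traceL T i (wdH1L k f)) =
      q 1 * K.repL T f ⟨_, hv (i + 2)⟩ - q 0 * K.repL T f ⟨_, hv (i + 1)⟩ -
        pairL hm2 (K.traceL T i (toH1L f))) f ?_ fun ψ => ?_
  · have hc : ∀ x, Continuous fun f => K.repL T f x := fun x =>
      (ContinuousEvalConst.continuous_eval_const x).comp (K.repL T).continuous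
    have := hc ⟨_, hv (i + 2)⟩
    have := hc ⟨_, hv (i + 1)⟩
    exact isClosed_eq (by fun_prop) (by fun_prop)
  · have hψ := smoothFn_contDiff ψ
    simp only [wdH1L_apply, toH1L_apply, toH1_smoothH2, wdH1_smoothH2, traceL_smooth, repL_smooth,
      pairL_apply]
    have e : ∀ {a : ℝ → ℝ} (χ : SmoothFn), ∫ s, a s * K.sideRestrict T i χ s ∂I01 =
        ∫ s, a s * χ.1 (K.edgePt T i s) ∂I01 := fun χ =>
      integral_congr_ae ((K.coeFn_sideRestrict T i χ).mono fun x hx => by simp only [hx])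
    simp only [e]
    have hc := fun k => (pd_continuous hψ k).comp (K.edgePt_continuous T i)
    have hc' := hψ.continuous.comp (K.edgePt_continuous T i)
    simp only [Function.comp_def] at hc hc'
    have hqc := hq.continuous
    have c0 := hc 0
    have c1 := hc 1
    have hder : ∀ s, HasDerivAt (fun s => q s * ψ.1 (K.edgePt T i s))
        (deriv q s * ψ.1 (K.edgePt T i s) + q s * (K.edgeVec T i 0 * pd 0 ψ.1 (K.edgePt T i s) +
          K.edgeVec T i 1 * pd 1 ψ.1 (K.edgePt T i s))) s := by
      intro s
      have h1 := hasDerivAt_sidePt (K.pos T) i hψ s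
      rw [fderiv_apply_eq] at h1
      exact (hq.differentiable (by simp) s).hasDerivAt.mul h1
    have k1 : Continuous fun s => deriv q s * ψ.1 (K.edgePt T i s) := hq'.mul hc'
    have k2 : Continuous fun s => q s * (K.edgeVec T i 0 * pd 0 ψ.1 (K.edgePt T i s) +
        K.edgeVec T i 1 * pd 1 ψ.1 (K.edgePt T i s)) :=
      hqc.mul ((continuous_const.mul c0).add (continuous_const.mul c1))
    have key := integral_I01_deriv hder (k1.add k2)
    have e1 : K.edgePt T i 1 = K.pos T (i + 2) := by simp [edgePt, edgeVec]
    have e0 : K.edgePt T i 0 = K.pos T (i + 1) := by simp [edgePt]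
    rw [e1, e0, integral_add (integrable_I01 k1) (integrable_I01 k2)] at key
    have e3 : ∫ s, q s * (K.edgeVec T i 0 * pd 0 ψ.1 (K.edgePt T i s) +
          K.edgeVec T i 1 * pd 1 ψ.1 (K.edgePt T i s)) ∂I01 =
        K.edgeVec T i 0 * (∫ s, q s * pd 0 ψ.1 (K.edgePt T i s) ∂I01) +
          K.edgeVec T i 1 * ∫ s, q s * pd 1 ψ.1 (K.edgePt T i s) ∂I01 := by
      rw [← integral_const_mul, ← integral_const_mul, ← integral_add
        (f := fun s => K.edgeVec T i 0 * (q s * pd 0 ψ.1 (K.edgePt T i s)))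
        (g := fun s => K.edgeVec T i 1 * (q s * pd 1 ψ.1 (K.edgePt T i s)))
        (integrable_I01 (continuous_const.mul (hqc.mul c0)))
        (integrable_I01 (continuous_const.mul (hqc.mul c1)))]
      refine integral_congr_ae (Filter.Eventually.of_forall fun s => ?_)
      ring
    rw [e3] at key
    rw [Fin.sum_univ_two]
    simp only [triRestrict, LinearMap.coe_mk, AddHom.coe_mk, ContinuousMap.coe_mk]
    linarith

end TriangulatedSurface

end

end ReggeFEM
namespace ReggeFEM
noncomputable section

/-! ### Polynomials in two variables -/

/-- The polynomials in two variables. -/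
abbrev MvP := MvPolynomial (Fin 2) ℝ

/-- The polynomials of total degree less than `n`. -/
def PolyLt : ℕ → Submodule ℝ MvP
  | 0 => ⊥
  | n + 1 => Poly n

theorem mem_Poly {n : ℕ} {p : MvP} : p ∈ Poly n ↔ p.totalDegree ≤ n :=
  MvPolynomial.mem_restrictTotalDegree _ _ _

theorem mem_PolyLt_of_lt {n : ℕ} {p : MvP} (h : p.totalDegree < n) : p ∈ PolyLt n := by
  cases n with
  | zero => omega
  | succ n => exact mem_Poly.2 (by omega)

theorem totalDegree_lt_of_mem_PolyLt {n : ℕ} {p : MvP} (h : p ∈ PolyLt n) :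
    p = 0 ∨ p.totalDegree < n := by
  cases n with
  | zero => exact Or.inl h
  | succ n => exact Or.inr (Nat.lt_succ_of_le (mem_Poly.1 h))

theorem Poly_mono {m n : ℕ} (h : m ≤ n) : Poly m ≤ Poly n :=
  fun _ hp => mem_Poly.2 ((mem_Poly.1 hp).trans h)

theorem PolyLt_mono {m n : ℕ} (h : m ≤ n) : PolyLt m ≤ PolyLt n := by
  intro p hp
  rcases totalDegree_lt_of_mem_PolyLt hp with rfl | hp
  · exact zero_mem _
  · exact mem_PolyLt_of_lt (by omega)

theorem mul_mem_Poly {m n : ℕ} {p q : MvP} (hp : p ∈ Poly m) (hq : q ∈ Poly n) :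
    p * q ∈ Poly (m + n) :=
  mem_Poly.2 ((MvPolynomial.totalDegree_mul _ _).trans
    (Nat.add_le_add (mem_Poly.1 hp) (mem_Poly.1 hq)))

theorem mul_mem_PolyLt {m n : ℕ} {p q : MvP} (hp : p ∈ Poly m) (hq : q ∈ PolyLt n) :
    p * q ∈ PolyLt (m + n) := by
  cases n with
  | zero => rw [(hq : q = 0), mul_zero]; exact zero_mem _
  | succ n => exact mul_mem_Poly hp hq

theorem C_mem_Poly (c : ℝ) : (MvPolynomial.C c : MvP) ∈ Poly 0 :=
  mem_Poly.2 (MvPolynomial.totalDegree_C c).le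

theorem X_mem_Poly (k : Fin 2) : (MvPolynomial.X k : MvP) ∈ Poly 1 :=
  mem_Poly.2 (MvPolynomial.totalDegree_X k).le

instance finiteDimensional_PolyLt (n : ℕ) : FiniteDimensional ℝ (PolyLt n) := by
  cases n with
  | zero => exact inferInstanceAs (FiniteDimensional ℝ (⊥ : Submodule ℝ MvP))
  | succ n => exact inferInstanceAs (FiniteDimensional ℝ (Poly n))

/-- Induction on the degree of polynomials in two variables. -/
theorem Poly_le_of_mul_X {S : ℕ → Submodule ℝ MvP} (hmono : Monotone S) (h1 : 1 ∈ S 0)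
    (hX : ∀ n k, ∀ p ∈ S n, MvPolynomial.X k * p ∈ S (n + 1)) (n : ℕ) : Poly n ≤ S n := by
  have hpow : ∀ a b : ℕ, (MvPolynomial.X 0 ^ a * MvPolynomial.X 1 ^ b : MvP) ∈ S (a + b) := by
    intro a
    induction a with
    | zero =>
      intro b
      induction b with
      | zero => simpa using h1
      | succ b ih =>
        have := hX _ 1 _ ih
        rw [show (MvPolynomial.X 0 ^ 0 * MvPolynomial.X 1 ^ (b + 1) : MvP) =
          MvPolynomial.X 1 * (MvPolynomial.X 0 ^ 0 * MvPolynomial.X 1 ^ b) by ring]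
        exact this
    | succ a ih =>
      intro b
      rw [show (MvPolynomial.X 0 ^ (a + 1) * MvPolynomial.X 1 ^ b : MvP) =
          MvPolynomial.X 0 * (MvPolynomial.X 0 ^ a * MvPolynomial.X 1 ^ b) by ring,
        show a + 1 + b = a + b + 1 by ring]
      exact hX _ 0 _ (ih b)
  intro p hp
  rw [MvPolynomial.as_sum p]
  refine Submodule.sum_mem _ fun s hs => ?_
  have hd : s 0 + s 1 ≤ n := by
    refine le_trans ?_ (mem_Poly.1 hp)
    have := MvPolynomial.le_totalDegree hs
    rwa [Finsupp.sum_fintype _ _ (by simp), Fin.sum_univ_two] at this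
  have e : (MvPolynomial.monomial s (p.coeff s) : MvP) =
      p.coeff s • (MvPolynomial.X 0 ^ s 0 * MvPolynomial.X 1 ^ s 1) := by
    rw [MvPolynomial.monomial_eq, Finsupp.prod_fintype _ _ (by simp), Fin.prod_univ_two,
      MvPolynomial.smul_eq_C_mul]
  rw [e]
  exact Submodule.smul_mem _ _ (hmono hd (hpow _ _))

/-- Induction through multiplication by the variables and Leibniz' rule. `PolyLt n` is used instead
of `Poly (n - 1)` because for `n = 0` the derivative is zero, whereas truncated subtraction would
allow constants. -/
theorem pderiv_mem_PolyLt {n : ℕ} {p : MvP} (hp : p ∈ Poly n) (k : Fin 2) :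
    MvPolynomial.pderiv k p ∈ PolyLt n := by
  let S : ℕ → Submodule ℝ MvP := fun n =>
    Poly n ⊓ (PolyLt n).comap (MvPolynomial.pderiv k : Derivation ℝ MvP MvP).toLinearMap
  refine (Poly_le_of_mul_X (S := S) ?_ ?_ ?_ n hp).2
  · exact fun a b h => inf_le_inf (Poly_mono h) (Submodule.comap_mono (PolyLt_mono h))
  · refine ⟨?_, ?_⟩
    · exact C_mem_Poly 1
    · change MvPolynomial.pderiv k (1 : MvP) ∈ PolyLt 0
      rw [MvPolynomial.pderiv_one]
      exact zero_mem _
  · intro n l p hp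
    refine ⟨by rw [add_comm]; exact mul_mem_Poly (X_mem_Poly l) hp.1, ?_⟩
    change MvPolynomial.pderiv k (MvPolynomial.X l * p) ∈ PolyLt (n + 1)
    rw [Derivation.leibniz, smul_eq_mul, smul_eq_mul, MvPolynomial.pderiv_X]
    refine add_mem ?_ ?_
    · rw [add_comm n]; exact mul_mem_PolyLt (X_mem_Poly l) hp.2
    · by_cases h : k = l
      · subst h
        rw [Pi.single_eq_same, mul_one]
        exact hp.1
      · rw [Pi.single_eq_of_ne (Ne.symm h)]
        simp

/-! ### Values of polynomials -/

@[simp] theorem pval_add (p q : MvP) (x : Plane) : pval (p + q) x = pval p x + pval q x :=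
  map_add _ _ _

@[simp] theorem pval_sub (p q : MvP) (x : Plane) : pval (p - q) x = pval p x - pval q x :=
  map_sub _ _ _

@[simp] theorem pval_mul (p q : MvP) (x : Plane) : pval (p * q) x = pval p x * pval q x :=
  map_mul _ _ _

@[simp] theorem pval_zero (x : Plane) : pval 0 x = 0 := map_zero _

@[simp] theorem pval_one (x : Plane) : pval 1 x = 1 := map_one _

@[simp] theorem pval_C (c : ℝ) (x : Plane) : pval (MvPolynomial.C c) x = c :=
  MvPolynomial.eval_C _

@[simp] theorem pval_X (k : Fin 2) (x : Plane) : pval (MvPolynomial.X k) x = x k :=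
  MvPolynomial.eval_X _

@[simp] theorem pval_smul (c : ℝ) (p : MvP) (x : Plane) : pval (c • p) x = c * pval p x :=
  MvPolynomial.smul_eval _ _ _

theorem pval_sum {ι : Type*} (s : Finset ι) (p : ι → MvP) (x : Plane) :
    pval (∑ i ∈ s, p i) x = ∑ i ∈ s, pval (p i) x := map_sum _ _ _

theorem pval_aeval (a : Polynomial ℝ) (l : MvP) (x : Plane) :
    pval (Polynomial.aeval l a) x = a.eval (pval l x) := by
  have h := Polynomial.aeval_algHom_apply (MvPolynomial.aeval (R := ℝ) fun i => x i) l a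
  rw [Polynomial.coe_aeval_eq_eval] at h
  exact h.symm

theorem pval_ext {p q : MvP} (h : ∀ x, pval p x = pval q x) : p = q :=
  MvPolynomial.funext fun x => h (WithLp.toLp 2 x)

theorem pval_contDiff (p : MvP) : ContDiff ℝ ∞ (pval p) := by
  induction p using MvPolynomial.induction_on with
  | C c =>
    have : pval (MvPolynomial.C c) = fun _ => c := funext fun x => pval_C c x
    rw [this]; exact contDiff_const
  | add p q hp hq =>
    have : pval (p + q) = fun x => pval p x + pval q x := funext fun x => pval_add p q x
    rw [this]; exact hp.add hq
  | mul_X p k hp =>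
    have : pval (p * MvPolynomial.X k) = fun x => pval p x * x k := funext fun x => by simp
    rw [this]; exact hp.mul (coord_contDiff k)

theorem pval_continuous (p : MvP) : Continuous (pval p) := (pval_contDiff p).continuous

theorem pval_ext_of_ae {Ω : Set Plane} (ho : IsOpen Ω) (hne : Ω.Nonempty) {p q : MvP}
    (h : pval p =ᵐ[volume.restrict Ω] pval q) : p = q := by
  have h1 : EqOn (pval p) (pval q) Ω :=
    Measure.eqOn_open_of_ae_eq h ho (pval_continuous p).continuousOn
      (pval_continuous q).continuousOn
  obtain ⟨x, hx⟩ := hne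
  have hcont : Continuous fun y : Fin 2 → ℝ => (WithLp.toLp 2 y : Plane) :=
    PiLp.continuous_toLp 2 _
  obtain ⟨ε, hε, hb⟩ := Metric.isOpen_iff.1 (ho.preimage hcont) (fun i => x i) hx
  have hinf : ∀ i, (Metric.ball (x i) ε).Infinite := fun i => by
    rw [Real.ball_eq_Ioo]
    exact Ioo_infinite (by linarith)
  refine MvPolynomial.funext_set (fun i => Metric.ball (x i) ε) hinf (fun y hy => ?_)
  have hy' : WithLp.toLp 2 y ∈ Ω := hb (by rwa [ball_pi _ hε])
  exact h1 hy'

theorem pd_pval (k : Fin 2) (p : MvP) : pd k (pval p) = pval (MvPolynomial.pderiv k p) := by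
  induction p using MvPolynomial.induction_on with
  | C c =>
    have : pval (MvPolynomial.C c) = fun _ => c := funext fun x => pval_C c x
    funext x
    rw [this]
    simp [pd]
  | add p q hp hq =>
    have : pval (p + q) = pval p + pval q := funext fun x => pval_add p q x
    rw [this, pd_add (pval_contDiff p) (pval_contDiff q), hp, hq]
    funext x; simp
  | mul_X p l hp =>
    have : pval (p * MvPolynomial.X l) = fun x => pval p x * x l := funext fun x => by simp
    funext x
    rw [this, pd_mul (pval_contDiff p) (coord_contDiff l), hp, pd_coord, Derivation.leibniz,
      smul_eq_mul, smul_eq_mul, MvPolynomial.pderiv_X]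
    simp only [pval_add, pval_mul, pval_X]
    by_cases h : k = l
    · subst h; simp; ring
    · simp [h]; ring

/-! ### Barycentric coordinates as polynomials -/

section bary

variable (P : Fin 3 → Plane)

/-- The barycentric coordinate as a polynomial. -/
def lamP (i : Fin 3) : MvP :=
  MvPolynomial.C (1 / tdet P) *
    (MvPolynomial.C ((P (i + 2) - P (i + 1)) 0) * (MvPolynomial.X 1 - MvPolynomial.C (P (i + 1) 1)) -
      MvPolynomial.C ((P (i + 2) - P (i + 1)) 1) * (MvPolynomial.X 0 - MvPolynomial.C (P (i + 1) 0)))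

@[simp] theorem pval_lamP (i : Fin 3) (x : Plane) : pval (lamP P i) x = lam P i x := by
  simp [lamP, lam, cross]
  ring

theorem lamP_mem_Poly (i : Fin 3) : lamP P i ∈ Poly 1 := by
  have hl : ∀ (a b : ℝ) (k : Fin 2),
      (MvPolynomial.C a * (MvPolynomial.X k - MvPolynomial.C b) : MvP) ∈ Poly 1 := fun a b k => by
    have := mul_mem_Poly (C_mem_Poly a) (sub_mem (X_mem_Poly k) (Poly_mono zero_le_one (C_mem_Poly b)))
    rwa [zero_add] at this
  have := mul_mem_Poly (C_mem_Poly (1 / tdet P)) (sub_mem (hl ((P (i + 2) - P (i + 1)) 0) (P (i + 1) 1) 1)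
    (hl ((P (i + 2) - P (i + 1)) 1) (P (i + 1) 0) 0))
  rwa [zero_add] at this

variable {P}

/-- An affine function is determined by its values at the vertices. In this form multiplication by a
coordinate preserves the normal form of `exists_decomp`. -/
theorem X_eq_lamP (hD : 0 < tdet P) (i : Fin 3) (k : Fin 2) :
    (MvPolynomial.X k : MvP) = MvPolynomial.C (P (i + 1) k) +
      MvPolynomial.C (P i k - P (i + 1) k) * lamP P i +
      MvPolynomial.C (P (i + 2) k - P (i + 1) k) * lamP P (i + 2) := by
  refine pval_ext fun x => ?_
  have h1 := lam_sum' hD i x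
  have h2 := congrArg (fun y : Plane => y k) (lam_recon hD x)
  simp only [Fin.sum_univ_three, PiLp.add_apply, PiLp.smul_apply, smul_eq_mul] at h2
  have h3 : lam P i x * P i k + lam P (i + 1) x * P (i + 1) k + lam P (i + 2) x * P (i + 2) k =
      x k := by
    rw [← h2]
    fin_cases i
    · rfl
    · change lam P 1 x * P 1 k + lam P 2 x * P 2 k + lam P 0 x * P 0 k = _; ring
    · change lam P 2 x * P 2 k + lam P 0 x * P 0 k + lam P 1 x * P 1 k = _; ring
  simp only [pval_X, pval_add, pval_C, pval_mul, pval_lamP]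
  rw [← h3]
  have h4 : lam P (i + 1) x = 1 - lam P i x - lam P (i + 2) x := by linarith
  rw [h4]; ring

theorem aeval_mem_Poly {l : MvP} (hl : l ∈ Poly 1) {a : Polynomial ℝ} {n : ℕ}
    (ha : a.natDegree ≤ n) : Polynomial.aeval l a ∈ Poly n := by
  have hpow : ∀ m, l ^ m ∈ Poly m := fun m => by
    induction m with
    | zero => rw [pow_zero]; exact C_mem_Poly 1
    | succ m ih => rw [pow_succ]; exact mul_mem_Poly ih hl
  rw [Polynomial.aeval_eq_sum_range]
  refine Submodule.sum_mem _ fun m hm => Submodule.smul_mem _ _ (Poly_mono ?_ (hpow m))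
  have := Finset.mem_range.1 hm
  omega

variable (P) in
/-- The restriction of a polynomial to a side. -/
def edgeP (i : Fin 3) : MvP →ₐ[ℝ] Polynomial ℝ :=
  MvPolynomial.aeval fun k => Polynomial.C (P (i + 1) k) +
    Polynomial.X * Polynomial.C ((P (i + 2) - P (i + 1)) k)

theorem eval_edgeP (i : Fin 3) (p : MvP) (s : ℝ) :
    (edgeP P i p).eval s = pval p (sidePt P i s) := by
  induction p using MvPolynomial.induction_on with
  | C c => simp [edgeP]
  | add p q hp hq => simp [hp, hq]
  | mul_X p k hp =>
    rw [map_mul, Polynomial.eval_mul, hp, pval_mul]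
    simp [edgeP, sidePt]

theorem natDegree_edgeP {n : ℕ} {p : MvP} (hp : p ∈ Poly n) (i : Fin 3) :
    (edgeP P i p).natDegree ≤ n := by
  let S : ℕ → Submodule ℝ MvP := fun n => (Polynomial.degreeLE ℝ n).comap (edgeP P i).toLinearMap
  have hS : ∀ {m : ℕ} {p : MvP}, p ∈ S m ↔ (edgeP P i p).natDegree ≤ m := fun {m p} => by
    simp only [S, Submodule.mem_comap, Polynomial.mem_degreeLE, Polynomial.natDegree_le_iff_degree_le]
    rfl
  refine hS.1 (Poly_le_of_mul_X (S := S) ?_ ?_ ?_ n hp)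
  · exact fun a b h p hp => hS.2 ((hS.1 hp).trans h)
  · exact hS.2 (by simp)
  · intro m k p hp
    refine hS.2 ?_
    rw [map_mul, add_comm m]
    refine Polynomial.natDegree_mul_le_of_le ?_ (hS.1 hp)
    simp only [edgeP, MvPolynomial.aeval_X]
    compute_degree

/-- Division of a polynomial by the barycentric coordinate that vanishes on a side. -/
theorem exists_decomp (hD : 0 < tdet P) (i : Fin 3) {n : ℕ} {p : MvP} (hp : p ∈ Poly n) :
    ∃ q ∈ PolyLt n, p = Polynomial.aeval (lamP P (i + 2)) (edgeP P i p) + lamP P i * q := by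
  -- The polynomials `a(λ_{i+2}) + λ_i q` with the right degrees are stable under multiplication by
  -- the coordinates, which are affine in `λ_i` and `λ_{i+2}`; hence they are all polynomials.
  -- Afterwards `a` is identified by restriction to the side `i`, where `λ_i = 0` and `λ_{i+2} = s`.
  let S : ℕ → Submodule ℝ MvP := fun n =>
    { carrier := {p | ∃ a : Polynomial ℝ, a.natDegree ≤ n ∧ ∃ q ∈ PolyLt n,
        p = Polynomial.aeval (lamP P (i + 2)) a + lamP P i * q}
      zero_mem' := ⟨0, by simp, 0, zero_mem _, by simp⟩
      add_mem' := by
        rintro _ _ ⟨a, ha, q, hq, rfl⟩ ⟨b, hb, s, hs, rfl⟩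
        refine ⟨a + b, Polynomial.natDegree_add_le_of_degree_le ha hb, q + s, add_mem hq hs, ?_⟩
        rw [map_add]; ring
      smul_mem' := by
        rintro c _ ⟨a, ha, q, hq, rfl⟩
        refine ⟨c • a, (Polynomial.natDegree_smul_le _ _).trans ha, c • q,
          Submodule.smul_mem _ _ hq, ?_⟩
        rw [map_smul, smul_add, mul_smul_comm] }
  have hS : p ∈ S n := by
    refine Poly_le_of_mul_X (S := S) ?_ ?_ ?_ n hp
    · rintro a b h _ ⟨c, hc, q, hq, rfl⟩
      exact ⟨c, hc.trans h, q, PolyLt_mono h hq, rfl⟩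
    · exact ⟨1, by simp, 0, zero_mem _, by simp⟩
    · rintro n k _ ⟨a, ha, q, hq, rfl⟩
      refine ⟨(Polynomial.C (P (i + 1) k) +
        Polynomial.C (P (i + 2) k - P (i + 1) k) * Polynomial.X) * a, ?_,
        MvPolynomial.C (P i k - P (i + 1) k) * Polynomial.aeval (lamP P (i + 2)) a +
          MvPolynomial.X k * q, ?_, ?_⟩
      · rw [add_comm n]
        refine Polynomial.natDegree_mul_le_of_le ?_ ha
        compute_degree
      · refine add_mem ?_ ?_
        · change _ ∈ Poly n
          have := mul_mem_Poly (C_mem_Poly (P i k - P (i + 1) k))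
            (aeval_mem_Poly (lamP_mem_Poly P (i + 2)) ha)
          rwa [zero_add] at this
        · rw [add_comm n]; exact mul_mem_PolyLt (X_mem_Poly k) hq
      · rw [map_mul, map_add, map_mul, Polynomial.aeval_X, Polynomial.aeval_C, Polynomial.aeval_C]
        simp only [MvPolynomial.algebraMap_eq]
        linear_combination (Polynomial.aeval (lamP P (i + 2)) a) * X_eq_lamP hD i k
  obtain ⟨a, ha, q, hq, rfl⟩ := hS
  refine ⟨q, hq, ?_⟩
  congr 2
  refine Polynomial.funext fun s => ?_
  rw [eval_edgeP, pval_add, pval_mul, pval_aeval, pval_lamP, pval_lamP]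
  obtain ⟨h0, _, h2⟩ := lam_sidePt hD i s
  rw [h0, h2]; ring

end bary

end
end ReggeFEM
namespace ReggeFEM
noncomputable section

/-! ### Unique representation of functionals -/

theorem existsUnique_of_nondegenerate {E : Type*} [AddCommGroup E] [Module ℝ E]
    [FiniteDimensional ℝ E] (B : E →ₗ[ℝ] E →ₗ[ℝ] ℝ) (hB : ∀ x, B x x = 0 → x = 0)
    (l : E →ₗ[ℝ] ℝ) : ∃! x, ∀ y, B x y = l y := by
  have hinj : Function.Injective B := by
    rw [← LinearMap.ker_eq_bot, LinearMap.ker_eq_bot']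
    exact fun x hx => hB x (by rw [hx]; rfl)
  have hsurj : Function.Surjective B :=
    (LinearMap.injective_iff_surjective_of_finrank_eq_finrank (V₂ := E →ₗ[ℝ] ℝ)
      (Subspace.dual_finrank_eq (K := ℝ) (V := E)).symm).1 hinj
  obtain ⟨x, hx⟩ := hsurj l
  exact ⟨x, fun y => by rw [hx], fun z hz => hinj (by rw [hx]; exact LinearMap.ext hz)⟩

/-- The weight serves the bubble functions `λ_i`, `s (1 - s)` and `λ_0 λ_1 λ_2`: they vanish on
parts of the boundary but are positive inside, which suffices for `∫ w J(p) J(q)` to be positive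
definite. -/
theorem existsUnique_weighted {X E : Type*} [MeasurableSpace X] {μ : Measure X} [AddCommGroup E]
    [Module ℝ E] [FiniteDimensional ℝ E] (J : E →ₗ[ℝ] (X → ℝ)) {w : X → ℝ}
    (hJ : ∀ p, MemLp (J p) 2 μ) (hw : ∀ p, MemLp (fun x => w x * J p x) 2 μ)
    (hpos : ∀ᵐ x ∂μ, 0 < w x) (hinj : ∀ p, J p =ᵐ[μ] 0 → p = 0) {h : X → ℝ} (hh : MemLp h 2 μ) :
    ∃! p, ∀ q, ∫ x, w x * J p x * J q x ∂μ = ∫ x, h x * J q x ∂μ := by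
  have hint : ∀ {f : X → ℝ}, MemLp f 2 μ → ∀ q, Integrable (fun x => f x * J q x) μ :=
    fun hf q => hf.integrable_mul (hJ q)
  let l : E →ₗ[ℝ] ℝ :=
    { toFun := fun q => ∫ x, h x * J q x ∂μ
      map_add' := fun q q' => by
        rw [← integral_add (hint hh q) (hint hh q')]
        simp [mul_add]
      map_smul' := fun c q => by
        rw [RingHom.id_apply, smul_eq_mul, ← integral_const_mul]
        simp [mul_left_comm] }
  let B : E →ₗ[ℝ] E →ₗ[ℝ] ℝ := LinearMap.mk₂ ℝ (fun p q => ∫ x, w x * J p x * J q x ∂μ)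
    (fun p p' q => by
      rw [← integral_add (hint (hw p) q) (hint (hw p') q)]
      simp [mul_add, add_mul])
    (fun c p q => by
      rw [smul_eq_mul, ← integral_const_mul]
      congr 1; funext x; simp; ring)
    (fun p q q' => by
      rw [← integral_add (hint (hw p) q) (hint (hw p) q')]
      simp [mul_add])
    (fun c p q => by
      rw [smul_eq_mul, ← integral_const_mul]
      congr 1; funext x; simp; ring)
  refine existsUnique_of_nondegenerate B (fun p hp => hinj p ?_) l
  have h1 : ∫ x, w x * J p x * J p x ∂μ = 0 := hp
  have h2 : 0 ≤ᵐ[μ] fun x => w x * J p x * J p x := by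
    filter_upwards [hpos] with x hx
    simp only [Pi.zero_apply]
    rw [mul_assoc]
    exact mul_nonneg hx.le (mul_self_nonneg _)
  have h3 := (integral_eq_zero_iff_of_nonneg_ae h2 (hint (hw p) p)).1 h1
  filter_upwards [h3, hpos] with x e1 e2
  simp only [Pi.zero_apply] at e1 ⊢
  rw [mul_assoc] at e1
  exact mul_self_eq_zero.1 ((mul_eq_zero.1 e1).resolve_left e2.ne')

theorem Polynomial.eq_zero_of_ae_I01 {a : Polynomial ℝ} (h : ∀ᵐ s ∂I01, a.eval s = 0) : a = 0 := by
  by_contra ha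
  have hfin : {s | a.IsRoot s}.Finite := Polynomial.finite_setOfPred_isRoot ha
  have h1 : ∀ᵐ s ∂I01, s ∉ {s | a.IsRoot s} :=
    ae_restrict_of_ae (measure_eq_zero_iff_ae_notMem.1 (hfin.measure_zero volume))
  have h2 : ∀ᵐ s ∂I01, False := by
    filter_upwards [h, h1] with s e1 e2 using e2 e1
  have h3 : (I01 : Measure ℝ) {s | ¬False} = 0 := ae_iff.1 h2
  simp at h3

/-- Polynomials of degree less than `n` in one variable. -/
abbrev PolyLt₁ (n : ℕ) : Submodule ℝ (Polynomial ℝ) := Polynomial.degreeLT ℝ n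

theorem mem_PolyLt₁_of_lt {n : ℕ} {a : Polynomial ℝ} (h : a.natDegree < n) : a ∈ PolyLt₁ n := by
  rw [Polynomial.mem_degreeLT]
  exact (Polynomial.degree_le_natDegree).trans_lt (by exact_mod_cast h)

theorem natDegree_lt_of_mem_PolyLt₁ {n : ℕ} {a : Polynomial ℝ} (h : a ∈ PolyLt₁ n) :
    a = 0 ∨ a.natDegree < n := by
  by_cases ha : a = 0
  · exact Or.inl ha
  · rw [Polynomial.mem_degreeLT] at h
    exact Or.inr ((Polynomial.natDegree_lt_iff_degree_lt ha).2 h)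

instance finiteDimensional_PolyLt₁ (n : ℕ) : FiniteDimensional ℝ (PolyLt₁ n) :=
  Module.Finite.equiv (Polynomial.degreeLTEquiv ℝ n).symm

theorem existsUnique_poly₁ {w : ℝ → ℝ} (hw : Continuous w) (hpos : ∀ s ∈ Ioo (0 : ℝ) 1, 0 < w s)
    (n : ℕ) {h : ℝ → ℝ} (hh : MemLp h 2 I01) : ∃! a : PolyLt₁ n, ∀ b : PolyLt₁ n,
      ∫ s, w s * a.1.eval s * b.1.eval s ∂I01 = ∫ s, h s * b.1.eval s ∂I01 := by
  let J : PolyLt₁ n →ₗ[ℝ] (ℝ → ℝ) :=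
    { toFun := fun a s => a.1.eval s
      map_add' := fun a b => by funext s; simp
      map_smul' := fun c a => by funext s; simp }
  refine existsUnique_weighted J (fun a => memLp_I01 a.1.continuous)
    (fun a => memLp_I01 (hw.mul a.1.continuous)) ?_ (fun a ha => ?_) hh
  · rw [I01, ← restrict_Ioo_eq_restrict_Icc]
    exact (ae_restrict_iff' measurableSet_Ioo).2 (Filter.Eventually.of_forall hpos)
  · exact Subtype.ext (Polynomial.eq_zero_of_ae_I01 ha)

namespace TriangulatedSurface

variable (K : TriangulatedSurface)

theorem memLp_cell (T : K.Tri) {ψ : Plane → ℝ} (hψ : Continuous ψ) :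
    MemLp ψ 2 (volume.restrict (K.cell T)) := (K.convexDomain T).memLp hψ

theorem existsUnique_poly (T : K.Tri) {w : Plane → ℝ} (hw : Continuous w)
    (hpos : ∀ x ∈ K.cell T, 0 < w x) (n : ℕ) {h : Plane → ℝ}
    (hh : MemLp h 2 (volume.restrict (K.cell T))) : ∃! p : PolyLt n, ∀ q : PolyLt n,
      ∫ x in K.cell T, w x * pval p x * pval q x = ∫ x in K.cell T, h x * pval q x := by
  let J : PolyLt n →ₗ[ℝ] (Plane → ℝ) :=
    { toFun := fun a => pval a
      map_add' := fun a b => by funext s; simp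
      map_smul' := fun c a => by funext s; simp }
  refine existsUnique_weighted J (fun a => K.memLp_cell T (pval_continuous a.1))
    (fun a => K.memLp_cell T (hw.mul (pval_continuous a.1))) ?_ (fun a ha => ?_) hh
  · exact (ae_restrict_iff' isOpen_interior.measurableSet).2 (Filter.Eventually.of_forall hpos)
  · refine Subtype.ext (pval_ext_of_ae (K.convexDomain T).isOpen (K.convexDomain T).nonempty
      (p := a.1) (q := 0) ?_)
    filter_upwards [ha] with x hx
    rw [pval_zero]; exact hx

/-! ### Polynomials as elements of Sobolev spaces -/

/-- Polynomials as smooth functions. -/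
def polySmooth : MvP →ₗ[ℝ] SmoothFn where
  toFun p := ⟨pval p, pval_contDiff p⟩
  map_add' p q := Subtype.ext (funext fun x => pval_add p q x)
  map_smul' c p := Subtype.ext (funext fun x => pval_smul c p x)

/-- Polynomials as elements of `H²(T)`. -/
def polyH2 (T : K.Tri) : MvP →ₗ[ℝ] H2 (K.cell T) := (smoothH2 (K.convexDomain T)).comp polySmooth

/-- Polynomials as elements of `H¹(T)`. -/
def polyH1 (T : K.Tri) : MvP →ₗ[ℝ] H1 (K.cell T) := toH1L.toLinearMap.comp (K.polyH2 T)

theorem toH1_polyH2 (T : K.Tri) (p : MvP) : toH1 (K.polyH2 T p) = K.polyH1 T p := rfl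

theorem fn_polyH1 (T : K.Tri) (p : MvP) :
    fn (K.polyH1 T p) =ᵐ[volume.restrict (K.cell T)] pval p :=
  coeFn_contL2 (K.convexDomain T) (pval_continuous p)

theorem wdH1_polyH2 (T : K.Tri) (p : MvP) (k : Fin 2) :
    wdH1 (K.polyH2 T p) k = K.polyH1 T (MvPolynomial.pderiv k p) := by
  refine H1.ext_fn (K.convexDomain T).isOpen (Lp.ext ?_)
  refine (coeFn_contL2 (K.convexDomain T) (pd_continuous (pval_contDiff p) k)).trans ?_
  rw [pd_pval]
  exact (K.fn_polyH1 T _).symm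

theorem wd_polyH1 (T : K.Tri) (p : MvP) (k : Fin 2) :
    wd (K.polyH1 T p) k =ᵐ[volume.restrict (K.cell T)] pval (MvPolynomial.pderiv k p) := by
  refine (coeFn_contL2 (K.convexDomain T) (pd_continuous (pval_contDiff p) k)).trans ?_
  rw [pd_pval]

theorem traceL_polyH1 (T : K.Tri) (p : MvP) (i : Fin 3) :
    K.traceL T i (K.polyH1 T p) =ᵐ[I01] fun s => (edgeP (K.pos T) i p).eval s := by
  have h : K.traceL T i (K.polyH1 T p) = K.sideRestrict T i ⟨pval p, pval_contDiff p⟩ :=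
    K.traceL_smooth T i _
  rw [h]
  refine (K.coeFn_sideRestrict T i _).trans (Filter.Eventually.of_forall fun s => ?_)
  exact (eval_edgeP i p s).symm

theorem rep_polyH2 (T : K.Tri) (p : MvP) {x : Plane} (hx : x ∈ K.tri T) :
    K.rep T (K.polyH2 T p) x = pval p x := by
  have h : K.repL T (K.polyH2 T p) = K.triRestrict T ⟨pval p, pval_contDiff p⟩ :=
    K.repL_smooth T _
  rw [K.rep_of_mem _ hx, h]
  rfl

theorem fn_polyH1_mem (T : K.Tri) {n : ℕ} {p : MvP} (hp : p ∈ Poly n) :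
    fn (K.polyH1 T p) ∈ PolyL2 n (K.cell T) := ⟨p, hp, K.fn_polyH1 T p⟩

theorem eq_polyH1_of_ae (T : K.Tri) {f : H1 (K.cell T)} {p : MvP}
    (h : fn f =ᵐ[volume.restrict (K.cell T)] pval p) : f = K.polyH1 T p :=
  H1.ext_fn (K.convexDomain T).isOpen (Lp.ext (h.trans (K.fn_polyH1 T p).symm))

theorem exists_polyH1 (T : K.Tri) {n : ℕ} {f : H1 (K.cell T)} (h : fn f ∈ PolyL2 n (K.cell T)) :
    ∃ p ∈ Poly n, f = K.polyH1 T p := by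
  obtain ⟨p, hp, h⟩ := h
  exact ⟨p, hp, K.eq_polyH1_of_ae T h⟩

theorem exists_polyH2 (T : K.Tri) {n : ℕ} {f : H2 (K.cell T)}
    (h : fn (toH1 f) ∈ PolyL2 n (K.cell T)) : ∃ p ∈ Poly n, f = K.polyH2 T p := by
  obtain ⟨p, hp, h⟩ := h
  exact ⟨p, hp, H2.ext_fn (K.convexDomain T).isOpen (Lp.ext (h.trans (K.fn_polyH1 T p).symm))⟩

instance finiteDimensional_PolyL2 (T : K.Tri) (n : ℕ) :
    FiniteDimensional ℝ (PolyL2 n (K.cell T)) := by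
  have h : PolyL2 n (K.cell T) = (Poly n).map (fnL.toLinearMap.comp (K.polyH1 T)) := by
    ext f
    constructor
    · rintro ⟨p, hp, h⟩
      exact ⟨p, hp, Lp.ext ((K.fn_polyH1 T p).trans h.symm)⟩
    · rintro ⟨p, hp, rfl⟩
      exact K.fn_polyH1_mem T hp
  rw [h]
  have : FiniteDimensional ℝ (Poly n) := inferInstance
  infer_instance

instance finiteDimensional_Vh (n : ℕ) : FiniteDimensional ℝ (K.Vh n) := by
  let F : K.Vh n →ₗ[ℝ] ∀ T, PolyL2 n (K.cell T) :=
    { toFun := fun v T => ⟨fn (toH1 (v.1.1 T)), v.2 T⟩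
      map_add' := fun _ _ => rfl
      map_smul' := fun _ _ => rfl }
  refine Module.Finite.of_injective F fun u v h => Subtype.ext (Subtype.ext (funext fun T => ?_))
  exact H2.ext_fn (K.convexDomain T).isOpen (congrArg Subtype.val (congrFun h T))

instance finiteDimensional_Wh (n : ℕ) : FiniteDimensional ℝ (K.Wh n) := by
  have hm : ∀ (α : K.Wh n) T k, fn (α.1.1 T k) ∈ PolyL2 n (K.cell T) := fun α T k => by
    obtain ⟨p, hp, -, h⟩ := α.2 T
    exact ⟨p k, hp k, h k⟩
  let F : K.Wh n →ₗ[ℝ] ∀ T, Fin 2 → PolyL2 n (K.cell T) :=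
    { toFun := fun v T k => ⟨fn (v.1.1 T k), hm v T k⟩
      map_add' := fun _ _ => rfl
      map_smul' := fun _ _ => rfl }
  refine Module.Finite.of_injective F fun u v h =>
    Subtype.ext (Subtype.ext (funext fun T => funext fun k => ?_))
  exact H1.ext_fn (K.convexDomain T).isOpen (congrArg Subtype.val (congrFun (congrFun h T) k))

end TriangulatedSurface

end
end ReggeFEM
namespace ReggeFEM
noncomputable section
namespace TriangulatedSurface

variable (K : TriangulatedSurface)

/-! ### Membership in the spaces in terms of the trace operator -/

/-- By uniqueness of traces, the traces that are chosen in the definition may be replaced by those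
of the trace operator; the same is done below for `W` and `Σ`. -/
theorem mem_V_iff {v : ∀ T : K.Tri, H2 (K.cell T)} : v ∈ K.V ↔
    (∀ T i T' j, K.Glued T i T' j → ∀ᵐ s ∂I01,
      K.traceL T i (toH1 (v T)) s = K.traceL T' j (toH1 (v T')) (1 - s)) ∧
    (∀ T i, K.IsBoundarySide T i → ∀ᵐ s ∂I01, K.traceL T i (toH1 (v T)) s = 0) := by
  constructor
  · rintro ⟨h1, h2⟩
    refine ⟨fun T i T' j h => ?_, fun T i h => ?_⟩
    · obtain ⟨t, t', ht, ht', e⟩ := h1 T i T' j h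
      filter_upwards [e, ht.ae_eq_traceL K i, ae_reflect (ht'.ae_eq_traceL K j)] with s a b c
      rw [← b, a, c]
    · obtain ⟨t, ht, e⟩ := h2 T i h
      filter_upwards [e, ht.ae_eq_traceL K i] with s a b
      rw [← b, a]
  · rintro ⟨h1, h2⟩
    exact ⟨fun T i T' j h => ⟨_, _, K.isTrace_traceL T _, K.isTrace_traceL T' _, h1 T i T' j h⟩,
      fun T i h => ⟨_, K.isTrace_traceL T _, h2 T i h⟩⟩

/-- The tangential component of a one-form along a side of a triangle. -/
def tanL (T : K.Tri) (i : Fin 3) (α : Fin 2 → H1 (K.cell T)) (s : ℝ) : ℝ :=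
  ∑ k, K.traceL T i (α k) s * K.edgeVec T i k

/-- The tangential component of a `(0,2)`-tensor along a side of a triangle. -/
def tanL₂ (T : K.Tri) (i : Fin 3) (σ : Fin 2 → Fin 2 → H1 (K.cell T)) (s : ℝ) : ℝ :=
  ∑ k, ∑ l, K.traceL T i (σ k l) s * K.edgeVec T i k * K.edgeVec T i l

theorem tangential_ae {T : K.Tri} {i : Fin 3} {α : Fin 2 → H1 (K.cell T)}
    {a : Fin 2 → Fin 3 → ℝ → ℝ} (h : ∀ k, K.IsTrace T (α k) (a k)) :
    K.tangential T i a =ᵐ[I01] K.tanL T i α := by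
  filter_upwards [(h 0).ae_eq_traceL K i, (h 1).ae_eq_traceL K i] with s e0 e1
  simp only [tangential, tanL, Fin.sum_univ_two, e0, e1]

theorem tangential₂_ae {T : K.Tri} {i : Fin 3} {σ : Fin 2 → Fin 2 → H1 (K.cell T)}
    {a : Fin 2 → Fin 2 → Fin 3 → ℝ → ℝ} (h : ∀ k l, K.IsTrace T (σ k l) (a k l)) :
    K.tangential₂ T i a =ᵐ[I01] K.tanL₂ T i σ := by
  filter_upwards [(h 0 0).ae_eq_traceL K i, (h 0 1).ae_eq_traceL K i, (h 1 0).ae_eq_traceL K i,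
    (h 1 1).ae_eq_traceL K i] with s e0 e1 e2 e3
  simp only [tangential₂, tanL₂, Fin.sum_univ_two, e0, e1, e2, e3]

theorem mem_W_iff {α : ∀ T : K.Tri, Fin 2 → H1 (K.cell T)} : α ∈ K.W ↔
    (∀ T i T' j, K.Glued T i T' j → ∀ᵐ s ∂I01,
      K.tanL T i (α T) s = -K.tanL T' j (α T') (1 - s)) ∧
    (∀ T i, K.IsBoundarySide T i → ∀ᵐ s ∂I01, K.tanL T i (α T) s = 0) := by
  constructor
  · rintro ⟨h1, h2⟩
    refine ⟨fun T i T' j h => ?_, fun T i h => ?_⟩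
    · obtain ⟨t, t', ht, ht', e⟩ := h1 T i T' j h
      filter_upwards [e, K.tangential_ae ht, ae_reflect (K.tangential_ae ht')] with s a b c
      rw [← b, a, c]
    · obtain ⟨t, ht, e⟩ := h2 T i h
      filter_upwards [e, K.tangential_ae ht] with s a b
      rw [← b, a]
  · rintro ⟨h1, h2⟩
    exact ⟨fun T i T' j h => ⟨_, _, fun _ => K.isTrace_traceL T _, fun _ => K.isTrace_traceL T' _,
      h1 T i T' j h⟩, fun T i h => ⟨_, fun _ => K.isTrace_traceL T _, h2 T i h⟩⟩

theorem mem_Sigma_iff {σ : ∀ T : K.Tri, Fin 2 → Fin 2 → H1 (K.cell T)} : σ ∈ K.Sigma ↔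
    (∀ T k l, σ T k l = σ T l k) ∧ (∀ T i T' j, K.Glued T i T' j → ∀ᵐ s ∂I01,
      K.tanL₂ T i (σ T) s = K.tanL₂ T' j (σ T') (1 - s)) := by
  constructor
  · rintro ⟨h0, h1⟩
    refine ⟨h0, fun T i T' j h => ?_⟩
    obtain ⟨t, t', ht, ht', e⟩ := h1 T i T' j h
    filter_upwards [e, K.tangential₂_ae ht, ae_reflect (K.tangential₂_ae ht')] with s a b c
    rw [← b, a, c]
  · rintro ⟨h0, h1⟩
    exact ⟨h0, fun T i T' j h => ⟨_, _, fun _ _ => K.isTrace_traceL T _,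
      fun _ _ => K.isTrace_traceL T' _, h1 T i T' j h⟩⟩

/-! ### Tangential derivatives -/

theorem memLp_tanL (T : K.Tri) (i : Fin 3) (α : Fin 2 → H1 (K.cell T)) :
    MemLp (K.tanL T i α) 2 I01 :=
  memLp_finsetSum _ fun k _ => by
    simpa only [mul_comm] using (Lp.memLp (K.traceL T i (α k))).const_mul (K.edgeVec T i k)

theorem integral_mul_tanL_wdH1 (T : K.Tri) (i : Fin 3) (f : H2 (K.cell T)) {q : ℝ → ℝ}
    (hq : ContDiff ℝ ∞ q) :
    ∫ s, q s * K.tanL T i (wdH1 f) s ∂I01 =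
      q 1 * K.rep T f (K.pos T (i + 2)) - q 0 * K.rep T f (K.pos T (i + 1)) -
        ∫ s, deriv q s * K.traceL T i (toH1 f) s ∂I01 := by
  rw [← K.integral_trace_wdH1 T f i hq]
  have hi : ∀ k, Integrable (fun s => q s * K.traceL T i (wdH1 f k) s) I01 := fun k =>
    (memLp_I01 hq.continuous).integrable_mul (Lp.memLp _)
  simp only [tanL, Finset.mul_sum]
  rw [integral_finsetSum _ fun k _ => by
    simpa only [mul_assoc] using (hi k).mul_const (K.edgeVec T i k)]
  refine Finset.sum_congr rfl fun k _ => ?_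
  rw [← integral_const_mul]
  congr 1; funext s; ring

theorem integral_test_mul_tanL (T : K.Tri) (i : Fin 3) (f : H2 (K.cell T)) {η : ℝ → ℝ}
    (hη : ContDiff ℝ ∞ η) (hs : tsupport η ⊆ Ioo 0 1) :
    ∫ s, η s * K.tanL T i (wdH1 f) s ∂I01 = -∫ s, deriv η s * K.traceL T i (toH1 f) s ∂I01 := by
  have e0 : η 0 = 0 := image_eq_zero_of_notMem_tsupport fun h => by simpa using hs h
  have e1 : η 1 = 0 := image_eq_zero_of_notMem_tsupport fun h => by simpa using hs h
  rw [K.integral_mul_tanL_wdH1 T i f hη, e0, e1]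
  ring

theorem tanL_wdH1_zero {T : K.Tri} {i : Fin 3} {f : H2 (K.cell T)}
    (h : ∀ᵐ s ∂I01, K.traceL T i (toH1 f) s = 0) : ∀ᵐ s ∂I01, K.tanL T i (wdH1 f) s = 0 := by
  refine ae_zero_of_integral_test ((K.memLp_tanL T i _).integrable (by norm_num)) fun η h1 h2 => ?_
  simp only [mul_comm _ (η _)]
  rw [K.integral_test_mul_tanL T i f h1 h2, neg_eq_zero]
  refine integral_eq_zero_of_ae ?_
  filter_upwards [h] with s hs
  rw [hs]; simp

/-- The trace of the tangential derivative is the distributional derivative of the trace, so testing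
with functions supported in the open side suffices. The sign arises from the opposite
parametrizations. Together with the boundary case above this is `dV ⊆ W`. -/
theorem tanL_wdH1_glued {T T' : K.Tri} {i j : Fin 3} {f : H2 (K.cell T)} {f' : H2 (K.cell T')}
    (h : ∀ᵐ s ∂I01, K.traceL T i (toH1 f) s = K.traceL T' j (toH1 f') (1 - s)) :
    ∀ᵐ s ∂I01, K.tanL T i (wdH1 f) s = -K.tanL T' j (wdH1 f') (1 - s) := by
  have hm : MemLp (fun s => K.tanL T' j (wdH1 f') (1 - s)) 2 I01 :=
    (K.memLp_tanL T' j (wdH1 f')).comp_measurePreserving measurePreserving_reflect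
  have key : ∀ᵐ s ∂I01, K.tanL T i (wdH1 f) s + K.tanL T' j (wdH1 f') (1 - s) = 0 := by
    refine ae_zero_of_integral_test
      (((K.memLp_tanL T i _).add hm).integrable (by norm_num)) fun η h1 h2 => ?_
    have hη : MemLp η 2 I01 := memLp_I01 h1.continuous
    have i1 : Integrable (fun s => η s * K.tanL T i (wdH1 f) s) I01 :=
      hη.integrable_mul (K.memLp_tanL T i _)
    have i2 : Integrable (fun s => η s * K.tanL T' j (wdH1 f') (1 - s)) I01 := hη.integrable_mul hm
    have h1' : ContDiff ℝ ∞ fun s => η (1 - s) := h1.comp (contDiff_const.sub contDiff_id)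
    have h2' : tsupport (fun s => η (1 - s)) ⊆ Ioo 0 1 := by
      have hc : Continuous fun s : ℝ => 1 - s := by fun_prop
      intro s hs
      have := h2 (tsupport_comp_subset_preimage η hc hs)
      exact ⟨by linarith [this.2], by linarith [this.1]⟩
    have e : ∀ s, (K.tanL T i (wdH1 f) s + K.tanL T' j (wdH1 f') (1 - s)) * η s =
        η s * K.tanL T i (wdH1 f) s + η s * K.tanL T' j (wdH1 f') (1 - s) := fun s => by ring
    simp only [e]
    rw [integral_add i1 i2, K.integral_test_mul_tanL T i f h1 h2]
    have e2 := integral_reflect fun s => η (1 - s) * K.tanL T' j (wdH1 f') s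
    simp only [sub_sub_cancel] at e2
    rw [e2, K.integral_test_mul_tanL T' j f' h1' h2']
    have e3 : ∀ s, deriv (fun s => η (1 - s)) s = -deriv η (1 - s) := fun s => by
      rw [deriv_comp_const_sub]
    simp only [e3, neg_mul]
    rw [integral_neg, neg_neg]
    have e4 := integral_reflect fun s => deriv η s * K.traceL T' j (toH1 f') (1 - s)
    simp only [sub_sub_cancel] at e4
    rw [e4, neg_add_eq_zero]
    refine integral_congr_ae ?_
    filter_upwards [h] with s hs
    rw [hs]
  filter_upwards [key] with s hs
  linarith

/-! ### The exterior derivative -/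

/-- The exterior derivative `V → W` as a continuous linear map. -/
def dL : K.V →L[ℝ] K.W :=
  LinearMap.mkContinuous
    { toFun := fun v => ⟨fun T k => wdH1 (v.1 T) k, K.mem_W_iff.2
        ⟨fun T i T' j h => K.tanL_wdH1_glued ((K.mem_V_iff.1 v.2).1 T i T' j h),
          fun T i h => K.tanL_wdH1_zero ((K.mem_V_iff.1 v.2).2 T i h)⟩⟩
      map_add' := fun _ _ => rfl
      map_smul' := fun _ _ => rfl } 1
    fun v => by
      rw [one_mul]
      refine (pi_norm_le_iff_of_nonneg (norm_nonneg _)).2 fun T => ?_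
      refine (pi_norm_le_iff_of_nonneg (norm_nonneg _)).2 fun k => ?_
      exact (norm_wdH1_le (v.1 T) k).trans (norm_le_pi_norm v.1 T)

theorem isD_dL (v : K.V) : K.IsD v (K.dL v) := fun _ _ => rfl

theorem existsUnique_isD (v : K.V) : ∃! w, K.IsD v w :=
  ⟨K.dL v, K.isD_dL v, fun _ hw => Subtype.ext (funext fun T => funext fun k => hw T k)⟩

theorem d_eq (v : K.V) : K.d v = K.dL v :=
  (K.existsUnique_isD v).unique (Classical.epsilon_spec (K.existsUnique_isD v).exists) (K.isD_dL v)

theorem existsUnique_isDivDist (α : K.W') : ∃! u, K.IsDivDist α u := by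
  refine ⟨-(α.comp K.dL), fun v => ?_, fun u hu => ContinuousLinearMap.ext fun v => ?_⟩
  · rw [d_eq]; rfl
  · rw [hu v, d_eq]; rfl

theorem divDist_apply (α : K.W') (v : K.V) : K.divDist α v = -α (K.dL v) := by
  rw [← d_eq]
  exact Classical.epsilon_spec (K.existsUnique_isDivDist α).exists v

/-- The derivatives have degree `r`, one less than the trimmed space admits, so their contraction
with `x` still has degree at most `r + 1`. The commutation relations rest on this inclusion. -/
theorem dL_mem_Wh {r : ℕ} {v : K.V} (hv : v ∈ K.Vh (r + 1)) : K.dL v ∈ K.Wh (r + 1) := by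
  intro T
  obtain ⟨p, hp, h⟩ := K.exists_polyH2 T (hv T)
  have hd : ∀ k, MvPolynomial.pderiv k p ∈ Poly r := fun k => pderiv_mem_PolyLt hp k
  refine ⟨fun k => MvPolynomial.pderiv k p, fun k => Poly_mono (Nat.le_succ r) (hd k), ?_,
    fun k => ?_⟩
  · refine Submodule.sum_mem _ fun k _ => ?_
    rw [add_comm]
    exact mul_mem_Poly (X_mem_Poly k) (hd k)
  · change fn (wdH1 (v.1 T) k) =ᵐ[_] _
    rw [h, wdH1_polyH2]
    exact K.fn_polyH1 T _

end TriangulatedSurface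
end
end ReggeFEM
namespace ReggeFEM
noncomputable section

/-! ### Functionals given by integrals -/

section

variable {E X : Type*} [NormedAddCommGroup E] [NormedSpace ℝ E] [MeasurableSpace X]
  {μ : Measure X}

/-- The functional `u ↦ ∫ Φ u` is well defined, linear and continuous. -/
def IsIntFunctional (μ : Measure X) (Φ : E → X → ℝ) : Prop :=
  (∀ u, Integrable (Φ u) μ) ∧ ∃ L : E →L[ℝ] ℝ, ∀ u, ∫ x, Φ u x ∂μ = L u

theorem isIntFunctional_mul {M : X → ℝ} (hM : MemLp M 2 μ) (A : E →L[ℝ] Lp ℝ 2 μ) :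
    IsIntFunctional μ fun u x => M x * A u x :=
  ⟨fun u => integrable_mul_L2 hM (A u), (pairL hM).comp A, fun u => (pairL_apply hM (A u)).symm⟩

theorem IsIntFunctional.sub {Φ Ψ : E → X → ℝ} (h : IsIntFunctional μ Φ)
    (h' : IsIntFunctional μ Ψ) : IsIntFunctional μ fun u x => Φ u x - Ψ u x := by
  obtain ⟨h1, L, hL⟩ := h
  obtain ⟨h1', L', hL'⟩ := h'
  exact ⟨fun u => (h1 u).sub (h1' u), L - L', fun u => by
    rw [integral_sub (h1 u) (h1' u), hL, hL']; rfl⟩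

theorem isIntFunctional_sum {ι : Type*} (s : Finset ι) {Φ : ι → E → X → ℝ}
    (h : ∀ i, IsIntFunctional μ (Φ i)) : IsIntFunctional μ fun u x => ∑ i ∈ s, Φ i u x := by
  choose h1 L hL using h
  exact ⟨fun u => integrable_finsetSum _ fun i _ => h1 i u, ∑ i ∈ s, L i, fun u => by
    rw [integral_finsetSum _ fun i _ => h1 i u]
    simp [hL]⟩

theorem IsIntFunctional.congr {Φ Ψ : E → X → ℝ} (h : IsIntFunctional μ Φ)
    (he : ∀ u, Φ u =ᵐ[μ] Ψ u) : IsIntFunctional μ Ψ := by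
  obtain ⟨h1, L, hL⟩ := h
  exact ⟨fun u => (h1 u).congr (he u), L, fun u => by rw [← integral_congr_ae (he u), hL]⟩

theorem exists_clm_sum {ι : Type*} [Fintype ι] {X : ι → Type*} [∀ i, MeasurableSpace (X i)]
    {μ : ∀ i, Measure (X i)} {Φ : ∀ i, E → X i → ℝ} (h : ∀ i, IsIntFunctional (μ i) (Φ i)) :
    ∃ L : E →L[ℝ] ℝ, ∀ u, ∑ i, ∫ x, Φ i u x ∂(μ i) = L u := by
  choose L hL using fun i => (h i).2
  exact ⟨∑ i, L i, fun u => by simp [hL]⟩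

theorem memLp_mul_of_continuousOn {X : Type*} [TopologicalSpace X] [MeasurableSpace X]
    [OpensMeasurableSpace X] {μ : Measure X} {s C : Set X} (hs : MeasurableSet s) (hC : IsCompact C)
    (hsC : s ⊆ C) {c f : X → ℝ} (hc : ContinuousOn c C) (hf : MemLp f 2 (μ.restrict s)) :
    MemLp (fun x => c x * f x) 2 (μ.restrict s) := by
  obtain ⟨B, hB⟩ := hC.exists_bound_of_continuousOn hc
  refine MemLp.of_le_mul (c := B) hf
    (((hc.mono hsC).aestronglyMeasurable hs).mul hf.1) ?_
  refine (ae_restrict_iff' hs).2 (Filter.Eventually.of_forall fun x hx => ?_)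
  rw [norm_mul]
  exact mul_le_mul_of_nonneg_right (hB x (hsC hx)) (norm_nonneg _)

end

namespace TriangulatedSurface

variable {K : TriangulatedSurface}

namespace ReggeMetric

variable (g : K.ReggeMetric)

/-! ### Continuity of the coefficients -/

theorem det_pos {T : K.Tri} {x : Plane} (hx : x ∈ K.tri T) : 0 < (g.coeff T x).det :=
  (g.posDef T x hx).det_pos

theorem continuousOn_coeff (T : K.Tri) (a b : Fin 2) :
    ContinuousOn (fun x => g.coeff T x a b) (K.tri T) := (g.smooth T a b).continuousOn

theorem continuousOn_det (T : K.Tri) : ContinuousOn (fun x => (g.coeff T x).det) (K.tri T) := by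
  simp only [Matrix.det_fin_two]
  exact ((g.continuousOn_coeff T 0 0).mul (g.continuousOn_coeff T 1 1)).sub
    ((g.continuousOn_coeff T 0 1).mul (g.continuousOn_coeff T 1 0))

theorem continuousOn_inv (T : K.Tri) (a b : Fin 2) :
    ContinuousOn (fun x => g.inv T x a b) (K.tri T) := by
  have hd : ContinuousOn (fun x => ((g.coeff T x).det)⁻¹) (K.tri T) :=
    (g.continuousOn_det T).inv₀ fun x hx => (g.det_pos hx).ne'
  have e : ∀ x, g.inv T x a b = ((g.coeff T x).det)⁻¹ * (g.coeff T x).adjugate a b := fun x => by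
    rw [inv, Matrix.inv_def, Ring.inverse_eq_inv', Matrix.smul_apply, smul_eq_mul]
  simp only [e, Matrix.adjugate_fin_two]
  refine hd.mul ?_
  fin_cases a <;> fin_cases b
  · exact g.continuousOn_coeff T 1 1
  · exact (g.continuousOn_coeff T 0 1).neg
  · exact (g.continuousOn_coeff T 1 0).neg
  · exact g.continuousOn_coeff T 0 0

theorem continuousOn_vol (T : K.Tri) : ContinuousOn (g.vol T) (K.tri T) :=
  (g.continuousOn_det T).sqrt

theorem vol_pos {T : K.Tri} {x : Plane} (hx : x ∈ K.tri T) : 0 < g.vol T x :=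
  Real.sqrt_pos.2 (g.det_pos hx)

theorem uniqueDiffOn_tri (T : K.Tri) : UniqueDiffOn ℝ (K.tri T) :=
  uniqueDiffOn_convex (convex_convexHull ℝ _) (K.convexDomain T).nonempty

theorem continuousOn_christoffel (T : K.Tri) (c a b : Fin 2) :
    ContinuousOn (fun x => g.christoffel T x c a b) (K.tri T) := by
  have hd : ∀ c a b, ContinuousOn (fun x => g.dcoeff T x c a b) (K.tri T) := fun c a b =>
    ((g.smooth T a b).continuousOn_fderivWithin (uniqueDiffOn_tri T) (by simp)).clm_apply
      continuousOn_const
  refine continuousOn_const.mul (continuousOn_finsetSum _ fun d _ => ?_)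
  exact (g.continuousOn_inv T c d).mul (((hd a b d).add (hd b a d)).sub (hd d a b))

variable {g} in
theorem continuousOn_edge {T : K.Tri} {c : Plane → ℝ} (hc : ContinuousOn c (K.tri T)) (i : Fin 3) :
    ContinuousOn (fun s => c (K.edgePt T i s)) (Icc 0 1) :=
  hc.comp (K.edgePt_continuous T i).continuousOn fun _ hs => K.edgePt_mem T i hs

theorem continuousOn_edgeSq (T : K.Tri) (i : Fin 3) : ContinuousOn (g.edgeSq T i) (Icc 0 1) :=
  continuousOn_finsetSum _ fun a _ => continuousOn_finsetSum _ fun b _ =>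
    ((continuousOn_edge (g.continuousOn_coeff T a b) i).mul continuousOn_const).mul
      continuousOn_const

theorem quadForm_pos {M : Matrix (Fin 2) (Fin 2) ℝ} (hM : M.PosDef) {v : Fin 2 → ℝ} (hv : v ≠ 0) :
    0 < ∑ a, ∑ b, M a b * v a * v b := by
  have h := hM.dotProduct_mulVec_pos hv
  simp only [dotProduct, Matrix.mulVec, Finset.mul_sum, star_trivial] at h
  refine h.trans_eq (Finset.sum_congr rfl fun a _ => Finset.sum_congr rfl fun b _ => by ring)

theorem edgeConormal_ne_zero (T : K.Tri) (i : Fin 3) : K.edgeConormal T i ≠ 0 := by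
  obtain ⟨k, hk⟩ := K.edgeVec_ne_zero T i
  exact fun h => hk (congrFun h k)

theorem edgeSq_pos (T : K.Tri) (i : Fin 3) {s : ℝ} (hs : s ∈ Icc (0 : ℝ) 1) :
    0 < g.edgeSq T i s := by
  refine quadForm_pos (g.posDef T _ (K.edgePt_mem T i hs)) fun h => edgeConormal_ne_zero T i ?_
  funext k
  fin_cases k
  · exact congrFun h 1
  · exact neg_eq_zero.2 (congrFun h 0)

theorem edgeLen_pos (T : K.Tri) (i : Fin 3) {s : ℝ} (hs : s ∈ Icc (0 : ℝ) 1) :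
    0 < g.edgeLen T i s := Real.sqrt_pos.2 (g.edgeSq_pos T i hs)

theorem continuousOn_edgeLen (T : K.Tri) (i : Fin 3) : ContinuousOn (g.edgeLen T i) (Icc 0 1) :=
  (g.continuousOn_edgeSq T i).sqrt

theorem continuousOn_tau (T : K.Tri) (i : Fin 3) (a : Fin 2) :
    ContinuousOn (fun s => g.tau T i s a) (Icc 0 1) :=
  continuousOn_const.div (g.continuousOn_edgeLen T i) fun _ hs => (g.edgeLen_pos T i hs).ne'

theorem continuousOn_normal (T : K.Tri) (i : Fin 3) (a : Fin 2) :
    ContinuousOn (fun s => g.normal T i s a) (Icc 0 1) := by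
  have hi := fun a b => continuousOn_edge (g.continuousOn_inv T a b) i
  refine ContinuousOn.div (continuousOn_finsetSum _ fun b _ => (hi a b).mul continuousOn_const)
    (continuousOn_finsetSum _ fun b _ => continuousOn_finsetSum _ fun c _ =>
      ((hi b c).mul continuousOn_const).mul continuousOn_const).sqrt fun s hs => ?_
  exact (Real.sqrt_pos.2 (quadForm_pos (g.posDef T _ (K.edgePt_mem T i hs)).inv
    (edgeConormal_ne_zero T i))).ne'

/-! ### Inner products and the form `ch` are continuous in their last argument -/

theorem memLp_cont_mul {T : K.Tri} {c f : Plane → ℝ} (hc : ContinuousOn c (K.tri T))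
    (hf : MemLp f 2 (volume.restrict (K.cell T))) :
    MemLp (fun x => c x * f x) 2 (volume.restrict (K.cell T)) :=
  memLp_mul_of_continuousOn isOpen_interior.measurableSet (K.tri_compact T) interior_subset hc hf

theorem memLp_cont_mul_I01 {c f : ℝ → ℝ} (hc : ContinuousOn c (Icc 0 1)) (hf : MemLp f 2 I01) :
    MemLp (fun x => c x * f x) 2 I01 :=
  memLp_mul_of_continuousOn measurableSet_Icc isCompact_Icc subset_rfl hc hf

/-- The restriction of piecewise functions to a triangle. -/
def projV (T : K.Tri) : K.V →L[ℝ] H2 (K.cell T) :=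
  (ContinuousLinearMap.proj (R := ℝ) (φ := fun T : K.Tri => H2 (K.cell T)) T).comp K.V.subtypeL

/-- The components of one-forms on a triangle. -/
def projW (T : K.Tri) (k : Fin 2) : K.W →L[ℝ] H1 (K.cell T) :=
  (ContinuousLinearMap.proj (R := ℝ) (φ := fun _ : Fin 2 => H1 (K.cell T)) k).comp
    ((ContinuousLinearMap.proj (R := ℝ) (φ := fun T : K.Tri => Fin 2 → H1 (K.cell T)) T).comp
      K.W.subtypeL)

theorem exists_clm_innerV (u : K.V) : ∃ L : K.V →L[ℝ] ℝ, ∀ v, g.innerV u v = L v := by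
  refine exists_clm_sum fun T => ?_
  refine (isIntFunctional_mul (memLp_cont_mul (g.continuousOn_vol T) (Lp.memLp (fn (toH1 (u.1 T)))))
    ((fnL.comp toH1L).comp (projV T))).congr fun v => Filter.Eventually.of_forall fun x => ?_
  change g.vol T x * fn (toH1 (u.1 T)) x * fn (toH1 (v.1 T)) x = _
  ring

theorem exists_clm_innerW (α : K.W) : ∃ L : K.W →L[ℝ] ℝ, ∀ β, g.innerW α β = L β := by
  refine exists_clm_sum fun T => ?_
  refine (isIntFunctional_sum Finset.univ fun b => isIntFunctional_mul
    (memLp_finsetSum Finset.univ fun a _ =>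
    (memLp_cont_mul ((g.continuousOn_vol T).mul (g.continuousOn_inv T a b)) (Lp.memLp (fn (α.1 T a)))))
    (fnL.comp (projW T b))).congr fun v => Filter.Eventually.of_forall fun x => ?_
  simp only [Fin.sum_univ_two]
  change (_ + _) * fn (v.1 T 0) x + (_ + _) * fn (v.1 T 1) x = _
  simp only [Pi.mul_apply]
  ring

/-- The coefficients of the tensor `Sσ`, with raised indices, times the volume density. -/
def stress (T : K.Tri) (σ : Fin 2 → Fin 2 → H1 (K.cell T)) (c d : Fin 2) (x : Plane) : ℝ :=
  ∑ a, ∑ b, g.inv T x a c * g.inv T x b d * g.S T x (fun a b => fn (σ a b) x) a b * g.vol T x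

theorem memLp_stress (T : K.Tri) (σ : Fin 2 → Fin 2 → H1 (K.cell T)) (c d : Fin 2) :
    MemLp (g.stress T σ c d) 2 (volume.restrict (K.cell T)) := by
  refine memLp_finsetSum _ fun a _ => memLp_finsetSum _ fun b _ => ?_
  have h1 : MemLp (fun x => g.S T x (fun a b => fn (σ a b) x) a b) 2
      (volume.restrict (K.cell T)) := by
    refine (Lp.memLp (fn (σ a b))).sub (memLp_cont_mul (g.continuousOn_coeff T a b) ?_)
    exact memLp_finsetSum _ fun c _ => memLp_finsetSum _ fun d _ =>
      memLp_cont_mul (g.continuousOn_inv T c d) (Lp.memLp (fn (σ c d)))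
  have h2 := memLp_cont_mul (((g.continuousOn_inv T a c).mul (g.continuousOn_inv T b d)).mul
    (g.continuousOn_vol T)) h1
  refine h2.ae_eq (Filter.Eventually.of_forall fun x => ?_)
  simp only [Pi.mul_apply]
  ring

/-- Separates the square-integrable coefficients, which depend on `σ` and the metric, from `∇α`; the
cell term of `c_h` is thereby a continuous functional of `α`. -/
theorem inner₂_S_mul_vol (T : K.Tri) (σ : Fin 2 → Fin 2 → H1 (K.cell T)) (x : Plane)
    (B : Fin 2 → Fin 2 → ℝ) :
    g.inner₂ T x (g.S T x fun a b => fn (σ a b) x) B * g.vol T x =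
      ∑ c, ∑ d, g.stress T σ c d x * B c d := by
  simp only [inner₂, stress, Fin.sum_univ_two]
  ring

theorem memLp_tautau (T : K.Tri) (i : Fin 3) (σ : Fin 2 → Fin 2 → H1 (K.cell T)) :
    MemLp (g.tautau T i σ) 2 I01 := by
  refine memLp_finsetSum _ fun a _ => memLp_finsetSum _ fun b _ => ?_
  have := memLp_cont_mul_I01 ((g.continuousOn_tau T i a).mul (g.continuousOn_tau T i b))
    ((K.isTrace_trace T (σ a b)).memLp i)
  refine this.ae_eq (Filter.Eventually.of_forall fun s => ?_)
  simp only [Pi.mul_apply]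
  ring

theorem isIntFunctional_ch_cell (T : K.Tri) (σ : Fin 2 → Fin 2 → H1 (K.cell T)) :
    IsIntFunctional (volume.restrict (K.cell T)) fun (β : K.W) x =>
      g.inner₂ T x (g.S T x fun a b => (fn (σ a b)) x) (g.covDeriv T (β.1 T) x) * g.vol T x := by
  have hc : ∀ c d, IsIntFunctional (volume.restrict (K.cell T)) fun (β : K.W) x =>
      g.stress T σ c d x * g.covDeriv T (β.1 T) x c d := fun c d => by
    refine ((isIntFunctional_mul (g.memLp_stress T σ c d)
      ((wdL c).comp (projW T d))).sub (isIntFunctional_sum Finset.univ fun e =>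
      isIntFunctional_mul (memLp_cont_mul (g.continuousOn_christoffel T e c d)
        (g.memLp_stress T σ c d)) (fnL.comp (projW T e)))).congr
      fun β => Filter.Eventually.of_forall fun x => ?_
    change g.stress T σ c d x * wd (β.1 T d) c x - ∑ e, g.christoffel T x e c d *
      g.stress T σ c d x * fn (β.1 T e) x = _
    refine Eq.trans ?_ (mul_sub _ _ _).symm
    rw [Finset.mul_sum]
    congr 1
    exact Finset.sum_congr rfl fun e _ => by ring
  refine (isIntFunctional_sum Finset.univ fun c => isIntFunctional_sum Finset.univ
    fun d => hc c d).congr fun β => Filter.Eventually.of_forall fun x => ?_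
  exact (g.inner₂_S_mul_vol T σ x _).symm

theorem isIntFunctional_ch_side (T : K.Tri) (i : Fin 3) (σ : Fin 2 → Fin 2 → H1 (K.cell T)) :
    IsIntFunctional I01 fun (β : K.W) s =>
      g.tautau T i σ s * g.normalComp T i (β.1 T) s * g.edgeLen T i s := by
  refine (isIntFunctional_sum Finset.univ fun a => isIntFunctional_mul
    (memLp_cont_mul_I01 ((g.continuousOn_normal T i a).mul (g.continuousOn_edgeLen T i))
      (g.memLp_tautau T i σ)) ((K.traceL T i).comp (projW T a))).congr fun β => ?_
  filter_upwards [K.trace_ae T (β.1 T 0) i, K.trace_ae T (β.1 T 1) i] with s e0 e1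
  simp only [normalComp, Fin.sum_univ_two, e0, e1]
  change _ * K.traceL T i (β.1 T 0) s + _ * K.traceL T i (β.1 T 1) s = _
  simp only [Pi.mul_apply]
  ring

/-- Coefficients of the metric are bounded on closed triangles, and traces are continuous in `H¹`.
This is what puts `(div S)_dist σ` into the dual of `W`. -/
theorem exists_clm_ch (σ : K.Sigma) : ∃ L : K.W →L[ℝ] ℝ, ∀ β, g.ch σ β = L β := by
  obtain ⟨L1, hL1⟩ := exists_clm_sum fun T => g.isIntFunctional_ch_cell T (σ.1 T)
  choose L2 hL2 using fun T => exists_clm_sum fun i => g.isIntFunctional_ch_side T i (σ.1 T)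
  exact ⟨L1 + ∑ T, L2 T, fun β => by simp only [ch, hL1, hL2, add_apply, sum_apply]⟩

end ReggeMetric
end TriangulatedSurface
end
end ReggeFEM
-- Well-posedness of the operators given by inner products, and item 1
namespace ReggeFEM
noncomputable section

/-- Riesz representation in finite dimension. Symmetry supplies linearity in the first argument from
linearity in the second. -/
theorem existsUnique_subspace {E : Type*} [NormedAddCommGroup E] [NormedSpace ℝ E]
    (Eh : Submodule ℝ E) [FiniteDimensional ℝ Eh] {I : E → E → ℝ}
    (hI : ∀ u, ∃ L : E →L[ℝ] ℝ, ∀ v, I u v = L v) (hsymm : ∀ u v, I u v = I v u)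
    (hpos : ∀ u, I u u = 0 → u = 0) {l : E → ℝ} (hl : ∃ L : E →L[ℝ] ℝ, ∀ v, l v = L v) :
    ∃! u : Eh, ∀ v : Eh, I u v = l v := by
  choose L hL using hI
  obtain ⟨l', hl'⟩ := hl
  let B : Eh →ₗ[ℝ] Eh →ₗ[ℝ] ℝ := LinearMap.mk₂ ℝ (fun u v => I u v)
    (fun u u' v => by simp only [hsymm _ (v : E), hL, Submodule.coe_add, map_add])
    (fun c u v => by simp only [hsymm _ (v : E), hL, Submodule.coe_smul, map_smul])
    (fun u v v' => by simp only [hL, Submodule.coe_add, map_add])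
    (fun c u v => by simp only [hL, Submodule.coe_smul, map_smul])
  have := existsUnique_of_nondegenerate B (fun u hu => Subtype.ext (hpos u hu))
    (l'.toLinearMap.comp Eh.subtype)
  simp only [hl']
  exact this

namespace TriangulatedSurface

variable {K : TriangulatedSurface}

namespace ReggeMetric

variable (g : K.ReggeMetric)

theorem innerV_comm (u v : K.V) : g.innerV u v = g.innerV v u := by
  simp only [innerV, mul_comm (fn (toH1 (u.1 _)) _)]

theorem inv_symm {T : K.Tri} {x : Plane} (hx : x ∈ K.tri T) (a b : Fin 2) :
    g.inv T x a b = g.inv T x b a := by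
  have := (g.posDef T x hx).inv.1.apply a b
  simpa [inv] using this.symm

theorem ae_mem_tri (T : K.Tri) : ∀ᵐ x ∂volume.restrict (K.cell T), x ∈ K.tri T := by
  filter_upwards [ae_restrict_mem isOpen_interior.measurableSet] with x hx using interior_subset hx

theorem innerW_comm (α β : K.W) : g.innerW α β = g.innerW β α := by
  refine Finset.sum_congr rfl fun T _ => integral_congr_ae ?_
  filter_upwards [ae_mem_tri T] with x hx
  simp only [Fin.sum_univ_two]
  rw [g.inv_symm hx 1 0]
  ring

theorem ae_eq_zero_of_sum_integral_eq_zero {q : ∀ _ : K.Tri, Plane → ℝ}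
    (hi : ∀ T, Integrable (q T) (volume.restrict (K.cell T)))
    (hq : ∀ T, 0 ≤ᵐ[volume.restrict (K.cell T)] q T)
    (h : ∑ T, ∫ x in K.cell T, q T x = 0) (T : K.Tri) :
    q T =ᵐ[volume.restrict (K.cell T)] 0 := by
  have h1 := (Finset.sum_eq_zero_iff_of_nonneg fun T _ => integral_nonneg_of_ae (hq T)).1 h T
    (Finset.mem_univ T)
  exact (integral_eq_zero_iff_of_nonneg_ae (hq T) (hi T)).1 h1

theorem innerV_self {u : K.V} (h : g.innerV u u = 0) : u = 0 := by
  have hi : ∀ T, Integrable (fun x => fn (toH1 (u.1 T)) x * fn (toH1 (u.1 T)) x * g.vol T x)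
      (volume.restrict (K.cell T)) := fun T => by
    refine (integrable_mul_L2 (memLp_cont_mul (g.continuousOn_vol T) (Lp.memLp (fn (toH1 (u.1 T)))))
      (fn (toH1 (u.1 T)))).congr (Filter.Eventually.of_forall fun x => ?_)
    change g.vol T x * fn (toH1 (u.1 T)) x * fn (toH1 (u.1 T)) x = _
    ring
  have key := ae_eq_zero_of_sum_integral_eq_zero hi (fun T => by
    filter_upwards [ae_mem_tri T] with x hx
    exact mul_nonneg (mul_self_nonneg _) (g.vol_pos hx).le) h
  refine Subtype.ext (funext fun T => H2.ext_fn (K.convexDomain T).isOpen (Lp.ext ?_))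
  filter_upwards [key T, ae_mem_tri T, Lp.coeFn_zero ℝ 2 (volume.restrict (K.cell T))]
    with x h1 hx h0
  have h2 : fn (toH1 (u.1 T)) x * fn (toH1 (u.1 T)) x * g.vol T x = 0 := h1
  rw [mul_self_eq_zero.1 ((mul_eq_zero.1 h2).resolve_right (g.vol_pos hx).ne')]
  exact h0.symm

theorem innerW_self {α : K.W} (h : g.innerW α α = 0) : α = 0 := by
  have hi : ∀ T, Integrable (fun x => (∑ a, ∑ b, g.inv T x a b * (fn (α.1 T a)) x *
      (fn (α.1 T b)) x) * g.vol T x) (volume.restrict (K.cell T)) := fun T => by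
    have := integrable_finsetSum Finset.univ fun a _ => integrable_finsetSum Finset.univ fun b _ =>
      integrable_mul_L2 (memLp_cont_mul ((g.continuousOn_vol T).mul (g.continuousOn_inv T a b))
        (Lp.memLp (fn (α.1 T a)))) (fn (α.1 T b))
    refine this.congr (Filter.Eventually.of_forall fun x => ?_)
    simp only [Fin.sum_univ_two, Pi.mul_apply]
    ring
  have hpos : ∀ T x, x ∈ K.tri T → (fun a => fn (α.1 T a) x) ≠ 0 →
      0 < ∑ a, ∑ b, g.inv T x a b * (fn (α.1 T a)) x * (fn (α.1 T b)) x := fun T x hx hne =>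
    quadForm_pos (g.posDef T x hx).inv hne
  have key := ae_eq_zero_of_sum_integral_eq_zero hi (fun T => by
    filter_upwards [ae_mem_tri T] with x hx
    refine mul_nonneg ?_ (g.vol_pos hx).le
    by_cases hne : (fun a => fn (α.1 T a) x) = 0
    · have h0 : ∀ a, fn (α.1 T a) x = 0 := fun a => congrFun hne a
      simp [h0]
    · exact (hpos T x hx hne).le) h
  refine Subtype.ext (funext fun T => funext fun a =>
    H1.ext_fn (K.convexDomain T).isOpen (Lp.ext ?_))
  filter_upwards [key T, ae_mem_tri T, Lp.coeFn_zero ℝ 2 (volume.restrict (K.cell T))]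
    with x h1 hx h0
  have h2 := (mul_eq_zero.1
    (show (∑ a, ∑ b, g.inv T x a b * (fn (α.1 T a)) x * (fn (α.1 T b)) x) * g.vol T x = 0 from h1)).resolve_right (g.vol_pos hx).ne'
  have h3 : (fun a => fn (α.1 T a) x) = 0 := by
    by_contra hne
    exact (hpos T x hx hne).ne' h2
  exact (congrFun h3 a).trans h0.symm

theorem existsUnique_isDivSDist (σ : K.Sigma) : ∃! α, g.IsDivSDist σ α := by
  obtain ⟨L, hL⟩ := g.exists_clm_ch σ
  refine ⟨-L, fun β => by rw [hL]; rfl, fun α hα => ContinuousLinearMap.ext fun β => ?_⟩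
  rw [hα β, hL]; rfl

theorem existsUnique_isDivh (r : ℕ) (α : K.Wh (r + 1)) : ∃! u, g.IsDivh r α u := by
  obtain ⟨L, hL⟩ := g.exists_clm_innerW α
  refine existsUnique_subspace (K.Vh (r + 1)) g.exists_clm_innerV g.innerV_comm
    (fun _ => g.innerV_self) (l := fun v => -g.innerW α (K.d v)) ⟨-(L.comp K.dL), fun v => ?_⟩
  rw [hL, d_eq]; rfl

theorem existsUnique_isDivSh (r : ℕ) (σ : K.Sigmah r) : ∃! α, g.IsDivSh r σ α := by
  obtain ⟨L, hL⟩ := g.exists_clm_ch σ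
  refine existsUnique_subspace (K.Wh (r + 1)) g.exists_clm_innerW g.innerW_comm
    (fun _ => g.innerW_self) (l := fun β => -g.ch σ β) ⟨-L, fun v => ?_⟩
  rw [hL]; rfl

theorem existsUnique_isPiV (r : ℕ) (u : K.V') : ∃! w, g.IsPiV r u w :=
  existsUnique_subspace (K.Vh (r + 1)) g.exists_clm_innerV g.innerV_comm
    (fun _ => g.innerV_self) (l := fun v => u v) ⟨u, fun _ => rfl⟩

theorem existsUnique_isPiW (r : ℕ) (α : K.W') : ∃! γ, g.IsPiW r α γ :=
  existsUnique_subspace (K.Wh (r + 1)) g.exists_clm_innerW g.innerW_comm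
    (fun _ => g.innerW_self) (l := fun v => α v) ⟨α, fun _ => rfl⟩

theorem divSDist_spec (σ : K.Sigma) : g.IsDivSDist σ (g.divSDist σ) :=
  Classical.epsilon_spec (g.existsUnique_isDivSDist σ).exists

theorem divh_spec (r : ℕ) (α : K.Wh (r + 1)) : g.IsDivh r α (g.divh r α) :=
  Classical.epsilon_spec (g.existsUnique_isDivh r α).exists

theorem divSh_spec (r : ℕ) (σ : K.Sigmah r) : g.IsDivSh r σ (g.divSh r σ) :=
  Classical.epsilon_spec (g.existsUnique_isDivSh r σ).exists

theorem piV_spec (r : ℕ) (u : K.V') : g.IsPiV r u (g.piV r u) :=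
  Classical.epsilon_spec (g.existsUnique_isPiV r u).exists

theorem piW_spec (r : ℕ) (α : K.W') : g.IsPiW r α (g.piW r α) :=
  Classical.epsilon_spec (g.existsUnique_isPiW r α).exists

/-- Paired with a finite element function `v`, both sides are `-α(dv)`: the projection `π_h^W` can
be dropped because `dv` is one of its test forms. -/
theorem divh_piW (r : ℕ) (α : K.W') : g.divh r (g.piW r α) = g.piV r (K.divDist α) := by
  refine (g.existsUnique_isPiV r (K.divDist α)).unique (fun v => ?_) (g.piV_spec r _)
  rw [g.divh_spec r _ v, divDist_apply, d_eq]
  exact congrArg Neg.neg (g.piW_spec r α ⟨K.dL v, K.dL_mem_Wh v.2⟩)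

/-- `⟨(div div S)ₕ σ, v⟩ = cₕ(σ, dv)`. -/
theorem innerV_divDivSh (r : ℕ) (σ : K.Sigmah r) (v : K.Vh (r + 1)) :
    g.innerV (g.divDivSh r σ) v = g.ch σ (K.dL v) := by
  rw [divDivSh, g.divh_spec r _ v, d_eq]
  have := g.divSh_spec r σ ⟨K.dL v, K.dL_mem_Wh v.2⟩
  rw [show g.innerW (g.divSh r σ) (K.dL v) = -g.ch σ (K.dL v) from this, neg_neg]

/-- `⟨(div div S)_dist σ, v⟩ = cₕ(σ, dv)`. -/
theorem divDivSDist_apply (σ : K.Sigma) (v : K.V) :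
    g.divDivSDist σ v = g.ch σ (K.dL v) := by
  rw [divDivSDist, divDist_apply, g.divSDist_spec σ, neg_neg]

/-- Reduces a commutation relation to an identity for `c_h` tested with gradients of finite element
functions. -/
theorem divDivSh_eq_piV (r : ℕ) {σ : K.Sigmah r} {u : K.V'}
    (h : ∀ v : K.Vh (r + 1), g.ch σ (K.dL v) = u v) : g.divDivSh r σ = g.piV r u :=
  (g.existsUnique_isPiV r u).unique (fun v => by rw [innerV_divDivSh, h]) (g.piV_spec r _)

end ReggeMetric
end TriangulatedSurface
end
end ReggeFEM
namespace ReggeFEM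
noncomputable section

theorem coeFn_lincomb {X H ι : Type*} [MeasurableSpace X] {μ : Measure X} [NormedAddCommGroup H]
    [NormedSpace ℝ H] [Fintype ι] (A : H →L[ℝ] Lp ℝ 2 μ) (c : ι → ℝ) (f : ι → H) :
    A (∑ i, c i • f i) =ᵐ[μ] fun x => ∑ i, c i * A (f i) x := by
  simp only [map_sum, map_smul]
  refine (Lp.coeFn_fun_finsetSum _ _).trans ?_
  filter_upwards [ae_all_iff.2 fun i => Lp.coeFn_smul (c i) (A (f i))] with x hx
  exact Finset.sum_congr rfl fun i _ => hx i

namespace TriangulatedSurface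

variable (K : TriangulatedSurface)

/-! ### The scalar interpolation problem of the Regge element -/

/-- The side moments up to degree `r` annihilate the restriction to the side `i`, so `p = λ_i q`
with `q` of degree less than `r`. Testing the interior moments with `q` itself, for the weight `λ_i
> 0`, gives `q = 0`. -/
theorem reggeScalar_unique (T : K.Tri) (i : Fin 3) {r : ℕ} {p : MvP} (hp : p ∈ Poly r)
    (hint : ∀ q ∈ PolyLt r, ∫ x in K.cell T, pval p x * pval q x = 0)
    (hedge : ∀ b ∈ PolyLt₁ (r + 1), ∫ s, (edgeP (K.pos T) i p).eval s * b.eval s ∂I01 = 0) :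
    p = 0 := by
  obtain ⟨q, hq, hpq⟩ := exists_decomp (K.tdet_pos T) i hp
  have ha : edgeP (K.pos T) i p = 0 := by
    have hu := existsUnique_poly₁ (w := fun _ => 1) continuous_const (fun _ _ => one_pos) (r + 1)
      (h := 0) MemLp.zero
    have := hu.unique (y₁ := ⟨_, mem_PolyLt₁_of_lt (Nat.lt_succ_of_le (natDegree_edgeP hp i))⟩)
      (y₂ := 0) (fun b => by simpa using hedge b.1 b.2) (fun b => by simp)
    exact congrArg Subtype.val this
  rw [ha, map_zero, zero_add] at hpq
  have hq0 : q = 0 := by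
    have hu := K.existsUnique_poly T (w := lam (K.pos T) i) (lam_continuous _ i)
      (fun x hx => by rw [cell_eq] at hx; exact hx i) r (h := 0) MemLp.zero
    have := hu.unique (y₁ := ⟨q, hq⟩) (y₂ := 0)
      (fun b => by simpa [hpq] using hint b.1 b.2) (fun b => by simp)
    exact congrArg Subtype.val this
  rw [hpq, hq0, mul_zero]

/-- Solved from the side inwards: the polynomial on the side is extended as a function of `λ_{i+2}`,
then a term `λ_i q`, invisible on the side, adjusts the interior moments. -/
theorem reggeScalar_exists (T : K.Tri) (i : Fin 3) (r : ℕ) {h : Plane → ℝ}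
    (hh : MemLp h 2 (volume.restrict (K.cell T))) {t : ℝ → ℝ} (ht : MemLp t 2 I01) :
    ∃ p ∈ Poly r, (∀ q ∈ PolyLt r, ∫ x in K.cell T, pval p x * pval q x =
        ∫ x in K.cell T, h x * pval q x) ∧
      ∀ b ∈ PolyLt₁ (r + 1), ∫ s, (edgeP (K.pos T) i p).eval s * b.eval s ∂I01 =
        ∫ s, t s * b.eval s ∂I01 := by
  obtain ⟨a, ha, -⟩ := existsUnique_poly₁ (w := fun _ => 1) continuous_const
    (fun _ _ => one_pos) (r + 1) ht
  set A : MvP := Polynomial.aeval (lamP (K.pos T) (i + 2)) a.1 with hA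
  have hAm := K.memLp_cell T (pval_continuous A)
  obtain ⟨q, hq, -⟩ := K.existsUnique_poly T (w := lam (K.pos T) i) (lam_continuous _ i)
    (fun x hx => by rw [cell_eq] at hx; exact hx i) r (hh.sub hAm)
  have hdeg : a.1.natDegree ≤ r := by
    rcases natDegree_lt_of_mem_PolyLt₁ a.2 with h | h
    · simp [h]
    · omega
  refine ⟨A + lamP (K.pos T) i * q, add_mem (aeval_mem_Poly (lamP_mem_Poly _ _) hdeg) ?_,
    fun b hb => ?_, fun b hb => ?_⟩
  · rcases totalDegree_lt_of_mem_PolyLt q.2 with h | h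
    · rw [h, mul_zero]; exact zero_mem _
    · have := mul_mem_Poly (lamP_mem_Poly (K.pos T) i) (mem_Poly.2 (le_refl q.1.totalDegree))
      exact Poly_mono (by omega) this
  · have e := hq ⟨b, hb⟩
    have hbm := K.memLp_cell T (pval_continuous b)
    have i1 : Integrable (fun x => pval A x * pval b x) (volume.restrict (K.cell T)) :=
      hAm.integrable_mul hbm
    have i2 : Integrable (fun x => h x * pval b x) (volume.restrict (K.cell T)) :=
      hh.integrable_mul hbm
    have i3 : Integrable (fun x => lam (K.pos T) i x * pval q x * pval b x)
        (volume.restrict (K.cell T)) :=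
      (K.memLp_cell T ((lam_continuous _ i).mul (pval_continuous q.1))).integrable_mul hbm
    simp only [Pi.sub_apply, sub_mul] at e
    rw [integral_sub i2 i1] at e
    simp only [pval_add, pval_mul, pval_lamP, add_mul]
    rw [integral_add i1 i3, e]
    ring
  · rw [← ha ⟨b, hb⟩]
    congr 1; funext s
    rw [eval_edgeP, pval_add, pval_mul, pval_lamP, hA, pval_aeval, pval_lamP]
    obtain ⟨h0, _, h2⟩ := lam_sidePt (K.tdet_pos T) i s
    rw [h0, h2]; ring

/-- `h` interpolates `f`, with degrees of freedom in the triangle and on the side `i`. -/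
def IsScalarRegge (r : ℕ) (T : K.Tri) (i : Fin 3) (f h : H1 (K.cell T)) : Prop :=
  (∀ q ∈ PolyLt r, ∫ x in K.cell T, (fn h x - fn f x) * pval q x = 0) ∧
    ∀ b ∈ PolyLt₁ (r + 1), ∫ s, (K.traceL T i h s - K.traceL T i f s) * b.eval s ∂I01 = 0

theorem integrable_fn_mul_pval (T : K.Tri) (f : H1 (K.cell T)) (q : MvP) :
    Integrable (fun x => fn f x * pval q x) (volume.restrict (K.cell T)) :=
  K.integrable_mul_cont T (fn f) (pval_continuous q)

theorem integrable_traceL_mul_eval (T : K.Tri) (i : Fin 3) (f : H1 (K.cell T)) (b : Polynomial ℝ) :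
    Integrable (fun s => K.traceL T i f s * b.eval s) I01 :=
  (Lp.memLp _).integrable_mul (memLp_I01 b.continuous)

theorem isScalarRegge_iff {r : ℕ} {T : K.Tri} {i : Fin 3} {f h : H1 (K.cell T)} :
    K.IsScalarRegge r T i f h ↔
      (∀ q ∈ PolyLt r, ∫ x in K.cell T, fn h x * pval q x = ∫ x in K.cell T, fn f x * pval q x) ∧
      ∀ b ∈ PolyLt₁ (r + 1), ∫ s, K.traceL T i h s * b.eval s ∂I01 =
        ∫ s, K.traceL T i f s * b.eval s ∂I01 := by
  refine and_congr (forall₂_congr fun q _ => ?_) (forall₂_congr fun b _ => ?_)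
  · simp only [sub_mul]
    rw [integral_sub (K.integrable_fn_mul_pval T h q) (K.integrable_fn_mul_pval T f q), sub_eq_zero]
  · simp only [sub_mul]
    rw [integral_sub (K.integrable_traceL_mul_eval T i h b) (K.integrable_traceL_mul_eval T i f b),
      sub_eq_zero]

theorem integral_fn_polyH1 (T : K.Tri) (p q : MvP) :
    ∫ x in K.cell T, fn (K.polyH1 T p) x * pval q x = ∫ x in K.cell T, pval p x * pval q x :=
  integral_congr_ae ((K.fn_polyH1 T p).mono fun x hx => by simp only [hx])

theorem integral_traceL_polyH1 (T : K.Tri) (i : Fin 3) (p : MvP) (b : Polynomial ℝ) :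
    ∫ s, K.traceL T i (K.polyH1 T p) s * b.eval s ∂I01 =
      ∫ s, (edgeP (K.pos T) i p).eval s * b.eval s ∂I01 :=
  integral_congr_ae ((K.traceL_polyH1 T p i).mono fun s hs => by simp only [hs])

theorem exists_isScalarRegge (r : ℕ) (T : K.Tri) (i : Fin 3) (f : H1 (K.cell T)) :
    ∃ p ∈ Poly r, K.IsScalarRegge r T i f (K.polyH1 T p) := by
  obtain ⟨p, hp, h1, h2⟩ := K.reggeScalar_exists T i r (Lp.memLp (fn f)) (Lp.memLp (K.traceL T i f))
  refine ⟨p, hp, (K.isScalarRegge_iff).2 ⟨fun q hq => ?_, fun b hb => ?_⟩⟩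
  · rw [integral_fn_polyH1, h1 q hq]
  · rw [integral_traceL_polyH1, h2 b hb]

theorem isScalarRegge_unique {r : ℕ} {T : K.Tri} {i : Fin 3} {f : H1 (K.cell T)} {p p' : MvP}
    (hp : p ∈ Poly r) (hp' : p' ∈ Poly r) (h : K.IsScalarRegge r T i f (K.polyH1 T p))
    (h' : K.IsScalarRegge r T i f (K.polyH1 T p')) : p = p' := by
  obtain ⟨h1, h2⟩ := K.isScalarRegge_iff.1 h
  obtain ⟨h1', h2'⟩ := K.isScalarRegge_iff.1 h'
  refine sub_eq_zero.1 (K.reggeScalar_unique T i (sub_mem hp hp') (fun q hq => ?_) fun b hb => ?_)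
  · have hi : ∀ a, Integrable (fun x => pval a x * pval q x) (volume.restrict (K.cell T)) :=
      fun a => (K.memLp_cell T (pval_continuous a)).integrable_mul (K.memLp_cell T (pval_continuous q))
    have e := (h1 q hq).trans (h1' q hq).symm
    rw [integral_fn_polyH1, integral_fn_polyH1] at e
    simp only [pval_sub, sub_mul]
    rw [integral_sub (hi p) (hi p'), e, sub_self]
  · have hi : ∀ a : Polynomial ℝ, Integrable (fun s => a.eval s * b.eval s) I01 :=
      fun a => (memLp_I01 a.continuous).integrable_mul (memLp_I01 b.continuous)
    have e := (h2 b hb).trans (h2' b hb).symm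
    rw [integral_traceL_polyH1, integral_traceL_polyH1] at e
    simp only [map_sub, Polynomial.eval_sub, sub_mul]
    rw [integral_sub (hi _) (hi _), e, sub_self]

/-- The interpolants of functions with matching traces on a common side have matching traces. -/
theorem isScalarRegge_glued {r : ℕ} {T T' : K.Tri} {i j : Fin 3} {f : H1 (K.cell T)}
    {f' : H1 (K.cell T')} {p p' : MvP} (hp : p ∈ Poly r) (hp' : p' ∈ Poly r)
    (h : K.IsScalarRegge r T i f (K.polyH1 T p)) (h' : K.IsScalarRegge r T' j f' (K.polyH1 T' p'))
    (hff : ∀ᵐ s ∂I01, K.traceL T i f s = K.traceL T' j f' (1 - s)) (s : ℝ) :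
    (edgeP (K.pos T) i p).eval s = (edgeP (K.pos T') j p').eval (1 - s) := by
  have hcomp : ∀ {a : Polynomial ℝ}, a.natDegree ≤ r →
      (a.comp (1 - Polynomial.X)).natDegree ≤ r := fun {a} ha => by
    refine Polynomial.natDegree_comp_le.trans ?_
    refine (Nat.mul_le_mul ha (show (1 - Polynomial.X : Polynomial ℝ).natDegree ≤ 1 by
      compute_degree)).trans (by omega)
  have hev : ∀ (a : Polynomial ℝ) (s : ℝ), (a.comp (1 - Polynomial.X)).eval s = a.eval (1 - s) :=
    fun a s => by simp
  -- The two restrictions, one of them reparametrized, solve the same moment problem on the side,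
  -- and this problem has only one solution.
  have hu := existsUnique_poly₁ (w := fun _ => 1) continuous_const (fun _ _ => one_pos) (r + 1)
    (Lp.memLp (K.traceL T i f))
  have := hu.unique
    (y₁ := ⟨edgeP (K.pos T) i p, mem_PolyLt₁_of_lt (Nat.lt_succ_of_le (natDegree_edgeP hp i))⟩)
    (y₂ := ⟨(edgeP (K.pos T') j p').comp (1 - Polynomial.X), mem_PolyLt₁_of_lt (Nat.lt_succ_of_le (hcomp (natDegree_edgeP hp' j)))⟩)
    (fun b => ?_) (fun b => ?_)
  · have e := congrArg (fun a : PolyLt₁ (r + 1) => a.1.eval s) this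
    simpa only [hev] using e
  · rw [← (K.isScalarRegge_iff.1 h).2 b.1 b.2, integral_traceL_polyH1]
    simp only [one_mul]
  · have hb' : b.1.comp (1 - Polynomial.X) ∈ PolyLt₁ (r + 1) := by
      refine mem_PolyLt₁_of_lt (Nat.lt_succ_of_le (hcomp ?_))
      rcases natDegree_lt_of_mem_PolyLt₁ b.2 with h0 | h0
      · simp [h0]
      · omega
    have e := (K.isScalarRegge_iff.1 h').2 _ hb'
    rw [integral_traceL_polyH1, ← integral_reflect, ← integral_reflect fun s =>
      K.traceL T' j f' s * _] at e
    simp only [hev, sub_sub_cancel] at e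
    simp only [hev, one_mul]
    rw [e]
    refine integral_congr_ae ?_
    filter_upwards [hff] with s hs
    rw [hs]

/-! ### Symmetric tensors in terms of their values on the sides -/

/-- The coefficients of the symmetric tensors dual to the values on the tangent vectors of the
sides. -/
def dualT (T : K.Tri) (i : Fin 3) (a b : Fin 2) : ℝ :=
  -(K.edgeConormal T (i + 1) a * K.edgeConormal T (i + 2) b +
    K.edgeConormal T (i + 2) a * K.edgeConormal T (i + 1) b) / (2 * tdet (K.pos T) ^ 2)

theorem dualT_comm (T : K.Tri) (i : Fin 3) (a b : Fin 2) : K.dualT T i a b = K.dualT T i b a := by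
  simp only [dualT]; ring

/-- The conormal of a side annihilates its tangent vector, so the symmetric product of the conormals
of the sides `i + 1` and `i + 2` vanishes on the tangents of both. On the tangent of the side `i`
the two conormals have the values `tdet` and `-tdet` up to order, which explains the sign and the
denominator in `dualT`. -/
theorem sum_dualT_edgeVec (T : K.Tri) (i j : Fin 3) :
    ∑ c : Fin 2 × Fin 2, K.edgeVec T j c.1 * K.edgeVec T j c.2 * K.dualT T i c.1 c.2 =
      if i = j then 1 else 0 := by
  have hD := (K.tdet_pos T).ne'
  simp only [Fintype.sum_prod_type, Fin.sum_univ_two, dualT]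
  field_simp
  simp only [edgeConormal, edgeVec, tdet, cross]
  fin_cases i <;> fin_cases j <;> simp <;> ring

/-- The right side is the projection to symmetric tensors: three tensors dual to three functionals
form a basis of this three-dimensional space. -/
theorem sum_dualT (T : K.Tri) (a b c d : Fin 2) :
    ∑ i, K.dualT T i a b * (K.edgeVec T i c * K.edgeVec T i d) =
      ((if a = c then 1 else 0) * (if b = d then 1 else 0) +
        (if a = d then 1 else 0) * (if b = c then 1 else 0)) / 2 := by
  have hD := (K.tdet_pos T).ne'
  simp only [Fin.sum_univ_three, dualT]
  field_simp
  simp only [edgeConormal, edgeVec, tdet, cross]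
  fin_cases a <;> fin_cases b <;> fin_cases c <;> fin_cases d <;> simp <;> ring

/-- The value `σ(e, e)` of a tensor on the tangent vector of a side, as a function in the
triangle. -/
def edgeForm {M : Type*} [AddCommGroup M] [Module ℝ M] (T : K.Tri) (i : Fin 3)
    (σ : Fin 2 → Fin 2 → M) : M :=
  ∑ c : Fin 2 × Fin 2, (K.edgeVec T i c.1 * K.edgeVec T i c.2) • σ c.1 c.2

theorem sum_dualT_edgeForm {M : Type*} [AddCommGroup M] [Module ℝ M] (T : K.Tri)
    {σ : Fin 2 → Fin 2 → M} (hσ : ∀ a b, σ a b = σ b a) (a b : Fin 2) :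
    ∑ i, K.dualT T i a b • K.edgeForm T i σ = σ a b := by
  simp only [edgeForm, Finset.smul_sum, smul_smul]
  rw [Finset.sum_comm]
  simp only [← Finset.sum_smul, sum_dualT, Fintype.sum_prod_type, Fin.sum_univ_two]
  have h := hσ 1 0
  have key : (2⁻¹ : ℝ) • σ 0 1 + (2⁻¹ : ℝ) • σ 0 1 = σ 0 1 := by rw [← add_smul]; norm_num
  fin_cases a <;> fin_cases b <;> simp [h, key]

theorem edgeForm_dualT {M : Type*} [AddCommGroup M] [Module ℝ M] (T : K.Tri) (p : Fin 3 → M)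
    (j : Fin 3) : K.edgeForm T j (fun a b => ∑ i, K.dualT T i a b • p i) = p j := by
  simp only [edgeForm, Finset.smul_sum, smul_smul]
  rw [Finset.sum_comm]
  simp only [← Finset.sum_smul, sum_dualT_edgeVec]
  simp

theorem tanL₂_ae (T : K.Tri) (i : Fin 3) (σ : Fin 2 → Fin 2 → H1 (K.cell T)) :
    K.tanL₂ T i σ =ᵐ[I01] K.traceL T i (K.edgeForm T i σ) := by
  filter_upwards [coeFn_lincomb (K.traceL T i)
    (fun c : Fin 2 × Fin 2 => K.edgeVec T i c.1 * K.edgeVec T i c.2) fun c => σ c.1 c.2] with s hs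
  rw [edgeForm, hs, tanL₂]
  simp only [Fintype.sum_prod_type, Fin.sum_univ_two]
  ring

theorem fn_edgeForm (T : K.Tri) (i : Fin 3) (σ : Fin 2 → Fin 2 → H1 (K.cell T)) :
    fn (K.edgeForm T i σ) =ᵐ[volume.restrict (K.cell T)]
      fun x => K.edgeForm T i fun a b => fn (σ a b) x := by
  filter_upwards [coeFn_lincomb fnL
    (fun c : Fin 2 × Fin 2 => K.edgeVec T i c.1 * K.edgeVec T i c.2) fun c => σ c.1 c.2] with x hx
  exact hx

theorem edgeForm_sub {M : Type*} [AddCommGroup M] [Module ℝ M] (T : K.Tri) (i : Fin 3)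
    (σ ρ : Fin 2 → Fin 2 → M) :
    K.edgeForm T i (fun a b => σ a b - ρ a b) = K.edgeForm T i σ - K.edgeForm T i ρ := by
  simp only [edgeForm, smul_sub, Finset.sum_sub_distrib]

theorem edgeForm_polyH1 (T : K.Tri) (i : Fin 3) (p : Fin 2 → Fin 2 → MvP) :
    K.edgeForm T i (fun a b => K.polyH1 T (p a b)) = K.polyH1 T (K.edgeForm T i p) := by
  simp only [edgeForm, map_sum, map_smul]

end TriangulatedSurface
end
end ReggeFEM
namespace ReggeFEM
noncomputable section
namespace TriangulatedSurface

variable {K : TriangulatedSurface}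

namespace ReggeMetric

variable (g : K.ReggeMetric)

/-! ### Piecewise constant metrics -/

variable {g}

theorem pos_mem_tri (T : K.Tri) (i : Fin 3) : K.pos T i ∈ K.tri T :=
  subset_convexHull ℝ _ (mem_range_self i)

theorem coeff_const (hg : g.IsPoly 0) {T : K.Tri} {x : Plane} (hx : x ∈ K.tri T) :
    g.coeff T x = g.coeff T (K.pos T 0) := by
  ext a b
  obtain ⟨p, hp, h⟩ := hg T a b
  rw [h x hx, h _ (pos_mem_tri T 0), MvPolynomial.totalDegree_eq_zero_iff_eq_C.1
    (Nat.le_zero.1 (mem_Poly.1 hp)), pval_C, pval_C]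

theorem inv_const (hg : g.IsPoly 0) {T : K.Tri} {x : Plane} (hx : x ∈ K.tri T) :
    g.inv T x = g.inv T (K.pos T 0) := by rw [inv, inv, coeff_const hg hx]

theorem vol_const (hg : g.IsPoly 0) {T : K.Tri} {x : Plane} (hx : x ∈ K.tri T) :
    g.vol T x = g.vol T (K.pos T 0) := by rw [vol, vol, coeff_const hg hx]

theorem edgeLen_const (hg : g.IsPoly 0) (T : K.Tri) (i : Fin 3) {s : ℝ} (hs : s ∈ Icc (0 : ℝ) 1) :
    g.edgeLen T i s = g.edgeLen T i 0 := by
  rw [edgeLen, edgeLen, edgeSq, edgeSq, coeff_const hg (K.edgePt_mem T i hs),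
    coeff_const hg (K.edgePt_mem T i (left_mem_Icc.2 zero_le_one))]

theorem normal_const (hg : g.IsPoly 0) (T : K.Tri) (i : Fin 3) {s : ℝ} (hs : s ∈ Icc (0 : ℝ) 1) :
    g.normal T i s = g.normal T i 0 := by
  funext a
  simp only [normal, inv_const hg (K.edgePt_mem T i hs),
    inv_const hg (K.edgePt_mem T i (left_mem_Icc.2 zero_le_one))]

theorem dcoeff_const (hg : g.IsPoly 0) {T : K.Tri} {x : Plane} (hx : x ∈ K.tri T)
    (c a b : Fin 2) : g.dcoeff T x c a b = 0 := by
  have e : EqOn (fun y => g.coeff T y a b) (fun _ => g.coeff T (K.pos T 0) a b) (K.tri T) :=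
    fun y hy => by simp only [coeff_const hg hy]
  rw [dcoeff, fderivWithin_congr e (e hx), fderivWithin_fun_const]
  rfl

theorem christoffel_const (hg : g.IsPoly 0) {T : K.Tri} {x : Plane} (hx : x ∈ K.tri T)
    (c a b : Fin 2) : g.christoffel T x c a b = 0 := by
  simp [christoffel, dcoeff_const hg hx]

theorem coeff_symm {T : K.Tri} {x : Plane} (hx : x ∈ K.tri T) (a b : Fin 2) :
    g.coeff T x a b = g.coeff T x b a := by
  have := (g.posDef T x hx).1.apply a b
  simpa using this.symm

theorem sum_inv_mul_coeff {T : K.Tri} {x : Plane} (hx : x ∈ K.tri T) (a b : Fin 2) :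
    ∑ c, g.inv T x a c * g.coeff T x c b = if a = b then 1 else 0 := by
  have := Matrix.nonsing_inv_mul (g.coeff T x) (g.det_pos hx).ne'.isUnit
  rw [← Matrix.mul_apply, inv, this, Matrix.one_apply]

/-! ### The conditions of the Regge interpolant -/

theorem sum_inner₂_dual (N P : Fin 2 → Fin 2 → ℝ) (E : Fin 3 → Fin 2 → Fin 2 → ℝ) (D : Fin 3 → ℝ)
    (v : ℝ) : (∑ a, ∑ b, ∑ c, ∑ d, N a c * N b d * (∑ i, E i a b * D i) * P c d) * v =
      ∑ i, D i * ∑ a, ∑ b, ∑ c, ∑ d, N a c * N b d * E i a b * v * P c d := by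
  simp only [Fin.sum_univ_two, Fin.sum_univ_three]
  ring

/-- A constant metric lets the tensor conditions decouple into scalar ones. To isolate `σ(e_i,
e_i)`, test with `q` times the square of the covector `m` obtained from `e_i` by lowering its index.
Conversely, the difference is expanded in the tensors `dualT`; their contractions with the test
tensor, raised by the metric, are polynomials `Q i` of degree less than `r`. -/
theorem interior_iff (hg : g.IsPoly 0) {r : ℕ} {T : K.Tri} {σ ρ : Fin 2 → Fin 2 → H1 (K.cell T)}
    (hσ : ∀ a b, σ a b = σ b a) (hρ : ∀ a b, ρ a b = ρ b a) :
    (∀ p : Fin 2 → Fin 2 → MvP, (∀ a b, p a b = p b a) → (∀ a b, (p a b).totalDegree < r) →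
      ∫ x in K.cell T, g.inner₂ T x (fun a b => fn (ρ a b) x - fn (σ a b) x)
        (fun a b => pval (p a b) x) * g.vol T x = 0) ↔
    ∀ i, ∀ q ∈ PolyLt r, ∫ x in K.cell T,
      (fn (K.edgeForm T i ρ) x - fn (K.edgeForm T i σ) x) * pval q x = 0 := by
  have hform : ∀ i, ∀ᵐ x ∂volume.restrict (K.cell T),
      fn (K.edgeForm T i ρ) x - fn (K.edgeForm T i σ) x =
        K.edgeForm T i fun a b => fn (ρ a b) x - fn (σ a b) x := fun i => by
    filter_upwards [K.fn_edgeForm T i ρ, K.fn_edgeForm T i σ] with x h1 h2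
    rw [h1, h2, edgeForm_sub]
  constructor
  · intro h i q hq
    rcases totalDegree_lt_of_mem_PolyLt hq with rfl | hq
    · simp
    set m : Fin 2 → ℝ := fun c => ∑ b, g.coeff T (K.pos T 0) c b * K.edgeVec T i b with hm
    have hv := (g.vol_pos (pos_mem_tri T 0)).ne'
    have h1 := h (fun c d => (m c * m d) • q) (fun a b => by rw [mul_comm]) (fun a b =>
      (MvPolynomial.totalDegree_smul_le _ _).trans_lt hq)
    have h2 : ∫ x in K.cell T, (fn (K.edgeForm T i ρ) x - fn (K.edgeForm T i σ) x) * pval q x *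
        g.vol T (K.pos T 0) = 0 := by
      rw [← h1]
      refine integral_congr_ae ?_
      filter_upwards [hform i, ae_mem_tri T] with x hx hxT
      rw [hx, vol_const hg hxT]
      congr 1
      have hN : ∀ a, ∑ c, g.inv T x a c * m c = K.edgeVec T i a := fun a => by
        simp only [hm, Finset.mul_sum, ← mul_assoc]
        rw [Finset.sum_comm]
        simp only [← Finset.sum_mul, ← coeff_const hg hxT, sum_inv_mul_coeff hxT]
        simp
      have hin : ∀ δ : Fin 2 → Fin 2 → ℝ, g.inner₂ T x δ (fun c d => pval ((m c * m d) • q) x) =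
          (∑ a, ∑ b, δ a b * (∑ c, g.inv T x a c * m c) * (∑ d, g.inv T x b d * m d)) *
            pval q x := fun δ => by
        simp only [inner₂, Fin.sum_univ_two, pval_smul]; ring
      rw [hin]
      simp only [hN, edgeForm, Fintype.sum_prod_type, smul_eq_mul, Fin.sum_univ_two]
      ring
    rw [integral_mul_const] at h2
    exact (mul_eq_zero.1 h2).resolve_right hv
  · intro h p _ hdeg
    set Q : Fin 3 → MvP := fun i => ∑ a, ∑ b, ∑ c, ∑ d, (g.inv T (K.pos T 0) a c *
      g.inv T (K.pos T 0) b d * K.dualT T i a b * g.vol T (K.pos T 0)) • p c d with hQ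
    have hQm : ∀ i, Q i ∈ PolyLt r := fun i => Submodule.sum_mem _ fun a _ =>
      Submodule.sum_mem _ fun b _ => Submodule.sum_mem _ fun c _ => Submodule.sum_mem _ fun d _ =>
        Submodule.smul_mem _ _ (mem_PolyLt_of_lt (hdeg c d))
    have hi : ∀ i, Integrable (fun x => (fn (K.edgeForm T i ρ) x - fn (K.edgeForm T i σ) x) *
        pval (Q i) x) (volume.restrict (K.cell T)) := fun i => by
      simp only [sub_mul]
      exact (K.integrable_fn_mul_pval T _ _).sub (K.integrable_fn_mul_pval T _ _)
    rw [show (0 : ℝ) = ∑ i, ∫ x in K.cell T, (fn (K.edgeForm T i ρ) x - fn (K.edgeForm T i σ) x) *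
        pval (Q i) x from (Finset.sum_eq_zero fun i _ => h i _ (hQm i)).symm,
      ← integral_finsetSum _ fun i _ => hi i]
    refine integral_congr_ae ?_
    filter_upwards [ae_all_iff.2 hform, ae_mem_tri T] with x hx hxT
    have hsym : ∀ a b, fn (ρ a b) x - fn (σ a b) x = fn (ρ b a) x - fn (σ b a) x := fun a b => by
      rw [hσ a b, hρ a b]
    have e : (fun a b => fn (ρ a b) x - fn (σ a b) x) = fun a b => ∑ i, K.dualT T i a b *
        (fn (K.edgeForm T i ρ) x - fn (K.edgeForm T i σ) x) := by
      funext a b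
      simp only [hx]
      exact (K.sum_dualT_edgeForm T hsym a b).symm
    rw [e, inner₂, inv_const hg hxT, vol_const hg hxT]
    simp only [hQ, pval_sum, pval_smul]
    exact sum_inner₂_dual _ _ _ _ _

theorem tautau_ae (T : K.Tri) (i : Fin 3) (σ : Fin 2 → Fin 2 → H1 (K.cell T)) :
    g.tautau T i σ =ᵐ[I01] fun s => K.traceL T i (K.edgeForm T i σ) s / g.edgeLen T i s ^ 2 := by
  have h := ae_all_iff.2 fun a => ae_all_iff.2 fun b => K.trace_ae T (σ a b) i
  filter_upwards [h, K.tanL₂_ae T i σ] with s hs h2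
  simp only [← h2, tautau, tanL₂, hs, tau, Fin.sum_univ_two]
  ring

/-- The length element is constant on a side, so the normalization of `τ` and the arc length
together contribute one nonzero factor. -/
theorem edge_iff (hg : g.IsPoly 0) {r : ℕ} {T : K.Tri} {i : Fin 3}
    {σ ρ : Fin 2 → Fin 2 → H1 (K.cell T)} :
    (∀ q : Polynomial ℝ, q.natDegree ≤ r → ∫ s in Icc (0 : ℝ) 1,
      (g.tautau T i ρ s - g.tautau T i σ s) * q.eval s * g.edgeLen T i s = 0) ↔
    ∀ b ∈ PolyLt₁ (r + 1), ∫ s, (K.traceL T i (K.edgeForm T i ρ) s -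
      K.traceL T i (K.edgeForm T i σ) s) * b.eval s ∂I01 = 0 := by
  have hl := (g.edgeLen_pos T i (left_mem_Icc.2 zero_le_one)).ne'
  have key : ∀ q : Polynomial ℝ, (∫ s in Icc (0 : ℝ) 1,
      (g.tautau T i ρ s - g.tautau T i σ s) * q.eval s * g.edgeLen T i s) =
      (∫ s, (K.traceL T i (K.edgeForm T i ρ) s -
      K.traceL T i (K.edgeForm T i σ) s) * q.eval s ∂I01) * (g.edgeLen T i 0)⁻¹ := fun q => by
    rw [← integral_mul_const]
    refine integral_congr_ae ?_
    filter_upwards [tautau_ae T i ρ, tautau_ae (g := g) T i σ, ae_restrict_mem measurableSet_Icc]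
      with s h1 h2 hs
    rw [h1, h2, edgeLen_const hg T i hs]
    field_simp
  have hz : ∀ q : Polynomial ℝ, (∫ s in Icc (0 : ℝ) 1,
      (g.tautau T i ρ s - g.tautau T i σ s) * q.eval s * g.edgeLen T i s) = 0 ↔
      ∫ s, (K.traceL T i (K.edgeForm T i ρ) s -
      K.traceL T i (K.edgeForm T i σ) s) * q.eval s ∂I01 = 0 := fun q => by
    rw [key q, mul_eq_zero]
    exact or_iff_left (inv_ne_zero hl)
  constructor
  · intro h b hb
    rw [← hz]
    refine h b ?_
    rcases natDegree_lt_of_mem_PolyLt₁ hb with h | h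
    · simp [h]
    · omega
  · intro h q hq
    rw [hz]
    exact h q (mem_PolyLt₁_of_lt (by omega))

theorem isPiSigma_iff (hg : g.IsPoly 0) {r : ℕ} {σ : K.Sigma} {ρ : K.Sigmah r} :
    g.IsPiSigma r σ ρ ↔ ∀ T i, K.IsScalarRegge r T i (K.edgeForm T i (σ.1 T))
      (K.edgeForm T i (ρ.1.1 T)) := by
  have hσ := (K.mem_Sigma_iff.1 σ.2).1
  have hρ := (K.mem_Sigma_iff.1 ρ.1.2).1
  constructor
  · intro h T i
    exact ⟨(interior_iff hg (hσ T) (hρ T)).1 (h.interior T) i, (edge_iff hg).1 (h.edge T i)⟩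
  · intro h
    exact ⟨fun T => (interior_iff hg (hσ T) (hρ T)).2 fun i => (h T i).1,
      fun T i => (edge_iff hg).2 (h T i).2⟩

/-- Three scalar problems on every triangle, assembled with the dual tensors. The result is
single-valued because the interpolant of `σ(e, e)` on a common side is determined by the common
values there. -/
theorem existsUnique_isPiSigma (hg : g.IsPoly 0) (r : ℕ) (σ : K.Sigma) :
    ∃! ρ, g.IsPiSigma r σ ρ := by
  choose p hp hps using fun T i => K.exists_isScalarRegge r T i (K.edgeForm T i (σ.1 T))
  have hpoly : ∀ T a b, ∑ i, K.dualT T i a b • p T i ∈ Poly r := fun T a b =>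
    Submodule.sum_mem _ fun i _ => Submodule.smul_mem _ _ (hp T i)
  have hform : ∀ T i, K.edgeForm T i (fun a b => K.polyH1 T (∑ i, K.dualT T i a b • p T i)) =
      K.polyH1 T (p T i) := fun T i => by rw [edgeForm_polyH1, edgeForm_dualT]
  let ρ : K.Sigmah r := ⟨⟨fun T a b => K.polyH1 T (∑ i, K.dualT T i a b • p T i),
    K.mem_Sigma_iff.2 ⟨fun T a b => by simp only [K.dualT_comm T _ a b], fun T i T' j h => by
      filter_upwards [K.tanL₂_ae T i (fun a b => K.polyH1 T (∑ i, K.dualT T i a b • p T i)),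
        ae_reflect (K.tanL₂_ae T' j (fun a b => K.polyH1 T' (∑ i, K.dualT T' i a b • p T' i))),
        K.traceL_polyH1 T (p T i) i, ae_reflect (K.traceL_polyH1 T' (p T' j) j)] with s h1 h2 h3 h4
      rw [h1, h2, hform, hform, h3, h4]
      refine K.isScalarRegge_glued (hp T i) (hp T' j) (hps T i) (hps T' j) ?_ s
      filter_upwards [(K.mem_Sigma_iff.1 σ.2).2 T i T' j h, K.tanL₂_ae T i (σ.1 T),
        ae_reflect (K.tanL₂_ae T' j (σ.1 T'))] with s e1 e2 e3
      rw [← e2, ← e3, e1]⟩⟩,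
    fun T a b => K.fn_polyH1_mem T (hpoly T a b)⟩
  refine ⟨ρ, (isPiSigma_iff hg).2 fun T i => ?_, fun ρ' hρ' => ?_⟩
  · rw [show K.edgeForm T i (ρ.1.1 T) = K.polyH1 T (p T i) from hform T i]
    exact hps T i
  · refine Subtype.ext (Subtype.ext (funext fun T => funext fun a => funext fun b => ?_))
    rw [← K.sum_dualT_edgeForm T ((K.mem_Sigma_iff.1 ρ'.1.2).1 T) a b,
      ← K.sum_dualT_edgeForm T ((K.mem_Sigma_iff.1 ρ.1.2).1 T) a b]
    refine Finset.sum_congr rfl fun i _ => ?_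
    congr 1
    choose q hq hqe using fun a b => K.exists_polyH1 T (ρ'.2 T a b)
    have e : K.edgeForm T i (ρ'.1.1 T) = K.polyH1 T (K.edgeForm T i q) := by
      rw [← edgeForm_polyH1]
      congr 1
      funext a b; exact hqe a b
    have h1 := (isPiSigma_iff hg).1 hρ' T i
    rw [e] at h1 ⊢
    rw [show K.edgeForm T i (ρ.1.1 T) = K.polyH1 T (p T i) from hform T i]
    congr 1
    refine K.isScalarRegge_unique ?_ (hp T i) h1 (hps T i)
    exact Submodule.sum_mem _ fun c _ => Submodule.smul_mem _ _ (hq c.1 c.2)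

theorem piSigma_spec (hg : g.IsPoly 0) (r : ℕ) (σ : K.Sigma) :
    g.IsPiSigma r σ (g.piSigma r σ) :=
  Classical.epsilon_spec (existsUnique_isPiSigma hg r σ).exists

/-! ### The interpolant commutes with the discrete operator -/

/-- The form sees a metric only on the closed triangles, derivatives included, since these are taken
within the triangle. -/
theorem Agree.ch_eq {g' : K.ReggeMetric} (h : g.Agree g') (σ : K.Sigma) (α : K.W) :
    g.ch σ α = g'.ch σ α := by
  have hinv : ∀ {T x}, x ∈ K.tri T → g.inv T x = g'.inv T x := fun {T x} hx => by
    rw [inv, inv, h T hx]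
  have hd : ∀ {T x}, x ∈ K.tri T → g.dcoeff T x = g'.dcoeff T x := fun {T x} hx => by
    funext c a b
    rw [dcoeff, dcoeff, fderivWithin_congr (fun y hy => by rw [h T hy]) (by rw [h T hx])]
  have hlen : ∀ {T i s}, s ∈ Icc (0 : ℝ) 1 → g.edgeLen T i s = g'.edgeLen T i s :=
    fun {T i s} hs => by rw [edgeLen, edgeLen, edgeSq, edgeSq, h T (K.edgePt_mem T i hs)]
  refine congrArg₂ (· + ·) (Finset.sum_congr rfl fun T _ => integral_congr_ae ?_)
    (Finset.sum_congr rfl fun T _ => Finset.sum_congr rfl fun i _ => integral_congr_ae ?_)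
  · filter_upwards [ae_mem_tri T] with x hx
    unfold inner₂ S covDeriv christoffel vol
    rw [hinv hx, hd hx, h T hx]
  · filter_upwards [ae_restrict_mem measurableSet_Icc] with s hs
    unfold tautau normalComp normal tau
    rw [hlen hs, hinv (K.edgePt_mem T i hs)]

/-- Since `⟨g, B⟩ = Tr B`, both sides equal `⟨A, B⟩ - Tr A Tr B`. This moves `S` from the tensor, of
which only moments are preserved, to the polynomial Hessian. -/
theorem inner₂_S_comm {T : K.Tri} {x : Plane} (hx : x ∈ K.tri T) (A B : Fin 2 → Fin 2 → ℝ) :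
    g.inner₂ T x (g.S T x A) B = g.inner₂ T x A (g.S T x B) := by
  have hc : ∀ c d, ∑ a, ∑ b, g.inv T x a c * g.inv T x b d * g.coeff T x a b =
      g.inv T x c d := fun c d => by
    have h1 : ∀ b, ∑ a, g.inv T x a c * g.coeff T x a b = if c = b then 1 else 0 := fun b => by
      rw [← sum_inv_mul_coeff hx c b]
      exact Finset.sum_congr rfl fun a _ => by rw [g.inv_symm hx a c]
    rw [Finset.sum_comm]
    have h2 : ∀ b, ∑ a, g.inv T x a c * g.inv T x b d * g.coeff T x a b =
        g.inv T x b d * if c = b then 1 else 0 := fun b => by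
      rw [← h1 b, Finset.mul_sum]
      exact Finset.sum_congr rfl fun a _ => by ring
    simp only [h2]
    simp
  have hc' : ∀ c d, ∑ a, ∑ b, g.inv T x c a * g.inv T x d b * g.coeff T x a b =
      g.inv T x c d := fun c d => by
    rw [← hc c d]
    refine Finset.sum_congr rfl fun a _ => Finset.sum_congr rfl fun b _ => ?_
    rw [g.inv_symm hx a c, g.inv_symm hx b d]
  have hL : g.inner₂ T x (g.S T x A) B = g.inner₂ T x A B -
      (∑ c, ∑ d, g.inv T x c d * A c d) * ∑ c, ∑ d, (∑ a, ∑ b, g.inv T x a c * g.inv T x b d *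
        g.coeff T x a b) * B c d := by
    simp only [inner₂, S, Fin.sum_univ_two]; ring
  have hR : g.inner₂ T x A (g.S T x B) = g.inner₂ T x A B -
      (∑ c, ∑ d, g.inv T x c d * B c d) * ∑ c, ∑ d, (∑ a, ∑ b, g.inv T x c a * g.inv T x d b *
        g.coeff T x a b) * A c d := by
    simp only [inner₂, S, Fin.sum_univ_two]; ring
  rw [hL, hR]
  simp only [hc, hc']
  ring

/-- The form `ch` does not distinguish a tensor from its Regge interpolant if it is tested with
the gradients of finite element functions. -/
theorem ch_piSigma (hg : g.IsPoly 0) {r : ℕ} {σ : K.Sigma} {ρ : K.Sigmah r}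
    (h : g.IsPiSigma r σ ρ) {v : K.V} (hv : v ∈ K.Vh (r + 1)) :
    g.ch ρ (K.dL v) = g.ch σ (K.dL v) := by
  choose p hp hpv using fun T => K.exists_polyH2 T (hv T)
  have hd : ∀ T k, (K.dL v).1 T k = K.polyH1 T (MvPolynomial.pderiv k (p T)) := fun T k => by
    rw [← wdH1_polyH2, ← hpv T]; rfl
  have hdeg : ∀ T k, MvPolynomial.pderiv k (p T) ∈ Poly r := fun T k => pderiv_mem_PolyLt (hp T) k
  refine congrArg₂ (· + ·) (Finset.sum_congr rfl fun T _ => ?_)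
    (Finset.sum_congr rfl fun T _ => Finset.sum_congr rfl fun i _ => ?_)
  · rw [← sub_eq_zero, ← integral_sub ((g.isIntFunctional_ch_cell T _).1 _)
      ((g.isIntFunctional_ch_cell T _).1 _)]
    set H : Fin 2 → Fin 2 → MvP := fun a b => MvPolynomial.pderiv a (MvPolynomial.pderiv b (p T))
    have hH : ∀ a b, H a b ∈ PolyLt r := fun a b => pderiv_mem_PolyLt (hdeg T b) a
    have hHs : ∀ a b, H a b = H b a := fun a b => by
      refine pval_ext fun x => ?_
      simp only [H, ← pd_pval]
      rw [pd_comm (pval_contDiff _)]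
    -- For a constant metric `∇dv` is the plain Hessian `H`, and `q = SH` is again a symmetric
    -- polynomial tensor of degree less than `r`: a test tensor of the interpolant.
    set q : Fin 2 → Fin 2 → MvP := fun a b => H a b - g.coeff T (K.pos T 0) a b •
      ∑ c, ∑ d, g.inv T (K.pos T 0) c d • H c d with hq
    have hqm : ∀ a b, q a b ∈ PolyLt r := fun a b => sub_mem (hH a b) (Submodule.smul_mem _ _
      (Submodule.sum_mem _ fun c _ => Submodule.sum_mem _ fun d _ =>
        Submodule.smul_mem _ _ (hH c d)))
    have key : ∫ x in K.cell T, g.inner₂ T x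
        (fun a b => fn (ρ.1.1 T a b) x - fn (σ.1 T a b) x) (fun a b => pval (q a b) x) *
        g.vol T x = 0 := by
      -- For `r = 0` the interior conditions are empty, since no polynomial has `totalDegree < 0`,
      -- and `q` is zero. A nonzero component forces `r > 0`, and then the zero components satisfy
      -- the strict inequality as well.
      by_cases h0 : ∀ a b, q a b = 0
      · simp [h0, inner₂]
      · refine h.interior T q (fun a b => by
          simp only [hq, hHs a b, coeff_symm (pos_mem_tri T 0) a b]) fun a b => ?_
        push Not at h0
        obtain ⟨c, d, hcd⟩ := h0
        have hr := (totalDegree_lt_of_mem_PolyLt (hqm c d)).resolve_left hcd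
        rcases totalDegree_lt_of_mem_PolyLt (hqm a b) with h0 | h0
        · rw [h0, MvPolynomial.totalDegree_zero]; omega
        · exact h0
    rw [← key]
    refine integral_congr_ae ?_
    filter_upwards [ae_mem_tri T, ae_all_iff.2 fun a => ae_all_iff.2 fun b =>
      K.wd_polyH1 T (MvPolynomial.pderiv b (p T)) a] with x hx hwd
    have hcov : g.covDeriv T ((K.dL v).1 T) x = fun a b => pval (H a b) x := by
      funext a b
      simp only [covDeriv, christoffel_const hg hx, zero_mul, Finset.sum_const_zero, sub_zero, hd]
      exact hwd a b
    have hS : g.S T x (fun a b => pval (H a b) x) = fun a b => pval (q a b) x := by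
      funext a b
      simp only [S, hq, pval_sub, pval_smul, pval_sum, coeff_const hg hx, inv_const hg hx]
    rw [hcov, inner₂_S_comm hx, inner₂_S_comm hx, hS, ← sub_mul]
    congr 1
    simp only [inner₂, Fin.sum_univ_two]
    ring
  · rw [← sub_eq_zero, ← integral_sub ((g.isIntFunctional_ch_side T i _).1 _)
      ((g.isIntFunctional_ch_side T i _).1 _)]
    -- The normal is constant along the side, so `dv(n)` is there a polynomial of degree at most
    -- `r`.
    have key := h.edge T i (∑ a, g.normal T i 0 a •
      edgeP (K.pos T) i (MvPolynomial.pderiv a (p T))) (Polynomial.natDegree_sum_le_of_forall_le _ _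
        fun a _ => (Polynomial.natDegree_smul_le _ _).trans (natDegree_edgeP (hdeg T a) i))
    rw [← key]
    refine integral_congr_ae ?_
    filter_upwards [ae_restrict_mem measurableSet_Icc, ae_all_iff.2 fun a =>
      (K.trace_ae T (K.polyH1 T (MvPolynomial.pderiv a (p T))) i).trans (K.traceL_polyH1 T _ i)]
      with s hs ht
    simp only [normalComp, hd, ht, normal_const hg T i hs,
      Polynomial.eval_smul, smul_eq_mul, Fin.sum_univ_two, Polynomial.eval_add]
    ring

theorem divDivSh_piSigma {gh gbar : K.ReggeMetric} (hgbar : gbar.IsPoly 0) (h : g.Agree gh)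
    (h' : gh.Agree gbar) (r : ℕ) (σ : K.Sigma) :
    gh.divDivSh r (gbar.piSigma r σ) = gh.piV r (g.divDivSDist σ) := by
  refine gh.divDivSh_eq_piV r fun v => ?_
  rw [h'.ch_eq, ch_piSigma hgbar (piSigma_spec hgbar r σ) v.2, divDivSDist_apply, h.ch_eq, h'.ch_eq]

end ReggeMetric
end TriangulatedSurface
end
end ReggeFEM
namespace ReggeFEM
noncomputable section
namespace TriangulatedSurface

variable {K : TriangulatedSurface}

/-! ### Sides of planar triangulations -/

theorem IsPlanar.pos_eq (hK : K.IsPlanar) {T T' : K.Tri} {i j : Fin 3} (h : K.Glued T i T' j) :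
    K.pos T (i + 1) = K.pos T' (j + 2) ∧ K.pos T (i + 2) = K.pos T' (j + 1) := by
  obtain ⟨p, hp, -⟩ := hK
  simp only [hp, h.1, h.2, and_self]

section glued

variable {T T' : K.Tri} {i j : Fin 3}
  (h : K.pos T (i + 1) = K.pos T' (j + 2) ∧ K.pos T (i + 2) = K.pos T' (j + 1))

include h

theorem edgeVec_glued : K.edgeVec T' j = -K.edgeVec T i := by
  simp [edgeVec, h.1, h.2]

theorem edgePt_glued (s : ℝ) : K.edgePt T' j (1 - s) = K.edgePt T i s := by
  rw [edgePt, edgePt, edgeVec_glued h, ← h.2, edgeVec]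
  module

theorem edgeConormal_glued (k : Fin 2) : K.edgeConormal T' j k = -K.edgeConormal T i k := by
  rw [edgeConormal, edgeConormal, edgeVec_glued h]
  fin_cases k <;> simp

/-- Both sides are cross products with the common edge, which is run through in opposite directions.
So the two triangles lie on different sides of the edge. -/
theorem lam_glued (x : Plane) :
    lam (K.pos T') j x * tdet (K.pos T') = -(lam (K.pos T) i x * tdet (K.pos T)) := by
  rw [lam, lam, div_mul_cancel₀ _ (K.tdet_pos T').ne', div_mul_cancel₀ _ (K.tdet_pos T).ne',
    ← h.1, ← h.2]
  simp [cross]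
  ring

end glued

/-- The open neighbourhood of an interior side on which four barycentric coordinates are
positive. -/
def kite (T : K.Tri) (i : Fin 3) (T' : K.Tri) (j : Fin 3) : Set Plane :=
  {x | (0 < lam (K.pos T) (i + 1) x ∧ 0 < lam (K.pos T) (i + 2) x) ∧
    0 < lam (K.pos T') (j + 1) x ∧ 0 < lam (K.pos T') (j + 2) x}

theorem isOpen_kite (T : K.Tri) (i : Fin 3) (T' : K.Tri) (j : Fin 3) : IsOpen (kite T i T' j) := by
  have ho : ∀ (T : K.Tri) i, IsOpen {x | 0 < lam (K.pos T) i x} := fun T i =>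
    isOpen_lt continuous_const (lam_continuous _ i)
  exact ((ho T _).inter (ho T _)).inter ((ho T' _).inter (ho T' _))

theorem mem_cell_iff {T : K.Tri} {x : Plane} : x ∈ K.cell T ↔ ∀ i, 0 < lam (K.pos T) i x := by
  rw [cell_eq]; rfl

theorem mem_tri_iff {T : K.Tri} {x : Plane} : x ∈ K.tri T ↔ ∀ i, 0 ≤ lam (K.pos T) i x :=
  mem_convexHull_iff (K.tdet_pos T) x

theorem forall_fin3 {p : Fin 3 → Prop} (i : Fin 3) (h0 : p i) (h1 : p (i + 1)) (h2 : p (i + 2))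
    (j : Fin 3) : p j := by
  rcases fin3_cases i j with rfl | rfl | rfl <;> assumption

theorem volume_tri_sdiff_cell (T : K.Tri) : volume (K.tri T \ K.cell T) = 0 := by
  have h : frontier (K.tri T) = K.tri T \ K.cell T := (K.tri_compact T).isClosed.frontier_eq
  rw [← h]
  exact (convex_convexHull ℝ _).addHaar_frontier volume

section kite

variable {T T' : K.Tri} {i j : Fin 3}
  (h : K.pos T (i + 1) = K.pos T' (j + 2) ∧ K.pos T (i + 2) = K.pos T' (j + 1))

include h

/-- Depending on the sign of `λ_i`, a point of the kite has nonnegative coordinates in one triangle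
or, by `lam_glued`, in the other. The kite is thus an open neighbourhood of the open side that
involves no third triangle. -/
theorem kite_subset_union : kite T i T' j ⊆ K.tri T ∪ K.tri T' := by
  rintro x ⟨⟨h1, h2⟩, h3, h4⟩
  rcases le_or_gt 0 (lam (K.pos T) i x) with h0 | h0
  · exact Or.inl (mem_tri_iff.2 (forall_fin3 i h0 h1.le h2.le))
  · refine Or.inr (mem_tri_iff.2 (forall_fin3 j ?_ h3.le h4.le))
    have := lam_glued h x
    refine le_of_mul_le_mul_right ?_ (K.tdet_pos T')
    rw [this, zero_mul]
    nlinarith [K.tdet_pos T]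

theorem kite_subset_domain : kite T i T' j ⊆ K.domain :=
  interior_maximal ((kite_subset_union h).trans
    (union_subset (subset_iUnion _ T) (subset_iUnion _ T'))) (isOpen_kite T i T' j)

theorem edgePt_mem_kite {s : ℝ} (hs : s ∈ Ioo (0 : ℝ) 1) : K.edgePt T i s ∈ kite T i T' j := by
  obtain ⟨-, h1, h2⟩ := K.lam_edgePt T i s
  obtain ⟨-, h3, h4⟩ := K.lam_edgePt T' j (1 - s)
  rw [edgePt_glued h] at h3 h4
  refine ⟨⟨?_, ?_⟩, ?_, ?_⟩
  · rw [h1]; linarith [hs.2]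
  · rw [h2]; exact hs.1
  · rw [h3]; linarith [hs.1]
  · rw [h4]; linarith [hs.2]

theorem disjoint_cells : Disjoint (K.cell T) (K.cell T') := by
  refine disjoint_left.2 fun x hx hx' => ?_
  have h1 := mem_cell_iff.1 hx i
  have h2 := mem_cell_iff.1 hx' j
  have := lam_glued h x
  nlinarith [mul_pos h1 (K.tdet_pos T), mul_pos h2 (K.tdet_pos T')]

theorem setIntegral_kite {G : Plane → ℝ} (hG : IntegrableOn G K.domain)
    (h0 : ∀ x, x ∉ kite T i T' j → G x = 0) :
    ∫ x in K.domain, G x = (∫ x in K.cell T, G x) + ∫ x in K.cell T', G x := by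
  have hsub : ∀ T, K.cell T ⊆ K.domain := fun T => interior_mono (subset_iUnion _ T)
  rw [← setIntegral_union (disjoint_cells h) isOpen_interior.measurableSet (hG.mono_set (hsub T))
    (hG.mono_set (hsub T'))]
  refine (setIntegral_eq_of_subset_of_ae_sdiff_eq_zero isOpen_interior.measurableSet.nullMeasurableSet
    (union_subset (hsub T) (hsub T')) ?_)
  have hn : ∀ T : K.Tri, ∀ᵐ x : Plane, x ∉ K.tri T \ K.cell T := fun T =>
    measure_eq_zero_iff_ae_notMem.1 (volume_tri_sdiff_cell T)
  filter_upwards [hn T, hn T'] with x h1 h2 hx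
  refine h0 x fun hk => ?_
  rcases kite_subset_union h hk with hx1 | hx1
  · exact h1 ⟨hx1, fun hc => hx.2 (Or.inl hc)⟩
  · exact h2 ⟨hx1, fun hc => hx.2 (Or.inr hc)⟩

end kite

open scoped Manifold in
/-- Extension of test functions from a side to the plane. -/
theorem exists_isTest_edgePt (T : K.Tri) (i : Fin 3) {O : Set Plane} (hO : IsOpen O)
    (hb : Bornology.IsBounded O) (hsub : ∀ s ∈ Ioo (0 : ℝ) 1, K.edgePt T i s ∈ O) {η : ℝ → ℝ}
    (hη : ContDiff ℝ ∞ η) (hs : tsupport η ⊆ Ioo 0 1) :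
    ∃ φ, IsTest O φ ∧ ∀ s, φ (K.edgePt T i s) = η s := by
  have hc : IsCompact (tsupport η) :=
    isCompact_Icc.of_isClosed_subset (isClosed_tsupport η) (hs.trans Ioo_subset_Icc_self)
  have ht : IsClosed (K.edgePt T i '' tsupport η) := (hc.image (K.edgePt_continuous T i)).isClosed
  -- The function `η(λ_{i+2})` already restricts to `η` on the side; the cutoff `χ` confines it to
  -- `O` and is 1 near the image of the support of `η`.
  obtain ⟨χ, h0, h1, -⟩ := exists_contMDiffMap_zero_one_nhds_of_isClosed (n := (⊤ : ℕ∞)) 𝓘(ℝ, Plane)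
    hO.isClosed_compl ht (by
      refine disjoint_left.2 fun x hx hx' => ?_
      obtain ⟨s, hs', rfl⟩ := hx'
      exact hx (hsub s (hs hs')))
  have hχ : ContDiff ℝ ∞ χ := χ.contMDiff.contDiff
  have hsupp : tsupport χ ⊆ O := by
    intro x hx
    by_contra hxO
    exact (notMem_tsupport_iff_eventuallyEq.2 (Filter.Eventually.filter_mono
      (nhds_le_nhdsSet hxO) h0)) hx
  have hsupp' : tsupport (fun x => χ x * η (lam (K.pos T) (i + 2) x)) ⊆ O :=
    (tsupport_mul_subset_left).trans hsupp
  refine ⟨fun x => χ x * η (lam (K.pos T) (i + 2) x), ⟨hχ.mul (hη.comp (lam_contDiff _ _)), ?_, hsupp'⟩,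
    fun s => ?_⟩
  · exact (hb.isCompact_closure).of_isClosed_subset (isClosed_tsupport _)
      (hsupp'.trans subset_closure)
  · simp only [(K.lam_edgePt T i s).2.2]
    by_cases hs' : s ∈ tsupport η
    · rw [(Filter.Eventually.self_of_nhdsSet h1) _ (mem_image_of_mem _ hs'), one_mul]
    · rw [image_eq_zero_of_notMem_tsupport hs', mul_zero]

theorem isOpen_domain : IsOpen K.domain := isOpen_interior

theorem cell_subset_domain (T : K.Tri) : K.cell T ⊆ K.domain :=
  interior_mono (subset_iUnion _ T)

theorem wd_ae_of_fn_ae {T : K.Tri} {F : H1 K.domain} {f : H1 (K.cell T)}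
    (h : fn F =ᵐ[volume.restrict (K.cell T)] fn f) (k : Fin 2) :
    wd F k =ᵐ[volume.restrict (K.cell T)] wd f k := by
  have hm : MemLp (wd F k) 2 (volume.restrict (K.cell T)) :=
    (Lp.memLp (wd F k)).mono_measure (Measure.restrict_mono (cell_subset_domain T) le_rfl)
  have hw : IsWeakDeriv (K.cell T) k (fn f) (hm.toLp _) := by
    intro φ hφ
    have hφ' : IsTest K.domain φ := ⟨hφ.smooth, hφ.compact, hφ.supp.trans (cell_subset_domain T)⟩
    have h1 := F.2 k φ hφ'
    have hres : ∀ (G : Plane → ℝ) {ψ : Plane → ℝ}, (∀ x, x ∉ K.cell T → ψ x = 0) →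
        ∫ x in K.domain, G x * ψ x = ∫ x in K.cell T, G x * ψ x := fun G ψ hψ =>
      setIntegral_eq_of_subset_of_forall_sdiff_eq_zero isOpen_domain.measurableSet
        (cell_subset_domain T) fun x hx => by rw [hψ x hx.2, mul_zero]
    have hz : ∀ x, x ∉ K.cell T → φ x = 0 := fun x hx =>
      image_eq_zero_of_notMem_tsupport fun hx' => hx (hφ.supp hx')
    have hz' : ∀ x, x ∉ K.cell T → pd k φ x = 0 := fun x hx => by
      rw [pd, image_eq_zero_of_notMem_tsupport fun hx' => hx (hφ.supp (tsupport_fderiv_subset ℝ hx'))]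
      rfl
    rw [hres _ hz', hres _ hz] at h1
    have e1 : ∫ x in K.cell T, fn f x * pd k φ x = ∫ x in K.cell T, fn F x * pd k φ x :=
      integral_congr_ae (h.mono fun x hx => by simp only [hx])
    have e2 : ∫ x in K.cell T, hm.toLp _ x * φ x = ∫ x in K.cell T, wd F k x * φ x :=
      integral_congr_ae (hm.coeFn_toLp.mono fun x hx => by simp only [hx])
    rw [e1, e2]
    exact h1
  have := isWeakDeriv_unique (K.convexDomain T).isOpen hw (f.2 k)
  refine hm.coeFn_toLp.symm.trans ?_
  rw [this]
  rfl

/-- The elements of `U` have single-valued traces on the interior sides. -/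
theorem traceL_glued_of_mem_U (hK : K.IsPlanar) {u : ∀ T : K.Tri, Fin 2 → H2 (K.cell T)}
    (hu : u ∈ K.U) {T T' : K.Tri} {i j : Fin 3} (hg : K.Glued T i T' j) (b : Fin 2) :
    ∀ᵐ s ∂I01, K.traceL T i (toH1 (u T b)) s = K.traceL T' j (toH1 (u T' b)) (1 - s) := by
  have h := hK.pos_eq hg
  obtain ⟨F, hF⟩ := hu
  obtain ⟨k, hk⟩ := K.edgeVec_ne_zero T i
  set t := K.traceL T i (toH1 (u T b))
  set t' := K.traceL T' j (toH1 (u T' b))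
  have ht' : MemLp (fun s => t' (1 - s)) 2 I01 :=
    (Lp.memLp t').comp_measurePreserving measurePreserving_reflect
  have key : ∀ᵐ s ∂I01, t s - t' (1 - s) = 0 := by
    refine ae_zero_of_integral_test (((Lp.memLp t).sub ht').integrable (by norm_num)) fun η h1 h2 => ?_
    -- With `φ` supported in the kite, the weak derivative formula on the domain splits into the two
    -- triangles. Green's formula on each of them leaves only the common side, with opposite
    -- conormals, so that the difference of the traces is tested with `η`.
    obtain ⟨φ, hφ, hφe⟩ := exists_isTest_edgePt T i (isOpen_kite T i T' j)
      (((K.tri_compact T).isBounded.union (K.tri_compact T').isBounded).subset (kite_subset_union h))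
      (fun s hs => edgePt_mem_kite h hs) h1 h2
    have hz : ∀ x, x ∉ kite T i T' j → φ x = 0 := fun x hx =>
      image_eq_zero_of_notMem_tsupport fun hx' => hx (hφ.supp hx')
    have hz' : ∀ x, x ∉ kite T i T' j → pd k φ x = 0 := fun x hx => by
      rw [pd, image_eq_zero_of_notMem_tsupport fun hx' => hx (hφ.supp (tsupport_fderiv_subset ℝ hx'))]
      rfl
    have hweak := (F b).2 k φ ⟨hφ.smooth, hφ.compact, hφ.supp.trans (kite_subset_domain h)⟩
    have hsplit : ∀ (G : L2 K.domain) {ψ : Plane → ℝ}, Continuous ψ → HasCompactSupport ψ →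
        (∀ x, x ∉ kite T i T' j → ψ x = 0) → ∫ x in K.domain, G x * ψ x =
          (∫ x in K.cell T, G x * ψ x) + ∫ x in K.cell T', G x * ψ x := fun G ψ hc hs h0 =>
      setIntegral_kite h (integrable_mul_cc G hc hs) fun x hx => by rw [h0 x hx, mul_zero]
    have e1 := hsplit (fn (F b)) (pd_continuous hφ.smooth k) (hφ.pd_compact k) hz'
    have e2 := hsplit (wd (F b) k) hφ.smooth.continuous hφ.compact hz
    have hcongr : ∀ T, (∫ x in K.cell T, fn (F b) x * pd k φ x) + ∫ x in K.cell T, wd (F b) k x * φ x =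
        (∫ x in K.cell T, fn (toH1 (u T b)) x * pd k φ x) +
          ∫ x in K.cell T, wd (toH1 (u T b)) k x * φ x := fun T => by
      congr 1
      · exact integral_congr_ae ((hF T b).mono fun x hx => by simp only [hx])
      · exact integral_congr_ae ((wd_ae_of_fn_ae (hF T b) k).mono fun x hx => by simp only [hx])
    have g1 := (K.isTrace_traceL T (toH1 (u T b))).green φ k hφ.smooth
    have g2 := (K.isTrace_traceL T' (toH1 (u T' b))).green φ k hφ.smooth
    have hother : ∀ l, l ≠ i → ∀ s, φ (K.edgePt T l s) = 0 := fun l hl s => hz _ fun hx => by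
      have h0 := (K.lam_edgePt T l s).1
      rcases fin3_cases i l with rfl | rfl | rfl
      · exact hl rfl
      · exact hx.1.1.ne' h0
      · exact hx.1.2.ne' h0
    have hother' : ∀ l, l ≠ j → ∀ s, φ (K.edgePt T' l s) = 0 := fun l hl s => hz _ fun hx => by
      have h0 := (K.lam_edgePt T' l s).1
      rcases fin3_cases j l with rfl | rfl | rfl
      · exact hl rfl
      · exact hx.2.1.ne' h0
      · exact hx.2.2.ne' h0
    rw [Finset.sum_eq_single i (fun l _ hl => by simp [hother l hl]) (by simp)] at g1
    rw [Finset.sum_eq_single j (fun l _ hl => by simp [hother' l hl]) (by simp),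
      edgeConormal_glued h] at g2
    have hη : MemLp η 2 I01 := memLp_I01 h1.continuous
    have i1 : Integrable (fun s => t s * η s) I01 := (Lp.memLp t).integrable_mul hη
    have i2 : Integrable (fun s => t' (1 - s) * η s) I01 := ht'.integrable_mul hη
    have e3 : ∫ s, t' s * φ (K.edgePt T' j s) ∂I01 = ∫ s, t' (1 - s) * η s ∂I01 := by
      rw [← integral_reflect]
      simp only [edgePt_glued h, hφe]
    simp only [hφe] at g1
    have hsum : (∫ s, t s * η s ∂I01) * K.edgeConormal T i k -
        (∫ s, t' (1 - s) * η s ∂I01) * K.edgeConormal T i k = 0 := by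
      rw [← e3]
      have a1 := hcongr T
      have a2 := hcongr T'
      have hweak' : ∫ x in K.domain, fn (F b) x * pd k φ x =
        -∫ x in K.domain, wd (F b) k x * φ x := hweak
      linarith
    simp only [sub_mul]
    rw [integral_sub i1 i2]
    rw [← sub_mul] at hsum
    exact (mul_eq_zero.1 hsum).resolve_right hk
  filter_upwards [key] with s hs
  linarith

end TriangulatedSurface
end
end ReggeFEM
namespace ReggeFEM
noncomputable section
namespace TriangulatedSurface

variable {K : TriangulatedSurface}

/-! ### Sums over the sides of all triangles -/

theorem Glued.symm {T T' : K.Tri} {i j : Fin 3} (h : K.Glued T i T' j) : K.Glued T' j T i :=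
  ⟨h.2.symm, h.1.symm⟩

/-- Two partners of a side induce the same orientation on the edge, so the axiom `oriented`
identifies the triangles. -/
theorem Glued.unique {T T₁ T₂ : K.Tri} {i j₁ j₂ : Fin 3} (h₁ : K.Glued T i T₁ j₁)
    (h₂ : K.Glued T i T₂ j₂) : (T₁, j₁) = (T₂, j₂) := by
  have hT : T₁ = T₂ := by
    refine K.oriented T₁ T₂ (j₁ + 1) (j₂ + 1) (h₁.2.symm.trans h₂.2) ?_
    rw [fin3_one_one, fin3_one_one]
    exact h₁.1.symm.trans h₂.1
  subst hT
  have := K.vert_injective T₁ (h₁.2.symm.trans h₂.2)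
  rw [add_right_cancel this]

/-- Gluing is an involution on the sides, extended by the identity on boundary sides, and
contributions cancel in pairs. A fixed point contributes zero: by `hb` on the boundary, and by `F +
F = 0` if a side were glued to itself. -/
theorem sum_sides_eq_zero {F : K.Tri → Fin 3 → ℝ}
    (hg : ∀ T i T' j, K.Glued T i T' j → F T i + F T' j = 0)
    (hb : ∀ T i, K.IsBoundarySide T i → F T i = 0) : ∑ T, ∑ i, F T i = 0 := by
  classical
  have hex : ∀ a : K.Tri × Fin 3, ∃ b : K.Tri × Fin 3,
      K.Glued a.1 a.2 b.1 b.2 ∨ (K.IsBoundarySide a.1 a.2 ∧ b = a) := fun a => by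
    by_cases h : K.IsBoundarySide a.1 a.2
    · exact ⟨a, Or.inr ⟨h, rfl⟩⟩
    · simp only [IsBoundarySide] at h
      push Not at h
      obtain ⟨T', j, h⟩ := h
      exact ⟨(T', j), Or.inl h⟩
  choose m hm using hex
  rw [← Fintype.sum_prod_type']
  refine Finset.sum_ninvolution m (fun a => ?_) (fun a ha he => ha ?_) (fun _ => Finset.mem_univ _)
    fun a => ?_
  · rcases hm a with h | ⟨h, he⟩
    · exact hg _ _ _ _ h
    · rw [he, hb _ _ h, add_zero]
  · rcases hm a with h | ⟨h, -⟩
    · have := hg _ _ _ _ h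
      rw [he] at this
      linarith
    · exact hb _ _ h
  · rcases hm a with h | ⟨h, he⟩
    · rcases hm (m a) with h' | ⟨h', -⟩
      · exact h'.unique h.symm
      · exact absurd h.symm (h' _ _)
    · rw [he, he]

/-! ### The position of the triangles of a planar triangulation -/

theorem exists_vert_notMem {T T' : K.Tri} (h : T ≠ T') : ∃ k, K.vert T k ∉ range (K.vert T') := by
  by_contra hcon
  push Not at hcon
  choose f hf using hcon
  have hinj : Function.Injective f := fun a b hab => K.vert_injective T (by rw [← hf, ← hf, hab])
  refine h (K.simplicial T T' (Subset.antisymm ?_ ?_))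
  · rintro _ ⟨a, rfl⟩
    exact ⟨f a, hf a⟩
  · rintro _ ⟨b, rfl⟩
    obtain ⟨a, rfl⟩ := Finite.surjective_of_injective hinj b
    exact ⟨a, (hf a).symm⟩

/-- The triangles intersect in the hull of their common vertices. If the vertex `k` is not common,
`λ_k` vanishes at all of these and, being affine, on their hull. -/
theorem IsPlanar.lam_eq_zero (hK : K.IsPlanar) {T T' : K.Tri} {k : Fin 3}
    (hk : K.vert T k ∉ range (K.vert T')) {x : Plane} (hx : x ∈ K.tri T) (hx' : x ∈ K.tri T') :
    lam (K.pos T) k x = 0 := by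
  obtain ⟨p, hp, hint⟩ := hK
  have hc : Convex ℝ {y | lam (K.pos T) k y = 0} := by
    intro y hy z hz a b _ _ hab
    have hy' : lam (K.pos T) k y = 0 := hy
    have hz' : lam (K.pos T) k z = 0 := hz
    change lam (K.pos T) k (a • y + b • z) = 0
    rw [lam_combo _ _ _ _ hab, hy', hz']
    ring
  have hm : x ∈ convexHull ℝ (p '' (range (K.vert T) ∩ range (K.vert T'))) := by
    rw [← hint]; exact ⟨hx, hx'⟩
  refine convexHull_min ?_ hc hm
  rintro _ ⟨z, ⟨⟨m, rfl⟩, hz⟩, rfl⟩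
  change lam (K.pos T) k _ = 0
  rw [← hp, lam_vertex (K.tdet_pos T), if_neg]
  rintro rfl
  exact hk hz

theorem IsPlanar.notMem_cell (hK : K.IsPlanar) {T T' : K.Tri} (h : T ≠ T') {x : Plane}
    (hx : x ∈ K.cell T) : x ∉ K.cell T' := fun hx' => by
  obtain ⟨k, hk⟩ := exists_vert_notMem h
  exact (mem_cell_iff.1 hx k).ne'
    (hK.lam_eq_zero hk (interior_subset hx) (interior_subset hx'))

/-- A point in the open side is not interior to `T`, so if it belonged to the domain, another
triangle would contain it. By `lam_eq_zero` that triangle has both ends of the side as vertices. It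
would either induce the same orientation, against `oriented`, or be glued to the side, which then is
not a boundary side. -/
theorem IsPlanar.edgePt_notMem_domain (hK : K.IsPlanar) {T : K.Tri} {i : Fin 3}
    (hb : K.IsBoundarySide T i) {s : ℝ} (hs : s ∈ Ioo (0 : ℝ) 1) : K.edgePt T i s ∉ K.domain := by
  intro hx
  obtain ⟨h0, h1, h2⟩ := K.lam_edgePt T i s
  have hxT := K.edgePt_mem T i (Ioo_subset_Icc_self hs)
  have hexT : ∃ T', T' ≠ T ∧ K.edgePt T i s ∈ K.tri T' := by
    by_contra hcon
    push Not at hcon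
    have hcl : IsClosed (⋃ T' : {T' : K.Tri // T' ≠ T}, K.tri T'.1) :=
      isClosed_iUnion_of_finite fun T' => (K.tri_compact T'.1).isClosed
    have hmem : K.edgePt T i s ∈ interior (K.tri T) := by
      refine interior_maximal (t := K.domain \ ⋃ T' : {T' : K.Tri // T' ≠ T}, K.tri T'.1) ?_
        (isOpen_domain.sdiff hcl) ⟨hx, ?_⟩
      · rintro y ⟨hy, hy'⟩
        obtain ⟨T', hT'⟩ := mem_iUnion.1 (interior_subset hy)
        by_cases hTT : T' = T
        · rwa [hTT] at hT'
        · exact absurd (mem_iUnion.2 ⟨⟨T', hTT⟩, hT'⟩) hy'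
      · rw [mem_iUnion]
        rintro ⟨T', hT'⟩
        exact hcon T'.1 T'.2 hT'
    exact (mem_cell_iff.1 hmem i).ne' h0
  obtain ⟨T', hne, hxT'⟩ := hexT
  have hm : ∀ k, lam (K.pos T) k (K.edgePt T i s) ≠ 0 → K.vert T k ∈ range (K.vert T') :=
    fun k hk => by
      by_contra hcon
      exact hk (hK.lam_eq_zero hcon hxT hxT')
  obtain ⟨a, ha⟩ := hm (i + 1) (by rw [h1]; exact (sub_pos.2 hs.2).ne')
  obtain ⟨b, hb'⟩ := hm (i + 2) (by rw [h2]; exact hs.1.ne')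
  rcases fin3_cases a b with rfl | rfl | rfl
  · have := K.vert_injective T (ha.symm.trans hb')
    revert this
    fin_cases i <;> decide
  · refine hne (K.oriented T T' (i + 1) a ha.symm ?_).symm
    rw [fin3_one_one]; exact hb'.symm
  · refine hb T' (a + 1) ⟨?_, ?_⟩
    · rw [fin3_one_two]; exact ha.symm
    · rw [fin3_one_one]; exact hb'.symm

/-! ### Gluing -/

theorem memLp_zeroExt {T : K.Tri} (f : L2 (K.cell T)) :
    MemLp (zeroExt f) 2 (volume.restrict K.domain) :=
  ((memLp_indicator_iff_restrict isOpen_interior.measurableSet).2 (Lp.memLp f)).restrict _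

/-- The function on the planar domain that is given on every triangle. -/
def glue (f : ∀ T : K.Tri, L2 (K.cell T)) : L2 K.domain := ∑ T, (memLp_zeroExt (f T)).toLp _

theorem coeFn_glue (f : ∀ T : K.Tri, L2 (K.cell T)) :
    glue f =ᵐ[volume.restrict K.domain] fun x => ∑ T, zeroExt (f T) x := by
  refine (Lp.coeFn_fun_finsetSum _ _).trans ?_
  filter_upwards [ae_all_iff.2 fun T => (memLp_zeroExt (f T)).coeFn_toLp] with x hx
  exact Finset.sum_congr rfl fun T _ => hx T

theorem glue_ae (hK : K.IsPlanar) (f : ∀ T : K.Tri, L2 (K.cell T)) (T : K.Tri) :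
    glue f =ᵐ[volume.restrict (K.cell T)] f T := by
  filter_upwards [ae_restrict_of_ae_restrict_of_subset (cell_subset_domain T) (coeFn_glue f),
    ae_restrict_mem isOpen_interior.measurableSet] with x hx hxT
  rw [hx, Finset.sum_eq_single T (fun T' _ hne => ?_) (by simp)]
  · exact indicator_of_mem hxT _
  · exact indicator_of_notMem (hK.notMem_cell hne.symm hxT) _

theorem integral_glue_mul (f : ∀ T : K.Tri, L2 (K.cell T)) {ψ : Plane → ℝ} (hc : Continuous ψ)
    (hs : HasCompactSupport ψ) :
    ∫ x in K.domain, glue f x * ψ x = ∑ T, ∫ x in K.cell T, f T x * ψ x := by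
  have h1 : ∫ x in K.domain, glue f x * ψ x = ∫ x in K.domain, ∑ T, zeroExt (f T) x * ψ x := by
    refine integral_congr_ae ((coeFn_glue f).mono fun x hx => ?_)
    simp only [hx, Finset.sum_mul]
  have hψ : MemLp ψ 2 (volume.restrict K.domain) := (hc.memLp_of_hasCompactSupport hs).restrict _
  have hi : ∀ T, Integrable (fun x => zeroExt (f T) x * ψ x) (volume.restrict K.domain) :=
    fun T => (memLp_zeroExt (f T)).integrable_mul hψ
  rw [h1, integral_finsetSum _ fun T _ => hi T]
  refine Finset.sum_congr rfl fun T _ => ?_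
  have h2 : ∀ x, zeroExt (f T) x * ψ x = (K.cell T).indicator (fun x => f T x * ψ x) x := fun x => by
    rw [zeroExt, indicator_mul_left]
  simp only [h2]
  have hm : MeasurableSet (K.cell T) := isOpen_interior.measurableSet
  rw [setIntegral_indicator hm, inter_eq_self_of_subset_right (cell_subset_domain T)]

/-- Piecewise `H²` functions with single-valued traces belong to `U`. -/
theorem mem_U_of_traceL (hK : K.IsPlanar) {u : ∀ T : K.Tri, Fin 2 → H2 (K.cell T)}
    (hu : ∀ T i T' j, K.Glued T i T' j → ∀ b, ∀ᵐ s ∂I01,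
      K.traceL T i (toH1 (u T b)) s = K.traceL T' j (toH1 (u T' b)) (1 - s)) : u ∈ K.U := by
  have hw : ∀ b k, IsWeakDeriv K.domain k (glue fun T => fn (toH1 (u T b)))
      (glue fun T => wd (toH1 (u T b)) k) := fun b k φ hφ => by
    rw [integral_glue_mul _ (pd_continuous hφ.smooth k) (hφ.pd_compact k),
      integral_glue_mul _ hφ.smooth.continuous hφ.compact, ← add_eq_zero_iff_eq_neg,
      ← Finset.sum_add_distrib]
    -- Green's formula on each triangle turns the defect of the weak derivative formula into a sum
    -- over sides: glued sides cancel by equality of traces and opposite conormals, and on the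
    -- interior of boundary sides the test function vanishes.
    simp only [fun T => (K.isTrace_traceL T (toH1 (u T b))).green φ k hφ.smooth]
    refine sum_sides_eq_zero (fun T i T' j h => ?_) fun T i h => ?_
    · have hp := hK.pos_eq h
      rw [edgeConormal_glued hp, ← integral_reflect fun s => K.traceL T' j (toH1 (u T' b)) s * _]
      simp only [edgePt_glued hp]
      rw [integral_congr_ae (g := fun s => K.traceL T' j (toH1 (u T' b)) (1 - s) *
        φ (K.edgePt T i s)) ((hu T i T' j h b).mono fun s hs => by simp only [hs])]
      ring
    · rw [integral_eq_zero_of_ae, zero_mul]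
      rw [← restrict_Ioo_eq_restrict_Icc]
      filter_upwards [ae_restrict_mem measurableSet_Ioo] with s hs
      rw [image_eq_zero_of_notMem_tsupport fun hx => hK.edgePt_notMem_domain h hs (hφ.supp hx),
        mul_zero]
      rfl
  exact ⟨fun b => ⟨(glue fun T => fn (toH1 (u T b)), fun k => glue fun T => wd (toH1 (u T b)) k),
    fun k => hw b k⟩, fun T b => glue_ae hK _ T⟩

end TriangulatedSurface
end
end ReggeFEM
namespace ReggeFEM
noncomputable section

/-! ### Polynomials on an interval with given end values -/

/-- Division by `s` and by `s - 1`; the latter accounts for the minus sign. -/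
theorem exists_eq_bubble {a : Polynomial ℝ} {r : ℕ} (ha : a.natDegree ≤ r + 1)
    (h0 : a.eval 0 = 0) (h1 : a.eval 1 = 0) :
    ∃ c ∈ PolyLt₁ r, ∀ s, a.eval s = -(s * (1 - s) * c.eval s) := by
  have hX : Polynomial.X ∣ a := Polynomial.X_dvd_iff.2 (by rwa [Polynomial.coeff_zero_eq_eval_zero])
  obtain ⟨b, rfl⟩ := hX
  have h1' : b.eval 1 = 0 := by simpa using h1
  obtain ⟨c, rfl⟩ := Polynomial.dvd_iff_isRoot.2 h1'
  refine ⟨c, ?_, fun s => by simp; ring⟩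
  by_cases hc : c = 0
  · rw [hc]; exact zero_mem _
  · refine mem_PolyLt₁_of_lt ?_
    have hX : (Polynomial.X - Polynomial.C (1 : ℝ)) ≠ 0 := Polynomial.X_sub_C_ne_zero 1
    rw [Polynomial.natDegree_mul Polynomial.X_ne_zero (mul_ne_zero hX hc),
      Polynomial.natDegree_mul hX hc, Polynomial.natDegree_X, Polynomial.natDegree_X_sub_C] at ha
    omega

theorem bubble_pos {s : ℝ} (hs : s ∈ Ioo (0 : ℝ) 1) : 0 < s * (1 - s) :=
  mul_pos hs.1 (sub_pos.2 hs.2)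

theorem continuous_bubble : Continuous fun s : ℝ => s * (1 - s) := by fun_prop

theorem lagrange₁_unique {a : Polynomial ℝ} {r : ℕ} (ha : a.natDegree ≤ r + 1)
    (h0 : a.eval 0 = 0) (h1 : a.eval 1 = 0)
    (hm : ∀ b ∈ PolyLt₁ r, ∫ s, a.eval s * b.eval s ∂I01 = 0) : a = 0 := by
  obtain ⟨c, hc, hac⟩ := exists_eq_bubble ha h0 h1
  have hu := existsUnique_poly₁ (w := fun s => s * (1 - s)) continuous_bubble
    (fun _ => bubble_pos) r (h := 0) MemLp.zero
  have := hu.unique (y₁ := ⟨c, hc⟩) (y₂ := 0) (fun b => ?_) (fun b => by simp)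
  · have h : c = 0 := congrArg Subtype.val this
    refine Polynomial.funext fun s => ?_
    rw [hac, h]; simp
  · have := hm b.1 b.2
    simp only [hac, neg_mul, integral_neg, neg_eq_zero] at this
    simpa using this

namespace TriangulatedSurface

variable (K : TriangulatedSurface)

/-! ### The scalar interpolation problem of the Lagrange element -/

theorem mul_bubble_mem_Poly {P : Fin 3 → Plane} {r : ℕ} (i : Fin 3) {b : Polynomial ℝ}
    (hb : b ∈ PolyLt₁ r) :
    lamP P (i + 1) * lamP P (i + 2) * Polynomial.aeval (lamP P (i + 2)) b ∈ Poly (r + 1) := by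
  rcases natDegree_lt_of_mem_PolyLt₁ hb with h | h
  · rw [h, map_zero, mul_zero]; exact zero_mem _
  · exact Poly_mono (by omega) (mul_mem_Poly (mul_mem_Poly (lamP_mem_Poly P (i + 1))
      (lamP_mem_Poly P (i + 2))) (aeval_mem_Poly (lamP_mem_Poly P (i + 2)) le_rfl))

theorem edgeP_eq_zero {T : K.Tri} {r : ℕ} {p : MvP} (hp : p ∈ Poly (r + 1))
    (hv : ∀ i, pval p (K.pos T i) = 0)
    (hedge : ∀ i, ∀ b ∈ PolyLt₁ r, ∫ s, (edgeP (K.pos T) i p).eval s * b.eval s ∂I01 = 0)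
    (i : Fin 3) : edgeP (K.pos T) i p = 0 := by
  refine lagrange₁_unique (natDegree_edgeP hp i) ?_ ?_ (hedge i)
  · rw [eval_edgeP]; simpa [sidePt] using hv (i + 1)
  · rw [eval_edgeP]; simpa [sidePt] using hv (i + 2)

/-- Vertex values and side moments make `p` vanish on the boundary. The factors `λ_0`, `λ_1`, `λ_2`
split off in turn, since a factor already removed is not identically zero on the next side. The
remaining factor is tested with itself for the weight `λ_0 λ_1 λ_2`. The space `PolyLt (r - 1)`
stands for `𝒫_{r-2}`; it is zero for `r = 0` and for `r = 1`. -/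
theorem lagrange_unique {T : K.Tri} {r : ℕ} {p : MvP} (hp : p ∈ Poly (r + 1))
    (hv : ∀ i, pval p (K.pos T i) = 0)
    (hedge : ∀ i, ∀ b ∈ PolyLt₁ r, ∫ s, (edgeP (K.pos T) i p).eval s * b.eval s ∂I01 = 0)
    (hint : ∀ q ∈ PolyLt (r - 1), ∫ x in K.cell T, pval p x * pval q x = 0) : p = 0 := by
  have he := K.edgeP_eq_zero hp hv hedge
  have hne : ∀ i j, i ≠ j → edgeP (K.pos T) j (lamP (K.pos T) i) ≠ 0 := fun i j hij h => by
    have h0 := fun s => congrArg (Polynomial.eval s) h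
    simp only [eval_edgeP, pval_lamP, Polynomial.eval_zero] at h0
    obtain ⟨-, h1, h2⟩ := lam_sidePt (K.tdet_pos T) j (1 / 2)
    rcases fin3_cases j i with rfl | rfl | rfl
    · exact hij rfl
    · rw [h0] at h1; norm_num at h1
    · rw [h0] at h2; norm_num at h2
  obtain ⟨q0, hq0, h0⟩ := exists_decomp (K.tdet_pos T) 0 hp
  rw [he, map_zero, zero_add] at h0
  have e1 := he 1
  rw [h0, map_mul] at e1
  have e1 := (mul_eq_zero.1 e1).resolve_left (hne 0 1 (by decide))
  obtain ⟨q1, hq1, h1⟩ := exists_decomp (K.tdet_pos T) 1 (n := r) hq0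
  rw [e1, map_zero, zero_add] at h1
  have hp1 : p = lamP (K.pos T) 0 * (lamP (K.pos T) 1 * q1) := by rw [← h1]; exact h0
  -- After two divisions the cofactor has degree less than `r`, so for `r = 0` it is zero and no
  -- third division is possible.
  cases r with
  | zero => rw [hp1, (hq1 : q1 = 0), mul_zero, mul_zero]
  | succ r =>
    have e2 := he 2
    rw [hp1, map_mul, map_mul] at e2
    have e2 := (mul_eq_zero.1 ((mul_eq_zero.1 e2).resolve_left (hne 0 2 (by decide)))).resolve_left
      (hne 1 2 (by decide))
    obtain ⟨q2, hq2, h2⟩ := exists_decomp (K.tdet_pos T) 2 (n := r) hq1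
    rw [e2, map_zero, zero_add] at h2
    have hpx : ∀ x, pval p x =
        lam (K.pos T) 0 x * lam (K.pos T) 1 x * lam (K.pos T) 2 x * pval q2 x := fun x => by
      rw [hp1, h2]; simp only [pval_mul, pval_lamP]; ring
    have hu := K.existsUnique_poly T
      (w := fun x => lam (K.pos T) 0 x * lam (K.pos T) 1 x * lam (K.pos T) 2 x)
      (((lam_continuous _ 0).mul (lam_continuous _ 1)).mul (lam_continuous _ 2))
      (fun x hx => mul_pos (mul_pos (mem_cell_iff.1 hx 0) (mem_cell_iff.1 hx 1))
        (mem_cell_iff.1 hx 2)) r (h := 0) MemLp.zero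
    have := hu.unique (y₁ := ⟨q2, hq2⟩) (y₂ := 0)
      (fun b => by simpa [hpx] using hint b.1 b.2) (fun b => by simp)
    have h : q2 = 0 := congrArg Subtype.val this
    refine pval_ext fun x => ?_
    rw [hpx, h]; simp

theorem lam_prod_eq_zero {P : Fin 3 → Plane} {x : Plane} (i : Fin 3) (hi : lam P i x = 0) :
    lam P 0 x * lam P 1 x * lam P 2 x = 0 := by
  fin_cases i <;> simp_all

/-- An affine function takes the vertex values. Then one bubble for each side, `λ_{i+1} λ_{i+2}
b(λ_{i+2})`, corrects the moments there; it vanishes on the two other sides and hence at all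
vertices. -/
theorem lagrange_boundary_exists (T : K.Tri) (r : ℕ) (c : Fin 3 → ℝ) {t : Fin 3 → ℝ → ℝ}
    (ht : ∀ i, MemLp (t i) 2 I01) :
    ∃ p ∈ Poly (r + 1), (∀ i, pval p (K.pos T i) = c i) ∧
      ∀ i, ∀ b ∈ PolyLt₁ r, ∫ s, (edgeP (K.pos T) i p).eval s * b.eval s ∂I01 =
        ∫ s, t i s * b.eval s ∂I01 := by
  have hD := K.tdet_pos T
  obtain ⟨A, hA, hAv⟩ : ∃ A ∈ Poly (r + 1), ∀ i, pval A (K.pos T i) = c i := by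
    refine ⟨∑ i, c i • lamP (K.pos T) i, Submodule.sum_mem _ fun i _ => Submodule.smul_mem _ _
      (Poly_mono (by omega) (lamP_mem_Poly _ i)), fun i => ?_⟩
    simp only [pval_sum, pval_smul, pval_lamP, lam_vertex hD]
    simp
  have hbex := fun i => existsUnique_poly₁ (w := fun s => s * (1 - s)) continuous_bubble
    (fun _ => bubble_pos) r ((ht i).sub (memLp_I01 (edgeP (K.pos T) i A).continuous))
  choose b hb _ using hbex
  obtain ⟨B, hB, hBx⟩ : ∃ B ∈ Poly (r + 1), ∀ x, pval B x = ∑ i, lam (K.pos T) (i + 1) x *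
      lam (K.pos T) (i + 2) x * (b i).1.eval (lam (K.pos T) (i + 2) x) := by
    refine ⟨∑ i, lamP (K.pos T) (i + 1) * lamP (K.pos T) (i + 2) *
      Polynomial.aeval (lamP (K.pos T) (i + 2)) (b i).1, Submodule.sum_mem _ fun i _ =>
        mul_bubble_mem_Poly i (b i).2, fun x => ?_⟩
    simp only [pval_sum, pval_mul, pval_lamP, pval_aeval]
  have hBe : ∀ i s, pval B (sidePt (K.pos T) i s) = s * (1 - s) * (b i).1.eval s := fun i s => by
    obtain ⟨h0, h1, h2⟩ := lam_sidePt hD i s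
    rw [hBx, Finset.sum_eq_single i (fun j _ hj => ?_) (by simp), h1, h2]
    · ring
    · rcases fin3_cases j i with rfl | rfl | rfl
      · exact absurd rfl hj
      · rw [h0]; ring
      · rw [h0]; ring
  have hBv : ∀ i, pval B (K.pos T i) = 0 := fun i => by
    have h := hBe (i + 1) 1
    rw [show sidePt (K.pos T) (i + 1) 1 = K.pos T i by simp [sidePt, fin3_one_two]] at h
    rw [h]; ring
  refine ⟨A + B, add_mem hA hB, fun i => by rw [pval_add, hAv, hBv, add_zero], fun i a ha => ?_⟩
  have hi1 : Integrable (fun s => (edgeP (K.pos T) i A).eval s * a.eval s) I01 :=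
    (memLp_I01 (edgeP (K.pos T) i A).continuous).integrable_mul (memLp_I01 a.continuous)
  have hi2 : Integrable (fun s => s * (1 - s) * (b i).1.eval s * a.eval s) I01 :=
    (memLp_I01 (continuous_bubble.mul (b i).1.continuous)).integrable_mul (memLp_I01 a.continuous)
  have hi3 : Integrable (fun s => t i s * a.eval s) I01 :=
    (ht i).integrable_mul (memLp_I01 a.continuous)
  have hps : ∀ s, (edgeP (K.pos T) i (A + B)).eval s * a.eval s =
      (edgeP (K.pos T) i A).eval s * a.eval s + s * (1 - s) * (b i).1.eval s * a.eval s :=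
    fun s => by rw [map_add, Polynomial.eval_add, eval_edgeP i B, hBe, add_mul]
  have e : ∫ s, s * (1 - s) * (b i).1.eval s * a.eval s ∂I01 =
      ∫ s, (t i s * a.eval s - (edgeP (K.pos T) i A).eval s * a.eval s) ∂I01 := by
    rw [hb i ⟨a, ha⟩]
    simp only [Pi.sub_apply, sub_mul]
  simp only [hps]
  rw [integral_add hi1 hi2, e, integral_sub hi3 hi1]
  ring

/-- The interior moments are corrected last, by a multiple of `λ_0 λ_1 λ_2`, which does not disturb
the boundary. -/
theorem lagrange_exists (T : K.Tri) (r : ℕ) (c : Fin 3 → ℝ) {t : Fin 3 → ℝ → ℝ}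
    (ht : ∀ i, MemLp (t i) 2 I01) {h : Plane → ℝ} (hh : MemLp h 2 (volume.restrict (K.cell T))) :
    ∃ p ∈ Poly (r + 1), (∀ i, pval p (K.pos T i) = c i) ∧
      (∀ i, ∀ b ∈ PolyLt₁ r, ∫ s, (edgeP (K.pos T) i p).eval s * b.eval s ∂I01 =
        ∫ s, t i s * b.eval s ∂I01) ∧
      ∀ q ∈ PolyLt (r - 1), ∫ x in K.cell T, pval p x * pval q x =
        ∫ x in K.cell T, h x * pval q x := by
  have hD := K.tdet_pos T
  obtain ⟨A, hA, hAv, hAe⟩ := K.lagrange_boundary_exists T r c ht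
  have hAm := K.memLp_cell T (pval_continuous A)
  have hwc : Continuous fun x => lam (K.pos T) 0 x * lam (K.pos T) 1 x * lam (K.pos T) 2 x :=
    ((lam_continuous _ 0).mul (lam_continuous _ 1)).mul (lam_continuous _ 2)
  obtain ⟨q, hq, -⟩ := K.existsUnique_poly T hwc
      (fun x hx => mul_pos (mul_pos (mem_cell_iff.1 hx 0) (mem_cell_iff.1 hx 1))
        (mem_cell_iff.1 hx 2)) (r - 1) (hh.sub hAm)
  obtain ⟨B, hB, hBx⟩ : ∃ B ∈ Poly (r + 1), ∀ x, pval B x =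
      lam (K.pos T) 0 x * lam (K.pos T) 1 x * lam (K.pos T) 2 x * pval q x := by
    refine ⟨lamP (K.pos T) 0 * lamP (K.pos T) 1 * lamP (K.pos T) 2 * q, ?_, fun x => by
      simp only [pval_mul, pval_lamP]⟩
    rcases totalDegree_lt_of_mem_PolyLt q.2 with h | h
    · rw [h, mul_zero]; exact zero_mem _
    · exact Poly_mono (by omega) (mul_mem_Poly (mul_mem_Poly (mul_mem_Poly (lamP_mem_Poly _ 0)
        (lamP_mem_Poly _ 1)) (lamP_mem_Poly _ 2)) (mem_Poly.2 (le_refl q.1.totalDegree)))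
  have hBz : ∀ x i, lam (K.pos T) i x = 0 → pval B x = 0 := fun x i hi => by
    rw [hBx, lam_prod_eq_zero i hi, zero_mul]
  refine ⟨A + B, add_mem hA hB, fun i => ?_, fun i b hb => ?_, fun a ha => ?_⟩
  · have hv : lam (K.pos T) (i + 1) (K.pos T i) = 0 := by
      rw [lam_vertex hD, if_neg]
      intro h
      exact absurd (add_eq_left.1 h) (by decide)
    rw [pval_add, hAv, hBz _ _ hv, add_zero]
  · have hBe : edgeP (K.pos T) i B = 0 := Polynomial.funext fun s => by
      rw [eval_edgeP, hBz _ _ (lam_sidePt hD i s).1, Polynomial.eval_zero]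
    rw [map_add, hBe, add_zero, hAe i b hb]
  · have hbm := K.memLp_cell T (pval_continuous a)
    have i1 : Integrable (fun x => pval A x * pval a x) (volume.restrict (K.cell T)) :=
      hAm.integrable_mul hbm
    have i2 : Integrable (fun x => h x * pval a x) (volume.restrict (K.cell T)) :=
      hh.integrable_mul hbm
    have i3 : Integrable (fun x => lam (K.pos T) 0 x * lam (K.pos T) 1 x * lam (K.pos T) 2 x *
        pval q x * pval a x) (volume.restrict (K.cell T)) :=
      (K.memLp_cell T (hwc.mul (pval_continuous q.1))).integrable_mul hbm
    have e := hq ⟨a, ha⟩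
    simp only [Pi.sub_apply, sub_mul] at e
    rw [integral_sub i2 i1] at e
    simp only [pval_add, hBx, add_mul]
    rw [integral_add i1 i3, e]
    ring

/-- All degrees of freedom of the Lagrange element of degree `r + 1` vanish. -/
structure LagZero (r : ℕ) (T : K.Tri) (d : H2 (K.cell T)) : Prop where
  interior : ∀ q ∈ PolyLt (r - 1), ∫ x in K.cell T, fn (toH1 d) x * pval q x = 0
  edge : ∀ i, ∀ b ∈ PolyLt₁ r, ∫ s, K.traceL T i (toH1 d) s * b.eval s ∂I01 = 0
  vertex : ∀ i, K.rep T d (K.pos T i) = 0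

theorem toH1_sub {Ω : Set Plane} (f h : H2 Ω) : toH1 (f - h) = toH1 f - toH1 h := rfl

theorem traceL_sub_ae (T : K.Tri) (i : Fin 3) (f h : H1 (K.cell T)) :
    K.traceL T i (f - h) =ᵐ[I01] fun s => K.traceL T i f s - K.traceL T i h s := by
  rw [map_sub]; exact Lp.coeFn_sub _ _

theorem fn_sub_ae (T : K.Tri) (f h : H1 (K.cell T)) :
    fn (f - h) =ᵐ[volume.restrict (K.cell T)] fun s => fn f s - fn h s :=
  Lp.coeFn_sub (fn f) (fn h)

theorem rep_sub (T : K.Tri) (f h : H2 (K.cell T)) {x : Plane} (hx : x ∈ K.tri T) :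
    K.rep T (f - h) x = K.rep T f x - K.rep T h x := by
  rw [K.rep_of_mem _ hx, K.rep_of_mem _ hx, K.rep_of_mem _ hx, map_sub]
  rfl

theorem lagZero_sub_iff {r : ℕ} {T : K.Tri} {f h : H2 (K.cell T)} : K.LagZero r T (f - h) ↔
    (∀ q ∈ PolyLt (r - 1), ∫ x in K.cell T, fn (toH1 f) x * pval q x =
        ∫ x in K.cell T, fn (toH1 h) x * pval q x) ∧
      (∀ i, ∀ b ∈ PolyLt₁ r, ∫ s, K.traceL T i (toH1 f) s * b.eval s ∂I01 =
        ∫ s, K.traceL T i (toH1 h) s * b.eval s ∂I01) ∧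
      ∀ i, K.rep T f (K.pos T i) = K.rep T h (K.pos T i) := by
  have e1 : ∀ q, ∫ x in K.cell T, fn (toH1 (f - h)) x * pval q x =
      (∫ x in K.cell T, fn (toH1 f) x * pval q x) - ∫ x in K.cell T, fn (toH1 h) x * pval q x :=
    fun q => by
      rw [← integral_sub (K.integrable_fn_mul_pval T _ q) (K.integrable_fn_mul_pval T _ q)]
      refine integral_congr_ae ((K.fn_sub_ae T (toH1 f) (toH1 h)).mono fun x hx => ?_)
      simp only [toH1_sub, hx, sub_mul]
  have e2 : ∀ i (b : Polynomial ℝ), ∫ s, K.traceL T i (toH1 (f - h)) s * b.eval s ∂I01 =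
      (∫ s, K.traceL T i (toH1 f) s * b.eval s ∂I01) -
        ∫ s, K.traceL T i (toH1 h) s * b.eval s ∂I01 := fun i b => by
      rw [← integral_sub (K.integrable_traceL_mul_eval T i _ b)
        (K.integrable_traceL_mul_eval T i _ b)]
      refine integral_congr_ae ((K.traceL_sub_ae T i (toH1 f) (toH1 h)).mono fun x hx => ?_)
      simp only [toH1_sub, hx, sub_mul]
  have e3 : ∀ i, K.rep T (f - h) (K.pos T i) = K.rep T f (K.pos T i) - K.rep T h (K.pos T i) :=
    fun i => K.rep_sub T f h (ReggeMetric.pos_mem_tri T i)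
  constructor
  · rintro ⟨h1, h2, h3⟩
    simp only [e1, e2, e3, sub_eq_zero] at h1 h2 h3
    exact ⟨h1, h2, h3⟩
  · rintro ⟨h1, h2, h3⟩
    constructor <;> simp only [e1, e2, e3, sub_eq_zero] <;> assumption

theorem exists_lagZero (r : ℕ) (T : K.Tri) (f : H2 (K.cell T)) :
    ∃ p ∈ Poly (r + 1), K.LagZero r T (K.polyH2 T p - f) := by
  obtain ⟨p, hp, h1, h2, h3⟩ := K.lagrange_exists T r (fun i => K.rep T f (K.pos T i))
    (t := fun i => K.traceL T i (toH1 f)) (fun i => Lp.memLp _) (Lp.memLp (fn (toH1 f)))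
  refine ⟨p, hp, (K.lagZero_sub_iff).2 ⟨fun q hq => ?_, fun i b hb => ?_, fun i => ?_⟩⟩
  · rw [toH1_polyH2, integral_fn_polyH1, h3 q hq]
  · rw [toH1_polyH2, integral_traceL_polyH1, h2 i b hb]
  · rw [rep_polyH2 _ _ _ (ReggeMetric.pos_mem_tri T i), h1]

theorem lagZero_poly {r : ℕ} {T : K.Tri} {p : MvP} (hp : p ∈ Poly (r + 1))
    (h : K.LagZero r T (K.polyH2 T p)) : p = 0 := by
  refine K.lagrange_unique (T := T) hp (fun i => ?_) (fun i b hb => ?_) fun q hq => ?_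
  · rw [← K.rep_polyH2 T p (ReggeMetric.pos_mem_tri T i)]; exact h.vertex i
  · rw [← integral_traceL_polyH1]; exact h.edge i b hb
  · rw [← integral_fn_polyH1]; exact h.interior q hq

theorem lagZero_unique {r : ℕ} {T : K.Tri} {f : H2 (K.cell T)} {p p' : MvP}
    (hp : p ∈ Poly (r + 1)) (hp' : p' ∈ Poly (r + 1)) (h : K.LagZero r T (K.polyH2 T p - f))
    (h' : K.LagZero r T (K.polyH2 T p' - f)) : p = p' := by
  obtain ⟨h1, h2, h3⟩ := K.lagZero_sub_iff.1 h
  obtain ⟨h1', h2', h3'⟩ := K.lagZero_sub_iff.1 h'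
  refine sub_eq_zero.1 (K.lagZero_poly (T := T) (sub_mem hp hp') ?_)
  rw [map_sub]
  exact K.lagZero_sub_iff.2 ⟨fun q hq => (h1 q hq).trans (h1' q hq).symm,
    fun i b hb => (h2 i b hb).trans (h2' i b hb).symm, fun i => (h3 i).trans (h3' i).symm⟩

/-- Continuous functions that agree almost everywhere on the side agree everywhere on it, at its
ends in particular. Thus equality of vertex values follows from equality of traces. -/
theorem rep_edge_eq {T T' : K.Tri} {i j : Fin 3} {f : H2 (K.cell T)} {f' : H2 (K.cell T')}
    (hff : ∀ᵐ s ∂I01, K.traceL T i (toH1 f) s = K.traceL T' j (toH1 f') (1 - s)) {s : ℝ}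
    (hs : s ∈ Icc (0 : ℝ) 1) : K.rep T f (K.edgePt T i s) = K.rep T' f' (K.edgePt T' j (1 - s)) := by
  have hmap : ∀ s ∈ Icc (0 : ℝ) 1, (1 - s) ∈ Icc (0 : ℝ) 1 := fun s hs =>
    ⟨by linarith [hs.2], by linarith [hs.1]⟩
  have h1 : ContinuousOn (fun s => K.rep T f (K.edgePt T i s)) (Icc 0 1) :=
    (K.continuousOn_rep T f).comp (K.edgePt_continuous T i).continuousOn
      fun s hs => K.edgePt_mem T i hs
  have h2 : ContinuousOn (fun s => K.rep T' f' (K.edgePt T' j (1 - s))) (Icc 0 1) :=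
    (K.continuousOn_rep T' f').comp
      ((K.edgePt_continuous T' j).comp (continuous_const.sub continuous_id)).continuousOn
      fun s hs => K.edgePt_mem T' j (hmap s hs)
  refine Measure.eqOn_Icc_of_ae_eq volume zero_ne_one ?_ h1 h2 hs
  filter_upwards [hff, K.rep_trace_ae T f i, ae_reflect (K.rep_trace_ae T' f' j)] with s e1 e2 e3
  rw [e2, e3, e1]

/-- The interpolants of functions with matching traces on a common side have matching traces. -/
theorem lagZero_glued {r : ℕ} {T T' : K.Tri} {i j : Fin 3} {f : H2 (K.cell T)}
    {f' : H2 (K.cell T')} {p p' : MvP} (hp : p ∈ Poly (r + 1)) (hp' : p' ∈ Poly (r + 1))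
    (h : K.LagZero r T (K.polyH2 T p - f)) (h' : K.LagZero r T' (K.polyH2 T' p' - f'))
    (hff : ∀ᵐ s ∂I01, K.traceL T i (toH1 f) s = K.traceL T' j (toH1 f') (1 - s)) (s : ℝ) :
    (edgeP (K.pos T) i p).eval s = (edgeP (K.pos T') j p').eval (1 - s) := by
  have hcomp : ∀ {a : Polynomial ℝ} {n : ℕ}, a.natDegree ≤ n →
      (a.comp (1 - Polynomial.X)).natDegree ≤ n := fun {a n} ha => by
    refine Polynomial.natDegree_comp_le.trans ?_
    refine (Nat.mul_le_mul ha (show (1 - Polynomial.X : Polynomial ℝ).natDegree ≤ 1 by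
      compute_degree)).trans (by omega)
  have hev : ∀ (a : Polynomial ℝ) (s : ℝ), (a.comp (1 - Polynomial.X)).eval s = a.eval (1 - s) :=
    fun a s => by simp
  obtain ⟨-, h2, h3⟩ := K.lagZero_sub_iff.1 h
  obtain ⟨-, h2', h3'⟩ := K.lagZero_sub_iff.1 h'
  have hv : ∀ i, pval p (K.pos T i) = K.rep T f (K.pos T i) := fun i => by
    rw [← h3, rep_polyH2 _ _ _ (ReggeMetric.pos_mem_tri T i)]
  have hv' : ∀ i, pval p' (K.pos T' i) = K.rep T' f' (K.pos T' i) := fun i => by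
    rw [← h3', rep_polyH2 _ _ _ (ReggeMetric.pos_mem_tri T' i)]
  -- The difference has degree at most `r + 1`, vanishes at both ends, and has no moments of degree
  -- less than `r`: it is zero by one-dimensional unisolvence.
  have hz : edgeP (K.pos T) i p - (edgeP (K.pos T') j p').comp (1 - Polynomial.X) = 0 := by
    refine lagrange₁_unique (r := r) ((Polynomial.natDegree_sub_le _ _).trans
      (max_le (natDegree_edgeP hp i) (hcomp (natDegree_edgeP hp' j)))) ?_ ?_ fun b hb => ?_
    · have e := K.rep_edge_eq hff (left_mem_Icc.2 zero_le_one)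
      rw [Polynomial.eval_sub, hev, eval_edgeP, eval_edgeP, sub_eq_zero]
      simp only [edgePt, edgeVec, sub_zero, zero_smul, add_zero, one_smul, add_sub_cancel] at e
      simpa [sidePt, hv, hv'] using e
    · have e := K.rep_edge_eq hff (right_mem_Icc.2 zero_le_one)
      rw [Polynomial.eval_sub, hev, eval_edgeP, eval_edgeP, sub_eq_zero]
      simp only [edgePt, edgeVec, sub_self, zero_smul, add_zero, one_smul, add_sub_cancel] at e
      simpa [sidePt, hv, hv'] using e
    · have hb' : b.comp (1 - Polynomial.X) ∈ PolyLt₁ r := by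
        rcases natDegree_lt_of_mem_PolyLt₁ hb with h0 | h0
        · rw [h0, Polynomial.zero_comp]; exact zero_mem _
        · exact mem_PolyLt₁_of_lt ((hcomp le_rfl).trans_lt h0)
      have hi : ∀ a : Polynomial ℝ, Integrable (fun s => a.eval s * b.eval s) I01 :=
        fun a => (memLp_I01 a.continuous).integrable_mul (memLp_I01 b.continuous)
      have e := h2' j _ hb'
      rw [toH1_polyH2, integral_traceL_polyH1, ← integral_reflect, ← integral_reflect fun s =>
        K.traceL T' j (toH1 f') s * _] at e
      simp only [hev, sub_sub_cancel] at e
      have e' := h2 i b hb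
      rw [toH1_polyH2, integral_traceL_polyH1] at e'
      simp only [Polynomial.eval_sub, sub_mul]
      rw [integral_sub (hi _) (hi _), e', sub_eq_zero]
      simp only [hev]
      rw [e]
      refine integral_congr_ae ?_
      filter_upwards [hff] with s hs
      rw [hs]
  have e := congrArg (Polynomial.eval s) hz
  rwa [Polynomial.eval_sub, hev, Polynomial.eval_zero, sub_eq_zero] at e

end TriangulatedSurface
end
end ReggeFEM
-- The planar Euclidean case: Lagrange interpolant, symmetric gradient, commutation
namespace ReggeFEM
noncomputable section
namespace TriangulatedSurface

variable {K : TriangulatedSurface}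

theorem tri_subset_closure_cell (T : K.Tri) : K.tri T ⊆ closure (K.cell T) := by
  have hc : Convex ℝ (K.tri T) := convex_convexHull ℝ _
  rw [cell, hc.closure_interior_eq_closure_of_nonempty_interior (K.convexDomain T).nonempty]
  exact subset_closure

theorem eqOn_tri_of_ae {T : K.Tri} {c c' : Plane → ℝ} (hc : ContinuousOn c (K.tri T))
    (hc' : ContinuousOn c' (K.tri T)) (h : c =ᵐ[volume.restrict (K.cell T)] c') :
    EqOn c c' (K.tri T) := by
  have h1 : EqOn c c' (K.cell T) :=
    Measure.eqOn_open_of_ae_eq h isOpen_interior (hc.mono interior_subset)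
      (hc'.mono interior_subset)
  exact h1.of_subset_closure hc hc' interior_subset (tri_subset_closure_cell T)

namespace ReggeMetric

variable {g : K.ReggeMetric}

/-! ### The Euclidean metric -/

theorem IsEuclidean.isPoly (hg : g.IsEuclidean) : g.IsPoly 0 := fun T a b =>
  ⟨MvPolynomial.C ((1 : Matrix (Fin 2) (Fin 2) ℝ) a b), C_mem_Poly _, fun x hx => by
    rw [hg T x hx, pval_C]⟩

theorem IsEuclidean.vol (hg : g.IsEuclidean) {T : K.Tri} {x : Plane} (hx : x ∈ K.tri T) :
    g.vol T x = 1 := by simp [ReggeMetric.vol, hg T x hx]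

theorem IsEuclidean.inv (hg : g.IsEuclidean) {T : K.Tri} {x : Plane} (hx : x ∈ K.tri T) :
    g.inv T x = 1 := by simp [ReggeMetric.inv, hg T x hx]

/-! ### The Lagrange interpolant -/

theorem sum_one_mul (d p : Fin 2 → ℝ) :
    ∑ a, ∑ b, (1 : Matrix (Fin 2) (Fin 2) ℝ) a b * d a * p b = ∑ b, d b * p b := by
  simp [Fin.sum_univ_two]

theorem isPiU_interior_iff (hg : g.IsEuclidean) {r : ℕ} {T : K.Tri}
    {u w : Fin 2 → H2 (K.cell T)} :
    (∀ p : Fin 2 → MvPolynomial (Fin 2) ℝ, (∀ b, (p b).totalDegree + 1 < r) →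
      ∫ x in K.cell T, (∑ a, ∑ b, g.coeff T x a b *
        ((fn (toH1 (w a))) x - (fn (toH1 (u a))) x) * pval (p b) x) * g.vol T x = 0) ↔
    ∀ b, ∀ q ∈ PolyLt (r - 1), ∫ x in K.cell T, fn (toH1 (w b - u b)) x * pval q x = 0 := by
  have key : ∀ p : Fin 2 → MvP, (∫ x in K.cell T, (∑ a, ∑ b, g.coeff T x a b *
        ((fn (toH1 (w a))) x - (fn (toH1 (u a))) x) * pval (p b) x) * g.vol T x) =
      ∑ b, ∫ x in K.cell T, fn (toH1 (w b - u b)) x * pval (p b) x := fun p => by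
    rw [← integral_finsetSum _ fun b _ => K.integrable_fn_mul_pval T _ _]
    refine integral_congr_ae ?_
    filter_upwards [ae_mem_tri T, ae_all_iff.2 fun b => K.fn_sub_ae T (toH1 (w b)) (toH1 (u b))]
      with x hx hs
    rw [hg T x hx, hg.vol hx, mul_one,
      sum_one_mul (fun a => fn (toH1 (w a)) x - fn (toH1 (u a)) x) fun b => pval (p b) x]
    simp only [toH1_sub, hs]
  simp only [key]
  constructor
  · intro h b q hq
    rcases totalDegree_lt_of_mem_PolyLt hq with rfl | hq
    · simp
    have := h (Pi.single b q) fun b' => by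
      by_cases hb : b' = b
      · subst hb; rw [Pi.single_eq_same]; omega
      · rw [Pi.single_eq_of_ne hb, MvPolynomial.totalDegree_zero]; omega
    rwa [Finset.sum_eq_single b (fun b' _ hb => by rw [Pi.single_eq_of_ne hb]; simp) (by simp),
      Pi.single_eq_same] at this
  · intro h p hp
    exact Finset.sum_eq_zero fun b _ => h b _ (mem_PolyLt_of_lt (by have := hp b; omega))

theorem isPiU_edge_iff (hg : g.IsEuclidean) {r : ℕ} {T : K.Tri} {i : Fin 3}
    {u w : Fin 2 → H2 (K.cell T)} :
    (∀ q : Fin 2 → Polynomial ℝ, (∀ b, (q b).natDegree < r) →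
      ∫ s in Icc (0 : ℝ) 1, (∑ a, ∑ b, g.coeff T (K.edgePt T i s) a b *
        (K.trace T (toH1 (w a)) i s - K.trace T (toH1 (u a)) i s) * (q b).eval s) *
        g.edgeLen T i s = 0) ↔
    ∀ k, ∀ b ∈ PolyLt₁ r, ∫ s, K.traceL T i (toH1 (w k - u k)) s * b.eval s ∂I01 = 0 := by
  have hl := (g.edgeLen_pos T i (left_mem_Icc.2 zero_le_one)).ne'
  have key : ∀ q : Fin 2 → Polynomial ℝ, (∫ s in Icc (0 : ℝ) 1,
        (∑ a, ∑ b, g.coeff T (K.edgePt T i s) a b *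
        (K.trace T (toH1 (w a)) i s - K.trace T (toH1 (u a)) i s) * (q b).eval s) *
        g.edgeLen T i s) =
      (∑ b, ∫ s, K.traceL T i (toH1 (w b - u b)) s * (q b).eval s ∂I01) * g.edgeLen T i 0 :=
    fun q => by
    rw [← integral_finsetSum _ fun b _ => K.integrable_traceL_mul_eval T i _ _,
      ← integral_mul_const]
    refine integral_congr_ae ?_
    filter_upwards [ae_restrict_mem measurableSet_Icc, ae_all_iff.2 fun b =>
      K.traceL_sub_ae T i (toH1 (w b)) (toH1 (u b)), ae_all_iff.2 fun b =>
      K.trace_ae T (toH1 (w b)) i, ae_all_iff.2 fun b => K.trace_ae T (toH1 (u b)) i]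
      with s hs h1 h2 h3
    rw [hg T _ (K.edgePt_mem T i hs), edgeLen_const hg.isPoly T i hs, sum_one_mul
      (fun a => K.trace T (toH1 (w a)) i s - K.trace T (toH1 (u a)) i s) fun b => (q b).eval s]
    simp only [toH1_sub, h1, h2, h3]
  have hz : ∀ x : ℝ, x * g.edgeLen T i 0 = 0 ↔ x = 0 := fun x => by
    rw [mul_eq_zero]; exact or_iff_left hl
  simp only [key, hz]
  constructor
  · intro h k b hb
    rcases natDegree_lt_of_mem_PolyLt₁ hb with rfl | hb
    · simp
    have := h (Pi.single k b) fun b' => by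
      by_cases hb : b' = k
      · subst hb; rwa [Pi.single_eq_same]
      · rw [Pi.single_eq_of_ne hb, Polynomial.natDegree_zero]; omega
    rwa [Finset.sum_eq_single k (fun b' _ hb => by rw [Pi.single_eq_of_ne hb]; simp) (by simp),
      Pi.single_eq_same] at this
  · intro h q hq
    exact Finset.sum_eq_zero fun b _ => h b _ (mem_PolyLt₁_of_lt (hq b))

/-- A function continuous on the closed triangle is determined there by its values almost
everywhere, so the choice of the representative in the definition is immaterial. -/
theorem isPiU_vertex_iff {T : K.Tri} {i : Fin 3} {u w : H2 (K.cell T)} :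
    (∃ c : Plane → ℝ, ContinuousOn c (K.tri T) ∧
      (∀ᵐ x ∂volume.restrict (K.cell T), c x = (fn (toH1 w)) x - (fn (toH1 u)) x) ∧
      c (K.pos T i) = 0) ↔ K.rep T (w - u) (K.pos T i) = 0 := by
  have hrep := (K.rep_ae T (w - u)).trans (K.fn_sub_ae T (toH1 w) (toH1 u))
  constructor
  · rintro ⟨c, hc, hae, h0⟩
    rw [← h0]
    exact eqOn_tri_of_ae (K.continuousOn_rep T _) hc (hrep.trans (Filter.EventuallyEq.symm hae)) (pos_mem_tri T i)
  · exact fun h => ⟨_, K.continuousOn_rep T (w - u), hrep, h⟩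

theorem isPiU_iff (hg : g.IsEuclidean) {r : ℕ} {u : K.U} {w : K.Uh (r + 1)} :
    g.IsPiU r u w ↔ ∀ T k, K.LagZero r T (w.1.1 T k - u.1 T k) := by
  constructor
  · rintro ⟨h1, h2, h3⟩ T k
    exact ⟨(isPiU_interior_iff hg).1 (h1 T) k, fun i => (isPiU_edge_iff hg).1 (h2 T i) k,
      fun i => isPiU_vertex_iff.1 (h3 T i k)⟩
  · exact fun h => ⟨fun T => (isPiU_interior_iff hg).2 fun k => (h T k).interior,
      fun T i => (isPiU_edge_iff hg).2 fun k => (h T k).edge i,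
      fun T i k => isPiU_vertex_iff.2 ((h T k).vertex i)⟩

/-- Solved componentwise on each triangle. Traces of `u` match on glued sides, hence so do those of
the interpolants, and in the planar case this implies membership in `U`. -/
theorem existsUnique_isPiU (hK : K.IsPlanar) (hg : g.IsEuclidean) (r : ℕ) (u : K.U) :
    ∃! w, g.IsPiU r u w := by
  choose p hp hpz using fun T k => K.exists_lagZero r T (u.1 T k)
  let w : K.Uh (r + 1) := ⟨⟨fun T k => K.polyH2 T (p T k),
    mem_U_of_traceL hK fun T i T' j h b => by
      filter_upwards [K.traceL_polyH1 T (p T b) i, ae_reflect (K.traceL_polyH1 T' (p T' b) j)]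
        with s h1 h2
      rw [toH1_polyH2, toH1_polyH2, h1, h2]
      exact K.lagZero_glued (hp T b) (hp T' b) (hpz T b) (hpz T' b)
        (traceL_glued_of_mem_U hK u.2 h b) s⟩, fun T k => K.fn_polyH1_mem T (hp T k)⟩
  refine ⟨w, (isPiU_iff hg).2 hpz, fun w' hw' => ?_⟩
  refine Subtype.ext (Subtype.ext (funext fun T => funext fun k => ?_))
  obtain ⟨q, hq, hqe⟩ := K.exists_polyH2 T (w'.2 T k)
  have h1 := (isPiU_iff hg).1 hw' T k
  rw [hqe] at h1 ⊢
  rw [K.lagZero_unique hq (hp T k) h1 (hpz T k)]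

theorem piU_spec (hK : K.IsPlanar) (hg : g.IsEuclidean) (r : ℕ) (u : K.U) :
    g.IsPiU r u (g.piU r u) := Classical.epsilon_spec (existsUnique_isPiU hK hg r u).exists

end ReggeMetric

/-! ### The symmetric gradient -/

/-- The symmetric gradient of a vector field. -/
def symGrad {T : K.Tri} (u : Fin 2 → H2 (K.cell T)) (a b : Fin 2) : H1 (K.cell T) :=
  (1 / 2 : ℝ) • (wdH1 (u b) a + wdH1 (u a) b)

theorem symGrad_sub {T : K.Tri} (u w : Fin 2 → H2 (K.cell T)) (a b : Fin 2) :
    symGrad w a b - symGrad u a b = symGrad (w - u) a b := by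
  have h : ∀ k l, wdH1 ((w - u) k) l = wdH1 (w k) l - wdH1 (u k) l := fun k l => rfl
  simp only [symGrad, h]
  module

theorem edgeForm_symGrad (T : K.Tri) (i : Fin 3) (u : Fin 2 → H2 (K.cell T)) :
    K.edgeForm T i (symGrad u) =
      ∑ c : Fin 2 × Fin 2, (K.edgeVec T i c.1 * K.edgeVec T i c.2) • wdH1 (u c.1) c.2 := by
  simp only [edgeForm, symGrad, Fintype.sum_prod_type, Fin.sum_univ_two]
  module

/-- On the tangent vector `e`, `(def u)(e, e)` is the scalar product of `e` with the derivative of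
`u` along `e`, so it depends only on the trace of `u`. This is why `def` maps `U` into `Σ`. -/
theorem traceL_edgeForm_symGrad (T : K.Tri) (i : Fin 3) (u : Fin 2 → H2 (K.cell T)) :
    K.traceL T i (K.edgeForm T i (symGrad u)) =ᵐ[I01]
      fun s => ∑ a, K.edgeVec T i a * K.tanL T i (wdH1 (u a)) s := by
  rw [edgeForm_symGrad]
  filter_upwards [coeFn_lincomb (K.traceL T i)
    (fun c : Fin 2 × Fin 2 => K.edgeVec T i c.1 * K.edgeVec T i c.2) fun c => wdH1 (u c.1) c.2]
    with s hs
  rw [hs]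
  simp only [Fintype.sum_prod_type, Fin.sum_univ_two, tanL]
  ring

theorem symGrad_mem_Sigma (hK : K.IsPlanar) (u : K.U) :
    (fun T => symGrad (u.1 T)) ∈ K.Sigma := by
  refine K.mem_Sigma_iff.2 ⟨fun T a b => by simp only [symGrad, add_comm],
    fun T i T' j h => ?_⟩
  filter_upwards [K.tanL₂_ae T i (symGrad (u.1 T)), ae_reflect (K.tanL₂_ae T' j (symGrad (u.1 T'))),
    traceL_edgeForm_symGrad T i (u.1 T), ae_reflect (traceL_edgeForm_symGrad T' j (u.1 T')),
    ae_all_iff.2 fun b => K.tanL_wdH1_glued (traceL_glued_of_mem_U hK u.2 h b)] with s h1 h2 h3 h4 h5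
  rw [h1, h2, h3, h4]
  refine Finset.sum_congr rfl fun a _ => ?_
  rw [h5, edgeVec_glued (hK.pos_eq h), PiLp.neg_apply]
  ring

/-- The symmetric gradient as a map from `U` to `Σ`. -/
def symGradU (hK : K.IsPlanar) (u : K.U) : K.Sigma := ⟨_, symGrad_mem_Sigma hK u⟩

theorem symGradU_mem_Sigmah (hK : K.IsPlanar) {r : ℕ} {u : K.U} (hu : u ∈ K.Uh (r + 1)) :
    symGradU hK u ∈ K.Sigmah r := fun T a b => by
  choose p hp hpe using fun k => K.exists_polyH2 T (hu T k)
  have e : (symGradU hK u).1 T a b = K.polyH1 T ((1 / 2 : ℝ) •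
      (MvPolynomial.pderiv a (p b) + MvPolynomial.pderiv b (p a))) := by
    rw [map_smul, map_add, ← wdH1_polyH2, ← wdH1_polyH2, ← hpe, ← hpe]
    rfl
  rw [e]
  exact K.fn_polyH1_mem T (Submodule.smul_mem _ _ (add_mem (pderiv_mem_PolyLt (hp b) a)
    (pderiv_mem_PolyLt (hp a) b)))

theorem fn_symGrad {T : K.Tri} (u : Fin 2 → H2 (K.cell T)) (a b : Fin 2) :
    fn (symGrad u a b) =ᵐ[volume.restrict (K.cell T)]
      fun x => (1 / 2) * (fn (wdH1 (u b) a) x + fn (wdH1 (u a) b) x) := by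
  filter_upwards [Lp.coeFn_smul (1 / 2 : ℝ) (fn (wdH1 (u b) a) + fn (wdH1 (u a) b)),
    Lp.coeFn_add (fn (wdH1 (u b) a)) (fn (wdH1 (u a) b))] with x h1 h2
  refine h1.trans ?_
  rw [Pi.smul_apply, h2]
  rfl

namespace ReggeMetric

variable {g : K.ReggeMetric}

theorem isDef_iff (hK : K.IsPlanar) (hg : g.IsEuclidean) {u : K.U} {σ : K.Sigma} :
    g.IsDef u σ ↔ σ = symGradU hK u := by
  have key : ∀ T a b, (fun x =>
      (1 / 2) * ∑ c, ((fn (toH1 (u.1 T c))) x * g.dcoeff T x c a b +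
        g.coeff T x c b * (fn (wdH1 (u.1 T c) a)) x + g.coeff T x a c * (fn (wdH1 (u.1 T c) b)) x))
      =ᵐ[volume.restrict (K.cell T)] fn (symGrad (u.1 T) a b) := fun T a b => by
    filter_upwards [ae_mem_tri T, fn_symGrad (u.1 T) a b] with x hx h
    rw [h, hg T x hx]
    simp only [dcoeff_const hg.isPoly hx, Matrix.one_apply]
    congr 1
    fin_cases a <;> fin_cases b <;> simp [Fin.sum_univ_two, add_comm]
  constructor
  · intro h
    refine Subtype.ext (funext fun T => funext fun a => funext fun b => ?_)
    exact H1.ext_fn (K.convexDomain T).isOpen (Lp.ext ((h T a b).trans (key T a b)))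
  · rintro rfl T a b
    exact (key T a b).symm

theorem existsUnique_isDef (hK : K.IsPlanar) (hg : g.IsEuclidean) (u : K.U) :
    ∃! σ, g.IsDef u σ := by
  simp only [isDef_iff hK hg]
  exact existsUnique_eq

theorem defU_eq (hK : K.IsPlanar) (hg : g.IsEuclidean) (u : K.U) : g.defU u = symGradU hK u :=
  (isDef_iff hK hg).1 (Classical.epsilon_spec (existsUnique_isDef hK hg u).exists)

theorem existsUnique_isDef_discrete (hK : K.IsPlanar) (hg : g.IsEuclidean) {r : ℕ}
    (u : K.Uh (r + 1)) : ∃! σ : K.Sigmah r, g.IsDef u σ := by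
  simp only [isDef_iff hK hg]
  exact ⟨⟨_, symGradU_mem_Sigmah hK u.2⟩, rfl, fun σ hσ => Subtype.ext hσ⟩

theorem defUh_eq (hK : K.IsPlanar) (hg : g.IsEuclidean) {r : ℕ} (u : K.Uh (r + 1)) :
    (g.defUh r u : K.Sigma) = symGradU hK u :=
  (isDef_iff hK hg).1
    (Classical.epsilon_spec (p := fun σ : K.Sigmah r => g.IsDef u σ)
      (existsUnique_isDef_discrete hK hg u).exists)

end ReggeMetric

/-! ### The interpolants commute with the symmetric gradient -/

/-- Green's formula: the interior term contains `∂ₖ q`, of degree less than `r - 1`, and the side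
terms contain restrictions of `q`, of degree less than `r`. These moments vanish by assumption. -/
theorem LagZero.integral_wd {r : ℕ} {T : K.Tri} {d : H2 (K.cell T)} (h : K.LagZero r T d)
    (k : Fin 2) {q : MvP} (hq : q ∈ PolyLt r) :
    ∫ x in K.cell T, fn (wdH1 d k) x * pval q x = 0 := by
  cases r with
  | zero => simp [show q = 0 from hq]
  | succ r =>
    have e := (K.isTrace_traceL T (toH1 d)).green (pval q) k (pval_contDiff q)
    rw [pd_pval, h.interior _ (pderiv_mem_PolyLt hq k), zero_add] at e
    refine e.trans (Finset.sum_eq_zero fun i _ => ?_)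
    have := h.edge i (edgeP (K.pos T) i q)
      (mem_PolyLt₁_of_lt (Nat.lt_succ_of_le (natDegree_edgeP hq i)))
    simp only [eval_edgeP] at this
    rw [show (∫ s in Icc (0 : ℝ) 1, K.traceL T i (toH1 d) s * pval q (K.edgePt T i s)) = 0 from
      this, zero_mul]

/-- Integration by parts along the side: the end terms vanish with the vertex values, and the
derivative of `b` has degree less than `r`. -/
theorem LagZero.integral_tan {r : ℕ} {T : K.Tri} {d : H2 (K.cell T)} (h : K.LagZero r T d)
    (i : Fin 3) {b : Polynomial ℝ} (hb : b ∈ PolyLt₁ (r + 1)) :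
    ∫ s, b.eval s * K.tanL T i (wdH1 d) s ∂I01 = 0 := by
  rw [K.integral_mul_tanL_wdH1 T i d (q := fun s => b.eval s) (by
    simpa using Polynomial.contDiff_aeval (𝕜 := ℝ) b ∞), h.vertex, h.vertex]
  have hd : Polynomial.derivative b ∈ PolyLt₁ r := by
    by_cases h0 : b.natDegree = 0
    · rw [Polynomial.derivative_of_natDegree_zero h0]; exact zero_mem _
    · refine mem_PolyLt₁_of_lt ((Polynomial.natDegree_derivative_lt h0).trans_le ?_)
      rcases natDegree_lt_of_mem_PolyLt₁ hb with h1 | h1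
      · simp [h1]
      · omega
  have e := h.edge i _ hd
  simp only [Polynomial.deriv, mul_comm (Polynomial.eval _ _)]
  rw [e]; ring

theorem LagZero.isScalarRegge {r : ℕ} {T : K.Tri} {u w : Fin 2 → H2 (K.cell T)}
    (h : ∀ k, K.LagZero r T (w k - u k)) (i : Fin 3) :
    K.IsScalarRegge r T i (K.edgeForm T i (symGrad u)) (K.edgeForm T i (symGrad w)) := by
  have hd : K.edgeForm T i (symGrad w) - K.edgeForm T i (symGrad u) =
      K.edgeForm T i (symGrad (w - u)) := by
    rw [← edgeForm_sub]
    simp only [symGrad_sub]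
  refine ⟨fun q hq => ?_, fun b hb => ?_⟩
  · have hc := coeFn_lincomb fnL (fun c : Fin 2 × Fin 2 => K.edgeVec T i c.1 * K.edgeVec T i c.2)
      fun c => wdH1 ((w - u) c.1) c.2
    rw [← edgeForm_symGrad, ← hd] at hc
    have e : ∀ᵐ x ∂volume.restrict (K.cell T), (fn (K.edgeForm T i (symGrad w)) x -
        fn (K.edgeForm T i (symGrad u)) x) * pval q x = ∑ c : Fin 2 × Fin 2,
          K.edgeVec T i c.1 * K.edgeVec T i c.2 * (fn (wdH1 ((w - u) c.1) c.2) x * pval q x) := by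
      filter_upwards [hc, K.fn_sub_ae T (K.edgeForm T i (symGrad w))
        (K.edgeForm T i (symGrad u))] with x h1 h2
      rw [← h2, show fn (K.edgeForm T i (symGrad w) - K.edgeForm T i (symGrad u)) x = _ from h1,
        Finset.sum_mul]
      exact Finset.sum_congr rfl fun c _ => mul_assoc _ _ _
    rw [integral_congr_ae e, integral_finsetSum _ fun c _ =>
      (K.integrable_fn_mul_pval T _ q).const_mul _]
    refine Finset.sum_eq_zero fun c _ => ?_
    rw [integral_const_mul, show ∫ x in K.cell T, fn (wdH1 ((w - u) c.1) c.2) x * pval q x = 0 from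
      (h c.1).integral_wd c.2 hq, mul_zero]
  · have e : ∀ᵐ s ∂I01, (K.traceL T i (K.edgeForm T i (symGrad w)) s -
        K.traceL T i (K.edgeForm T i (symGrad u)) s) * b.eval s = ∑ a, K.edgeVec T i a *
          (b.eval s * K.tanL T i (wdH1 ((w - u) a)) s) := by
      filter_upwards [traceL_edgeForm_symGrad T i (w - u), K.traceL_sub_ae T i
        (K.edgeForm T i (symGrad w)) (K.edgeForm T i (symGrad u))] with s h1 h2
      rw [← h2, hd, h1, Finset.sum_mul]
      exact Finset.sum_congr rfl fun c _ => by ring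
    have hi : ∀ a, Integrable (fun s => b.eval s * K.tanL T i (wdH1 ((w - u) a)) s) I01 :=
      fun a => (memLp_I01 b.continuous).integrable_mul (K.memLp_tanL T i _)
    rw [integral_congr_ae e, integral_finsetSum _ fun a _ => (hi a).const_mul _]
    refine Finset.sum_eq_zero fun a _ => ?_
    rw [integral_const_mul, show ∫ s, b.eval s * K.tanL T i (wdH1 ((w - u) a)) s ∂I01 = 0 from
      (h a).integral_tan i hb, mul_zero]

namespace ReggeMetric

variable {g gbar : K.ReggeMetric}

theorem piSigma_defU (hK : K.IsPlanar) (hg : g.IsEuclidean) (hgbar : gbar.IsEuclidean) (r : ℕ)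
    (u : K.U) : gbar.piSigma r (g.defU u) = g.defUh r (gbar.piU r u) := by
  refine (existsUnique_isPiSigma hgbar.isPoly r (g.defU u)).unique
    (piSigma_spec hgbar.isPoly r _) ((isPiSigma_iff hgbar.isPoly).2 fun T i => ?_)
  rw [defU_eq hK hg, defUh_eq hK hg]
  exact LagZero.isScalarRegge ((isPiU_iff hgbar).1 (piU_spec hK hgbar r u) T) i

end ReggeMetric
end TriangulatedSurface
end
end ReggeFEM
-- The rows are complexes, and rigid motions are reproduced
namespace ReggeFEM
noncomputable section

/-- Second weak derivatives commute. -/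
theorem wd_wdH1_comm {Ω : Set Plane} (hΩ : IsConvexDomain Ω) (f : H2 Ω) (k l : Fin 2) :
    wd (wdH1 f k) l = wd (wdH1 f l) k := by
  refine (denseRange_smoothH2 hΩ).induction_on (p := fun f => wd (wdH1 f k) l = wd (wdH1 f l) k) f
    (isClosed_eq ((wdL l).comp (wdH1L k)).continuous ((wdL k).comp (wdH1L l)).continuous)
    fun ψ => Lp.ext ?_
  refine (coeFn_contL2 hΩ (pd_continuous (pd_contDiff (smoothFn_contDiff ψ) k) l)).trans ?_
  rw [pd_comm (smoothFn_contDiff ψ)]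
  exact (coeFn_contL2 hΩ (pd_continuous (pd_contDiff (smoothFn_contDiff ψ) l) k)).symm

namespace TriangulatedSurface

variable {K : TriangulatedSurface}

/-! ### The distributional operator annihilates symmetric gradients -/

theorem integrable_L2_mul {X : Type*} [MeasurableSpace X] {μ : Measure X} (f h : Lp ℝ 2 μ) :
    Integrable (fun x => f x * h x) μ := (Lp.memLp f).integrable_mul (Lp.memLp h)

theorem integrable_traceL_mul_tanL (T : K.Tri) (i : Fin 3) (f : H1 (K.cell T))
    (α : Fin 2 → H1 (K.cell T)) : Integrable (fun s => K.traceL T i f s * K.tanL T i α s) I01 :=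
  (Lp.memLp _).integrable_mul (K.memLp_tanL T i α)

/-- Integration by parts of the Jacobian determinant. -/
theorem integral_jacobian (T : K.Tri) (f : H1 (K.cell T)) (h : H2 (K.cell T)) :
    ∫ x in K.cell T, (wd f 0 x * wd (toH1 h) 1 x - wd f 1 x * wd (toH1 h) 0 x) =
      ∑ i, ∫ s, K.traceL T i f s * K.tanL T i (wdH1 h) s ∂I01 := by
  -- Green's formula for `f` with `∂₁h` in the direction 0 and with `∂₀h` in the direction 1. In the
  -- difference the second derivatives of `h` cancel, and the conormal components combine to the
  -- tangential derivative of `h`.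
  have g0 := K.green T f (wdH1 h 1) 0
  have g1 := K.green T f (wdH1 h 0) 1
  rw [wd_wdH1_comm (K.convexDomain T) h 1 0] at g0
  rw [integral_sub (integrable_L2_mul _ _) (integrable_L2_mul _ _)]
  have e0 : ∫ x in K.cell T, wd f 0 x * wd (toH1 h) 1 x =
      ∫ x in K.cell T, wd f 0 x * fn (wdH1 h 1) x := rfl
  have e1 : ∫ x in K.cell T, wd f 1 x * wd (toH1 h) 0 x =
      ∫ x in K.cell T, wd f 1 x * fn (wdH1 h 0) x := rfl
  have hs : ∀ i, ∫ s, K.traceL T i f s * K.tanL T i (wdH1 h) s ∂I01 =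
      (∫ s, K.traceL T i f s * K.traceL T i (wdH1 h 1) s ∂I01) * K.edgeConormal T i 0 -
      (∫ s, K.traceL T i f s * K.traceL T i (wdH1 h 0) s ∂I01) * K.edgeConormal T i 1 := fun i => by
    rw [← integral_mul_const, ← integral_mul_const, ← integral_sub
      ((integrable_L2_mul _ _).mul_const _) ((integrable_L2_mul _ _).mul_const _)]
    refine integral_congr_ae (Filter.Eventually.of_forall fun s => ?_)
    simp only [tanL, edgeConormal, Fin.sum_univ_two, Matrix.cons_val_zero, Matrix.cons_val_one]
    ring
  simp only [hs, Finset.sum_sub_distrib]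
  rw [← g0, ← g1, e0, e1]
  ring

/-- In two dimensions `A - Tr A` is minus the cofactor matrix of a symmetric `A`; this is the source
of the Jacobian determinants below. -/
theorem inner₂_S_one (A H : Fin 2 → Fin 2 → ℝ) (hA : A 0 1 = A 1 0) (hH : H 0 1 = H 1 0) :
    ∑ a, ∑ b, ∑ c, ∑ d, (1 : Matrix (Fin 2) (Fin 2) ℝ) a c * (1 : Matrix (Fin 2) (Fin 2) ℝ) b d *
      (A a b - (1 : Matrix (Fin 2) (Fin 2) ℝ) a b *
        ∑ c, ∑ d, (1 : Matrix (Fin 2) (Fin 2) ℝ) c d * A c d) * H c d =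
      2 * A 0 1 * H 0 1 - A 1 1 * H 0 0 - A 0 0 * H 1 1 := by
  simp only [Fin.sum_univ_two, Matrix.one_apply]
  simp [← hA, ← hH]
  ring

/-- The contribution of a side to the form `cₕ(δ; def u, dv)`. -/
def sideTerm (T : K.Tri) (i : Fin 3) (u : Fin 2 → H2 (K.cell T)) (v : H2 (K.cell T)) (s : ℝ) : ℝ :=
  K.tanL T i (wdH1 v) s * (K.edgeVec T i 1 * K.tanL T i (wdH1 (u 0)) s -
    K.edgeVec T i 0 * K.tanL T i (wdH1 (u 1)) s) / (K.edgeVec T i 0 ^ 2 + K.edgeVec T i 1 ^ 2)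

namespace ReggeMetric

variable {g : K.ReggeMetric}

/-- By the cofactor structure the integrand is the Jacobian determinant of `(∂₁v, u₀)` minus that of
`(∂₀v, u₁)`, and `integral_jacobian` takes both to the boundary. -/
theorem ch_cell_symGrad (hg : g.IsEuclidean) (T : K.Tri) (u : Fin 2 → H2 (K.cell T))
    (v : H2 (K.cell T)) :
    ∫ x in K.cell T, g.inner₂ T x (g.S T x fun a b => fn (symGrad u a b) x)
        (g.covDeriv T (wdH1 v) x) * g.vol T x =
      ∑ i, ((∫ s, K.traceL T i (wdH1 v 1) s * K.tanL T i (wdH1 (u 0)) s ∂I01) -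
        ∫ s, K.traceL T i (wdH1 v 0) s * K.tanL T i (wdH1 (u 1)) s ∂I01) := by
  have hi : ∀ k l, Integrable (fun x => wd (wdH1 v k) 0 x * wd (toH1 (u l)) 1 x -
      wd (wdH1 v k) 1 x * wd (toH1 (u l)) 0 x) (volume.restrict (K.cell T)) := fun k l =>
    (integrable_L2_mul _ _).sub (integrable_L2_mul _ _)
  rw [Finset.sum_sub_distrib, ← integral_jacobian, ← integral_jacobian,
    ← integral_sub (hi 1 0) (hi 0 1)]
  refine integral_congr_ae ?_
  filter_upwards [ae_mem_tri T, ae_all_iff.2 fun a => ae_all_iff.2 fun b => fn_symGrad u a b]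
    with x hx hA
  have hcov : ∀ a b, g.covDeriv T (wdH1 v) x a b = wd (wdH1 v b) a x := fun a b => by
    simp only [covDeriv, christoffel_const hg.isPoly hx, zero_mul, Finset.sum_const_zero, sub_zero]
  have hsym : wd (wdH1 v 1) 0 x = wd (wdH1 v 0) 1 x := by
    rw [wd_wdH1_comm (K.convexDomain T) v 1 0]
  simp only [inner₂, S, hg.inv hx, hg T x hx, hg.vol hx, mul_one, hcov]
  rw [inner₂_S_one (fun a b => fn (symGrad u a b) x) (fun a b => wd (wdH1 v b) a x)
    (by simp only [hA]; ring) hsym]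
  have hf : ∀ a b, fn (wdH1 (u b) a) x = wd (toH1 (u b)) a x := fun a b => rfl
  simp only [hA, hf, hsym]
  ring

theorem edgeLen_sq (hg : g.IsEuclidean) (T : K.Tri) (i : Fin 3) {s : ℝ} (hs : s ∈ Icc (0 : ℝ) 1) :
    g.edgeLen T i s ^ 2 = K.edgeVec T i 0 ^ 2 + K.edgeVec T i 1 ^ 2 := by
  rw [edgeLen, edgeSq, hg T _ (K.edgePt_mem T i hs), Real.sq_sqrt] <;>
  simp only [Fin.sum_univ_two, Matrix.one_apply] <;> simp <;> nlinarith [sq_nonneg (K.edgeVec T i 0), sq_nonneg (K.edgeVec T i 1)]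

theorem normal_eq (hg : g.IsEuclidean) (T : K.Tri) (i : Fin 3) {s : ℝ} (hs : s ∈ Icc (0 : ℝ) 1)
    (a : Fin 2) : g.normal T i s a = K.edgeConormal T i a / g.edgeLen T i s := by
  rw [normal, edgeLen, edgeSq, hg.inv (K.edgePt_mem T i hs), hg T _ (K.edgePt_mem T i hs)]
  congr 1
  · simp [Matrix.one_apply]
  · congr 1
    simp [Matrix.one_apply, edgeConormal]
    ring

/-- Split `dv` on the side into its tangential and normal parts. In the boundary terms from the
cell, the normal part has the factor `(def u)(e, e)`, and the side term of `c_h` cancels exactly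
this; only the tangential part of `dv` survives. -/
theorem ch_side_symGrad (hg : g.IsEuclidean) (T : K.Tri) (i : Fin 3) (u : Fin 2 → H2 (K.cell T))
    (v : H2 (K.cell T)) : ∀ᵐ s ∂I01,
    K.traceL T i (wdH1 v 1) s * K.tanL T i (wdH1 (u 0)) s -
        K.traceL T i (wdH1 v 0) s * K.tanL T i (wdH1 (u 1)) s +
      g.tautau T i (symGrad u) s * g.normalComp T i (wdH1 v) s * g.edgeLen T i s =
        sideTerm T i u v s := by
  filter_upwards [ae_restrict_mem measurableSet_Icc, tautau_ae (g := g) T i (symGrad u),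
    traceL_edgeForm_symGrad T i u, ae_all_iff.2 fun k => K.trace_ae T (wdH1 v k) i]
    with s hs h1 h2 h3
  have hl := g.edgeLen_pos T i hs
  have hq := edgeLen_sq hg T i hs
  have hq' : K.edgeVec T i 0 ^ 2 + K.edgeVec T i 1 ^ 2 ≠ 0 := by rw [← hq]; positivity
  rw [h1, h2]
  simp only [normalComp, h3, normal_eq hg T i hs, sideTerm, Fin.sum_univ_two]
  have e : ∀ X a b : ℝ, X / g.edgeLen T i s ^ 2 * (a / g.edgeLen T i s + b / g.edgeLen T i s) *
      g.edgeLen T i s = X * (a + b) / (K.edgeVec T i 0 ^ 2 + K.edgeVec T i 1 ^ 2) := fun X a b => by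
    rw [← hq]; field_simp
  simp only [← mul_div_assoc, e]
  rw [eq_div_iff hq', add_mul, div_mul_cancel₀ _ hq']
  simp only [edgeConormal, Matrix.cons_val_zero, Matrix.cons_val_one]
  have ht : K.tanL T i (wdH1 v) s = K.traceL T i (wdH1 v 0) s * K.edgeVec T i 0 +
    K.traceL T i (wdH1 v 1) s * K.edgeVec T i 1 := Fin.sum_univ_two _
  rw [ht]
  ring

/-- Three factors of `sideTerm` are odd under reversal of the side: the tangential derivative of
`v`, that of `u`, and the tangent vector. So glued sides cancel, and boundary sides drop out because
the tangential derivative of `v` is zero there. -/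
theorem ch_symGradU (hK : K.IsPlanar) (hg : g.IsEuclidean) (u : K.U) (v : K.V) :
    g.ch (symGradU hK u) (K.dL v) = 0 := by
  have hV := K.mem_W_iff.1 (K.dL v).2
  have hside : ∀ T i, (((∫ s, K.traceL T i (wdH1 (v.1 T) 1) s *
      K.tanL T i (wdH1 (u.1 T 0)) s ∂I01) -
        ∫ s, K.traceL T i (wdH1 (v.1 T) 0) s * K.tanL T i (wdH1 (u.1 T 1)) s ∂I01) +
      ∫ s in Icc (0 : ℝ) 1, g.tautau T i ((symGradU hK u).1 T) s *
        g.normalComp T i ((K.dL v).1 T) s * g.edgeLen T i s) =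
      ∫ s, sideTerm T i (u.1 T) (v.1 T) s ∂I01 := fun T i => by
    have i1 := integrable_traceL_mul_tanL T i (wdH1 (v.1 T) 1) (wdH1 (u.1 T 0))
    have i2 := integrable_traceL_mul_tanL T i (wdH1 (v.1 T) 0) (wdH1 (u.1 T 1))
    have i12 : Integrable (fun s => K.traceL T i (wdH1 (v.1 T) 1) s *
        K.tanL T i (wdH1 (u.1 T 0)) s - K.traceL T i (wdH1 (v.1 T) 0) s *
          K.tanL T i (wdH1 (u.1 T 1)) s) I01 := i1.sub i2
    have i3 : Integrable (fun s => g.tautau T i ((symGradU hK u).1 T) s *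
        g.normalComp T i ((K.dL v).1 T) s * g.edgeLen T i s) I01 :=
      (g.isIntFunctional_ch_side T i _).1 (K.dL v)
    rw [← integral_sub i1 i2, ← integral_add i12 i3]
    exact integral_congr_ae (ch_side_symGrad hg T i (u.1 T) (v.1 T))
  have hcell : ∀ T, ∫ x in K.cell T, g.inner₂ T x (g.S T x fun a b =>
      fn ((symGradU hK u).1 T a b) x) (g.covDeriv T ((K.dL v).1 T) x) * g.vol T x = _ :=
    fun T => ch_cell_symGrad hg T (u.1 T) (v.1 T)
  rw [ch, ← Finset.sum_add_distrib]
  simp only [hcell, ← Finset.sum_add_distrib, hside]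
  refine sum_sides_eq_zero (fun T i T' j h => ?_) fun T i h => ?_
  · rw [← integral_reflect (sideTerm T' j (u.1 T') (v.1 T')), ← eq_neg_iff_add_eq_zero,
      ← integral_neg]
    refine integral_congr_ae ?_
    filter_upwards [hV.1 T i T' j h, ae_all_iff.2 fun b =>
      K.tanL_wdH1_glued (traceL_glued_of_mem_U hK u.2 h b)] with s h1 h2
    have h1' : K.tanL T i (wdH1 (v.1 T)) s = -K.tanL T' j (wdH1 (v.1 T')) (1 - s) := h1
    rw [sideTerm, sideTerm, h1', h2, h2, edgeVec_glued (hK.pos_eq h)]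
    simp only [PiLp.neg_apply, neg_sq]
    ring
  · refine integral_eq_zero_of_ae ?_
    filter_upwards [hV.2 T i h] with s hs
    rw [sideTerm, show K.tanL T i (wdH1 (v.1 T)) s = 0 from hs]
    simp

theorem divDivSDist_defU (hK : K.IsPlanar) (hg : g.IsEuclidean) (u : K.U) :
    g.divDivSDist (g.defU u) = 0 := by
  ext v
  rw [divDivSDist_apply, defU_eq hK hg, ch_symGradU hK hg]
  rfl

theorem divDivSh_defUh {gh : K.ReggeMetric} (hK : K.IsPlanar) (hg : g.IsEuclidean)
    (hgh : gh.IsEuclidean) {r : ℕ} (u : K.Uh (r + 1)) : gh.divDivSh r (g.defUh r u) = 0 := by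
  refine Subtype.ext (gh.innerV_self ?_)
  rw [innerV_divDivSh, defUh_eq hK hg, ch_symGradU hK hgh]

/-! ### Rigid motions -/

/-- The derivatives `∂_a u_b` are antisymmetric in the indices, and second derivatives commute.
Alternating both rules, with three changes of sign, returns a second derivative to its own negative,
so it vanishes. The first derivatives are then constants `m a`, and `u c` minus the corresponding
linear function has zero gradient. -/
theorem exists_affine_of_symGrad_eq_zero {T : K.Tri} {u : Fin 2 → H2 (K.cell T)}
    (h : ∀ a b, symGrad u a b = 0) (c : Fin 2) : ∃ p ∈ Poly 1, u c = K.polyH2 T p := by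
  have hΩ := K.convexDomain T
  have hanti : ∀ a b, wdH1 (u b) a = -wdH1 (u a) b := fun a b =>
    eq_neg_of_add_eq_zero_left ((smul_eq_zero.1 (h a b)).resolve_left (by norm_num))
  have hS : ∀ a b c, wd (wdH1 (u b) a) c = -wd (wdH1 (u a) b) c := fun a b c => by
    rw [hanti a b]; rfl
  have hz : ∀ a b, wd (wdH1 (u c) a) b = 0 := fun a b => by
    have e : wd (wdH1 (u c) a) b = -wd (wdH1 (u c) a) b := by
      conv_lhs => rw [hS, wd_wdH1_comm hΩ, hS, neg_neg, wd_wdH1_comm hΩ, hS, wd_wdH1_comm hΩ]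
    refine (smul_eq_zero.1 ?_).resolve_left (two_ne_zero (α := ℝ))
    rw [two_smul]
    exact eq_neg_iff_add_eq_zero.1 e
  choose m hm using fun a => exists_const_of_wd_eq_zero hΩ (hz a)
  set q : MvP := ∑ a, m a • MvPolynomial.X a with hq
  have hwd : ∀ a, wd (toH1 (u c - K.polyH2 T q)) a = 0 := fun a => by
    refine sub_eq_zero.2 (Lp.ext ?_)
    refine (hm a).trans ((K.wd_polyH1 T q a).trans (Filter.Eventually.of_forall fun x => ?_)).symm
    simp only [hq, Fin.sum_univ_two]
    fin_cases a <;> simp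
  obtain ⟨k, hk⟩ := exists_const_of_wd_eq_zero hΩ hwd
  refine ⟨q + MvPolynomial.C k, add_mem (Submodule.sum_mem _ fun a _ =>
    Submodule.smul_mem _ _ (X_mem_Poly a)) (Poly_mono zero_le_one (C_mem_Poly k)),
    H2.ext_fn hΩ.isOpen (Lp.ext ?_)⟩
  rw [toH1_polyH2]
  filter_upwards [hk, K.fn_sub_ae T (toH1 (u c)) (toH1 (K.polyH2 T q)), K.fn_polyH1 T q,
    K.fn_polyH1 T (q + MvPolynomial.C k)] with x h1 h2 h3 h4
  rw [toH1_sub, h2, toH1_polyH2, h3] at h1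
  rw [h4, pval_add, pval_C]
  linarith

/-- An affine field has degree at most `r + 1` for every `r`, and it satisfies its own interpolation
conditions. -/
theorem piU_of_defU_eq_zero {gbar : K.ReggeMetric} (hK : K.IsPlanar) (hg : g.IsEuclidean)
    (hgbar : gbar.IsEuclidean) (r : ℕ) {u : K.U} (hu : g.defU u = 0) :
    (gbar.piU r u : K.U) = u := by
  rw [defU_eq hK hg] at hu
  have hmem : u ∈ K.Uh (r + 1) := fun T c => by
    obtain ⟨p, hp, he⟩ := exists_affine_of_symGrad_eq_zero (u := u.1 T) (fun a b =>
      congrFun (congrFun (congrFun (congrArg Subtype.val hu) T) a) b) c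
    rw [he]
    exact K.fn_polyH1_mem T (Poly_mono (by omega) hp)
  have h : g.IsPiU r u ⟨u, hmem⟩ := (isPiU_iff hg).2 fun T k =>
    K.lagZero_sub_iff.2 ⟨fun _ _ => rfl, fun _ _ _ => rfl, fun _ => rfl⟩
  have h' : gbar.IsPiU r u ⟨u, hmem⟩ := (isPiU_iff hgbar).2 ((isPiU_iff hg).1 h)
  exact congrArg Subtype.val ((existsUnique_isPiU hK hgbar r u).unique
    (piU_spec hK hgbar r u) h')

end ReggeMetric
end TriangulatedSurface
end
end ReggeFEM
-- The main theorem
theorem mainTheorem6 (K : ReggeFEM.TriangulatedSurface) (r : ℕ) (g gh gbar : K.ReggeMetric)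
    (hgh : gh.IsPoly r) (hgbar : gbar.IsPoly 0) :
    -- the operators are well defined
    ((∀ v, ∃! w, K.IsD v w) ∧
      (∀ α, ∃! u, K.IsDivDist α u) ∧
      (∀ σ, ∃! α, g.IsDivSDist σ α) ∧
      (∀ α, ∃! u, gh.IsDivh r α u) ∧
      (∀ σ, ∃! α, gh.IsDivSh r σ α) ∧
      (∀ u, ∃! w, gh.IsPiV r u w) ∧
      (∀ α, ∃! γ, gh.IsPiW r α γ) ∧
      (∀ σ, ∃! ρ, gbar.IsPiSigma r σ ρ)) ∧
    -- (1)
    (∀ α : K.W', gh.divh r (gh.piW r α) = gh.piV r (K.divDist α)) ∧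
    -- (2)
    (g.Agree gh → gh.Agree gbar →
      ∀ σ : K.Sigma, gh.divDivSh r (gbar.piSigma r σ) = gh.piV r (g.divDivSDist σ)) ∧
    -- (3)
    (K.IsPlanar → g.IsEuclidean → gh.IsEuclidean → gbar.IsEuclidean →
      (∀ u, ∃! σ, g.IsDef u σ) ∧
      (∀ u : K.Uh (r + 1), ∃! σ : K.Sigmah r, g.IsDef u σ) ∧
      (∀ u, ∃! w, gbar.IsPiU r u w) ∧
      (∀ u : K.U, gbar.piSigma r (g.defU u) = g.defUh r (gbar.piU r u)) ∧
      -- the rows `RM → U → Σ → V' → 0` and `RM → Uₕ → Σₕ → Vₕ → 0`, with `RM = ker def`, are complexes,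
      -- and `RM → U` commutes with the interpolation
      (∀ u : K.U, g.divDivSDist (g.defU u) = 0) ∧
      (∀ u : K.Uh (r + 1), gh.divDivSh r (g.defUh r u) = 0) ∧
      (∀ u : K.U, g.defU u = 0 → (gbar.piU r u : K.U) = u)) := by
  refine ⟨⟨K.existsUnique_isD, K.existsUnique_isDivDist, g.existsUnique_isDivSDist,
    gh.existsUnique_isDivh r, gh.existsUnique_isDivSh r, gh.existsUnique_isPiV r,
    gh.existsUnique_isPiW r, ReggeFEM.TriangulatedSurface.ReggeMetric.existsUnique_isPiSigma hgbar r⟩,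
    gh.divh_piW r, fun h h' σ =>
      ReggeFEM.TriangulatedSurface.ReggeMetric.divDivSh_piSigma hgbar h h' r σ,
    fun hK hg hgh hgbar => ?_⟩
  open ReggeFEM.TriangulatedSurface.ReggeMetric in
  exact ⟨existsUnique_isDef hK hg, existsUnique_isDef_discrete hK hg, existsUnique_isPiU hK hgbar r,
    piSigma_defU hK hg hgbar r, divDivSDist_defU hK hg, divDivSh_defUh hK hg hgh,
    fun u => piU_of_defU_eq_zero hK hg hgbar r⟩
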